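/- Let $d\ge 1$. For $f\in L^p(\mathbb R^d)$ with $p\ge 2$, let $$\mathcal E f(\xi,s)=\int_{|y|\le 1} f(y)\,e^{is|y|^2-i\langle \xi,y\rangle}\,dy,\qquad (\xi,s)\in\mathbb R^d\times\mathbb R,$$ and for $\rho>0$ let $\mathcal A(\rho)=\{\xi\in\mathbb R^d: 3\rho\le|\xi|\le 12\rho\}$. With $\widehat f(\xi)=\int f(y)e^{-i\langle y,\xi\rangle}dy$, write $m(D)f=(m\widehat f\,)^\vee$ for the Fourier multiplier operator with symbol $m$ acting on tempered distributions, and let $Uf(\cdot,t)=e^{it\Delta}f$ be the operator with symbol $e^{-it|\xi|^2}$. Let $\chi\in C^\infty(\mathbb R^d)$ be a real-valued function with $\chi(\xi)=1$ for $|\xi|\le 1$ and $\chi(\xi)=0$ for $|\xi|\ge 2$, let $P_0=\chi(D)$ and $P_k=\chi(2^{-k}D)-\chi(2^{1-k}D)$ for $k\ge 1$. For $\gamma\in\mathbb R$ and $\nu>0$, the Besov space $B^p_{\gamma,\nu}$ consists of the tempered distributions $f$ with $$\|f\|_{B^p_{\gamma,\nu}}=\Big(\sum_{k\ge 0}2^{k\gamma\nu}\|P_kf\|_p^\nu\Big)^{1/\nu}<\infty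 .$$ **Theorem.** Let $p,q,r\in[2,\infty]$ with $p\le q$, let $\beta>-d\big(\tfrac12-\tfrac1p\big)$ and let $0<\nu\le 1$. Then $$\sup_{\lambda>1}\lambda^{-\beta}\sup_{\|f\|_p\le 1}\Big(\int_{\mathcal A(\lambda)}\Big(\int_\lambda^{2\lambda}\big|\mathcal E f\big(\tfrac{s}{\lambda}\xi,s\big)\big|^r\,ds\Big)^{q/r}d\xi\Big)^{1/q}<\infty$$ holds if and only if, for $\gamma=d\big(1-\tfrac1p-\tfrac1q\big)-\tfrac2r+2\beta$, $$\sup_{\|f\|_{B^p_{\gamma,\nu}}\le 1}\Big\|\Big(\int_{-1}^1|e^{it\Delta}f|^r\,dt\Big)^{1/r}\Big\|_{L^q(\mathbb R^d)}<\infty ,$$ that is, $U$ is bounded from $B^p_{\gamma,\nu}$ to $L^q(\mathbb R^d;L^r([-1,1]))$. If in addition $r<\infty$, then this equivalence remains valid for $0<\nu\le 2$. (Integrals are replaced by essential suprema when $q$ or $r$ is $\infty$; the last norm is understood to be $\infty$ if $Uf$ is not a measurable function on $\mathbb R^d\times[-1,1]$.) -/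

import Mathlib

open MeasureTheory Set
open scoped ENNReal SchwartzMap ContDiff

noncomputable section

/-- The space `ℝ^d` with the Euclidean norm. -/
abbrev Rd (d : ℕ) : Type := EuclideanSpace ℝ (Fin d)

/-- The Fourier extension (adjoint restriction) operator of the paraboloid over the unit ball,
`𝓔 f (ξ, s) = ∫_{|y| ≤ 1} f(y) e^{i s |y|² - i ⟨ξ, y⟩} dy`. -/
def extensionOp {d : ℕ} (f : Rd d → ℂ) (ξ : Rd d) (s : ℝ) : ℂ :=
  ∫ y in Metric.closedBall (0 : Rd d) 1,
    f y * Complex.exp (Complex.I * ((s * ‖y‖ ^ 2 - inner ℝ ξ y : ℝ) : ℂ))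

/-- The annulus `{ξ ∈ ℝ^d : 3ρ ≤ |ξ| ≤ 12ρ}`. -/
def annulus (d : ℕ) (ρ : ℝ) : Set (Rd d) := {ξ | 3 * ρ ≤ ‖ξ‖ ∧ ‖ξ‖ ≤ 12 * ρ}

/-- The mixed norm of `F` in `L^q(A; L^r(J))`, the `L^r` norm in the second variable inside
(essential suprema if an exponent is `∞`). -/
def mixedNorm {d : ℕ} (q r : ℝ≥0∞) (A : Set (Rd d)) (J : Set ℝ) (F : Rd d → ℝ → ℂ) : ℝ≥0∞ :=
  eLpNorm (fun x => eLpNorm (F x) r (volume.restrict J)) q (volume.restrict A)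

/-- `m(D) f = (m f̂)^∨` with respect to `f̂(ξ) = ∫ f(y) e^{-i⟨y, ξ⟩} dy`. Mathlib's Fourier
transform has the phase `e^{-2πi⟨y, ξ⟩}`, so its frequency variable is rescaled by `2π`. -/
def multOp {d : ℕ} (m : Rd d → ℂ) (f : 𝓢'(Rd d, ℂ)) : 𝓢'(Rd d, ℂ) :=
  TemperedDistribution.fourierMultiplierCLM ℂ (fun ξ => m ((2 * Real.pi) • ξ)) f

/-- The Schrödinger propagator `e^{itΔ}` on tempered distributions, with multiplier
`e^{-it|ξ|²}`. -/
def schrodinger {d : ℕ} (t : ℝ) (f : 𝓢'(Rd d, ℂ)) : 𝓢'(Rd d, ℂ) :=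
  multOp (fun ξ => Complex.exp (-Complex.I * ((t * ‖ξ‖ ^ 2 : ℝ) : ℂ))) f

/-- The tempered distribution `T` is given by integration against the function `g`. -/
def IsGivenBy {d : ℕ} (T : 𝓢'(Rd d, ℂ)) (g : Rd d → ℂ) : Prop :=
  ∀ φ : 𝓢(Rd d, ℂ), T φ = ∫ x, φ x * g x

/-- The `L^p` norm of a tempered distribution; it is `∞` if the distribution is not an `L^p`
function. -/
def distLpNorm {d : ℕ} (p : ℝ≥0∞) (T : 𝓢'(Rd d, ℂ)) : ℝ≥0∞ :=
  ⨅ (g : Rd d → ℂ) (_ : MemLp g p volume ∧ IsGivenBy T g), eLpNorm g p volume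

/-- A smooth cutoff, equal to `1` for `|ξ| ≤ 1` and vanishing for `|ξ| ≥ 2`, which generates an
inhomogeneous Littlewood–Paley decomposition. -/
structure IsLPCutoff {d : ℕ} (χ : Rd d → ℝ) : Prop where
  smooth : ContDiff ℝ ∞ χ
  eq_one : ∀ ξ, ‖ξ‖ ≤ 1 → χ ξ = 1
  eq_zero : ∀ ξ, 2 ≤ ‖ξ‖ → χ ξ = 0

/-- The symbols `χ_0 = χ` and `χ_k(ξ) = χ(2^{-k} ξ) - χ(2^{1-k} ξ)` for `k ≥ 1`; the latter is
supported in `2^{k-1} ≤ |ξ| ≤ 2^{k+1}`. -/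
def lpSymbol {d : ℕ} (χ : Rd d → ℝ) : ℕ → Rd d → ℝ
  | 0, ξ => χ ξ
  | k + 1, ξ => χ (((2 : ℝ) ^ (k + 1))⁻¹ • ξ) - χ (((2 : ℝ) ^ k)⁻¹ • ξ)

/-- The Littlewood–Paley operators `P_k = χ_k(D)`. -/
def lpProj {d : ℕ} (χ : Rd d → ℝ) (k : ℕ) (f : 𝓢'(Rd d, ℂ)) : 𝓢'(Rd d, ℂ) :=
  multOp (fun ξ => ((lpSymbol χ k ξ : ℝ) : ℂ)) f

/-- The Besov (quasi-)norm `(∑_{k ≥ 0} 2^{kγν} ‖P_k f‖_p^ν)^{1/ν}` of `B^p_{γ,ν}(ℝ^d)`, with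
value `∞` at the tempered distributions outside of that space. -/
def besovNorm {d : ℕ} (χ : Rd d → ℝ) (p : ℝ≥0∞) (γ ν : ℝ) (f : 𝓢'(Rd d, ℂ)) : ℝ≥0∞ :=
  (∑' k : ℕ, (ENNReal.ofReal ((2 : ℝ) ^ ((k : ℝ) * γ)) * distLpNorm p (lpProj χ k f)) ^ ν)
    ^ (1 / ν)

/-- On `ℝ^d × [-1, 1]` the solution `(x, t) ↦ e^{itΔ} f (x)` is the measurable function `F`. -/
def IsSolution {d : ℕ} (f : 𝓢'(Rd d, ℂ)) (F : Rd d → ℝ → ℂ) : Prop :=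
  AEStronglyMeasurable (Function.uncurry F)
    ((volume : Measure (Rd d)).prod (volume.restrict (Icc (-1 : ℝ) 1))) ∧
  ∀ᵐ t ∂(volume.restrict (Icc (-1 : ℝ) 1)), IsGivenBy (schrodinger t f) (fun x => F x t)

/-- `‖(∫_{-1}^1 |e^{itΔ} f|^r dt)^{1/r}‖_q`, with value `∞` if `e^{itΔ} f` is not a function on
`ℝ^d × [-1, 1]`. -/
def solutionNorm {d : ℕ} (q r : ℝ≥0∞) (f : 𝓢'(Rd d, ℂ)) : ℝ≥0∞ :=
  ⨅ (F : Rd d → ℝ → ℂ) (_ : IsSolution f F), mixedNorm q r univ (Icc (-1) 1) F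

/-- The scaled mixed norm bound for the extension operator with growth `λ^β`:
`sup_{λ > 1} λ^{-β} sup_{‖f‖_p ≤ 1} ‖𝓔 f (s ξ / λ, s)‖_{L^q_ξ(A(λ); L^r_s([λ, 2λ]))} < ∞`. -/
def ExtensionBound (d : ℕ) (p q r : ℝ≥0∞) (β : ℝ) : Prop :=
  (⨆ (l : ℝ) (_ : 1 < l), ENNReal.ofReal (l ^ (-β)) *
    ⨆ (f : Rd d → ℂ) (_ : MemLp f p volume ∧ eLpNorm f p volume ≤ 1),
      mixedNorm q r (annulus d l) (Icc l (2 * l))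
        (fun ξ s => extensionOp f ((s / l) • ξ) s)) < ⊤

/-- `U : f ↦ e^{itΔ} f` is bounded from `B^p_{γ,ν}(ℝ^d)` to `L^q(ℝ^d; L^r([-1, 1]))`. -/
def SchrodingerBound {d : ℕ} (χ : Rd d → ℝ) (p q r : ℝ≥0∞) (γ ν : ℝ) : Prop :=
  (⨆ (f : 𝓢'(Rd d, ℂ)) (_ : besovNorm χ p γ ν f ≤ 1), solutionNorm q r f) < ⊤

end

open FourierTransform Laplacian Filter Topology LineDeriv

/-! The link between the two bounds is the explicit kernel (4πit)^{-d/2} e^{i|x-y|²/4t} of the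
propagator. For data supported in a ball of radius R about c, expanding the square shows that
|e^{itΔ}h(x)| equals (4πt)^{-d/2} R^d times the modulus of the extension operator at (R(x-c)/2t,
R²/4t), applied to the rescaled data (`norm_kernelInt_eq`). The inversion s = R²/4t carries t ∈ [T,
2T] to s ∈ [λ, 2λ] with λ = R²/8T, and the annulus A(λ) corresponds to 3R/2 ≤ |x-c| ≤ 6R.

To pass between the propagator and its frequency localizations, the localized kernel is written as
the free kernel times an amplitude, which is an oscillatory integral with parameter 1/4t
(`osc_eq_schrodingerKernel_mul`). Differentiating in that parameter is a Laplacian on the Fourier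
side, a local operation. Hence the amplitude equals the symbol at the velocity z/4πt up to O(t^{-N})
wherever the symbol is locally constant. The localized kernel is therefore negligible at velocities
off the support of the symbol, and agrees with the free kernel where the symbol is 1.

Extension bound implies Schrödinger bound. At unit frequency and times t ~ T only points y with
|x-y| ~ T interact with x. On a ball of radius εT finitely many rescaled extension bounds give an
estimate with rapidly decaying weights and constant T^α, α = d/2 - d/p + β. Since p ≤ q, these local
estimates can be summed over the ball centres (`exists_eLpNorm_le_of_forall_ball`). The hypothesis
on β says that α > 0, so dyadic times sum geometrically, and parabolic scaling gives the factor
2^{kγ} for frequency 2^k on [-1, 1]. For ν ≤ 1 the pieces are summed by the triangle inequality. For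
r < ∞ and ν ≤ 2 a piece of spatial frequency 2^k oscillates in time at frequency 4^k, and an
elementary one-sided Littlewood–Paley inequality in t gives a square sum
(`exists_integral_norm_sum_le`). The series is finally identified with e^{itΔ}f as a tempered
distribution for almost every t.

Schrödinger bound implies extension bound. With λ = R² the function f is dilated to a ball of radius
R, and times t ∈ [1/8, 1/4] are used. All relevant velocities are comparable to R, so the free
evolution may be replaced by its localization to frequencies of size R, with error O(R^{-N})
(`exists_norm_osc_dilate_sub_schrodingerKernel_le`). On such functions the Besov norm is at most a
multiple of R^γ times the p-norm of the data, whatever ν is. -/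

/-! ### Oscillatory integrals with quadratic phase. -/

/-- The quadratic phase `e^{i s |y|²}`. -/
noncomputable def chirp {d : ℕ} (s : ℝ) (y : Rd d) : ℂ := Complex.exp (Complex.I * ((s * ‖y‖ ^ 2 : ℝ) : ℂ))

/-- The oscillatory integral `∫ e^{i s |y|² + 2π i ⟨ζ, y⟩} g(y) dy`. -/
noncomputable def osc {d : ℕ} (g : 𝓢(Rd d, ℂ)) (s : ℝ) (ζ : Rd d) : ℂ :=
  ∫ y, Complex.exp (Complex.I * ((s * ‖y‖ ^ 2 + 2 * Real.pi * inner ℝ ζ y : ℝ) : ℂ)) * g y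

theorem norm_cexp_I_mul_ofReal (x : ℝ) : ‖Complex.exp (Complex.I * (x : ℂ))‖ = 1 := by
  rw [mul_comm]; exact Complex.norm_exp_ofReal_mul_I x

theorem iteratedDeriv_cexp_I_mul (n : ℕ) :
    iteratedDeriv n (fun x : ℝ => Complex.exp (Complex.I * (x : ℂ)))
      = fun x : ℝ => Complex.I ^ n * Complex.exp (Complex.I * (x : ℂ)) := by
  induction n with
  | zero => simp
  | succ n ih =>
    rw [iteratedDeriv_succ, ih]
    funext x
    have h : HasDerivAt (fun x : ℝ => Complex.I ^ n * Complex.exp (Complex.I * (x : ℂ)))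
        (Complex.I ^ n * (Complex.exp (Complex.I * (x : ℂ)) * (Complex.I * 1))) x := by
      refine HasDerivAt.const_mul _ (HasDerivAt.cexp ?_)
      exact (HasDerivAt.ofReal_comp (hasDerivAt_id x)).const_mul _
    rw [h.deriv]; ring

theorem hasTemperateGrowth_cexp_I_mul :
    (fun x : ℝ => Complex.exp (Complex.I * (x : ℂ))).HasTemperateGrowth := by
  have h : ContDiff ℝ ∞ (Complex.ofReal) := Complex.ofRealCLM.contDiff
  refine ⟨by fun_prop, fun n => ⟨0, 1, fun x => ?_⟩⟩
  rw [norm_iteratedFDeriv_eq_norm_iteratedDeriv, iteratedDeriv_cexp_I_mul]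
  simp

theorem hasTemperateGrowth_chirp {d : ℕ} (s : ℝ) :
    (chirp s : Rd d → ℂ).HasTemperateGrowth := by
  have h : (fun y : Rd d => s * ‖y‖ ^ 2).HasTemperateGrowth := by fun_prop
  exact hasTemperateGrowth_cexp_I_mul.comp h

theorem osc_eq_fourierInv {d : ℕ} (g : 𝓢(Rd d, ℂ)) (s : ℝ) (ζ : Rd d) :
    osc g s ζ = 𝓕⁻ (SchwartzMap.smulLeftCLM ℂ (chirp s) g) ζ := by
  rw [SchwartzMap.fourierInv_coe, Real.fourierInv_eq']
  unfold osc
  congr 1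
  funext y
  rw [SchwartzMap.smulLeftCLM_apply_apply (hasTemperateGrowth_chirp s), smul_eq_mul, smul_eq_mul,
    ← mul_assoc, chirp, ← Complex.exp_add, real_inner_comm]
  congr 2
  push_cast
  ring

theorem osc_zero {d : ℕ} (g : 𝓢(Rd d, ℂ)) (ζ : Rd d) : osc g 0 ζ = 𝓕⁻ g ζ := by
  rw [osc_eq_fourierInv]
  have : (chirp 0 : Rd d → ℂ) = fun _ => 1 := by funext y; simp [chirp]
  rw [this]; simp

theorem norm_osc_le {d : ℕ} (g : 𝓢(Rd d, ℂ)) (s : ℝ) (ζ : Rd d) :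
    ‖osc g s ζ‖ ≤ ∫ y, ‖g y‖ := by
  refine (norm_integral_le_integral_norm _).trans (le_of_eq ?_)
  congr 1; funext y
  rw [norm_mul, norm_cexp_I_mul_ofReal, one_mul]

theorem continuous_osc {d : ℕ} (g : 𝓢(Rd d, ℂ)) :
    Continuous (fun z : ℝ × Rd d => osc g z.1 z.2) := by
  refine continuous_of_dominated (bound := fun y => ‖g y‖) ?_ ?_ g.integrable.norm ?_
  · intro z; exact Continuous.aestronglyMeasurable (by fun_prop)
  · intro z; refine ae_of_all _ fun y => ?_
    rw [norm_mul, norm_cexp_I_mul_ofReal, one_mul]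
  · refine ae_of_all _ fun y => by fun_prop

/-- Multiplication by `i |y|²`, the generator of the flow `s ↦ e^{i s |y|²}`. -/
noncomputable def quadMul {d : ℕ} (g : 𝓢(Rd d, ℂ)) : 𝓢(Rd d, ℂ) :=
  SchwartzMap.smulLeftCLM ℂ (fun y : Rd d => Complex.I * ((‖y‖ ^ 2 : ℝ) : ℂ)) g

theorem quadMul_apply {d : ℕ} (g : 𝓢(Rd d, ℂ)) (y : Rd d) :
    quadMul g y = Complex.I * ((‖y‖ ^ 2 : ℝ) : ℂ) * g y := by
  rw [quadMul, SchwartzMap.smulLeftCLM_apply_apply (by fun_prop), smul_eq_mul]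

theorem hasDerivAt_osc {d : ℕ} (g : 𝓢(Rd d, ℂ)) (s : ℝ) (ζ : Rd d) :
    HasDerivAt (fun s => osc g s ζ) (osc (quadMul g) s ζ) s := by
  have := hasDerivAt_integral_of_dominated_loc_of_deriv_le (μ := (volume : Measure (Rd d)))
    (F := fun s y => Complex.exp (Complex.I * ((s * ‖y‖ ^ 2 + 2 * Real.pi * inner ℝ ζ y : ℝ) : ℂ)) * g y)
    (F' := fun s y => Complex.exp (Complex.I * ((s * ‖y‖ ^ 2 + 2 * Real.pi * inner ℝ ζ y : ℝ) : ℂ)) * quadMul g y)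
    (x₀ := s) (s := univ) (bound := fun y => ‖quadMul g y‖) univ_mem
    (Eventually.of_forall fun s => Continuous.aestronglyMeasurable (by fun_prop))
    ?_ (Continuous.aestronglyMeasurable (by fun_prop)) ?_ (quadMul g).integrable.norm ?_
  · exact this.2
  · refine (g.integrable.norm).mono' (Continuous.aestronglyMeasurable (by fun_prop))
      (ae_of_all _ fun y => ?_)
    rw [norm_mul, norm_cexp_I_mul_ofReal, one_mul]
  · refine ae_of_all _ fun y s _ => ?_
    rw [norm_mul, norm_cexp_I_mul_ofReal, one_mul]
  · refine ae_of_all _ fun y s _ => ?_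
    rw [quadMul_apply]
    have h : HasDerivAt (fun s : ℝ => ((s * ‖y‖ ^ 2 + 2 * Real.pi * inner ℝ ζ y : ℝ) : ℂ))
        (((1 * ‖y‖ ^ 2 : ℝ)) : ℂ) s :=
      HasDerivAt.ofReal_comp (((hasDerivAt_id s).mul_const _).add_const _)
    have h2 := (((h.const_mul Complex.I).cexp).mul_const (g y))
    exact h2.congr_deriv (by rw [one_mul]; ring)

/-- Multiplication by |y|² is -Δ/(2π)² on the other side of the Fourier transform. The
`s`-derivative of `osc` is thus governed by a local operator; all asymptotics below come from this
locality. -/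
theorem fourierInv_quadMul {d : ℕ} (g : 𝓢(Rd d, ℂ)) :
    𝓕⁻ (quadMul g) = (-Complex.I / (2 * Real.pi) ^ 2) • Δ (𝓕⁻ g) := by
  have h := SchwartzMap.laplacian_eq_fourierMultiplierCLM (E := Rd d) (𝓕⁻ g)
  rw [SchwartzMap.fourierMultiplierCLM_apply, FourierTransform.fourier_fourierInv_eq] at h
  have h2 : quadMul g = Complex.I • SchwartzMap.smulLeftCLM ℂ (fun y : Rd d => ‖y‖ ^ 2) g := by
    ext y
    rw [quadMul_apply, smul_apply,
      SchwartzMap.smulLeftCLM_apply_apply (by fun_prop), smul_eq_mul, Complex.real_smul]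
    ring
  rw [h, h2, FourierTransform.fourierInv_smul]
  ext y
  simp only [smul_apply, Complex.real_smul, smul_eq_mul]
  push_cast
  field_simp

/-- The Laplacian is local and annihilates constants. -/
theorem fourierInv_quadMul_eventuallyEq {d : ℕ} (g : 𝓢(Rd d, ℂ)) (c : ℂ) (ζ : Rd d)
    (h : ∀ᶠ z in 𝓝 ζ, 𝓕⁻ g z = c) : ∀ᶠ z in 𝓝 ζ, 𝓕⁻ (quadMul g) z = 0 := by
  rw [fourierInv_quadMul]
  filter_upwards [eventually_eventually_nhds.2 h] with z hz
  rw [smul_apply, SchwartzMap.laplacian_apply,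
    (InnerProductSpace.laplacian_congr_nhds (f₂ := fun _ => c) hz).self_of_nhds]
  simp [InnerProductSpace.laplacian_const]

/-- The oscillatory integral differs from its value at `s = 0` by little, relative to its
derivative. -/
theorem norm_osc_sub_le {d : ℕ} (g : 𝓢(Rd d, ℂ)) (ζ : Rd d) (C : ℝ) (N : ℕ)
    (h : ∀ s, ‖osc (quadMul g) s ζ‖ ≤ C * |s| ^ N) (s : ℝ) :
    ‖osc g s ζ - 𝓕⁻ g ζ‖ ≤ C * |s| ^ (N + 1) := by
  have hC : 0 ≤ C := by have := (norm_nonneg _).trans (h 1); simpa using this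
  have := (convex_uIcc (0 : ℝ) s).norm_image_sub_le_of_norm_hasDerivWithin_le
    (f := fun s => osc g s ζ) (f' := fun s => osc (quadMul g) s ζ) (C := C * |s| ^ N)
    (fun x _ => (hasDerivAt_osc g x ζ).hasDerivWithinAt) ?_ (left_mem_uIcc) (right_mem_uIcc)
  · rw [osc_zero] at this
    refine this.trans (le_of_eq ?_)
    simp [pow_succ, mul_assoc]
  · intro x hx
    refine (h x).trans ?_
    have : |x| ≤ |s| := by
      have := abs_sub_left_of_mem_uIcc hx
      simpa using this
    gcongr

/-- Where the Fourier transform of the amplitude vanishes, the oscillatory integral is of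
arbitrarily high order in `s`. -/
theorem exists_norm_osc_le_pow {d : ℕ} (N : ℕ) : ∀ g : 𝓢(Rd d, ℂ), ∃ C : ℝ, 0 ≤ C ∧ ∀ (s : ℝ) (ζ : Rd d),
    (∀ᶠ z in 𝓝 ζ, 𝓕⁻ g z = 0) → ‖osc g s ζ‖ ≤ C * |s| ^ N := by
  induction N with
  | zero =>
    intro g
    exact ⟨∫ y, ‖g y‖, by positivity, fun s ζ _ => by simpa using norm_osc_le g s ζ⟩
  | succ N ih =>
    intro g
    obtain ⟨C, hC, h⟩ := ih (quadMul g)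
    refine ⟨C, hC, fun s ζ hz => ?_⟩
    -- Vanishing near `ζ` is inherited by `quadMul g`, so the induction hypothesis bounds the
    -- derivative in `s`, and integrating from 0 gains one more power.
    have := norm_osc_sub_le g ζ C N (fun s => h s ζ (fourierInv_quadMul_eventuallyEq g 0 ζ hz)) s
    rwa [hz.self_of_nhds, sub_zero] at this

/-- One derivative in `s` removes the constant `c`, after which the vanishing case applies; this is
also why `C` does not depend on `c`. -/
theorem exists_norm_osc_sub_le_pow {d : ℕ} (N : ℕ) (g : 𝓢(Rd d, ℂ)) : ∃ C : ℝ, 0 ≤ C ∧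
    ∀ (s : ℝ) (ζ : Rd d) (c : ℂ), (∀ᶠ z in 𝓝 ζ, 𝓕⁻ g z = c) →
      ‖osc g s ζ - c‖ ≤ C * |s| ^ (N + 1) := by
  obtain ⟨C, hC, h⟩ := exists_norm_osc_le_pow N (quadMul g)
  refine ⟨C, hC, fun s ζ c hz => ?_⟩
  have := norm_osc_sub_le g ζ C N (fun s => h s ζ (fourierInv_quadMul_eventuallyEq g c ζ hz)) s
  rwa [hz.self_of_nhds] at this

/-- Integration by parts, expressed through the Fourier transform of a derivative. A derivative
falling on the chirp costs a factor `s`, so powers of |ζ| are traded for powers of 1 + |s|. -/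
theorem inner_mul_osc {d : ℕ} (g : 𝓢(Rd d, ℂ)) (m : Rd d) (s : ℝ) (ζ : Rd d) :
    -(2 * Real.pi * Complex.I) * (inner ℝ ζ m : ℝ) * osc g s ζ = osc (∂_{m} g) s ζ +
      2 * Complex.I * s * osc (SchwartzMap.smulLeftCLM ℂ (fun y => ((inner ℝ y m : ℝ) : ℂ)) g) s ζ := by
  have key : ∂_{m} (SchwartzMap.smulLeftCLM ℂ (chirp s) g) =
      SchwartzMap.smulLeftCLM ℂ (chirp s) (∂_{m} g) + (2 * Complex.I * s) •
        SchwartzMap.smulLeftCLM ℂ (chirp s)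
          (SchwartzMap.smulLeftCLM ℂ (fun y : Rd d => ((inner ℝ y m : ℝ) : ℂ)) g) := by
    have hc := hasTemperateGrowth_chirp (d := d) s
    ext y
    rw [SchwartzMap.lineDerivOp_apply_eq_fderiv, add_apply, smul_apply,
      SchwartzMap.smulLeftCLM_apply_apply hc, SchwartzMap.smulLeftCLM_apply_apply hc,
      SchwartzMap.smulLeftCLM_apply_apply (by fun_prop), SchwartzMap.lineDerivOp_apply_eq_fderiv]
    have h1 : HasFDerivAt (chirp s : Rd d → ℂ)
        (chirp s y • (Complex.I • Complex.ofRealCLM.comp (s • (2 • innerSL ℝ y)))) y := by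
      refine HasFDerivAt.cexp (HasFDerivAt.const_mul ?_ _)
      exact Complex.ofRealCLM.hasFDerivAt.comp y
        (((hasStrictFDerivAt_norm_sq y).hasFDerivAt).const_mul s)
    have h2 := h1.mul (g.differentiableAt.hasFDerivAt (x := y))
    have h3 : (SchwartzMap.smulLeftCLM ℂ (chirp s) g : Rd d → ℂ) = fun y => chirp s y * g y := by
      funext y; rw [SchwartzMap.smulLeftCLM_apply_apply hc, smul_eq_mul]
    rw [h3]
    have h4 : fderiv ℝ (fun y => chirp s y * g y) y = _ := h2.fderiv
    rw [h4]
    simp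
    ring
  have h := congrArg (fun f : 𝓢(Rd d, ℂ) => 𝓕⁻ f ζ) key
  simp only [SchwartzMap.fourierInv_lineDerivOp_eq, FourierTransform.fourierInv_add,
    FourierTransform.fourierInv_smul, add_apply, smul_apply, ← osc_eq_fourierInv, smul_eq_mul] at h
  rw [← h, SchwartzMap.smulLeftCLM_apply_apply (by fun_prop), osc_eq_fourierInv g]
  simp
  ring

theorem norm_le_sum_abs_coord {d : ℕ} (ζ : Rd d) : ‖ζ‖ ≤ ∑ i, |ζ i| := by
  have h : ζ = ∑ i, ζ i • EuclideanSpace.basisFun (Fin d) ℝ i := by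
    simpa using ((EuclideanSpace.basisFun (Fin d) ℝ).sum_repr ζ).symm
  calc ‖ζ‖ = ‖∑ i, ζ i • EuclideanSpace.basisFun (Fin d) ℝ i‖ := by rw [← h]
    _ ≤ ∑ i, ‖ζ i • EuclideanSpace.basisFun (Fin d) ℝ i‖ := norm_sum_le _ _
    _ = ∑ i, |ζ i| := by simp [norm_smul]

theorem exists_pow_mul_norm_osc_le {d : ℕ} (M : ℕ) : ∀ g : 𝓢(Rd d, ℂ), ∃ C : ℝ, 0 ≤ C ∧
    ∀ (s : ℝ) (ζ : Rd d), ‖ζ‖ ^ M * ‖osc g s ζ‖ ≤ C * (1 + |s|) ^ M := by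
  induction M with
  | zero =>
    intro g
    exact ⟨∫ y, ‖g y‖, by positivity, fun s ζ => by simpa using norm_osc_le g s ζ⟩
  | succ M ih =>
    intro g
    let e : Fin d → Rd d := fun i => EuclideanSpace.basisFun (Fin d) ℝ i
    choose C₁ hC₁ h₁ using fun i => ih (∂_{e i} g)
    choose C₂ hC₂ h₂ using fun i =>
      ih (SchwartzMap.smulLeftCLM ℂ (fun y => ((inner ℝ y (e i) : ℝ) : ℂ)) g)
    refine ⟨∑ i, (C₁ i + 2 * C₂ i), Finset.sum_nonneg fun i _ => by
      have := hC₁ i; have := hC₂ i; positivity, fun s ζ => ?_⟩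
    rw [Finset.sum_mul]
    calc ‖ζ‖ ^ (M + 1) * ‖osc g s ζ‖ = ‖ζ‖ * (‖ζ‖ ^ M * ‖osc g s ζ‖) := by ring
      _ ≤ (∑ i, |ζ i|) * (‖ζ‖ ^ M * ‖osc g s ζ‖) := by
          gcongr; exact norm_le_sum_abs_coord ζ
      _ ≤ _ := ?_
    rw [Finset.sum_mul]
    refine Finset.sum_le_sum fun i _ => ?_
    have hz : inner ℝ ζ (e i) = ζ i := by
      simp [e, EuclideanSpace.inner_single_right]
    have hk := congrArg norm (inner_mul_osc g (e i) s ζ)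
    rw [hz, norm_mul, norm_mul, norm_neg] at hk
    have hpi : (1 : ℝ) ≤ ‖(2 * Real.pi * Complex.I : ℂ)‖ := by
      simp [abs_of_pos Real.pi_pos]
      linarith [Real.pi_gt_three]
    have h3 : |ζ i| * ‖osc g s ζ‖ ≤ ‖osc (∂_{e i} g) s ζ‖ + 2 * |s| *
        ‖osc (SchwartzMap.smulLeftCLM ℂ (fun y => ((inner ℝ y (e i) : ℝ) : ℂ)) g) s ζ‖ := by
      calc |ζ i| * ‖osc g s ζ‖ ≤ ‖(2 * Real.pi * Complex.I : ℂ)‖ * (|ζ i| * ‖osc g s ζ‖) :=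
            le_mul_of_one_le_left (by positivity) hpi
        _ = ‖(2 * Real.pi * Complex.I : ℂ)‖ * ‖((ζ i : ℝ) : ℂ)‖ * ‖osc g s ζ‖ := by
            rw [Complex.norm_real, Real.norm_eq_abs]; ring
        _ ≤ _ := by
            rw [hk]
            refine (norm_add_le _ _).trans (le_of_eq ?_)
            simp
    have a1 := h₁ i s ζ
    have a2 := h₂ i s ζ
    have hs : 0 ≤ |s| := abs_nonneg s
    calc |ζ i| * (‖ζ‖ ^ M * ‖osc g s ζ‖) = ‖ζ‖ ^ M * (|ζ i| * ‖osc g s ζ‖) := by ring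
      _ ≤ ‖ζ‖ ^ M * (‖osc (∂_{e i} g) s ζ‖ + 2 * |s| *
        ‖osc (SchwartzMap.smulLeftCLM ℂ (fun y => ((inner ℝ y (e i) : ℝ) : ℂ)) g) s ζ‖) := by
          gcongr
      _ = ‖ζ‖ ^ M * ‖osc (∂_{e i} g) s ζ‖ + 2 * |s| * (‖ζ‖ ^ M *
        ‖osc (SchwartzMap.smulLeftCLM ℂ (fun y => ((inner ℝ y (e i) : ℝ) : ℂ)) g) s ζ‖) := by ring
      _ ≤ C₁ i * (1 + |s|) ^ M + 2 * |s| * (C₂ i * (1 + |s|) ^ M) := by gcongr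
      _ ≤ C₁ i * (1 + |s|) ^ M * (1 + |s|) + 2 * (1 + |s|) * (C₂ i * (1 + |s|) ^ M) := by
          have := hC₁ i; have := hC₂ i
          have : C₁ i * (1 + |s|) ^ M ≤ C₁ i * (1 + |s|) ^ M * (1 + |s|) :=
            le_mul_of_one_le_right (by positivity) (by linarith)
          gcongr
          linarith
      _ = (C₁ i + 2 * C₂ i) * (1 + |s|) ^ (M + 1) := by ring

/-! ### The free Schrödinger kernel and its frequency localizations. -/

/-- The kernel `(4 π i t)^{-d/2} e^{i |z|² / (4 t)}` of the free Schrödinger propagator. -/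
noncomputable def schrodingerKernel {d : ℕ} (t : ℝ) (z : Rd d) : ℂ :=
  ((Real.pi : ℂ) / (4 * Real.pi ^ 2 * t * Complex.I)) ^ ((d : ℂ) / 2) *
    Complex.exp (Complex.I * ((‖z‖ ^ 2 / (4 * t) : ℝ) : ℂ))

/-- The oscillating Gaussian is not integrable, so `i t` is replaced by `ε + i t`. For ε > 0 the
Fourier transform can be moved across the pairing and the Gaussian transform is explicit; both sides
converge by domination as ε → 0. -/
theorem osc_eq_integral_schrodingerKernel {d : ℕ} (Φ : 𝓢(Rd d, ℂ)) {t : ℝ} (ht : 0 < t) (z : Rd d) :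
    osc Φ (-4 * Real.pi ^ 2 * t) z = ∫ w, schrodingerKernel t (z - w) * 𝓕⁻ Φ w := by
  have hpi := Real.pi_pos
  set φ : 𝓢(Rd d, ℂ) := 𝓕⁻ Φ with hφ
  have hΦ : Φ = 𝓕 φ := by rw [hφ, FourierTransform.fourier_fourierInv_eq]
  let b : ℝ → ℂ := fun ε => 4 * Real.pi ^ 2 * (ε + t * Complex.I)
  have hbcont : Continuous b := by fun_prop
  have hb0 : b 0 = 4 * Real.pi ^ 2 * t * Complex.I := by simp [b]; ring
  have hbre : ∀ ε, (b ε).re = 4 * Real.pi ^ 2 * ε := fun ε => by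
    have : b ε = ((4 * Real.pi ^ 2 * ε : ℝ) : ℂ) + ((4 * Real.pi ^ 2 * t : ℝ) : ℂ) * Complex.I := by
      simp [b]; ring
    rw [this, Complex.add_re, Complex.ofReal_re, Complex.re_ofReal_mul, Complex.I_re]; ring
  have hbim : ∀ ε, (b ε).im = 4 * Real.pi ^ 2 * t := fun ε => by
    have : b ε = ((4 * Real.pi ^ 2 * ε : ℝ) : ℂ) + ((4 * Real.pi ^ 2 * t : ℝ) : ℂ) * Complex.I := by
      simp [b]; ring
    rw [this, Complex.add_im, Complex.ofReal_im, Complex.im_ofReal_mul, Complex.I_im]; ring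
  have hbne : ∀ ε, b ε ≠ 0 := fun ε h => by
    have := hbim ε
    rw [h, Complex.zero_im] at this
    have : 0 < 4 * Real.pi ^ 2 * t := by positivity
    linarith
  have hid : ∀ ε : ℝ, 0 < ε → ∫ ξ : Rd d, Φ ξ * Complex.exp (-b ε * ‖ξ‖ ^ 2 + 2 * Real.pi * Complex.I * (inner ℝ z ξ : ℝ))
      = ∫ w : Rd d, φ w * ((Real.pi / b ε) ^ ((d : ℂ) / 2) *
        Complex.exp (-Real.pi ^ 2 * ‖z - w‖ ^ 2 / b ε)) := by
    intro ε hε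
    have hb : 0 < (b ε).re := by rw [hbre]; positivity
    have hint := GaussianFourier.integrable_cexp_neg_mul_sq_norm_add (V := Rd d) hb (2 * Real.pi * Complex.I) z
    have h : ∫ ξ : Rd d, 𝓕 (φ : Rd d → ℂ) ξ • Complex.exp (-b ε * ‖ξ‖ ^ 2 + 2 * Real.pi * Complex.I * (inner ℝ z ξ : ℝ))
        = ∫ w, φ w • 𝓕 (fun v : Rd d => Complex.exp (-b ε * ‖v‖ ^ 2 + 2 * Real.pi * Complex.I * (inner ℝ z v : ℝ))) w := by
      simpa using! VectorFourier.integral_fourierIntegral_smul_eq_flip (L := innerₗ (Rd d))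
        Real.continuous_fourierChar continuous_inner φ.integrable hint
    have hF : ∀ w : Rd d, 𝓕 (fun v : Rd d => Complex.exp (-b ε * ‖v‖ ^ 2 + 2 * Real.pi * Complex.I * (inner ℝ z v : ℝ))) w = _ :=
      fun w => fourier_gaussian_innerProductSpace' hb z w
    simp only [hF, smul_eq_mul, finrank_euclideanSpace_fin] at h
    rw [← h, hΦ, SchwartzMap.fourier_coe]
  have hL : Tendsto (fun ε => ∫ ξ : Rd d, Φ ξ * Complex.exp (-b ε * ‖ξ‖ ^ 2 + 2 * Real.pi * Complex.I * (inner ℝ z ξ : ℝ)))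
      (𝓝[>] 0) (𝓝 (∫ ξ : Rd d, Φ ξ * Complex.exp (-b 0 * ‖ξ‖ ^ 2 + 2 * Real.pi * Complex.I * (inner ℝ z ξ : ℝ)))) := by
    refine tendsto_integral_filter_of_dominated_convergence (fun ξ => ‖Φ ξ‖)
      (Eventually.of_forall fun ε => Continuous.aestronglyMeasurable (by fun_prop)) ?_
      Φ.integrable.norm (ae_of_all _ fun ξ => ?_)
    · filter_upwards [self_mem_nhdsWithin] with ε hε
      refine ae_of_all _ fun ξ => ?_
      rw [norm_mul, Complex.norm_exp]
      refine mul_le_of_le_one_right (norm_nonneg _) (Real.exp_le_one_iff.2 ?_)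
      have : (-b ε * ‖ξ‖ ^ 2 + 2 * Real.pi * Complex.I * (inner ℝ z ξ : ℝ)).re = -(b ε).re * ‖ξ‖ ^ 2 := by
        have : (-b ε * ‖ξ‖ ^ 2 + 2 * Real.pi * Complex.I * (inner ℝ z ξ : ℝ)) =
          -(b ε * ((‖ξ‖ ^ 2 : ℝ) : ℂ)) + ((2 * Real.pi * (inner ℝ z ξ) : ℝ) : ℂ) * Complex.I := by
          push_cast; ring
        rw [this, Complex.add_re, Complex.neg_re, Complex.re_mul_ofReal, Complex.re_ofReal_mul, Complex.I_re]
        ring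
      rw [this, hbre]
      have hε' : (0 : ℝ) < ε := hε
      have : 0 ≤ 4 * Real.pi ^ 2 * ε * ‖ξ‖ ^ 2 := by positivity
      linarith
    · exact Continuous.tendsto' (by fun_prop) _ _ rfl |>.mono_left nhdsWithin_le_nhds
  have hcp : Tendsto (fun ε => ((Real.pi : ℂ) / b ε) ^ ((d : ℂ) / 2)) (𝓝[>] 0) (𝓝 ((Real.pi / b 0) ^ ((d : ℂ) / 2))) := by
    have h1 : ContinuousAt (fun ε => (Real.pi : ℂ) / b ε) 0 :=
      continuousAt_const.div hbcont.continuousAt (hbne 0)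
    -- The limit lies on the negative imaginary axis, off the branch cut, so the principal power is
    -- continuous there.
    have h2 : (Real.pi : ℂ) / b 0 ∈ Complex.slitPlane := by
      right
      rw [hb0]
      have : (Real.pi : ℂ) / (4 * Real.pi ^ 2 * t * Complex.I) = ((-(1 / (4 * Real.pi * t)) : ℝ) : ℂ) * Complex.I := by
        have : (Real.pi : ℂ) ≠ 0 := by exact_mod_cast hpi.ne'
        have : (t : ℂ) ≠ 0 := by exact_mod_cast ht.ne'
        push_cast
        field_simp
        simp
      rw [this]
      simp
      exact ht.ne'
    exact ((h1.cpow continuousAt_const h2).tendsto).mono_left nhdsWithin_le_nhds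
  have hR : Tendsto (fun ε => ∫ w : Rd d, φ w * ((Real.pi / b ε) ^ ((d : ℂ) / 2) *
        Complex.exp (-Real.pi ^ 2 * ‖z - w‖ ^ 2 / b ε)))
      (𝓝[>] 0) (𝓝 (∫ w : Rd d, φ w * ((Real.pi / b 0) ^ ((d : ℂ) / 2) *
        Complex.exp (-Real.pi ^ 2 * ‖z - w‖ ^ 2 / b 0)))) := by
    have hcb := (hcp.norm.eventually (eventually_le_nhds (lt_add_one _)))
    refine tendsto_integral_filter_of_dominated_convergence
      (fun w => ‖φ w‖ * (‖((Real.pi : ℂ) / b 0) ^ ((d : ℂ) / 2)‖ + 1))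
      (Eventually.of_forall fun ε => Continuous.aestronglyMeasurable ?_) ?_
      (φ.integrable.norm.mul_const _) (ae_of_all _ fun w => ?_)
    · have := hbne ε
      fun_prop
    · filter_upwards [self_mem_nhdsWithin, hcb] with ε hε hcε
      refine ae_of_all _ fun w => ?_
      rw [norm_mul, norm_mul]
      refine mul_le_mul_of_nonneg_left ?_ (norm_nonneg _)
      refine (mul_le_of_le_one_right (norm_nonneg _) ?_).trans hcε
      rw [Complex.norm_exp]
      refine Real.exp_le_one_iff.2 ?_
      have : (-Real.pi ^ 2 * ‖z - w‖ ^ 2 / b ε : ℂ) = ((-(Real.pi ^ 2 * ‖z - w‖ ^ 2) : ℝ) : ℂ) * (b ε)⁻¹ := by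
        push_cast; ring
      rw [this, Complex.re_ofReal_mul, Complex.inv_re, hbre]
      have hε' : (0 : ℝ) < ε := hε
      have : 0 ≤ (Real.pi ^ 2 * ‖z - w‖ ^ 2) * (4 * Real.pi ^ 2 * ε / Complex.normSq (b ε)) := by
        have := Complex.normSq_nonneg (b ε)
        positivity
      linarith
    · refine tendsto_const_nhds.mul (hcp.mul ?_)
      have h1 : ContinuousAt (fun ε => Complex.exp (-Real.pi ^ 2 * ‖z - w‖ ^ 2 / b ε)) 0 :=
        (continuousAt_const.div hbcont.continuousAt (hbne 0)).cexp
      exact h1.tendsto.mono_left nhdsWithin_le_nhds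
  have heq := tendsto_nhds_unique (hL.congr' (by
    filter_upwards [self_mem_nhdsWithin] with ε hε using hid ε hε)) hR
  have e1 : osc Φ (-4 * Real.pi ^ 2 * t) z = ∫ ξ : Rd d, Φ ξ * Complex.exp (-b 0 * ‖ξ‖ ^ 2 + 2 * Real.pi * Complex.I * (inner ℝ z ξ : ℝ)) := by
    unfold osc
    congr 1
    funext ξ
    rw [mul_comm, hb0]
    congr 2
    push_cast
    ring
  rw [e1, heq]
  congr 1
  funext w
  rw [mul_comm, schrodingerKernel, hb0]
  congr 3
  have : (Real.pi : ℂ) ≠ 0 := by exact_mod_cast hpi.ne'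
  have : (t : ℂ) ≠ 0 := by exact_mod_cast ht.ne'
  push_cast
  field_simp
  simp

theorem norm_schrodingerKernel {d : ℕ} {t : ℝ} (ht : 0 < t) (z : Rd d) :
    ‖schrodingerKernel t z‖ = (4 * Real.pi * t) ^ (-(d : ℝ) / 2) := by
  have hpi := Real.pi_pos
  rw [schrodingerKernel, norm_mul, norm_cexp_I_mul_ofReal, mul_one]
  have h : ((d : ℂ) / 2) = (((d : ℝ) / 2 : ℝ) : ℂ) := by push_cast; rfl
  rw [h, Complex.norm_cpow_real]
  have h2 : ‖(Real.pi : ℂ) / (4 * Real.pi ^ 2 * t * Complex.I)‖ = (4 * Real.pi * t)⁻¹ := by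
    simp [abs_of_pos hpi, abs_of_pos ht]
    field_simp
  rw [h2, Real.inv_rpow (by positivity), neg_div, Real.rpow_neg (by positivity)]

/-- The evolution of a Schwartz function, as the propagator kernel times an amplitude. -/
theorem osc_eq_schrodingerKernel_mul {d : ℕ} (Φ : 𝓢(Rd d, ℂ)) {t : ℝ} (ht : 0 < t) (z : Rd d) :
    osc Φ (-4 * Real.pi ^ 2 * t) z =
      schrodingerKernel t z * osc (𝓕⁻ Φ) (1 / (4 * t)) (-(4 * Real.pi * t)⁻¹ • z) := by
  rw [osc_eq_integral_schrodingerKernel Φ ht, osc, ← integral_const_mul]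
  congr 1
  funext w
  rw [← mul_assoc, schrodingerKernel, schrodingerKernel, mul_assoc _ (Complex.exp _) (Complex.exp _),
    ← Complex.exp_add]
  congr 3
  rw [← mul_add, ← Complex.ofReal_add]
  congr 2
  -- In |z-w|²/4t = |z|²/4t - ⟨z,w⟩/2t + |w|²/4t the first term belongs to the free kernel; the
  -- other two are the phase of `osc` with parameter 1/4t at the point -z/4πt.
  rw [norm_sub_sq_real, real_inner_smul_left]
  have := Real.pi_pos
  field_simp
  ring

theorem norm_osc_schrodinger {d : ℕ} (Φ : 𝓢(Rd d, ℂ)) {t : ℝ} (ht : 0 < t) (z : Rd d) :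
    ‖osc Φ (-4 * Real.pi ^ 2 * t) z‖ = (4 * Real.pi * t) ^ (-(d : ℝ) / 2) *
      ‖osc (𝓕⁻ Φ) (1 / (4 * t)) (-(4 * Real.pi * t)⁻¹ • z)‖ := by
  rw [osc_eq_schrodingerKernel_mul Φ ht, norm_mul, norm_schrodingerKernel ht]

/-- The reflection makes the amplitude of `osc_eq_schrodingerKernel_mul`, evaluated at -z/4πt, see
the symbol at the velocity z/4πt. -/
theorem fourierInv_fourierInv_apply {d : ℕ} (Φ : 𝓢(Rd d, ℂ)) (ζ : Rd d) :
    𝓕⁻ (𝓕⁻ Φ) ζ = Φ (-ζ) := by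
  have h := congrArg (fun f : 𝓢(Rd d, ℂ) => f (-ζ)) (FourierTransform.fourier_fourierInv_eq (F := 𝓢(Rd d, ℂ)) Φ)
  rw [← h, SchwartzMap.fourierInv_coe, SchwartzMap.fourier_coe, Real.fourierInv_eq_fourier_neg]

theorem eventually_fourierInv_fourierInv {d : ℕ} (Φ : 𝓢(Rd d, ℂ)) (ζ : Rd d) (c : ℂ)
    (h : ∀ᶠ z in 𝓝 ζ, Φ z = c) : ∀ᶠ z in 𝓝 (-ζ), 𝓕⁻ (𝓕⁻ Φ) z = c := by
  have h2 : Tendsto (fun z : Rd d => -z) (𝓝 (-ζ)) (𝓝 ζ) := by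
    simpa using (continuous_neg (G := Rd d)).tendsto (-ζ)
  filter_upwards [h2.eventually h] with z hz
  rw [fourierInv_fourierInv_apply, hz]

theorem rpow_neg_half_le_one {d : ℕ} {t : ℝ} (ht : 1 ≤ t) :
    (4 * Real.pi * t) ^ (-(d : ℝ) / 2) ≤ 1 := by
  refine Real.rpow_le_one_of_one_le_of_nonpos ?_ ?_
  · nlinarith [Real.pi_gt_three]
  · have : (0 : ℝ) ≤ d := by positivity
    linarith

/-- Away from the set of velocities in the support of the symbol, the kernel of the localized
propagator is rapidly decaying. -/
theorem exists_norm_osc_le_of_far {d : ℕ} (Φ : 𝓢(Rd d, ℂ)) (N : ℕ) : ∃ C : ℝ, 0 ≤ C ∧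
    ∀ t : ℝ, 1 ≤ t → ∀ z : Rd d, (∀ᶠ ζ in 𝓝 ((4 * Real.pi * t)⁻¹ • z), Φ ζ = 0) →
      ‖osc Φ (-4 * Real.pi ^ 2 * t) z‖ * (t + ‖z‖) ^ N ≤ C := by
  obtain ⟨C₁, hC₁, h₁⟩ := exists_norm_osc_le_pow (2 * N) (𝓕⁻ Φ)
  obtain ⟨C₂, hC₂, h₂⟩ := exists_pow_mul_norm_osc_le (2 * N) Φ
  -- The bound A ≲ t^{-2N} and the bound A ≲ (t/‖z‖)^{2N} are averaged geometrically, which leaves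
  -- order `N` in ‖z‖. The 41 comes from 1 + 4π²t ≤ 41t for t ≥ 1, using π² ≤ 10.
  refine ⟨2 ^ (N - 1) * (C₁ + Real.sqrt (C₁ * (C₂ * 41 ^ (2 * N)))), by positivity,
    fun t ht z hz => ?_⟩
  have ht0 : 0 < t := by linarith
  set A := ‖osc Φ (-4 * Real.pi ^ 2 * t) z‖ with hA
  have hA0 : 0 ≤ A := norm_nonneg _
  have e1 : A * t ^ (2 * N) ≤ C₁ := by
    have h := h₁ (1 / (4 * t)) (-(4 * Real.pi * t)⁻¹ • z)
      (by rw [neg_smul]; exact eventually_fourierInv_fourierInv Φ _ 0 hz)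
    have : A ≤ C₁ * (1 / t) ^ (2 * N) := by
      rw [hA, norm_osc_schrodinger Φ ht0]
      refine (mul_le_of_le_one_left (norm_nonneg _) (rpow_neg_half_le_one ht)).trans (h.trans ?_)
      rw [abs_of_nonneg (by positivity)]
      gcongr
      linarith
    calc A * t ^ (2 * N) ≤ C₁ * (1 / t) ^ (2 * N) * t ^ (2 * N) := by gcongr
      _ = C₁ := by rw [mul_assoc, ← mul_pow, one_div_mul_cancel ht0.ne', one_pow, mul_one]
  have e2 : ‖z‖ ^ (2 * N) * A ≤ C₂ * 41 ^ (2 * N) * t ^ (2 * N) := by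
    refine (h₂ _ z).trans ?_
    rw [mul_assoc C₂, ← mul_pow]
    gcongr
    rw [abs_mul, abs_of_pos ht0, neg_mul, abs_neg, abs_of_nonneg (by positivity)]
    have : Real.pi ^ 2 ≤ 10 := by nlinarith [Real.pi_lt_d2, Real.pi_pos]
    nlinarith
  have e3 : ‖z‖ ^ N * A ≤ Real.sqrt (C₁ * (C₂ * 41 ^ (2 * N))) := by
    refine Real.le_sqrt_of_sq_le ?_
    have : 0 < t ^ (2 * N) := by positivity
    refine le_of_mul_le_mul_right ?_ this
    calc (‖z‖ ^ N * A) ^ 2 * t ^ (2 * N) = (A * t ^ (2 * N)) * (‖z‖ ^ (2 * N) * A) := by ring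
      _ ≤ C₁ * (C₂ * 41 ^ (2 * N) * t ^ (2 * N)) := by gcongr
      _ = _ := by ring
  have e4 : A * t ^ N ≤ C₁ := by
    refine le_trans ?_ e1
    gcongr
    omega
  calc A * (t + ‖z‖) ^ N ≤ A * (2 ^ (N - 1) * (t ^ N + ‖z‖ ^ N)) := by
        gcongr
        exact add_pow_le ht0.le (norm_nonneg _) N
    _ = 2 ^ (N - 1) * (A * t ^ N + ‖z‖ ^ N * A) := by ring
    _ ≤ _ := by gcongr

theorem exists_norm_osc_le_of_abs_le {d : ℕ} (Φ : 𝓢(Rd d, ℂ)) (N : ℕ) (S : ℝ) : ∃ C : ℝ, 0 ≤ C ∧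
    ∀ s : ℝ, |s| ≤ S → ∀ z : Rd d, ‖osc Φ s z‖ * (1 + ‖z‖) ^ N ≤ C := by
  obtain ⟨C₁, hC₁, h₁⟩ := exists_pow_mul_norm_osc_le N Φ
  refine ⟨2 ^ (N - 1) * ((∫ y, ‖Φ y‖) + C₁ * (1 + |S|) ^ N), by positivity, fun s hs z => ?_⟩
  calc ‖osc Φ s z‖ * (1 + ‖z‖) ^ N ≤ ‖osc Φ s z‖ * (2 ^ (N - 1) * (1 ^ N + ‖z‖ ^ N)) := by
        gcongr
        exact add_pow_le zero_le_one (norm_nonneg _) N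
    _ = 2 ^ (N - 1) * (‖osc Φ s z‖ + ‖z‖ ^ N * ‖osc Φ s z‖) := by ring
    _ ≤ _ := by
      have h := (h₁ s z).trans (mul_le_mul_of_nonneg_left
        (pow_le_pow_left₀ (by positivity) (add_le_add_right (hs.trans (le_abs_self S)) 1) N) hC₁)
      have h' := norm_osc_le Φ s z
      exact mul_le_mul_of_nonneg_left (add_le_add h' h) (by positivity)

/-- Where the symbol is identically one, the kernel of the localized propagator agrees with the
propagator kernel up to a rapidly decaying error. -/
theorem exists_norm_osc_sub_schrodingerKernel_le {d : ℕ} (Φ : 𝓢(Rd d, ℂ)) (N : ℕ) :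
    ∃ C : ℝ, 0 ≤ C ∧ ∀ t : ℝ, 0 < t → ∀ z : Rd d,
      (∀ᶠ ζ in 𝓝 ((4 * Real.pi * t)⁻¹ • z), Φ ζ = 1) →
      ‖osc Φ (-4 * Real.pi ^ 2 * t) z - schrodingerKernel t z‖ ≤
        (4 * Real.pi * t) ^ (-(d : ℝ) / 2) * (C * (1 / t) ^ (N + 1)) := by
  obtain ⟨C₁, hC₁, h₁⟩ := exists_norm_osc_sub_le_pow N (𝓕⁻ Φ)
  refine ⟨C₁, hC₁, fun t ht z hz => ?_⟩
  have h := h₁ (1 / (4 * t)) (-(4 * Real.pi * t)⁻¹ • z) 1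
      (by rw [neg_smul]; exact eventually_fourierInv_fourierInv Φ _ 1 hz)
  rw [osc_eq_schrodingerKernel_mul Φ ht, ← mul_sub_one, norm_mul, norm_schrodingerKernel ht]
  gcongr
  refine h.trans ?_
  rw [abs_of_nonneg (by positivity)]
  gcongr
  linarith

theorem measurable_schrodingerKernel {d : ℕ} :
    Measurable (fun z : ℝ × Rd d => schrodingerKernel z.1 z.2) := by
  unfold schrodingerKernel
  fun_prop

/-- The frequency localized evolution `e^{itΔ} Φ(D/2π) f`. -/
noncomputable def evol {d : ℕ} (Φ : 𝓢(Rd d, ℂ)) (t : ℝ) (f : Rd d → ℂ) (x : Rd d) : ℂ :=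
  ∫ y, osc Φ (-4 * Real.pi ^ 2 * t) (x - y) * f y

theorem evol_congr {d : ℕ} (Φ : 𝓢(Rd d, ℂ)) (t : ℝ) {f g : Rd d → ℂ} (h : f =ᵐ[volume] g)
    (x : Rd d) : evol Φ t f x = evol Φ t g x := by
  refine integral_congr_ae ?_
  filter_upwards [h] with y hy
  rw [hy]

/-- `evol` ignores null sets, so `f` may be replaced by a measurable version. The result holds
everywhere, so that slices can later be taken without exceptional sets. -/
theorem stronglyMeasurable_evol {d : ℕ} (Φ : 𝓢(Rd d, ℂ)) {f : Rd d → ℂ}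
    (hf : AEStronglyMeasurable f volume) :
    StronglyMeasurable (fun z : Rd d × ℝ => evol Φ z.2 f z.1) := by
  have h : (fun z : Rd d × ℝ => evol Φ z.2 f z.1) = fun z => evol Φ z.2 (hf.mk f) z.1 := by
    funext z; exact evol_congr _ _ hf.ae_eq_mk _
  rw [h]
  unfold evol
  refine StronglyMeasurable.integral_prod_right (f := fun (z : Rd d × ℝ) y =>
    osc Φ (-4 * Real.pi ^ 2 * z.2) (z.1 - y) * hf.mk f y) ?_
  refine StronglyMeasurable.mul (Continuous.stronglyMeasurable ?_)
    (hf.stronglyMeasurable_mk.comp_measurable measurable_snd)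
  exact (continuous_osc Φ).comp (f := fun p : (Rd d × ℝ) × Rd d =>
    (-4 * Real.pi ^ 2 * p.1.2, p.1.1 - p.2)) (by fun_prop)

/-! ### Mixed norms. -/

theorem eLpNorm_ennreal_const_mul {α : Type*} [MeasurableSpace α] {μ : Measure α} {c : ℝ≥0∞}
    (hc : c ≠ ⊤) (G : α → ℝ≥0∞) (q : ℝ≥0∞) :
    eLpNorm (fun x => c * G x) q μ = c * eLpNorm G q μ := by
  rcases eq_or_ne q 0 with rfl | hq0
  · simp
  rcases eq_or_ne q ⊤ with rfl | hqt
  · simp only [eLpNorm_exponent_top, eLpNormEssSup, enorm_eq_self]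
    exact ENNReal.essSup_const_mul
  · have hq : 0 < q.toReal := ENNReal.toReal_pos hq0 hqt
    rw [eLpNorm_eq_lintegral_rpow_enorm_toReal hq0 hqt,
      eLpNorm_eq_lintegral_rpow_enorm_toReal hq0 hqt]
    simp only [enorm_eq_self, ENNReal.mul_rpow_of_nonneg _ _ hq.le]
    rw [lintegral_const_mul' _ _ (ENNReal.rpow_ne_top_of_nonneg hq.le hc),
      ENNReal.mul_rpow_of_nonneg _ _ (by positivity), ← ENNReal.rpow_mul,
      mul_one_div_cancel hq.ne', ENNReal.rpow_one]

/-- For finite exponents this is Tonelli. For r = ∞ the essential supremum at `x` exceeds `a`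
exactly when the slice at `x` of the superlevel set {|F| > a} has positive measure, and the measure
of slices is measurable. -/
theorem measurable_eLpNorm_right {α β ε : Type*} [MeasurableSpace α] [MeasurableSpace β]
    [TopologicalSpace ε] [ContinuousENorm ε]
    {μ : Measure β} [SFinite μ] {F : α → β → ε}
    (hF : StronglyMeasurable (Function.uncurry F)) (r : ℝ≥0∞) :
    Measurable (fun x => eLpNorm (F x) r μ) := by
  rcases eq_or_ne r 0 with rfl | hr0
  · simp
  have hFm : Measurable (fun z : α × β => ‖F z.1 z.2‖ₑ) := hF.enorm
  rcases eq_or_ne r ⊤ with rfl | hrt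
  · refine measurable_of_Ioi fun a => ?_
    have hs : MeasurableSet {z : α × β | a < ‖F z.1 z.2‖ₑ} := measurableSet_lt measurable_const hFm
    have h := measurable_measure_prodMk_left (ν := μ) hs
    have heq : (fun x => eLpNorm (F x) ⊤ μ) ⁻¹' Ioi a =
        {x | 0 < μ (Prod.mk x ⁻¹' {z : α × β | a < ‖F z.1 z.2‖ₑ})} := by
      ext x
      simp only [mem_preimage, mem_Ioi, mem_ofPred_eq, pos_iff_ne_zero, preimage_ofPred_eq]
      rw [← not_le, not_iff_comm, not_not, eLpNorm_exponent_top]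
      constructor
      · intro h0
        refine essSup_le_of_ae_le a ?_
        have : ∀ᵐ t ∂μ, ¬ a < ‖F x t‖ₑ := measure_eq_zero_iff_ae_notMem.1 h0
        filter_upwards [this] with t ht using not_lt.1 ht
      · intro hle
        refine measure_eq_zero_iff_ae_notMem.2 ?_
        filter_upwards [ae_le_eLpNormEssSup (f := F x) (μ := μ)] with t ht
        exact not_lt.2 (ht.trans hle)
    rw [heq]
    exact measurableSet_lt measurable_const h
  · simp only [eLpNorm_eq_lintegral_rpow_enorm_toReal hr0 hrt]
    exact ((hFm.pow_const _).lintegral_prod_right').pow_const _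

section mixedNorm

variable {d : ℕ} {q r : ℝ≥0∞} {A : Set (Rd d)} {J : Set ℝ} {F G : Rd d → ℝ → ℂ}

theorem mixedNorm_mono (hA : MeasurableSet A) (hJ : MeasurableSet J)
    (h : ∀ x ∈ A, ∀ t ∈ J, ‖F x t‖ ≤ ‖G x t‖) : mixedNorm q r A J F ≤ mixedNorm q r A J G := by
  refine eLpNorm_mono_enorm_ae ?_
  filter_upwards [ae_restrict_mem hA] with x hx
  refine eLpNorm_mono_enorm_ae ?_
  filter_upwards [ae_restrict_mem hJ] with t ht
  exact enorm_le_iff_norm_le.2 (h x hx t ht)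

theorem mixedNorm_congr (hA : MeasurableSet A) (hJ : MeasurableSet J)
    (h : ∀ x ∈ A, ∀ t ∈ J, ‖F x t‖ = ‖G x t‖) : mixedNorm q r A J F = mixedNorm q r A J G :=
  le_antisymm (mixedNorm_mono hA hJ fun x hx t ht => (h x hx t ht).le)
    (mixedNorm_mono hA hJ fun x hx t ht => (h x hx t ht).ge)

theorem mixedNorm_mono_set {A' : Set (Rd d)} {J' : Set ℝ} (hA : A ⊆ A') (hJ : J ⊆ J') :
    mixedNorm q r A J F ≤ mixedNorm q r A' J' F := by
  refine (eLpNorm_mono_measure _ (Measure.restrict_mono_set _ hA)).trans ?_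
  exact eLpNorm_mono_enorm fun x => eLpNorm_mono_measure _ (Measure.restrict_mono_set _ hJ)

theorem mixedNorm_zero : mixedNorm q r A J (fun _ _ => 0) = 0 := by
  unfold mixedNorm
  have : (fun _ : Rd d => eLpNorm (fun _ : ℝ => (0 : ℂ)) r (volume.restrict J)) = fun _ => 0 := by
    funext x; exact eLpNorm_zero'
  rw [this]
  exact eLpNorm_zero'

theorem mixedNorm_add_le (hq : 1 ≤ q) (hr : 1 ≤ r) (hF : StronglyMeasurable (Function.uncurry F))
    (hG : StronglyMeasurable (Function.uncurry G)) :
    mixedNorm q r A J (fun x t => F x t + G x t) ≤ mixedNorm q r A J F + mixedNorm q r A J G := by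
  refine le_trans (eLpNorm_mono_enorm (g := (fun x => eLpNorm (F x) r (volume.restrict J)) +
    fun x => eLpNorm (G x) r (volume.restrict J)) fun x => ?_)
    (eLpNorm_add_le (measurable_eLpNorm_right hF r).aestronglyMeasurable
      (measurable_eLpNorm_right hG r).aestronglyMeasurable hq)
  exact eLpNorm_add_le (hF.comp_measurable measurable_prodMk_left).aestronglyMeasurable
    (hG.comp_measurable measurable_prodMk_left).aestronglyMeasurable hr

theorem mixedNorm_sum_le {ι : Type*} (s : Finset ι) {F : ι → Rd d → ℝ → ℂ} (hq : 1 ≤ q)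
    (hr : 1 ≤ r) (hF : ∀ i, StronglyMeasurable (Function.uncurry (F i))) :
    mixedNorm q r A J (fun x t => ∑ i ∈ s, F i x t) ≤ ∑ i ∈ s, mixedNorm q r A J (F i) := by
  classical
  induction s using Finset.induction_on with
  | empty => simp [mixedNorm_zero]
  | insert i s hi ih =>
    simp only [Finset.sum_insert hi]
    refine (mixedNorm_add_le hq hr (hF i) ?_).trans (by gcongr)
    have := Finset.stronglyMeasurable_fun_sum s fun i _ => hF i
    exact this

theorem mixedNorm_const_mul (c : ℂ) :
    mixedNorm q r A J (fun x t => c * F x t) = ‖c‖ₑ * mixedNorm q r A J F := by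
  unfold mixedNorm
  rw [← eLpNorm_ennreal_const_mul enorm_ne_top]
  congr 1
  funext x
  exact eLpNorm_const_smul c (F x) r _

theorem mixedNorm_le_of_norm_le (hA : MeasurableSet A) (hJ : MeasurableSet J)
    {c : ℝ≥0∞} (h : ∀ x ∈ A, ∀ t ∈ J, ‖F x t‖ₑ ≤ c) :
    mixedNorm q r A J F ≤ c * volume J ^ r.toReal⁻¹ * volume A ^ q.toReal⁻¹ := by
  have h1 : ∀ᵐ x ∂(volume.restrict A), ‖eLpNorm (F x) r (volume.restrict J)‖ₑ ≤
      c * volume J ^ r.toReal⁻¹ := by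
    filter_upwards [ae_restrict_mem hA] with x hx
    have : ∀ᵐ t ∂(volume.restrict J), ‖F x t‖ₑ ≤ c := by
      filter_upwards [ae_restrict_mem hJ] with t ht using h x hx t ht
    simpa using eLpNorm_le_of_ae_enorm_bound (p := r) this
  unfold mixedNorm
  simpa using eLpNorm_le_of_ae_enorm_bound (p := q) h1

theorem mixedNorm_le_mul_of_norm_le (hA : MeasurableSet A) (hJ : MeasurableSet J) {c : ℝ}
    (h : ∀ x ∈ A, ∀ t ∈ J, ‖F x t‖ ≤ c * ‖G x t‖) :
    mixedNorm q r A J F ≤ ENNReal.ofReal c * mixedNorm q r A J G := by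
  rcases le_or_gt 0 c with hc | hc
  · have : ENNReal.ofReal c = ‖(c : ℂ)‖ₑ := by
      rw [← ofReal_norm]; simp [abs_of_nonneg hc]
    rw [this, ← mixedNorm_const_mul]
    refine mixedNorm_mono hA hJ fun x hx t ht => ?_
    rw [norm_mul]; simpa [abs_of_nonneg hc] using h x hx t ht
  · rw [ENNReal.ofReal_of_nonpos hc.le, zero_mul, ← mixedNorm_zero (q := q) (r := r) (A := A) (J := J)]
    refine mixedNorm_mono hA hJ fun x hx t ht => (h x hx t ht).trans ?_
    simpa using mul_nonpos_of_nonpos_of_nonneg hc.le (norm_nonneg (G x t))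

theorem eLpNorm_restrict_union_le {α ε : Type*} [MeasurableSpace α] [TopologicalSpace ε]
    [ESeminormedAddMonoid ε] {μ : Measure α} {f : α → ε} (hf : AEStronglyMeasurable f μ) {s t : Set α}
    (hs : MeasurableSet s) (ht : MeasurableSet t) (hr : 1 ≤ r) :
    eLpNorm f r (μ.restrict (s ∪ t)) ≤ eLpNorm f r (μ.restrict s) + eLpNorm f r (μ.restrict t) := by
  rw [← eLpNorm_indicator_eq_eLpNorm_restrict hs, ← eLpNorm_indicator_eq_eLpNorm_restrict ht,
    ← eLpNorm_indicator_eq_eLpNorm_restrict (hs.union ht)]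
  have : (s ∪ t).indicator f = s.indicator f + (t \ s).indicator f := by
    funext x
    by_cases h1 : x ∈ t <;> by_cases h2 : x ∈ s <;> simp [h1, h2]
  rw [this]
  refine (eLpNorm_add_le (hf.indicator hs) (hf.indicator (ht.diff hs)) hr).trans ?_
  gcongr
  refine eLpNorm_mono_enorm fun x => ?_
  by_cases h1 : x ∈ t <;> by_cases h2 : x ∈ s <;> simp [h1, h2]

theorem mixedNorm_union_le (hq : 1 ≤ q) (hr : 1 ≤ r) (hF : StronglyMeasurable (Function.uncurry F))
    {J₁ J₂ : Set ℝ} (h₁ : MeasurableSet J₁) (h₂ : MeasurableSet J₂) :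
    mixedNorm q r A (J₁ ∪ J₂) F ≤ mixedNorm q r A J₁ F + mixedNorm q r A J₂ F := by
  refine le_trans (eLpNorm_mono_enorm (g := (fun x => eLpNorm (F x) r (volume.restrict J₁)) +
    fun x => eLpNorm (F x) r (volume.restrict J₂)) fun x => ?_)
    (eLpNorm_add_le (measurable_eLpNorm_right hF r).aestronglyMeasurable
      (measurable_eLpNorm_right hF r).aestronglyMeasurable hq)
  exact eLpNorm_restrict_union_le
    (hF.comp_measurable measurable_prodMk_left).aestronglyMeasurable h₁ h₂ hr

theorem eLpNorm_le_of_measure_le_smul_map {α β ε : Type*} [MeasurableSpace α] [MeasurableSpace β]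
    [TopologicalSpace ε] [ContinuousENorm ε] {μ : Measure β} {ν : Measure α} {e : α → β}
    (he : MeasurableEmbedding e) {K : ℝ≥0∞} (h : μ ≤ K • ν.map e) (f : β → ε) (p : ℝ≥0∞) :
    eLpNorm f p μ ≤ K ^ (p⁻¹).toReal * eLpNorm (fun x => f (e x)) p ν := by
  have := eLpNorm_le_of_measure_le_smul h (f := f) (p := p)
  rwa [he.eLpNorm_map_measure, one_div, smul_eq_mul] at this

/-- Change of variables in mixed norms. -/
theorem mixedNorm_le_comp {A' : Set (Rd d)} {J' : Set ℝ} {e : Rd d → Rd d} {τ : ℝ → ℝ}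
    (he : MeasurableEmbedding e) (hτ : MeasurableEmbedding τ) {K₁ K₂ : ℝ≥0∞} (hK₂ : K₂ ≠ ⊤)
    (h₁ : (volume.restrict A : Measure (Rd d)) ≤ K₁ • (volume.restrict A').map e)
    (h₂ : (volume.restrict J : Measure ℝ) ≤ K₂ • (volume.restrict J').map τ) :
    mixedNorm q r A J F ≤ K₁ ^ (q⁻¹).toReal * K₂ ^ (r⁻¹).toReal *
      mixedNorm q r A' J' (fun x t => F (e x) (τ t)) := by
  have hK : K₂ ^ (r⁻¹).toReal ≠ ⊤ := ENNReal.rpow_ne_top_of_nonneg (by positivity) hK₂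
  unfold mixedNorm
  refine (eLpNorm_le_of_measure_le_smul_map he h₁ _ q).trans ?_
  rw [mul_assoc, ← eLpNorm_ennreal_const_mul hK]
  gcongr
  refine eLpNorm_mono_enorm fun x => ?_
  exact eLpNorm_le_of_measure_le_smul_map hτ h₂ _ r

end mixedNorm

/-! ### Changes of variables: affine maps in space, inversion in time. -/

theorem measurableEmbedding_affine {d : ℕ} (c : Rd d) {a : ℝ} (ha : a ≠ 0) :
    MeasurableEmbedding (fun x : Rd d => c + a • x) :=
  ((Homeomorph.smulOfNeZero a ha).trans (Homeomorph.addLeft c)).measurableEmbedding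

theorem map_affine_volume {d : ℕ} (c : Rd d) {a : ℝ} (ha : 0 < a) :
    (volume : Measure (Rd d)).map (fun x => c + a • x) = ENNReal.ofReal ((a ^ d)⁻¹) • volume := by
  have h : (fun x : Rd d => c + a • x) = (fun x => c + x) ∘ (fun x => a • x) := rfl
  rw [h, ← Measure.map_map (measurable_const_add c) (measurable_const_smul a),
    Measure.map_addHaar_smul _ ha.ne', Measure.map_smul, map_add_left_eq_self,
    finrank_euclideanSpace_fin, abs_of_pos (by positivity)]

/-- A domination of measures suffices for upper bounds of norms, and it requires only an inclusion
of the preimage of `A` in `A'`, not equality. -/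
theorem restrict_le_smul_map_affine {d : ℕ} (c : Rd d) {a : ℝ} (ha : 0 < a) {A A' : Set (Rd d)}
    (h : ∀ x, c + a • x ∈ A → x ∈ A') :
    (volume.restrict A : Measure (Rd d)) ≤
      ENNReal.ofReal (a ^ d) • (volume.restrict A').map (fun x => c + a • x) := by
  have he := measurableEmbedding_affine c ha.ne'
  have h1 : (volume : Measure (Rd d)) =
      ENNReal.ofReal (a ^ d) • (volume : Measure (Rd d)).map (fun x => c + a • x) := by
    rw [map_affine_volume c ha, smul_smul, ← ENNReal.ofReal_mul (by positivity),
      mul_inv_cancel₀ (by positivity), ENNReal.ofReal_one, one_smul]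
  conv_lhs => rw [h1]
  rw [Measure.restrict_smul, he.restrict_map]
  gcongr
  · exact he.measurable
  · exact h

theorem eLpNorm_comp_affine {d : ℕ} {ε : Type*} [TopologicalSpace ε] [ContinuousENorm ε]
    (c : Rd d) {a : ℝ} (ha : 0 < a) (f : Rd d → ε) (p : ℝ≥0∞) :
    eLpNorm (fun x => f (c + a • x)) p volume =
      ENNReal.ofReal ((a ^ d)⁻¹) ^ (p⁻¹).toReal * eLpNorm f p volume := by
  have he := measurableEmbedding_affine c ha.ne'
  have h : (fun x => f (c + a • x)) = f ∘ (fun x => c + a • x) := rfl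
  rw [h, ← he.eLpNorm_map_measure, map_affine_volume c ha, eLpNorm_smul_measure_of_ne_zero,
    one_div, smul_eq_mul]
  simp; positivity

theorem lintegral_comp_affine {d : ℕ} (c : Rd d) {a : ℝ} (ha : 0 < a) (f : Rd d → ℝ≥0∞) :
    ∫⁻ x, f x = ENNReal.ofReal (a ^ d) * ∫⁻ x, f (c + a • x) := by
  have he := measurableEmbedding_affine c ha.ne'
  rw [← he.lintegral_map, map_affine_volume c ha, lintegral_smul_measure, smul_eq_mul, ← mul_assoc,
    ← ENNReal.ofReal_mul (by positivity), mul_inv_cancel₀ (by positivity), ENNReal.ofReal_one, one_mul]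

theorem measurableEmbedding_const_div {b : ℝ} (hb : b ≠ 0) : MeasurableEmbedding (fun s : ℝ => b / s) := by
  have h : (fun s : ℝ => b / s) = ((MeasurableEquiv.inv ℝ).trans (MeasurableEquiv.mulLeft₀ b hb)) := by
    funext s; simp [div_eq_mul_inv]
  rw [h]
  exact MeasurableEquiv.measurableEmbedding _

/-- The inversion `s ↦ b / s` distorts Lebesgue measure by a bounded factor away from the origin. -/
theorem restrict_le_smul_map_const_div {b l : ℝ} (hb : 0 < b) (hl : 0 < l) {J : Set ℝ}
    (hJ : MeasurableSet J) (hJl : ∀ t ∈ J, l ≤ b / t) {J' : Set ℝ}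
    (h : ∀ t ∈ J, b / t ∈ J') :
    (volume.restrict J : Measure ℝ) ≤
      ENNReal.ofReal (b / l ^ 2) • (volume.restrict J').map (fun s => b / s) := by
  have he := measurableEmbedding_const_div hb.ne'
  -- The inversion is an involution on all of ℝ; the convention b/0 = 0 covers the origin.
  have hinv : ∀ t : ℝ, b / (b / t) = t := fun t => by
    rcases eq_or_ne t 0 with rfl | ht
    · simp
    · field_simp
  refine Measure.le_iff.2 fun S hS => ?_
  rw [Measure.restrict_apply hS, Measure.smul_apply, he.map_apply, smul_eq_mul,
    Measure.restrict_apply (he.measurable hS)]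
  set P : Set ℝ := (fun s => b / s) ⁻¹' (S ∩ J) with hP
  have hPm : MeasurableSet P := he.measurable (hS.inter hJ)
  have himg : S ∩ J = (fun s => b / s) '' P := by
    ext t
    simp only [hP, mem_image, mem_preimage]
    constructor
    · intro ht; exact ⟨b / t, by rwa [hinv], hinv t⟩
    · rintro ⟨s, hs, rfl⟩; exact hs
  have hPl : ∀ s ∈ P, l ≤ s := fun s hs => by simpa [hinv] using hJl _ hs.2
  have hPsub : P ⊆ (fun s => b / s) ⁻¹' S ∩ J' := fun s hs =>
    ⟨hs.1, by simpa [hinv] using h _ hs.2⟩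
  have hder : ∀ s ∈ P, HasDerivWithinAt (fun s => b / s) (-b / s ^ 2) P s := fun s hs => by
    have hs0 : s ≠ 0 := (hl.trans_le (hPl s hs)).ne'
    have := ((hasDerivAt_const s b).div (hasDerivAt_id s) hs0)
    refine (this.congr_deriv ?_).hasDerivWithinAt
    simp
  have hint := lintegral_image_eq_lintegral_abs_deriv_mul hPm hder he.injective.injOn (fun _ => 1)
  rw [← himg, setLIntegral_one] at hint
  rw [hint]
  calc ∫⁻ s in P, ENNReal.ofReal |-b / s ^ 2| * 1 ≤ ∫⁻ s in P, ENNReal.ofReal (b / l ^ 2) := by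
        refine setLIntegral_mono measurable_const fun s hs => ?_
        rw [mul_one]
        refine ENNReal.ofReal_le_ofReal ?_
        -- The Jacobian b/s² is at most b/l² on s ≥ l.
        rw [abs_div, abs_neg, abs_of_pos hb, abs_of_nonneg (by positivity)]
        have := hPl s hs
        gcongr
    _ = ENNReal.ofReal (b / l ^ 2) * volume P := by rw [setLIntegral_const]
    _ ≤ _ := by gcongr

/-! ### Polynomial weights and the passage from local to global estimates. -/

/-- The weight `(1 + |y - x| / T)^{-(d+1)}`. -/
noncomputable def polyWeight {d : ℕ} (T : ℝ) (x y : Rd d) : ℝ := ((1 + ‖y - x‖ / T) ^ (d + 1))⁻¹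

section polyWeight

variable {d : ℕ} {T : ℝ}

theorem polyWeight_pos (hT : 0 < T) (x y : Rd d) : 0 < polyWeight T x y := by
  unfold polyWeight; positivity

theorem polyWeight_le_one (hT : 0 < T) (x y : Rd d) : polyWeight T x y ≤ 1 := by
  unfold polyWeight
  refine inv_le_one_of_one_le₀ (one_le_pow₀ ?_)
  have : 0 ≤ ‖y - x‖ / T := by positivity
  linarith

theorem polyWeight_comm (x y : Rd d) : polyWeight T x y = polyWeight T y x := by
  unfold polyWeight; rw [norm_sub_rev]

theorem continuous_polyWeight (hT : 0 < T) :
    Continuous (fun z : Rd d × Rd d => polyWeight T z.1 z.2) := by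
  unfold polyWeight
  refine Continuous.inv₀ (by fun_prop) fun z => ?_
  positivity

theorem measurable_polyWeight : Measurable (fun z : Rd d × Rd d => polyWeight T z.1 z.2) := by
  unfold polyWeight; fun_prop

/-- The total mass of the weight at unit scale. -/
noncomputable def polyMass (d : ℕ) : ℝ≥0∞ := ∫⁻ y : Rd d, ENNReal.ofReal (polyWeight 1 0 y)

theorem polyMass_ne_top (d : ℕ) : polyMass d ≠ ⊤ := by
  have h := finite_integral_one_add_norm (E := Rd d) (μ := volume) (r := d + 1) (by simp)
  refine ne_of_lt (lt_of_le_of_lt (lintegral_mono fun y => ?_) h)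
  refine ENNReal.ofReal_le_ofReal ?_
  unfold polyWeight
  rw [Real.rpow_neg (by positivity)]
  norm_cast
  simp

theorem lintegral_polyWeight (hT : 0 < T) (x : Rd d) :
    ∫⁻ y, ENNReal.ofReal (polyWeight T x y) = ENNReal.ofReal (T ^ d) * polyMass d := by
  rw [lintegral_comp_affine x hT]
  congr 2
  funext y
  unfold polyWeight
  rw [add_sub_cancel_left, norm_smul, Real.norm_of_nonneg hT.le, mul_div_cancel_left₀ _ hT.ne']
  simp

/-- Hölder with respect to the measure of density `polyWeight T x`, which is at most Lebesgue
measure and has mass comparable to T^d. Since T ≥ 1, the power 1 - 1/p of the mass is bounded by the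
enlarged mass T^d (1 + `polyMass d`) itself. -/
theorem lintegral_polyWeight_mul_le {p : ℝ≥0∞} (hp : 1 ≤ p) (hT : 1 ≤ T) (x : Rd d)
    {G : Rd d → ℝ≥0∞} (hG : AEMeasurable G volume) :
    ∫⁻ y, ENNReal.ofReal (polyWeight T x y) * G y ≤
      ENNReal.ofReal (T ^ d) * (1 + polyMass d) * eLpNorm G p volume := by
  have hT0 : 0 < T := by linarith
  have hw : Measurable (fun y : Rd d => ENNReal.ofReal (polyWeight T x y)) :=
    (measurable_polyWeight.comp measurable_prodMk_left).ennreal_ofReal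
  set ν := (volume : Measure (Rd d)).withDensity (fun y => ENNReal.ofReal (polyWeight T x y)) with hν
  have hνle : ν ≤ volume := by
    refine Measure.le_iff.2 fun s hs => ?_
    rw [hν, withDensity_apply _ hs]
    calc ∫⁻ a in s, ENNReal.ofReal (polyWeight T x a) ≤ ∫⁻ a in s, 1 := by
          refine lintegral_mono fun y => ?_
          simpa using polyWeight_le_one hT0 x y
      _ = volume s := by simp
  have hνu : ν univ = ENNReal.ofReal (T ^ d) * polyMass d := by
    rw [hν, withDensity_apply _ MeasurableSet.univ, setLIntegral_univ, lintegral_polyWeight hT0]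
  have h1 : ∫⁻ y, ENNReal.ofReal (polyWeight T x y) * G y = eLpNorm G 1 ν := by
    rw [eLpNorm_one_eq_lintegral_enorm, hν, lintegral_withDensity_eq_lintegral_mul₀ hw.aemeasurable]
    · rfl
    · exact hG
  have h2 := eLpNorm_le_eLpNorm_mul_rpow_measure_univ hp
    (hG.mono_ac (Measure.absolutelyContinuous_of_le hνle)).aestronglyMeasurable
  rw [h1]
  refine h2.trans ?_
  rw [mul_comm (_ * _)]
  refine mul_le_mul' (eLpNorm_mono_measure _ hνle) ?_
  · rw [hνu]
    have hexp : 1 / (1 : ℝ≥0∞).toReal - 1 / p.toReal ≤ 1 := by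
      simp
    have hexp0 : 0 ≤ 1 / (1 : ℝ≥0∞).toReal - 1 / p.toReal := by
      rcases eq_or_ne p ⊤ with rfl | hpt
      · simp
      · have : 1 ≤ p.toReal := by
          rw [← ENNReal.toReal_one]; exact ENNReal.toReal_mono hpt hp
        simp
        exact inv_le_one_of_one_le₀ this
    have hT1 : 1 ≤ ENNReal.ofReal (T ^ d) := by
      rw [ENNReal.one_le_ofReal]; exact one_le_pow₀ hT
    calc (ENNReal.ofReal (T ^ d) * polyMass d) ^ (1 / (1 : ℝ≥0∞).toReal - 1 / p.toReal)
        ≤ (ENNReal.ofReal (T ^ d) * (1 + polyMass d)) ^ (1 / (1 : ℝ≥0∞).toReal - 1 / p.toReal) := by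
          gcongr; exact le_add_self
      _ ≤ (ENNReal.ofReal (T ^ d) * (1 + polyMass d)) ^ (1 : ℝ) :=
          ENNReal.rpow_le_rpow_of_exponent_le
            (one_le_mul hT1 le_self_add) hexp
      _ = _ := ENNReal.rpow_one _

/-- A local estimate, uniform in the centre, with rapidly decaying weights on the right hand side
implies the global estimate. -/
theorem exists_eLpNorm_le_of_forall_ball {p q : ℝ≥0∞} (hp : 1 ≤ p) (hpq : p ≤ q) {ε : ℝ}
    (hε : 0 < ε) : ∃ C : ℝ≥0∞, C ≠ ⊤ ∧ ∀ T : ℝ, 0 < T → ∀ (G : Rd d → ℝ≥0∞) (f : Rd d → ℂ)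
      (A : ℝ≥0∞), Measurable G → AEStronglyMeasurable f volume →
      (∀ x, eLpNorm G q (volume.restrict (Metric.ball x (ε * T))) ≤
        A * eLpNorm (fun y => (polyWeight T x y : ℂ) * f y) p volume) →
      eLpNorm G q volume ≤ C * A * eLpNorm f p volume := by
  have hwf : ∀ T : ℝ, 0 < T → ∀ (f : Rd d → ℂ) x,
      eLpNorm (fun y => (polyWeight T x y : ℂ) * f y) p volume ≤ eLpNorm f p volume := by
    intro T hT f x
    refine eLpNorm_mono fun y => ?_
    rw [norm_mul, Complex.norm_real, Real.norm_of_nonneg (polyWeight_pos hT x y).le]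
    exact mul_le_of_le_one_left (norm_nonneg _) (polyWeight_le_one hT x y)
  rcases eq_or_ne q ⊤ with rfl | hqt
  · refine ⟨1, ENNReal.one_ne_top, fun T hT G f A hG hf h => ?_⟩
    rw [one_mul, eLpNorm_exponent_top]
    refine essSup_le_of_ae_le _ ?_
    -- For q = ∞ no summation is needed: a locally null set is null.
    have : volume {x | ¬ ‖G x‖ₑ ≤ A * eLpNorm f p volume} = 0 := by
      refine measure_null_of_locally_null _ fun x _ => ?_
      refine ⟨{x | ¬ ‖G x‖ₑ ≤ A * eLpNorm f p volume} ∩ Metric.ball x (ε * T),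
        inter_mem self_mem_nhdsWithin (mem_nhdsWithin_of_mem_nhds (Metric.ball_mem_nhds x (by positivity))), ?_⟩
      have h1 : ∀ᵐ y ∂(volume.restrict (Metric.ball x (ε * T))), ‖G y‖ₑ ≤ A * eLpNorm f p volume := by
        filter_upwards [ae_le_eLpNormEssSup (f := G) (μ := volume.restrict (Metric.ball x (ε * T)))] with y hy
        refine hy.trans ((h x).trans ?_)
        gcongr
        exact hwf T hT f x
      rw [ae_restrict_iff' Metric.isOpen_ball.measurableSet] at h1
      refine measure_mono_null ?_ (ae_iff.1 h1)
      rintro y ⟨hy1, hy2⟩ hy3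
      exact hy1 (hy3 hy2)
    exact ae_iff.2 this
  have hpt : p ≠ ⊤ := ne_top_of_le_ne_top hqt hpq
  have hp0 : p ≠ 0 := (zero_lt_one.trans_le hp).ne'
  have hq0 : q ≠ 0 := (zero_lt_one.trans_le (hp.trans hpq)).ne'
  have hP1 : 1 ≤ p.toReal := by
    rw [← ENNReal.toReal_one]; exact ENNReal.toReal_mono hpt hp
  have hPQ : p.toReal ≤ q.toReal := ENNReal.toReal_mono hqt hpq
  have hQ0 : 0 < q.toReal := by linarith
  set P := p.toReal
  set Q := q.toReal
  set V := volume (Metric.ball (0 : Rd d) ε) with hV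
  have hV0 : V ≠ 0 := (Metric.measure_ball_pos volume _ hε).ne'
  have hVt : V ≠ ⊤ := measure_ball_lt_top.ne
  refine ⟨(polyMass d / V) ^ (1 / Q), ENNReal.rpow_ne_top_of_nonneg (by positivity)
    (ENNReal.div_ne_top (polyMass_ne_top d) hV0), fun T hT G f A hG hf h => ?_⟩
  have hvol : ∀ x : Rd d, volume (Metric.ball x (ε * T)) = ENNReal.ofReal (T ^ d) * V := fun x => by
    rw [mul_comm, hV, Measure.addHaar_ball_mul_of_pos volume x hT, finrank_euclideanSpace_fin]
  have hTd0 : ENNReal.ofReal (T ^ d) ≠ 0 := by simp; positivity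
  set N := eLpNorm f p volume with hN
  have hNP : N ^ P = ∫⁻ y, ‖f y‖ₑ ^ P := by
    rw [hN, eLpNorm_eq_lintegral_rpow_enorm_toReal hp0 hpt, ← ENNReal.rpow_mul, one_div_mul_cancel
      (by linarith), ENNReal.rpow_one]
  have hset : MeasurableSet {z : Rd d × Rd d | z.2 ∈ Metric.ball z.1 (ε * T)} := by
    refine measurableSet_lt (f := fun z : Rd d × Rd d => dist z.2 z.1) (by fun_prop) measurable_const
  -- The power `Q` is split as (Q - P) + P. The weight is dropped in the first factor, which only
  -- produces the global norm; in the second it is kept, with its power `P` ≥ 1 lowered to 1 because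
  -- the weight is at most 1. Here P ≤ Q is essential.
  have hloc : ∀ x, ∫⁻ y in Metric.ball x (ε * T), G y ^ Q ≤
      A ^ Q * (N ^ (Q - P) * ∫⁻ y, ENNReal.ofReal (polyWeight T x y) * ‖f y‖ₑ ^ P) := by
    intro x
    have h1 := h x
    rw [eLpNorm_eq_lintegral_rpow_enorm_toReal hq0 hqt] at h1
    have h2 := ENNReal.rpow_le_rpow h1 hQ0.le
    rw [← ENNReal.rpow_mul, one_div_mul_cancel hQ0.ne', ENNReal.rpow_one,
      ENNReal.mul_rpow_of_nonneg _ _ hQ0.le] at h2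
    refine h2.trans ?_
    gcongr
    have h3 : (eLpNorm (fun y => (polyWeight T x y : ℂ) * f y) p volume) ^ Q =
        (eLpNorm (fun y => (polyWeight T x y : ℂ) * f y) p volume) ^ (Q - P) *
        (eLpNorm (fun y => (polyWeight T x y : ℂ) * f y) p volume) ^ P := by
      rw [← ENNReal.rpow_add_of_nonneg _ _ (by linarith) (by linarith)]; congr 1; ring
    rw [h3]
    have h4 : 0 ≤ Q - P := by linarith
    gcongr
    · exact hwf T hT f x
    · rw [eLpNorm_eq_lintegral_rpow_enorm_toReal hp0 hpt, ← ENNReal.rpow_mul, one_div_mul_cancel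
        (by linarith), ENNReal.rpow_one]
      refine lintegral_mono fun y => ?_
      rw [enorm_mul, ENNReal.mul_rpow_of_nonneg _ _ (by linarith)]
      gcongr
      have : ‖(polyWeight T x y : ℂ)‖ₑ = ENNReal.ofReal (polyWeight T x y) := by
        rw [← ofReal_norm, Complex.norm_real, Real.norm_of_nonneg (polyWeight_pos hT x y).le]
      rw [this]
      calc ENNReal.ofReal (polyWeight T x y) ^ P ≤ ENNReal.ofReal (polyWeight T x y) ^ (1 : ℝ) :=
            ENNReal.rpow_le_rpow_of_exponent_ge (by simpa using polyWeight_le_one hT x y) hP1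
        _ = _ := ENNReal.rpow_one _
  -- Fubini: the centres whose ball contains a given `y` form a ball of volume T^d V. The same
  -- factor T^d appears in `hR`, and cancels at the end.
  have hL : ∫⁻ x, ∫⁻ y in Metric.ball x (ε * T), G y ^ Q =
      ENNReal.ofReal (T ^ d) * V * ∫⁻ y, G y ^ Q := by
    have e1 : ∀ x, ∫⁻ y in Metric.ball x (ε * T), G y ^ Q =
        ∫⁻ y, {z : Rd d × Rd d | z.2 ∈ Metric.ball z.1 (ε * T)}.indicator (fun z => G z.2 ^ Q) (x, y) := by
      intro x
      rw [← lintegral_indicator Metric.isOpen_ball.measurableSet]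
      rfl
    simp_rw [e1]
    rw [lintegral_lintegral_swap]
    · rw [← lintegral_const_mul _ (hG.pow_const _)]
      congr 1
      funext y
      have : ∀ x, {z : Rd d × Rd d | z.2 ∈ Metric.ball z.1 (ε * T)}.indicator (fun z => G z.2 ^ Q) (x, y) =
          (Metric.ball y (ε * T)).indicator (fun _ => G y ^ Q) x := by
        intro x
        simp only [indicator, mem_ofPred_eq, Metric.mem_ball, dist_comm y x]
      simp_rw [this]
      rw [lintegral_indicator Metric.isOpen_ball.measurableSet, setLIntegral_const, hvol, mul_comm]
    · exact (((hG.comp measurable_snd).pow_const _).indicator hset).aemeasurable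
  have hR : ∫⁻ x, ∫⁻ y, ENNReal.ofReal (polyWeight T x y) * ‖f y‖ₑ ^ P =
      ENNReal.ofReal (T ^ d) * polyMass d * N ^ P := by
    rw [lintegral_lintegral_swap]
    · have : ∀ y, ∫⁻ x, ENNReal.ofReal (polyWeight T x y) * ‖f y‖ₑ ^ P =
          ENNReal.ofReal (T ^ d) * polyMass d * ‖f y‖ₑ ^ P := by
        intro y
        rw [lintegral_mul_const]
        · simp_rw [polyWeight_comm (T := T) _ y]
          rw [lintegral_polyWeight hT]
        · exact (measurable_polyWeight.comp measurable_prodMk_right).ennreal_ofReal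
      simp_rw [this]
      rw [lintegral_const_mul' _ _ (ENNReal.mul_ne_top ENNReal.ofReal_ne_top (polyMass_ne_top d)), hNP]
    · exact measurable_polyWeight.ennreal_ofReal.aemeasurable.mul
        ((hf.enorm.pow_const _).comp_quasiMeasurePreserving Measure.quasiMeasurePreserving_snd)
  have hmain : ENNReal.ofReal (T ^ d) * V * ∫⁻ y, G y ^ Q ≤
      A ^ Q * (N ^ (Q - P) * (ENNReal.ofReal (T ^ d) * polyMass d * N ^ P)) := by
    rw [← hL, ← hR]
    refine (lintegral_mono hloc).trans ?_
    have hm : AEMeasurable (fun x => ∫⁻ y, ENNReal.ofReal (polyWeight T x y) * ‖f y‖ₑ ^ P) volume := by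
      refine AEMeasurable.lintegral_prod_right' (f := fun z : Rd d × Rd d =>
        ENNReal.ofReal (polyWeight T z.1 z.2) * ‖f z.2‖ₑ ^ P) ?_
      exact measurable_polyWeight.ennreal_ofReal.aemeasurable.mul
        ((hf.enorm.pow_const _).comp_quasiMeasurePreserving Measure.quasiMeasurePreserving_snd)
    rw [lintegral_const_mul'' _ (hm.const_mul _), lintegral_const_mul'' _ hm]
  have hfin : ∫⁻ y, G y ^ Q ≤ polyMass d / V * A ^ Q * N ^ Q := by
    have h5 : N ^ Q = N ^ (Q - P) * N ^ P := by
      rw [← ENNReal.rpow_add_of_nonneg _ _ (by linarith) (by linarith)]; congr 1; ring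
    have h6 : ENNReal.ofReal (T ^ d) * V * ∫⁻ y, G y ^ Q ≤ ENNReal.ofReal (T ^ d) * V *
        (polyMass d / V * A ^ Q * N ^ Q) := by
      refine hmain.trans (le_of_eq ?_)
      rw [h5, ENNReal.div_eq_inv_mul]
      calc A ^ Q * (N ^ (Q - P) * (ENNReal.ofReal (T ^ d) * polyMass d * N ^ P))
          = (V * V⁻¹) * (A ^ Q * (N ^ (Q - P) * (ENNReal.ofReal (T ^ d) * polyMass d * N ^ P))) := by
            rw [ENNReal.mul_inv_cancel hV0 hVt, one_mul]
        _ = _ := by ring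
    exact (ENNReal.mul_le_mul_iff_right (mul_ne_zero hTd0 hV0)
      (ENNReal.mul_ne_top ENNReal.ofReal_ne_top hVt)).1 h6
  rw [eLpNorm_eq_lintegral_rpow_enorm_toReal hq0 hqt]
  simp only [enorm_eq_self]
  refine (ENNReal.rpow_le_rpow hfin (by positivity)).trans (le_of_eq ?_)
  rw [ENNReal.mul_rpow_of_nonneg _ _ (by positivity), ENNReal.mul_rpow_of_nonneg _ _ (by positivity),
    ← ENNReal.rpow_mul, ← ENNReal.rpow_mul, mul_one_div_cancel hQ0.ne', ENNReal.rpow_one, ENNReal.rpow_one]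

end polyWeight

/-- Young's inequality `L¹ * L^p ⊂ L^p`. -/
theorem eLpNorm_convolution_le {d : ℕ} {p : ℝ≥0∞} (hp : 1 ≤ p) {φ f : Rd d → ℂ}
    (hφ : Continuous φ) (hf : AEStronglyMeasurable f volume) :
    eLpNorm (fun x => ∫ y, φ (x - y) * f y) p volume ≤ (∫⁻ y, ‖φ y‖ₑ) * eLpNorm f p volume := by
  set I := ∫⁻ y, ‖φ y‖ₑ with hI
  have hIx : ∀ x, ∫⁻ y, ‖φ (x - y)‖ₑ = I := fun x =>
    lintegral_sub_left_eq_self (fun y => ‖φ y‖ₑ) x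
  have hpt : ∀ x, ‖∫ y, φ (x - y) * f y‖ₑ ≤ ∫⁻ y, ‖φ (x - y)‖ₑ * ‖f y‖ₑ := fun x => by
    refine (enorm_integral_le_lintegral_enorm _).trans (le_of_eq ?_)
    simp_rw [enorm_mul]
  refine (eLpNorm_mono_enorm (g := fun x => ∫⁻ y, ‖φ (x - y)‖ₑ * ‖f y‖ₑ) hpt).trans ?_
  have hφm : Measurable fun z : Rd d × Rd d => ‖φ (z.1 - z.2)‖ₑ :=
    (hφ.comp (continuous_fst.sub continuous_snd)).measurable.enorm
  rcases eq_or_ne p ⊤ with rfl | hpt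
  · rw [eLpNorm_exponent_top]
    refine essSup_le_of_ae_le _ (ae_of_all _ fun x => ?_)
    simp only [enorm_eq_self]
    calc ∫⁻ y, ‖φ (x - y)‖ₑ * ‖f y‖ₑ ≤ ∫⁻ y, ‖φ (x - y)‖ₑ * eLpNorm f ⊤ volume := by
          refine lintegral_mono_ae ?_
          filter_upwards [ae_le_eLpNormEssSup (f := f) (μ := volume)] with y hy
          gcongr
          simpa using hy
      _ = _ := by
          have : Measurable fun y => ‖φ (x - y)‖ₑ := hφm.comp measurable_prodMk_left
          rw [lintegral_mul_const _ this, hIx]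
  have hp0 : p ≠ 0 := (zero_lt_one.trans_le hp).ne'
  have hP1 : 1 ≤ p.toReal := by
    rw [← ENNReal.toReal_one]; exact ENNReal.toReal_mono hpt hp
  set P := p.toReal
  -- Jensen's inequality for the measure |φ(x - y)| dy, whose total mass is `I`.
  have hloc : ∀ x, (∫⁻ y, ‖φ (x - y)‖ₑ * ‖f y‖ₑ) ^ P ≤
      I ^ (P - 1) * ∫⁻ y, ‖φ (x - y)‖ₑ * ‖f y‖ₑ ^ P := by
    intro x
    have hw : Measurable fun y => ‖φ (x - y)‖ₑ := hφm.comp measurable_prodMk_left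
    set ν := (volume : Measure (Rd d)).withDensity (fun y => ‖φ (x - y)‖ₑ) with hν
    have hac : ν ≪ volume := withDensity_absolutelyContinuous _ _
    have e1 : ∫⁻ y, ‖φ (x - y)‖ₑ * ‖f y‖ₑ = eLpNorm f 1 ν := by
      rw [eLpNorm_one_eq_lintegral_enorm, hν, lintegral_withDensity_eq_lintegral_mul₀ hw.aemeasurable hf.enorm]
      rfl
    have e2 : ∫⁻ y, ‖φ (x - y)‖ₑ * ‖f y‖ₑ ^ P = (eLpNorm f p ν) ^ P := by
      rw [eLpNorm_eq_lintegral_rpow_enorm_toReal hp0 hpt, ← ENNReal.rpow_mul, one_div_mul_cancel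
        (by linarith), ENNReal.rpow_one, hν,
        lintegral_withDensity_eq_lintegral_mul₀ hw.aemeasurable (hf.enorm.pow_const _)]
      rfl
    have e3 : ν univ = I := by
      rw [hν, withDensity_apply _ MeasurableSet.univ, setLIntegral_univ, hIx]
    have h2 := eLpNorm_le_eLpNorm_mul_rpow_measure_univ hp (hf.mono_ac hac)
    rw [e1, e2]
    refine (ENNReal.rpow_le_rpow h2 (by linarith)).trans (le_of_eq ?_)
    rw [e3, ENNReal.mul_rpow_of_nonneg _ _ (by linarith), ← ENNReal.rpow_mul, mul_comm]
    congr 2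
    have : P ≠ 0 := by linarith
    simp only [ENNReal.toReal_one]
    change (1 / 1 - 1 / P) * P = P - 1
    field_simp
  rw [eLpNorm_eq_lintegral_rpow_enorm_toReal hp0 hpt, eLpNorm_eq_lintegral_rpow_enorm_toReal hp0 hpt]
  simp only [enorm_eq_self]
  have hjm : AEMeasurable (fun z : Rd d × Rd d => ‖φ (z.1 - z.2)‖ₑ * ‖f z.2‖ₑ ^ P)
      ((volume : Measure (Rd d)).prod volume) :=
    hφm.aemeasurable.mul
      ((hf.enorm.pow_const _).comp_quasiMeasurePreserving Measure.quasiMeasurePreserving_snd)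
  have hint : ∫⁻ x, (∫⁻ y, ‖φ (x - y)‖ₑ * ‖f y‖ₑ) ^ P ≤ I ^ P * ∫⁻ y, ‖f y‖ₑ ^ P := by
    calc ∫⁻ x, (∫⁻ y, ‖φ (x - y)‖ₑ * ‖f y‖ₑ) ^ P
        ≤ ∫⁻ x, I ^ (P - 1) * ∫⁻ y, ‖φ (x - y)‖ₑ * ‖f y‖ₑ ^ P := lintegral_mono hloc
      _ = I ^ (P - 1) * ∫⁻ x, ∫⁻ y, ‖φ (x - y)‖ₑ * ‖f y‖ₑ ^ P := by
          rw [lintegral_const_mul'' _ hjm.lintegral_prod_right']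
      _ = I ^ (P - 1) * ∫⁻ y, I * ‖f y‖ₑ ^ P := by
          rw [lintegral_lintegral_swap hjm]
          congr 2
          funext y
          have : Measurable fun x => ‖φ (x - y)‖ₑ := hφm.comp measurable_prodMk_right
          rw [lintegral_mul_const _ this]
          congr 1
          exact lintegral_sub_right_eq_self (fun y => ‖φ y‖ₑ) y
      _ = I ^ (P - 1) * (I * ∫⁻ y, ‖f y‖ₑ ^ P) := by
          rw [lintegral_const_mul'' _ (hf.enorm.pow_const _)]
      _ = I ^ P * ∫⁻ y, ‖f y‖ₑ ^ P := by
          rw [← mul_assoc]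
          congr 1
          nth_rw 2 [← ENNReal.rpow_one I]
          rw [← ENNReal.rpow_add_of_nonneg _ _ (by linarith) zero_le_one]
          congr 1; ring
  refine (ENNReal.rpow_le_rpow hint (by positivity)).trans (le_of_eq ?_)
  rw [ENNReal.mul_rpow_of_nonneg _ _ (by positivity), ← ENNReal.rpow_mul, mul_one_div_cancel
    (by linarith), ENNReal.rpow_one]

theorem toReal_inv_le_one {p : ℝ≥0∞} (hp : 1 ≤ p) : (p⁻¹).toReal ≤ 1 := by
  rw [← ENNReal.toReal_one]
  exact ENNReal.toReal_mono ENNReal.one_ne_top (ENNReal.inv_le_one.2 hp)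

/-- A crude replacement of volume powers 1/p by the volumes themselves, valid for p = ∞ too; it is
affordable because it is used together with arbitrarily fast decay. -/
theorem rpow_toReal_inv_le {p x y : ℝ≥0∞} (hp : 1 ≤ p) (hxy : x ≤ y) (hy : 1 ≤ y) :
    x ^ p.toReal⁻¹ ≤ y := by
  have h1 : p.toReal⁻¹ ≤ 1 := by rw [← ENNReal.toReal_inv]; exact toReal_inv_le_one hp
  calc x ^ p.toReal⁻¹ ≤ y ^ p.toReal⁻¹ := ENNReal.rpow_le_rpow hxy (by positivity)
    _ ≤ y ^ (1 : ℝ) := ENNReal.rpow_le_rpow_of_exponent_le hy h1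
    _ = y := ENNReal.rpow_one y

/-! ### Weighted estimates for decaying kernels on balls of radius comparable to T. -/

section localization

variable {d : ℕ} {p q r : ℝ≥0∞} {T : ℝ}

theorem polyWeight_sq_eq (hT : 0 < T) (x y : Rd d) :
    ((T + ‖y - x‖) ^ (2 * (d + 1)))⁻¹ = (T ^ (2 * (d + 1)))⁻¹ * polyWeight T x y ^ 2 := by
  unfold polyWeight
  have : T + ‖y - x‖ = T * (1 + ‖y - x‖ / T) := by field_simp
  rw [this, mul_pow, mul_inv, inv_pow, ← pow_mul]
  ring

theorem aestronglyMeasurable_polyWeight_mul (x : Rd d) {f : Rd d → ℂ}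
    (hf : AEStronglyMeasurable f volume) :
    AEStronglyMeasurable (fun y => (polyWeight T x y : ℂ) * f y) volume := by
  have hw : Measurable fun y : Rd d => polyWeight T x y := by unfold polyWeight; fun_prop
  have hw' : Measurable fun y : Rd d => (polyWeight T x y : ℂ) := by fun_prop
  exact hw'.aestronglyMeasurable.mul hf

/-- Of the two available weights, one is spent on Hölder and the other stays attached to `f`. -/
theorem lintegral_polyWeight_sq_mul_le (hp : 1 ≤ p) (hT : 1 ≤ T) (x : Rd d)
    {f : Rd d → ℂ} (hf : AEStronglyMeasurable f volume) :
    ∫⁻ y, ENNReal.ofReal (polyWeight T x y ^ 2) * ‖f y‖ₑ ≤ ENNReal.ofReal (T ^ d) *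
      (1 + polyMass d) * eLpNorm (fun y => (polyWeight T x y : ℂ) * f y) p volume := by
  have hT0 : 0 < T := by linarith
  have hm := aestronglyMeasurable_polyWeight_mul (T := T) x hf
  have h := lintegral_polyWeight_mul_le hp hT x hm.enorm
  rw [eLpNorm_enorm] at h
  refine le_trans (lintegral_mono fun y => le_of_eq ?_) h
  have h0 := (polyWeight_pos hT0 x y).le
  have h1 : ‖(polyWeight T x y : ℂ)‖ₑ = ENNReal.ofReal (polyWeight T x y) := by
    rw [← ofReal_norm, Complex.norm_real, Real.norm_of_nonneg h0]
  have h2 : ENNReal.ofReal (polyWeight T x y ^ 2) =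
      ENNReal.ofReal (polyWeight T x y) * ENNReal.ofReal (polyWeight T x y) := by
    rw [sq, ENNReal.ofReal_mul h0]
  simp only [enorm_mul, h1, h2, mul_assoc]

/-- Decay of order 2(d+1) is T^{-2(d+1)} times two weights; Hölder gives back T^d, leaving
T^{-(d+2)}. Moving the centre from `x` to `x₀` costs a factor 2 per power since ‖x - x₀‖ ≤ T. -/
theorem lintegral_enorm_mul_le_of_decay (hp : 1 ≤ p) (hT : 1 ≤ T) {x x₀ : Rd d}
    (hx : ‖x - x₀‖ ≤ T) {k f : Rd d → ℂ} (hf : AEStronglyMeasurable f volume) {C : ℝ} (hC : 0 ≤ C)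
    (hk : ∀ y, ‖k y‖ * (T + ‖x - y‖) ^ (2 * (d + 1)) ≤ C) :
    ∫⁻ y, ‖k y * f y‖ₑ ≤ ENNReal.ofReal ((T ^ (d + 2))⁻¹) * (ENNReal.ofReal (2 ^ (2 * (d + 1)) * C) *
      (1 + polyMass d) * eLpNorm (fun y => (polyWeight T x₀ y : ℂ) * f y) p volume) := by
  have hT0 : 0 < T := by linarith
  have hk' : ∀ y, ‖k y‖ₑ ≤ ENNReal.ofReal (2 ^ (2 * (d + 1)) * C * (T ^ (2 * (d + 1)))⁻¹) *
      ENNReal.ofReal (polyWeight T x₀ y ^ 2) := by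
    intro y
    rw [← ENNReal.ofReal_mul (by positivity), ← ofReal_norm]
    refine ENNReal.ofReal_le_ofReal ?_
    rw [mul_assoc, ← polyWeight_sq_eq hT0, ← div_eq_mul_inv, le_div_iff₀ (by positivity)]
    have h1 : T + ‖y - x₀‖ ≤ 2 * (T + ‖x - y‖) := by
      have : ‖y - x₀‖ ≤ ‖y - x‖ + ‖x - x₀‖ := norm_sub_le_norm_sub_add_norm_sub y x x₀
      rw [norm_sub_rev y x] at this
      linarith [norm_nonneg (x - y)]
    calc ‖k y‖ * (T + ‖y - x₀‖) ^ (2 * (d + 1)) ≤ ‖k y‖ * (2 * (T + ‖x - y‖)) ^ (2 * (d + 1)) := by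
          gcongr
      _ = 2 ^ (2 * (d + 1)) * (‖k y‖ * (T + ‖x - y‖) ^ (2 * (d + 1))) := by rw [mul_pow]; ring
      _ ≤ _ := by gcongr; exact hk y
  calc ∫⁻ y, ‖k y * f y‖ₑ ≤ ∫⁻ y, ENNReal.ofReal (2 ^ (2 * (d + 1)) * C * (T ^ (2 * (d + 1)))⁻¹) *
        (ENNReal.ofReal (polyWeight T x₀ y ^ 2) * ‖f y‖ₑ) := by
        refine lintegral_mono fun y => ?_
        rw [enorm_mul, ← mul_assoc]
        gcongr
        exact hk' y
    _ = ENNReal.ofReal (2 ^ (2 * (d + 1)) * C * (T ^ (2 * (d + 1)))⁻¹) *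
        ∫⁻ y, (ENNReal.ofReal (polyWeight T x₀ y ^ 2) * ‖f y‖ₑ) :=
        lintegral_const_mul' _ _ ENNReal.ofReal_ne_top
    _ ≤ ENNReal.ofReal (2 ^ (2 * (d + 1)) * C * (T ^ (2 * (d + 1)))⁻¹) * (ENNReal.ofReal (T ^ d) *
      (1 + polyMass d) * eLpNorm (fun y => (polyWeight T x₀ y : ℂ) * f y) p volume) := by
        gcongr
        exact lintegral_polyWeight_sq_mul_le hp hT x₀ hf
    _ = _ := by
        have : (T ^ (d + 2))⁻¹ * (2 ^ (2 * (d + 1)) * C) =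
            2 ^ (2 * (d + 1)) * C * (T ^ (2 * (d + 1)))⁻¹ * T ^ d := by
          have : T ^ (2 * (d + 1)) = T ^ (d + 2) * T ^ d := by ring
          rw [this]
          field_simp
        rw [← mul_assoc, ← mul_assoc, ← mul_assoc, ← mul_assoc, ← ENNReal.ofReal_mul (by positivity),
          ← ENNReal.ofReal_mul (by positivity), this]

theorem setLIntegral_enorm_le_of_near (hp : 1 ≤ p) (hT : 1 ≤ T) {x₀ : Rd d}
    {f : Rd d → ℂ} (hf : AEStronglyMeasurable f volume) {b : ℝ} (hb : 0 ≤ b) {S : Set (Rd d)}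
    (hSm : MeasurableSet S) (hS : ∀ y ∈ S, ‖y - x₀‖ ≤ b * T) :
    ∫⁻ y in S, ‖f y‖ₑ ≤ ENNReal.ofReal (T ^ d) * (ENNReal.ofReal ((1 + b) ^ (2 * (d + 1))) *
      (1 + polyMass d) * eLpNorm (fun y => (polyWeight T x₀ y : ℂ) * f y) p volume) := by
  have hT0 : 0 < T := by linarith
  calc ∫⁻ y in S, ‖f y‖ₑ ≤ ∫⁻ y in S, ENNReal.ofReal ((1 + b) ^ (2 * (d + 1))) *
        (ENNReal.ofReal (polyWeight T x₀ y ^ 2) * ‖f y‖ₑ) := by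
        refine setLIntegral_mono' hSm fun y hy => ?_
        rw [← mul_assoc, ← ENNReal.ofReal_mul (by positivity)]
        refine le_mul_of_one_le_left zero_le (ENNReal.one_le_ofReal.2 ?_)
        unfold polyWeight
        rw [inv_pow, ← pow_mul, mul_comm (d + 1), ← div_eq_mul_inv, one_le_div (by positivity)]
        gcongr
        rw [div_le_iff₀ hT0]
        exact hS y hy
    _ = ENNReal.ofReal ((1 + b) ^ (2 * (d + 1))) *
        ∫⁻ y in S, (ENNReal.ofReal (polyWeight T x₀ y ^ 2) * ‖f y‖ₑ) :=
        lintegral_const_mul' _ _ ENNReal.ofReal_ne_top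
    _ ≤ ENNReal.ofReal ((1 + b) ^ (2 * (d + 1))) *
        ∫⁻ y, (ENNReal.ofReal (polyWeight T x₀ y ^ 2) * ‖f y‖ₑ) := by
        gcongr; exact Measure.restrict_le_self
    _ ≤ ENNReal.ofReal ((1 + b) ^ (2 * (d + 1))) * (ENNReal.ofReal (T ^ d) *
      (1 + polyMass d) * eLpNorm (fun y => (polyWeight T x₀ y : ℂ) * f y) p volume) := by
        gcongr
        exact lintegral_polyWeight_sq_mul_le hp hT x₀ hf
    _ = _ := by ring

/-- The decay T^{-(d+2)} outweighs both the time length T and the volume T^d of the ball, so the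
error terms are bounded whatever `q` and `r` are. -/
theorem mixedNorm_ball_le (hq : 1 ≤ q) (hr : 1 ≤ r) (hT : 1 ≤ T) {ε : ℝ} (x₀ : Rd d)
    {J : Set ℝ} (hJm : MeasurableSet J) (hJ : volume J ≤ ENNReal.ofReal T)
    {F : Rd d → ℝ → ℂ} {c : ℝ≥0∞} (h : ∀ x ∈ Metric.ball x₀ (ε * T), ∀ t ∈ J,
      ‖F x t‖ₑ ≤ ENNReal.ofReal ((T ^ (d + 2))⁻¹) * c) :
    mixedNorm q r (Metric.ball x₀ (ε * T)) J F ≤ c * (1 + volume (Metric.ball (0 : Rd d) ε)) := by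
  have hT0 : 0 < T := by linarith
  refine (mixedNorm_le_of_norm_le Metric.isOpen_ball.measurableSet hJm h).trans ?_
  have h1 : volume J ^ r.toReal⁻¹ ≤ ENNReal.ofReal T :=
    rpow_toReal_inv_le hr hJ (ENNReal.one_le_ofReal.2 hT)
  have hvol : volume (Metric.ball x₀ (ε * T)) =
      ENNReal.ofReal (T ^ d) * volume (Metric.ball (0 : Rd d) ε) := by
    rw [mul_comm, Measure.addHaar_ball_mul_of_pos volume x₀ hT0, finrank_euclideanSpace_fin]
  have h2 : volume (Metric.ball x₀ (ε * T)) ^ q.toReal⁻¹ ≤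
      ENNReal.ofReal (T ^ d) * (1 + volume (Metric.ball (0 : Rd d) ε)) := by
    refine rpow_toReal_inv_le hq ?_ ?_
    · rw [hvol]; gcongr; exact le_add_self
    · exact one_le_mul (ENNReal.one_le_ofReal.2 (one_le_pow₀ hT)) le_self_add
  calc _ ≤ ENNReal.ofReal ((T ^ (d + 2))⁻¹) * c * ENNReal.ofReal T *
        (ENNReal.ofReal (T ^ d) * (1 + volume (Metric.ball (0 : Rd d) ε))) := by gcongr
    _ = ENNReal.ofReal ((T ^ (d + 2))⁻¹ * T * T ^ d) *
        (c * (1 + volume (Metric.ball (0 : Rd d) ε))) := by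
        rw [ENNReal.ofReal_mul (by positivity), ENNReal.ofReal_mul (by positivity)]; ring
    _ ≤ 1 * (c * (1 + volume (Metric.ball (0 : Rd d) ε))) := by
        gcongr
        rw [ENNReal.ofReal_le_one]
        have : (T ^ (d + 2))⁻¹ * T * T ^ d = T⁻¹ := by field_simp; ring
        rw [this]
        exact inv_le_one_of_one_le₀ hT
    _ = _ := one_mul _

end localization

/-! ### The free kernel and the extension operator. -/

/-- Integration against the kernel of the free Schrödinger propagator. -/
noncomputable def kernelInt {d : ℕ} (t : ℝ) (h : Rd d → ℂ) (x : Rd d) : ℂ :=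
  ∫ y, schrodingerKernel t (x - y) * h y

theorem stronglyMeasurable_kernelInt {d : ℕ} {h : Rd d → ℂ} (hh : AEStronglyMeasurable h volume) :
    StronglyMeasurable (fun z : Rd d × ℝ => kernelInt z.2 h z.1) := by
  have h' : (fun z : Rd d × ℝ => kernelInt z.2 h z.1) = fun z => kernelInt z.2 (hh.mk h) z.1 := by
    funext z
    refine integral_congr_ae ?_
    filter_upwards [hh.ae_eq_mk] with y hy
    rw [hy]
  rw [h']
  unfold kernelInt
  refine StronglyMeasurable.integral_prod_right (f := fun (z : Rd d × ℝ) y =>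
    schrodingerKernel z.2 (z.1 - y) * hh.mk h y) ?_
  refine StronglyMeasurable.mul (Measurable.stronglyMeasurable ?_)
    (hh.stronglyMeasurable_mk.comp_measurable measurable_snd)
  exact measurable_schrodingerKernel.comp (f := fun p : (Rd d × ℝ) × Rd d =>
    (p.1.2, p.1.1 - p.2)) (by fun_prop)

theorem integrable_schrodingerKernel_mul {d : ℕ} {t : ℝ} (ht : 0 < t) {h : Rd d → ℂ}
    (hh : Integrable h) (x : Rd d) : Integrable fun y => schrodingerKernel t (x - y) * h y := by
  refine (hh.norm.const_mul ((4 * Real.pi * t) ^ (-(d : ℝ) / 2))).mono' ?_ (ae_of_all _ fun y => ?_)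
  · refine AEStronglyMeasurable.mul ?_ hh.aestronglyMeasurable
    exact (measurable_schrodingerKernel.comp (f := fun y : Rd d => (t, x - y))
      (by fun_prop)).aestronglyMeasurable
  · rw [norm_mul, norm_schrodingerKernel ht]

/-- The frequency cutoff is moved from the kernel to the data, leaving the free kernel, to which the
explicit formula applies. Since that kernel is only bounded, Fubini rests on the integrability of
`g`. -/
theorem evol_eq_kernelInt {d : ℕ} (Φ : 𝓢(Rd d, ℂ)) {t : ℝ} (ht : 0 < t) {g : Rd d → ℂ}
    (hg : Integrable g) (x : Rd d) :
    evol Φ t g x = kernelInt t (fun w => ∫ y, 𝓕⁻ Φ (w - y) * g y) x := by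
  unfold evol kernelInt
  have h1 : ∀ y, osc Φ (-4 * Real.pi ^ 2 * t) (x - y) * g y =
      ∫ w, schrodingerKernel t (x - w) * (𝓕⁻ Φ (w - y) * g y) := by
    intro y
    rw [osc_eq_integral_schrodingerKernel Φ ht, ← integral_mul_const,
      ← integral_sub_right_eq_self _ y]
    congr 1
    funext w
    rw [mul_assoc, sub_sub_sub_cancel_right]
  simp_rw [h1]
  rw [integral_integral_swap]
  · simp_rw [integral_const_mul]
  · have h2 := hg.convolution_integrand (ContinuousLinearMap.mul ℂ ℂ) (𝓕⁻ Φ).integrable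
      (μ := volume) (ν := volume)
    have h3 : Integrable (fun z : Rd d × Rd d => 𝓕⁻ Φ (z.2 - z.1) * g z.1)
        ((volume : Measure (Rd d)).prod volume) := by
      refine h2.swap.congr (ae_of_all _ fun z => ?_)
      simp [mul_comm]
    refine (h3.norm.const_mul ((4 * Real.pi * t) ^ (-(d : ℝ) / 2))).mono' ?_ (ae_of_all _ fun z => ?_)
    · refine AEStronglyMeasurable.mul ?_ h3.aestronglyMeasurable
      exact (measurable_schrodingerKernel.comp (f := fun z : Rd d × Rd d => (t, x - z.2))
        (by fun_prop)).aestronglyMeasurable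
    · simp only [Function.uncurry]
      rw [norm_mul, norm_schrodingerKernel ht]

/-- The extension operator bound for functions of arbitrary norm. -/
theorem ExtensionBound.exists_mixedNorm_le {d : ℕ} {p q r : ℝ≥0∞} {β : ℝ} (hp : 1 ≤ p)
    (h : ExtensionBound d p q r β) : ∃ B : ℝ≥0∞, B ≠ ⊤ ∧ ∀ l : ℝ, 1 < l → ∀ f : Rd d → ℂ,
      MemLp f p volume →
      mixedNorm q r (annulus d l) (Icc l (2 * l)) (fun ξ s => extensionOp f ((s / l) • ξ) s) ≤
        B * ENNReal.ofReal (l ^ β) * eLpNorm f p volume := by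
  refine ⟨_, h.ne, fun l hl f hf => ?_⟩
  set B := (⨆ (l : ℝ) (_ : 1 < l), ENNReal.ofReal (l ^ (-β)) *
    ⨆ (f : Rd d → ℂ) (_ : MemLp f p volume ∧ eLpNorm f p volume ≤ 1),
      mixedNorm q r (annulus d l) (Icc l (2 * l))
        (fun ξ s => extensionOp f ((s / l) • ξ) s)) with hB
  have hl0 : 0 < l := by linarith
  have hunit : ∀ g : Rd d → ℂ, MemLp g p volume → eLpNorm g p volume ≤ 1 →
      mixedNorm q r (annulus d l) (Icc l (2 * l)) (fun ξ s => extensionOp g ((s / l) • ξ) s) ≤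
        B * ENNReal.ofReal (l ^ β) := by
    intro g hg hg1
    have h1 : ENNReal.ofReal (l ^ (-β)) * mixedNorm q r (annulus d l) (Icc l (2 * l))
        (fun ξ s => extensionOp g ((s / l) • ξ) s) ≤ B := by
      rw [hB]
      refine le_trans ?_ (le_iSup₂ (f := fun (l : ℝ) (_ : 1 < l) => ENNReal.ofReal (l ^ (-β)) *
        ⨆ (f : Rd d → ℂ) (_ : MemLp f p volume ∧ eLpNorm f p volume ≤ 1),
          mixedNorm q r (annulus d l) (Icc l (2 * l))
            (fun ξ s => extensionOp f ((s / l) • ξ) s)) l hl)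
      gcongr
      exact le_iSup₂ (f := fun (f : Rd d → ℂ) (_ : MemLp f p volume ∧ eLpNorm f p volume ≤ 1) =>
          mixedNorm q r (annulus d l) (Icc l (2 * l))
            (fun ξ s => extensionOp f ((s / l) • ξ) s)) g ⟨hg, hg1⟩
    calc _ = ENNReal.ofReal (l ^ β) * (ENNReal.ofReal (l ^ (-β)) *
          mixedNorm q r (annulus d l) (Icc l (2 * l))
            (fun ξ s => extensionOp g ((s / l) • ξ) s)) := by
          rw [← mul_assoc, ← ENNReal.ofReal_mul (by positivity), ← Real.rpow_add hl0]
          simp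
      _ ≤ ENNReal.ofReal (l ^ β) * B := by gcongr
      _ = _ := mul_comm _ _
  have hp0 : p ≠ 0 := (zero_lt_one.trans_le hp).ne'
  -- Data of norm zero cannot be normalized, but its extension vanishes identically.
  rcases eq_or_ne (eLpNorm f p volume) 0 with h0 | h0
  · have hf0 : f =ᵐ[volume] 0 := (eLpNorm_eq_zero_iff hf.1 hp0).1 h0
    have : ∀ ξ s, extensionOp f ξ s = 0 := fun ξ s => by
      unfold extensionOp
      rw [integral_congr_ae (g := fun _ => 0), integral_zero]
      filter_upwards [ae_restrict_of_ae hf0] with y hy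
      simp [hy]
    simp only [this, mixedNorm_zero]
    exact zero_le
  · have hft := hf.2.ne
    set N := (eLpNorm f p volume).toReal with hN
    have hN0 : 0 < N := ENNReal.toReal_pos h0 hft
    have hNe : ENNReal.ofReal N = eLpNorm f p volume := ENNReal.ofReal_toReal hft
    have hg : MemLp (fun y => ((N⁻¹ : ℝ) : ℂ) * f y) p volume := hf.const_mul _
    have hgn : eLpNorm (fun y => ((N⁻¹ : ℝ) : ℂ) * f y) p volume ≤ 1 := by
      have := eLpNorm_const_smul (((N⁻¹ : ℝ) : ℂ)) f p volume
      refine le_of_eq (this.trans ?_)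
      rw [← ofReal_norm, Complex.norm_real, Real.norm_of_nonneg (by positivity), ← hNe,
        ← ENNReal.ofReal_mul (by positivity), inv_mul_cancel₀ hN0.ne', ENNReal.ofReal_one]
    have hsc : (fun (ξ : Rd d) (s : ℝ) => extensionOp f ((s / l) • ξ) s) =
        fun ξ s => (N : ℂ) * extensionOp (fun y => ((N⁻¹ : ℝ) : ℂ) * f y) ((s / l) • ξ) s := by
      funext ξ s
      unfold extensionOp
      rw [← integral_const_mul]
      congr 1
      funext y
      have : (N : ℂ) ≠ 0 := by exact_mod_cast hN0.ne'
      push_cast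
      field_simp
    rw [hsc, mixedNorm_const_mul, ← hNe, ← ofReal_norm, Complex.norm_real,
      Real.norm_of_nonneg hN0.le, mul_comm]
    gcongr
    exact hunit _ hg hgn

/-- The free evolution of a function supported in a ball of radius `R`, in terms of the extension
operator. -/
theorem norm_kernelInt_eq {d : ℕ} {t R : ℝ} (ht : 0 < t) (hR : 0 < R) (c : Rd d) {h : Rd d → ℂ}
    (hs : ∀ y, y ∉ Metric.closedBall c R → h y = 0) (x : Rd d) :
    ‖kernelInt t h x‖ = (4 * Real.pi * t) ^ (-(d : ℝ) / 2) * R ^ d *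
      ‖extensionOp (fun y => h (c + R • y)) ((R / (2 * t)) • (x - c)) (R ^ 2 / (4 * t))‖ := by
  have hpi := Real.pi_pos
  have hsub : kernelInt t h x = (R ^ d : ℝ) * ∫ y, schrodingerKernel t (x - (c + R • y)) * h (c + R • y) := by
    unfold kernelInt
    rw [← integral_add_left_eq_self (fun y => schrodingerKernel t (x - y) * h y) c,
      Measure.integral_comp_smul volume (fun y => schrodingerKernel t (x - (c + y)) * h (c + y)) R,
      finrank_euclideanSpace_fin, abs_of_pos (by positivity), Complex.real_smul, ← mul_assoc,
      ← Complex.ofReal_mul, mul_inv_cancel₀ (by positivity), Complex.ofReal_one, one_mul]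
  have hext : ∫ y, schrodingerKernel t (x - (c + R • y)) * h (c + R • y) =
      schrodingerKernel t (x - c) *
        extensionOp (fun y => h (c + R • y)) ((R / (2 * t)) • (x - c)) (R ^ 2 / (4 * t)) := by
    unfold extensionOp
    rw [← integral_const_mul, ← integral_indicator Metric.isClosed_closedBall.measurableSet]
    congr 1
    funext y
    by_cases hy : y ∈ Metric.closedBall (0 : Rd d) 1
    · rw [indicator_of_mem hy]
      unfold schrodingerKernel
      -- Expansion of the square: |x-c-Ry|²/4t = |x-c|²/4t - (R/2t)⟨x-c, y⟩ + (R²/4t)|y|².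
      have : Complex.I * ((‖x - (c + R • y)‖ ^ 2 / (4 * t) : ℝ) : ℂ) =
          Complex.I * ((‖x - c‖ ^ 2 / (4 * t) : ℝ) : ℂ) +
          Complex.I * ((R ^ 2 / (4 * t) * ‖y‖ ^ 2 - inner ℝ ((R / (2 * t)) • (x - c)) y : ℝ) : ℂ) := by
        rw [← mul_add, ← Complex.ofReal_add]
        congr 2
        rw [← sub_sub, norm_sub_sq_real, real_inner_smul_right, real_inner_smul_left, norm_smul,
          Real.norm_of_nonneg hR.le]
        field_simp
        ring
      rw [this, Complex.exp_add]
      ring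
    · rw [indicator_of_notMem hy, hs, mul_zero]
      rw [mem_closedBall_iff_norm] at hy ⊢
      rw [add_sub_cancel_left, norm_smul, Real.norm_of_nonneg hR.le]
      rw [sub_zero] at hy
      nlinarith
  rw [hsub, hext, norm_mul, norm_mul, norm_schrodingerKernel ht, Complex.norm_real,
    Real.norm_of_nonneg (by positivity)]
  ring

/-- Take R = ρT and λ = R²/8T = ρ²T/8. Then s = R²/4t maps [T, 2T] to [λ, 2λ], and x = c + (R/2λ)ξ
turns the argument of the extension operator into (s/λ)ξ. Both Jacobian factors depend on ρ only.
The power of T collects T^{-d/2} from the kernel, R^{d(1-1/p)} from rescaling the data and λ^β from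
the hypothesis. -/
theorem ExtensionBound.exists_kernelInt_le {d : ℕ} {p q r : ℝ≥0∞} {β : ℝ} (hp : 1 ≤ p)
    (hE : ExtensionBound d p q r β) {ρ : ℝ} (hρ : 0 < ρ) : ∃ C : ℝ≥0∞, C ≠ ⊤ ∧
      ∀ T : ℝ, 0 < T → 1 < ρ ^ 2 * T / 8 → ∀ (c : Rd d) (h : Rd d → ℂ), MemLp h p volume →
      (∀ y, y ∉ Metric.closedBall c (ρ * T) → h y = 0) → ∀ A : Set (Rd d),
      (∀ x ∈ A, 3 / 2 * (ρ * T) ≤ ‖x - c‖ ∧ ‖x - c‖ ≤ 6 * (ρ * T)) →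
      mixedNorm q r A (Icc T (2 * T)) (fun x t => kernelInt t h x) ≤
        C * ENNReal.ofReal (T ^ ((d : ℝ) / 2 - d * (p⁻¹).toReal + β)) * eLpNorm h p volume := by
  obtain ⟨B, hB, hEB⟩ := hE.exists_mixedNorm_le hp
  set π' := (p⁻¹).toReal with hπ'
  refine ⟨ENNReal.ofReal ((4 / ρ) ^ d) ^ (q⁻¹).toReal * ENNReal.ofReal (16 / ρ ^ 2) ^ (r⁻¹).toReal *
    (B * ENNReal.ofReal (ρ ^ d * ((ρ ^ d)⁻¹) ^ π' * (ρ ^ 2 / 8) ^ β)), ?_, ?_⟩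
  · refine ENNReal.mul_ne_top (ENNReal.mul_ne_top ?_ ?_) (ENNReal.mul_ne_top hB ENNReal.ofReal_ne_top)
    · exact ENNReal.rpow_ne_top_of_nonneg (by positivity) ENNReal.ofReal_ne_top
    · exact ENNReal.rpow_ne_top_of_nonneg (by positivity) ENNReal.ofReal_ne_top
  intro T hT hlam c h hh hsupp A hA
  have hpi := Real.pi_pos
  set R := ρ * T with hR
  have hR0 : 0 < R := by positivity
  set l := ρ ^ 2 * T / 8 with hl
  have hl0 : 0 < l := by linarith
  have hlR : l = R ^ 2 / (8 * T) := by rw [hl, hR]; field_simp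
  have ha : 0 < R / (2 * l) := by positivity
  have hb : 0 < R ^ 2 / 4 := by positivity
  have hRl : R / (2 * l) = 4 / ρ := by rw [hl, hR]; field_simp; ring
  have hRl2 : R ^ 2 / 4 / l ^ 2 = 16 / ρ ^ 2 := by rw [hl, hR]; field_simp; ring
  have hK₁ := restrict_le_smul_map_affine c ha (A := A) (A' := annulus d l) (fun x hx => by
    have h1 := hA _ hx
    rw [add_sub_cancel_left, norm_smul, Real.norm_of_nonneg ha.le] at h1
    have h2 : R * ‖x‖ = (R / (2 * l) * ‖x‖) * (2 * l) := by field_simp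
    refine ⟨?_, ?_⟩
    · have : R * (3 * l) ≤ R * ‖x‖ := by rw [h2]; nlinarith [h1.1]
      exact le_of_mul_le_mul_left this hR0
    · have : R * ‖x‖ ≤ R * (12 * l) := by rw [h2]; nlinarith [h1.2]
      exact le_of_mul_le_mul_left this hR0)
  have hK₂ := restrict_le_smul_map_const_div hb hl0 (J := Icc T (2 * T)) (J' := Icc l (2 * l))
    measurableSet_Icc
    (fun t ht => by
      have : 0 < t := hT.trans_le ht.1
      rw [le_div_iff₀ this, hlR]
      calc R ^ 2 / (8 * T) * t ≤ R ^ 2 / (8 * T) * (2 * T) := by gcongr; exact ht.2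
        _ = R ^ 2 / 4 := by field_simp; ring)
    (fun t ht => by
      have h0 : 0 < t := hT.trans_le ht.1
      refine ⟨?_, ?_⟩
      · rw [le_div_iff₀ h0, hlR]
        calc R ^ 2 / (8 * T) * t ≤ R ^ 2 / (8 * T) * (2 * T) := by gcongr; exact ht.2
          _ = R ^ 2 / 4 := by field_simp; ring
      · rw [div_le_iff₀ h0, hlR]
        calc R ^ 2 / 4 = 2 * (R ^ 2 / (8 * T)) * T := by field_simp; ring
          _ ≤ 2 * (R ^ 2 / (8 * T)) * t := by gcongr; exact ht.1)
  have hcomp := mixedNorm_le_comp (q := q) (r := r) (F := fun x t => kernelInt t h x)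
    (measurableEmbedding_affine c ha.ne') (measurableEmbedding_const_div hb.ne')
    ENNReal.ofReal_ne_top hK₁ hK₂
  refine hcomp.trans ?_
  rw [hRl, hRl2]
  set K := ENNReal.ofReal ((4 / ρ) ^ d) ^ (q⁻¹).toReal * ENNReal.ofReal (16 / ρ ^ 2) ^ (r⁻¹).toReal
  rw [mul_assoc K, mul_assoc K]
  refine mul_le_mul' le_rfl ?_
  have hg : MemLp (fun y => h (c + R • y)) p volume := by
    refine ⟨?_, ?_⟩
    · refine hh.1.comp_quasiMeasurePreserving ⟨(measurableEmbedding_affine c hR0.ne').measurable, ?_⟩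
      rw [map_affine_volume c hR0]
      exact Measure.smul_absolutelyContinuous
    · rw [eLpNorm_comp_affine c hR0]
      exact ENNReal.mul_lt_top (ENNReal.rpow_lt_top_of_nonneg (by positivity) ENNReal.ofReal_ne_top) hh.2
  have hmono : mixedNorm q r (annulus d l) (Icc l (2 * l))
      (fun x t => kernelInt (R ^ 2 / 4 / t) h (c + (4 / ρ) • x)) ≤
      ENNReal.ofReal (T ^ (-(d : ℝ) / 2) * R ^ d) * mixedNorm q r (annulus d l) (Icc l (2 * l))
        (fun ξ s => extensionOp (fun y => h (c + R • y)) ((s / l) • ξ) s) := by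
    refine mixedNorm_le_mul_of_norm_le ?_ measurableSet_Icc fun ξ _ s hs => ?_
    · exact (measurableSet_le measurable_const measurable_norm).inter
        (measurableSet_le measurable_norm measurable_const)
    have hs0 : 0 < s := hl0.trans_le hs.1
    have ht : 0 < R ^ 2 / 4 / s := by positivity
    rw [norm_kernelInt_eq ht hR0 c hsupp]
    have e1 : R ^ 2 / (4 * (R ^ 2 / 4 / s)) = s := by field_simp
    have e2 : (R / (2 * (R ^ 2 / 4 / s))) • (c + (4 / ρ) • ξ - c) = (s / l) • ξ := by
      rw [add_sub_cancel_left, smul_smul, ← hRl]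
      congr 1
      field_simp
      ring
    rw [e1, e2]
    gcongr ?_ * _ * _
    refine Real.rpow_le_rpow_of_nonpos hT ?_ ?_
    · have : T ≤ R ^ 2 / 4 / s := by
        rw [le_div_iff₀ hs0]
        calc T * s ≤ T * (2 * l) := by gcongr; exact hs.2
          _ = R ^ 2 / 4 := by rw [hlR]; field_simp; ring
      nlinarith [Real.pi_gt_three]
    · have : (0 : ℝ) ≤ d := by positivity
      linarith
  refine hmono.trans ?_
  refine (mul_le_mul' le_rfl (hEB l hlam _ hg)).trans (le_of_eq ?_)
  rw [eLpNorm_comp_affine c hR0, ENNReal.ofReal_rpow_of_pos (by positivity)]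
  have hreal : T ^ (-(d : ℝ) / 2) * R ^ d * l ^ β * ((R ^ d)⁻¹) ^ π' =
      ρ ^ d * ((ρ ^ d)⁻¹) ^ π' * (ρ ^ 2 / 8) ^ β * T ^ ((d : ℝ) / 2 - d * π' + β) := by
    have e1 : l = ρ ^ 2 / 8 * T := by rw [hl]; ring
    have e2 : T ^ ((d : ℝ) / 2 - d * π' + β) =
        T ^ (-(d : ℝ) / 2) * T ^ d * ((T ^ d)⁻¹) ^ π' * T ^ β := by
      rw [← Real.rpow_natCast T d, ← Real.rpow_neg hT.le, ← Real.rpow_mul hT.le, ← Real.rpow_add hT,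
        ← Real.rpow_add hT, ← Real.rpow_add hT]
      congr 1
      ring
    rw [e1, Real.mul_rpow (by positivity) hT.le, hR, mul_pow, mul_inv,
      Real.mul_rpow (by positivity) (by positivity), e2]
    ring
  calc _ = B * eLpNorm h p volume * (ENNReal.ofReal (T ^ (-(d : ℝ) / 2) * R ^ d) *
        ENNReal.ofReal (l ^ β) * ENNReal.ofReal (((R ^ d)⁻¹) ^ π')) := by ring
    _ = B * eLpNorm h p volume * ENNReal.ofReal
        (T ^ (-(d : ℝ) / 2) * R ^ d * l ^ β * ((R ^ d)⁻¹) ^ π') := by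
        rw [← ENNReal.ofReal_mul (by positivity), ← ENNReal.ofReal_mul (by positivity)]
    _ = _ := by
        rw [hreal, ENNReal.ofReal_mul (by positivity)]
        ring

theorem kernelInt_add {d : ℕ} {t : ℝ} (ht : 0 < t) {g h : Rd d → ℂ} (hg : Integrable g)
    (hh : Integrable h) (x : Rd d) :
    kernelInt t (g + h) x = kernelInt t g x + kernelInt t h x := by
  unfold kernelInt
  rw [← integral_add (integrable_schrodingerKernel_mul ht hg x)
    (integrable_schrodingerKernel_mul ht hh x)]
  simp only [Pi.add_apply, mul_add]

/-- The local estimate for the propagator kernel, for data supported in a dilate of a compact set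
away from the origin. -/
theorem ExtensionBound.exists_kernelInt_le_of_isCompact {d : ℕ} {p q r : ℝ≥0∞} {β : ℝ} (hp : 1 ≤ p)
    (hq : 1 ≤ q) (hr : 1 ≤ r)
    (hE : ExtensionBound d p q r β) {S : Set (Rd d)} (hS : IsCompact S) {ε : ℝ} (hε : 0 < ε)
    (hSε : ∀ u ∈ S, 2 * ε ≤ ‖u‖) : ∃ C : ℝ≥0∞, C ≠ ⊤ ∧
      ∀ T : ℝ, 18 / ε ^ 2 < T → ∀ (x₀ : Rd d) (h : Rd d → ℂ), Integrable h → MemLp h p volume →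
      (∀ y, T⁻¹ • (y - x₀) ∉ S → h y = 0) →
      mixedNorm q r (Metric.ball x₀ (ε * T)) (Icc T (2 * T)) (fun x t => kernelInt t h x) ≤
        C * ENNReal.ofReal (T ^ ((d : ℝ) / 2 - d * (p⁻¹).toReal + β)) * eLpNorm h p volume := by
  suffices H : ∃ S' : Set (Rd d), MeasurableSet S' ∧ S ⊆ S' ∧ ∃ C : ℝ≥0∞, C ≠ ⊤ ∧
      ∀ T : ℝ, 18 / ε ^ 2 < T → ∀ (x₀ : Rd d) (h : Rd d → ℂ), Integrable h → MemLp h p volume →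
      (∀ y, T⁻¹ • (y - x₀) ∉ S' → h y = 0) →
      mixedNorm q r (Metric.ball x₀ (ε * T)) (Icc T (2 * T)) (fun x t => kernelInt t h x) ≤
        C * ENNReal.ofReal (T ^ ((d : ℝ) / 2 - d * (p⁻¹).toReal + β)) * eLpNorm h p volume by
    obtain ⟨S', -, hSS', C, hC, H⟩ := H
    exact ⟨C, hC, fun T hT x₀ h hi hh hs => H T hT x₀ h hi hh fun y hy => hs y fun hy' => hy (hSS' hy')⟩
  -- Compactness enters as an induction over sets. A measurable enlargement `S'` is carried along so
  -- that, for a union, the data can be cut into two measurable pieces.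
  refine hS.induction_on (p := fun S => ∃ S' : Set (Rd d), MeasurableSet S' ∧ S ⊆ S' ∧
      ∃ C : ℝ≥0∞, C ≠ ⊤ ∧
      ∀ T : ℝ, 18 / ε ^ 2 < T → ∀ (x₀ : Rd d) (h : Rd d → ℂ), Integrable h → MemLp h p volume →
      (∀ y, T⁻¹ • (y - x₀) ∉ S' → h y = 0) →
      mixedNorm q r (Metric.ball x₀ (ε * T)) (Icc T (2 * T)) (fun x t => kernelInt t h x) ≤
        C * ENNReal.ofReal (T ^ ((d : ℝ) / 2 - d * (p⁻¹).toReal + β)) * eLpNorm h p volume)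
    ?_ ?_ ?_ ?_
  · refine ⟨∅, MeasurableSet.empty, subset_rfl, 0, ENNReal.zero_ne_top, fun T _ x₀ h _ _ hs => ?_⟩
    have : (fun (x : Rd d) (t : ℝ) => kernelInt t h x) = fun _ _ => 0 := by
      funext x t
      unfold kernelInt
      simp [hs _ (notMem_empty _)]
    rw [this, mixedNorm_zero]
    exact zero_le
  · rintro s t hst ⟨S', hm, hS', H⟩
    exact ⟨S', hm, hst.trans hS', H⟩
  · rintro s t ⟨S₁, hm₁, hS₁, C₁, hC₁, H₁⟩ ⟨S₂, hm₂, hS₂, C₂, hC₂, H₂⟩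
    refine ⟨S₁ ∪ S₂, hm₁.union hm₂, union_subset_union hS₁ hS₂, C₁ + C₂,
      ENNReal.add_ne_top.2 ⟨hC₁, hC₂⟩, fun T hT x₀ h hi hh hs => ?_⟩
    have hT0 : 0 < T := lt_trans (by positivity) hT
    set P : Set (Rd d) := (fun y => T⁻¹ • (y - x₀)) ⁻¹' S₁ with hP
    have hPm : MeasurableSet P := by
      have : Measurable fun y : Rd d => T⁻¹ • (y - x₀) := by fun_prop
      exact this hm₁
    have hh₁ := hh.indicator hPm
    have hh₂ := hh.indicator hPm.compl
    have e1 := H₁ T hT x₀ _ (hi.indicator hPm) hh₁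
      (fun y hy => indicator_of_notMem (s := P) (show y ∉ P from hy) h)
    have e2 := H₂ T hT x₀ _ (hi.indicator hPm.compl) hh₂ (fun y hy => by
      by_cases hyP : y ∈ P
      · exact indicator_of_notMem (s := Pᶜ) (fun h' => h' hyP) h
      · rw [indicator_of_mem (s := Pᶜ) hyP]
        exact hs y fun h' => h'.elim hyP hy)
    have hsplit : ∀ x ∈ Metric.ball x₀ (ε * T), ∀ t ∈ Icc T (2 * T), ‖kernelInt t h x‖ ≤
        ‖kernelInt t (P.indicator h) x + kernelInt t (Pᶜ.indicator h) x‖ := by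
      intro x _ t ht
      have ht0 : 0 < t := hT0.trans_le ht.1
      rw [← kernelInt_add ht0 (hi.indicator hPm) (hi.indicator hPm.compl), indicator_self_add_compl]
    refine (mixedNorm_mono Metric.isOpen_ball.measurableSet measurableSet_Icc hsplit).trans ?_
    refine (mixedNorm_add_le hq hr (stronglyMeasurable_kernelInt hh₁.1)
      (stronglyMeasurable_kernelInt hh₂.1)).trans ?_
    refine (add_le_add e1 e2).trans ?_
    rw [add_mul, add_mul]
    gcongr
    · exact eLpNorm_indicator_le _
    · exact eLpNorm_indicator_le _
  · intro u hu
    have hu2 := hSε u hu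
    have hu0 : 0 < ‖u‖ := by linarith
    -- With ρ = ‖u‖/3 and centre x₀ + Tu, points within εT ≤ T‖u‖/2 of `x₀` are at distance between
    -- T‖u‖/2 = (3/2)ρT and (3/2)T‖u‖ ≤ 6ρT from the centre, as the annulus requires.
    obtain ⟨C, hC, H⟩ := hE.exists_kernelInt_le hp (ρ := ‖u‖ / 3) (by positivity)
    refine ⟨Metric.closedBall u (‖u‖ / 3), mem_nhdsWithin_of_mem_nhds
      (Metric.closedBall_mem_nhds u (by positivity)), Metric.closedBall u (‖u‖ / 3),
      Metric.isClosed_closedBall.measurableSet, subset_rfl, C, hC, fun T hT x₀ h _ hh hs => ?_⟩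
    have hT0 : 0 < T := lt_trans (by positivity) hT
    refine H T hT0 ?_ (x₀ + T • u) h hh (fun y hy => hs y fun hy' => hy ?_) _ fun x hx => ?_
    · have h1 : 18 < T * ε ^ 2 := by rwa [div_lt_iff₀ (by positivity)] at hT
      have h2 : (2 * ε) ^ 2 ≤ ‖u‖ ^ 2 := by gcongr
      have h3 : T * (2 * ε) ^ 2 ≤ T * ‖u‖ ^ 2 := by gcongr
      nlinarith
    · rw [Metric.mem_closedBall, dist_eq_norm] at hy' ⊢
      have : y - (x₀ + T • u) = T • (T⁻¹ • (y - x₀) - u) := by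
        rw [smul_sub, smul_inv_smul₀ hT0.ne']
        abel
      rw [this, norm_smul, Real.norm_of_nonneg hT0.le, mul_comm]
      gcongr
    · rw [Metric.mem_ball, dist_eq_norm] at hx
      have e1 : ‖T • u‖ = T * ‖u‖ := by rw [norm_smul, Real.norm_of_nonneg hT0.le]
      have e2 : x - (x₀ + T • u) = (x - x₀) - T • u := by abel
      have h1 : ‖T • u‖ - ‖x - x₀‖ ≤ ‖(x - x₀) - T • u‖ := by
        rw [norm_sub_rev (x - x₀)]; exact norm_sub_norm_le _ _
      have h2 := norm_sub_le (x - x₀) (T • u)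
      have h3 : T * (2 * ε) ≤ T * ‖u‖ := by gcongr
      rw [e2]
      rw [e1] at h1 h2
      constructor <;> nlinarith

/-! ### The unit-frequency estimate at times comparable to a large T. -/

theorem continuous_osc_right {d : ℕ} (Φ : 𝓢(Rd d, ℂ)) (s : ℝ) : Continuous (osc Φ s) :=
  (continuous_osc Φ).comp (Continuous.prodMk_right s)

theorem integrable_osc_sub_mul {d : ℕ} (Φ : 𝓢(Rd d, ℂ)) (s : ℝ) {p : ℝ≥0∞} (hp : 1 ≤ p)
    {f : Rd d → ℂ} (hf : MemLp f p volume) (x : Rd d) :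
    Integrable fun y => osc Φ s (x - y) * f y := by
  obtain ⟨K, hK, hKΦ⟩ := exists_norm_osc_le_of_abs_le Φ (2 * (d + 1)) |s|
  refine ⟨(((continuous_osc_right Φ s).comp (continuous_const.sub continuous_id)
    ).aestronglyMeasurable).mul hf.1, ?_⟩
  have h := lintegral_enorm_mul_le_of_decay (k := fun y => osc Φ s (x - y)) hp le_rfl (x := x)
    (x₀ := x) (by simp) hf.1 hK fun y => hKΦ s le_rfl (x - y)
  refine h.trans_lt (ENNReal.mul_lt_top ENNReal.ofReal_lt_top (ENNReal.mul_lt_top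
      (ENNReal.mul_lt_top ENNReal.ofReal_lt_top (ENNReal.add_lt_top.2
          ⟨ENNReal.one_lt_top, (polyMass_ne_top d).lt_top⟩)) ?_))
  refine lt_of_le_of_lt (eLpNorm_mono fun y => ?_) hf.2
  rw [norm_mul, Complex.norm_real, Real.norm_of_nonneg (polyWeight_pos one_pos x y).le]
  exact mul_le_of_le_one_left (norm_nonneg _) (polyWeight_le_one one_pos x y)

theorem evol_add {d : ℕ} (Φ : 𝓢(Rd d, ℂ)) (t : ℝ) {p : ℝ≥0∞} {f g : Rd d → ℂ}
    (hf : MemLp f p volume) (hg : MemLp g p volume) (hp : 1 ≤ p) (x : Rd d) :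
    evol Φ t (f + g) x = evol Φ t f x + evol Φ t g x := by
  unfold evol
  rw [← integral_add (integrable_osc_sub_mul Φ _ hp hf x) (integrable_osc_sub_mul Φ _ hp hg x)]
  simp only [Pi.add_apply, mul_add]

theorem SchwartzMap.exists_setLIntegral_norm_le {d : ℕ} (φ : 𝓢(Rd d, ℂ)) (N : ℕ) :
    ∃ C : ℝ, 0 ≤ C ∧ ∀ R : ℝ, 0 < R →
      ∫⁻ v in {v : Rd d | R ≤ ‖v‖}, ‖φ v‖ₑ ≤ ENNReal.ofReal ((R ^ N)⁻¹ * C) := by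
  refine ⟨∫ v, ‖v‖ ^ N * ‖φ v‖, integral_nonneg fun v => by positivity, fun R hR => ?_⟩
  have hint := φ.integrable_pow_mul volume N
  rw [ENNReal.ofReal_mul (by positivity), ofReal_integral_eq_lintegral_ofReal hint
    (Eventually.of_forall fun v => by positivity), ← lintegral_const_mul' _ _ ENNReal.ofReal_ne_top]
  refine (setLIntegral_mono' (measurableSet_le measurable_const measurable_norm)
    fun v hv => ?_).trans (setLIntegral_le_lintegral _ _)
  rw [← ENNReal.ofReal_mul (by positivity), ← ofReal_norm]
  refine ENNReal.ofReal_le_ofReal ?_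
  rw [inv_mul_eq_div, le_div_iff₀ (by positivity), mul_comm]
  have : R ^ N ≤ ‖v‖ ^ N := by gcongr; exact hv
  gcongr

/-- As `S` and `N` are at distance at least `R`, only the tail of `φ` beyond `R` enters; its mass
then multiplies the L¹ norm by Tonelli. -/
theorem setLIntegral_convolution_indicator_le {d : ℕ} {φ f : Rd d → ℂ} (hφ : Continuous φ)
    (hf : AEStronglyMeasurable f volume) {S N : Set (Rd d)} (hS : MeasurableSet S)
    (hN : MeasurableSet N) {R : ℝ} (hR : ∀ w ∈ S, ∀ y ∈ N, R ≤ ‖w - y‖) :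
    ∫⁻ w in S, ‖∫ y, φ (w - y) * N.indicator f y‖ₑ ≤
      (∫⁻ v in {v : Rd d | R ≤ ‖v‖}, ‖φ v‖ₑ) * ∫⁻ y in N, ‖f y‖ₑ := by
  have hRm : MeasurableSet {v : Rd d | R ≤ ‖v‖} := measurableSet_le measurable_const measurable_norm
  set τ : Rd d → ℝ≥0∞ := indicator {v : Rd d | R ≤ ‖v‖} fun v => ‖φ v‖ₑ with hτ
  have hτm : Measurable τ := hφ.measurable.enorm.indicator hRm
  have hfm : AEMeasurable (fun y => ‖N.indicator f y‖ₑ) volume := (hf.indicator hN).enorm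
  have h1 : ∀ w ∈ S, ‖∫ y, φ (w - y) * N.indicator f y‖ₑ ≤
      ∫⁻ y, τ (w - y) * ‖N.indicator f y‖ₑ := by
    intro w hw
    refine (enorm_integral_le_lintegral_enorm _).trans (lintegral_mono fun y => ?_)
    by_cases hy : y ∈ N
    · rw [enorm_mul, hτ, indicator_of_mem (show w - y ∈ {v : Rd d | R ≤ ‖v‖} from hR w hw y hy)]
    · simp [indicator_of_notMem hy]
  refine (setLIntegral_mono' hS h1).trans ((setLIntegral_le_lintegral _ _).trans ?_)
  rw [lintegral_lintegral_swap]
  · have h2 : ∀ y, ∫⁻ w, τ (w - y) * ‖N.indicator f y‖ₑ =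
        (∫⁻ v in {v : Rd d | R ≤ ‖v‖}, ‖φ v‖ₑ) * ‖N.indicator f y‖ₑ := by
      intro y
      rw [lintegral_mul_const' _ _ enorm_ne_top, lintegral_sub_right_eq_self τ y,
        hτ, lintegral_indicator hRm]
    simp_rw [h2]
    rw [lintegral_const_mul'' _ hfm]
    refine mul_le_mul' le_rfl (le_of_eq ?_)
    rw [← lintegral_indicator hN]
    refine lintegral_congr fun y => ?_
    by_cases hy : y ∈ N <;> simp [hy]
  · refine AEMeasurable.mul ?_ ?_
    · exact (hτm.comp (measurable_fst.sub measurable_snd)).aemeasurable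
    · exact hfm.comp_snd

theorem eLpNorm_indicator_le_polyWeight {d : ℕ} {p : ℝ≥0∞} {T : ℝ} (hT : 0 < T) {x₀ : Rd d}
    {f : Rd d → ℂ} {b : ℝ} (hb : 0 ≤ b) {N : Set (Rd d)} (hN : ∀ y ∈ N, ‖y - x₀‖ ≤ b * T) :
    eLpNorm (N.indicator f) p volume ≤ ENNReal.ofReal ((1 + b) ^ (d + 1)) *
      eLpNorm (fun y => (polyWeight T x₀ y : ℂ) * f y) p volume := by
  refine eLpNorm_le_mul_eLpNorm_of_ae_le_mul (Eventually.of_forall fun y => ?_) p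
  by_cases hy : y ∈ N
  · rw [indicator_of_mem hy, norm_mul, Complex.norm_real,
      Real.norm_of_nonneg (polyWeight_pos hT x₀ y).le, ← mul_assoc]
    refine le_mul_of_one_le_left (norm_nonneg _) ?_
    unfold polyWeight
    rw [← div_eq_mul_inv, one_le_div (by positivity)]
    have : ‖y - x₀‖ / T ≤ b := by rw [div_le_iff₀ hT]; exact hN y hy
    gcongr
  · rw [indicator_of_notMem hy, norm_zero]
    positivity

/-- Data at positions that no velocity in the support of the symbol connects with the ball. The
localized kernel is rapidly decreasing there, so the extension hypothesis is not involved. -/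
theorem exists_mixedNorm_evol_far_le {d : ℕ} {p q r : ℝ≥0∞} (hp : 1 ≤ p) (hq : 1 ≤ q) (hr : 1 ≤ r)
    (Φ : 𝓢(Rd d, ℂ)) (ε : ℝ) (hε : ε ≤ 1) : ∃ C : ℝ≥0∞, C ≠ ⊤ ∧
      ∀ T : ℝ, 1 ≤ T → ∀ (x₀ : Rd d) (f : Rd d → ℂ), AEStronglyMeasurable f volume →
      ∀ N : Set (Rd d), (∀ x ∈ Metric.ball x₀ (ε * T), ∀ t ∈ Icc T (2 * T), ∀ y ∈ N,
        ∀ᶠ ζ in 𝓝 ((4 * Real.pi * t)⁻¹ • (x - y)), Φ ζ = 0) →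
      mixedNorm q r (Metric.ball x₀ (ε * T)) (Icc T (2 * T))
        (fun x t => evol Φ t (N.indicator f) x) ≤
        C * eLpNorm (fun y => (polyWeight T x₀ y : ℂ) * f y) p volume := by
  obtain ⟨K, hK, hKΦ⟩ := exists_norm_osc_le_of_far Φ (2 * (d + 1))
  refine ⟨ENNReal.ofReal (2 ^ (2 * (d + 1)) * K) * (1 + polyMass d) *
    (1 + volume (Metric.ball (0 : Rd d) ε)), ?_, fun T hT x₀ f hf N hN => ?_⟩
  · refine ENNReal.mul_ne_top (ENNReal.mul_ne_top ENNReal.ofReal_ne_top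
      (ENNReal.add_ne_top.2 ⟨ENNReal.one_ne_top, polyMass_ne_top d⟩))
      (ENNReal.add_ne_top.2 ⟨ENNReal.one_ne_top, measure_ball_lt_top.ne⟩)
  have hT0 : 0 < T := by linarith
  have key := mixedNorm_ball_le hq hr hT (ε := ε) x₀ (J := Icc T (2 * T)) measurableSet_Icc
    (by rw [Real.volume_Icc]; exact ENNReal.ofReal_le_ofReal (by linarith))
    (F := fun x t => evol Φ t (N.indicator f) x)
    (c := ENNReal.ofReal (2 ^ (2 * (d + 1)) * K) * (1 + polyMass d) *
      eLpNorm (fun y => (polyWeight T x₀ y : ℂ) * f y) p volume) (fun x hx t ht => ?_)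
  · refine key.trans (le_of_eq ?_)
    ring
  have ht1 : 1 ≤ t := hT.trans ht.1
  have hx' : ‖x - x₀‖ ≤ T := by
    rw [Metric.mem_ball, dist_eq_norm] at hx
    nlinarith
  refine le_trans ?_ (lintegral_enorm_mul_le_of_decay hp hT hx'
    (k := N.indicator fun y => osc Φ (-4 * Real.pi ^ 2 * t) (x - y)) hf hK fun y => ?_)
  · refine (enorm_integral_le_lintegral_enorm _).trans (le_of_eq (lintegral_congr fun y => ?_))
    by_cases hy : y ∈ N <;> simp [hy]
  · by_cases hy : y ∈ N
    · rw [indicator_of_mem hy]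
      refine le_trans ?_ (hKΦ t ht1 (x - y) (hN x hx t ht y hy))
      gcongr
      exact ht.1
    · rw [indicator_of_notMem hy, norm_zero, zero_mul]
      exact hK

/-- The cut-off data is convolved with `𝓕⁻ Φ` and then evolves under the free kernel. The
convolution lives, up to Schwartz tails, on the slightly larger annulus between a/2 and 2b in units
of T; there the estimate for compact sets applies. The tails contribute O(1), which is absorbed
because the power of T is at least 1. -/
theorem ExtensionBound.exists_evol_near_le {d : ℕ} {p q r : ℝ≥0∞} {β : ℝ} (hp : 1 ≤ p)
    (hq : 1 ≤ q) (hr : 1 ≤ r) (hE : ExtensionBound d p q r β)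
    (hβ : 0 ≤ (d : ℝ) / 2 - d * (p⁻¹).toReal + β) (Φ : 𝓢(Rd d, ℂ)) {ε a b : ℝ} (ha : 0 < a)
    (hε0 : 0 < ε) (hεa : 4 * ε ≤ a) (hab : a ≤ b) : ∃ C : ℝ≥0∞, C ≠ ⊤ ∧
      ∀ T : ℝ, 1 ≤ T → 18 / ε ^ 2 < T → ∀ (x₀ : Rd d) (f : Rd d → ℂ), MemLp f p volume →
      mixedNorm q r (Metric.ball x₀ (ε * T)) (Icc T (2 * T))
        (fun x t => evol Φ t ({y | a * T ≤ ‖y - x₀‖ ∧ ‖y - x₀‖ ≤ b * T}.indicator f) x) ≤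
        C * ENNReal.ofReal (T ^ ((d : ℝ) / 2 - d * (p⁻¹).toReal + β)) *
          eLpNorm (fun y => (polyWeight T x₀ y : ℂ) * f y) p volume := by
  have hb : 0 < b := by linarith
  set S : Set (Rd d) := {u | a / 2 ≤ ‖u‖ ∧ ‖u‖ ≤ 2 * b} with hS
  have hSc : IsCompact S := by
    refine (isCompact_closedBall (0 : Rd d) (2 * b)).of_isClosed_subset ?_ fun u hu => ?_
    · exact (isClosed_le continuous_const continuous_norm).inter
        (isClosed_le continuous_norm continuous_const)
    · simpa using hu.2
  obtain ⟨C₁, hC₁, H₁⟩ := hE.exists_kernelInt_le_of_isCompact hp hq hr hSc hε0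
    (fun u hu => by linarith [hu.1])
  -- Tail order 2d + 2: the L¹ norm of the data costs T^d, and T^{-(d+2)} must remain for
  -- `mixedNorm_ball_le`.
  obtain ⟨C₂, hC₂, H₂⟩ := (𝓕⁻ Φ).exists_setLIntegral_norm_le (2 * d + 2)
  set M := ∫⁻ y, ‖𝓕⁻ Φ y‖ₑ with hM
  have hMt : M ≠ ⊤ := (𝓕⁻ Φ).integrable.2.ne
  set B₁ := C₁ * (M * ENNReal.ofReal ((1 + b) ^ (d + 1))) with hB₁
  set B₂ := ENNReal.ofReal (((a / 2) ^ (2 * d + 2))⁻¹ * C₂) *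
    (ENNReal.ofReal ((1 + b) ^ (2 * (d + 1))) * (1 + polyMass d)) with hB₂
  refine ⟨B₁ + B₂ * (1 + volume (Metric.ball (0 : Rd d) ε)), ?_, fun T hT hTε x₀ f hf => ?_⟩
  · refine ENNReal.add_ne_top.2 ⟨ENNReal.mul_ne_top hC₁ (ENNReal.mul_ne_top hMt
      ENNReal.ofReal_ne_top), ENNReal.mul_ne_top (ENNReal.mul_ne_top ENNReal.ofReal_ne_top
        (ENNReal.mul_ne_top ENNReal.ofReal_ne_top (ENNReal.add_ne_top.2
          ⟨ENNReal.one_ne_top, polyMass_ne_top d⟩))) (ENNReal.add_ne_top.2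
            ⟨ENNReal.one_ne_top, measure_ball_lt_top.ne⟩)⟩
  have hT0 : 0 < T := by linarith
  set N : Set (Rd d) := {y | a * T ≤ ‖y - x₀‖ ∧ ‖y - x₀‖ ≤ b * T} with hN
  have hNm : MeasurableSet N := by
    have : Measurable fun y : Rd d => ‖y - x₀‖ := by fun_prop
    exact (measurableSet_le measurable_const this).inter (measurableSet_le this measurable_const)
  set W := eLpNorm (fun y => (polyWeight T x₀ y : ℂ) * f y) p volume with hW
  have hWt : W ≠ ⊤ := by
    refine ne_top_of_le_ne_top hf.2.ne (eLpNorm_mono fun y => ?_)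
    rw [norm_mul, Complex.norm_real, Real.norm_of_nonneg (polyWeight_pos hT0 x₀ y).le]
    exact mul_le_of_le_one_left (norm_nonneg _) (polyWeight_le_one hT0 x₀ y)
  have hI := setLIntegral_enorm_le_of_near (x₀ := x₀) (b := b) hp hT hf.1 hb.le hNm
    (fun y hy => hy.2)
  have hfi : Integrable (N.indicator f) := by
    refine ⟨hf.1.indicator hNm, ?_⟩
    have : ∀ y, ‖N.indicator f y‖ₑ = N.indicator (fun y => ‖f y‖ₑ) y := fun y => by
      by_cases hy : y ∈ N <;> simp [hy]
    unfold HasFiniteIntegral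
    simp_rw [this]
    rw [lintegral_indicator hNm]
    refine hI.trans_lt (ENNReal.mul_lt_top ENNReal.ofReal_lt_top (ENNReal.mul_lt_top
      (ENNReal.mul_lt_top ENNReal.ofReal_lt_top (ENNReal.add_lt_top.2
          ⟨ENNReal.one_lt_top, (polyMass_ne_top d).lt_top⟩)) hWt.lt_top))
  set h : Rd d → ℂ := fun w => ∫ y, 𝓕⁻ Φ (w - y) * N.indicator f y with hh
  have hhm : AEStronglyMeasurable h volume := by
    refine StronglyMeasurable.aestronglyMeasurable ?_
    have hm : StronglyMeasurable (fun w => ∫ y, 𝓕⁻ Φ (w - y) * (hfi.1.mk _) y) := by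
      refine StronglyMeasurable.integral_prod_right (f := fun w y => 𝓕⁻ Φ (w - y) * (hfi.1.mk _) y) ?_
      refine StronglyMeasurable.mul ?_ (hfi.1.stronglyMeasurable_mk.comp_measurable measurable_snd)
      exact ((𝓕⁻ Φ).continuous.comp (continuous_fst.sub continuous_snd)).stronglyMeasurable
    have : h = fun w => ∫ y, 𝓕⁻ Φ (w - y) * (hfi.1.mk _) y := by
      funext w
      refine integral_congr_ae ?_
      filter_upwards [hfi.1.ae_eq_mk] with y hy
      rw [hy]
    rw [this]
    exact hm
  have hhp' := eLpNorm_convolution_le hp (𝓕⁻ Φ).continuous (hf.1.indicator hNm)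
  have hhp : eLpNorm h p volume ≤ M * ENNReal.ofReal ((1 + b) ^ (d + 1)) * W := by
    refine hhp'.trans ?_
    rw [mul_assoc]
    exact mul_le_mul' le_rfl (eLpNorm_indicator_le_polyWeight hT0 hb.le fun y hy => hy.2)
  have hhL : MemLp h p volume := ⟨hhm, hhp.trans_lt (ENNReal.mul_lt_top (ENNReal.mul_lt_top
    hMt.lt_top ENNReal.ofReal_lt_top) hWt.lt_top)⟩
  have hhi : Integrable h := by
    rw [← memLp_one_iff_integrable] at hfi ⊢
    exact ⟨hhm, (eLpNorm_convolution_le le_rfl (𝓕⁻ Φ).continuous hfi.1).trans_lt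
      (ENNReal.mul_lt_top hMt.lt_top hfi.2)⟩
  set P : Set (Rd d) := {w | T⁻¹ • (w - x₀) ∈ S} with hP
  have hPm : MeasurableSet P := by
    have : Measurable fun y : Rd d => T⁻¹ • (y - x₀) := by fun_prop
    exact this hSc.isClosed.measurableSet
  have hsplit : ∀ x ∈ Metric.ball x₀ (ε * T), ∀ t ∈ Icc T (2 * T), ‖evol Φ t (N.indicator f) x‖ ≤
      ‖kernelInt t (P.indicator h) x + kernelInt t (Pᶜ.indicator h) x‖ := by
    intro x _ t ht
    have ht0 : 0 < t := hT0.trans_le ht.1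
    rw [← kernelInt_add ht0 (hhi.indicator hPm) (hhi.indicator hPm.compl),
      indicator_self_add_compl, evol_eq_kernelInt Φ ht0 hfi]
  refine (mixedNorm_mono Metric.isOpen_ball.measurableSet measurableSet_Icc hsplit).trans ?_
  refine (mixedNorm_add_le hq hr (stronglyMeasurable_kernelInt (hhm.indicator hPm))
    (stronglyMeasurable_kernelInt (hhm.indicator hPm.compl))).trans ?_
  have e1 : mixedNorm q r (Metric.ball x₀ (ε * T)) (Icc T (2 * T))
      (fun x t => kernelInt t (P.indicator h) x) ≤
      B₁ * ENNReal.ofReal (T ^ ((d : ℝ) / 2 - d * (p⁻¹).toReal + β)) * W := by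
    refine (H₁ T hTε x₀ _ (hhi.indicator hPm) (hhL.indicator hPm) fun y hy =>
      indicator_of_notMem (s := P) hy h).trans ?_
    refine (mul_le_mul' le_rfl ((eLpNorm_indicator_le _).trans hhp)).trans (le_of_eq ?_)
    rw [hB₁]
    ring
  have e2 : mixedNorm q r (Metric.ball x₀ (ε * T)) (Icc T (2 * T))
      (fun x t => kernelInt t (Pᶜ.indicator h) x) ≤
      B₂ * W * (1 + volume (Metric.ball (0 : Rd d) ε)) := by
    refine mixedNorm_ball_le hq hr hT (ε := ε) x₀ (J := Icc T (2 * T)) measurableSet_Icc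
      (by rw [Real.volume_Icc]; exact ENNReal.ofReal_le_ofReal (by linarith)) fun x _ t ht => ?_
    have ht0 : 0 < t := hT0.trans_le ht.1
    calc ‖kernelInt t (Pᶜ.indicator h) x‖ₑ ≤ ∫⁻ w, ‖Pᶜ.indicator h w‖ₑ := by
          refine (enorm_integral_le_lintegral_enorm _).trans (lintegral_mono fun w => ?_)
          rw [enorm_mul]
          refine mul_le_of_le_one_left' ?_
          rw [← ofReal_norm, norm_schrodingerKernel ht0, ENNReal.ofReal_le_one]
          exact rpow_neg_half_le_one (hT.trans ht.1)
      _ = ∫⁻ w in Pᶜ, ‖h w‖ₑ := by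
          rw [← lintegral_indicator hPm.compl]
          refine lintegral_congr fun w => ?_
          by_cases hw : w ∈ Pᶜ
          · rw [indicator_of_mem hw, indicator_of_mem hw]
          · rw [indicator_of_notMem hw, indicator_of_notMem hw, enorm_zero]
      _ ≤ (∫⁻ v in {v : Rd d | a / 2 * T ≤ ‖v‖}, ‖𝓕⁻ Φ v‖ₑ) * ∫⁻ y in N, ‖f y‖ₑ := by
          refine setLIntegral_convolution_indicator_le (𝓕⁻ Φ).continuous hf.1 hPm.compl hNm ?_
          intro w hw y hy
          -- Outside the enlarged annulus ‖w - x₀‖ is below aT/2 or above 2bT, while ‖y - x₀‖ is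
          -- between aT and bT; in both cases the two points are at least aT/2 apart.
          have hw' : ¬ (a / 2 ≤ T⁻¹ * ‖w - x₀‖ ∧ T⁻¹ * ‖w - x₀‖ ≤ 2 * b) := by
            intro h'
            refine hw ?_
            show T⁻¹ • (w - x₀) ∈ S
            rw [hS, mem_ofPred_eq, norm_smul, Real.norm_of_nonneg (by positivity)]
            exact h'
          rw [inv_mul_eq_div, le_div_iff₀ hT0, div_le_iff₀ hT0] at hw'
          have h1 := norm_sub_norm_le (w - x₀) (y - x₀)
          have h2 := norm_sub_norm_le (y - x₀) (w - x₀)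
          rw [sub_sub_sub_cancel_right] at h1 h2
          rw [norm_sub_rev y w] at h2
          have h3 := hy.1
          have h4 := hy.2
          have h5 : a * T ≤ b * T := by gcongr
          have h6 : 0 < a * T := by positivity
          by_contra! hlt
          exact hw' ⟨by linarith, by linarith⟩
      _ ≤ _ := mul_le_mul' (H₂ (a / 2 * T) (by positivity)) hI
      _ = _ := by
          have : ((a / 2 * T) ^ (2 * d + 2))⁻¹ * C₂ * T ^ d =
              (T ^ (d + 2))⁻¹ * (((a / 2) ^ (2 * d + 2))⁻¹ * C₂) := by
            rw [mul_pow, show 2 * d + 2 = d + (d + 2) by ring, pow_add T]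
            field_simp
          rw [← mul_assoc, ← ENNReal.ofReal_mul (by positivity), this,
            ENNReal.ofReal_mul (by positivity), hB₂]
          ring
  refine (add_le_add e1 e2).trans ?_
  have hT1 : 1 ≤ ENNReal.ofReal (T ^ ((d : ℝ) / 2 - d * (p⁻¹).toReal + β)) := by
    rw [ENNReal.one_le_ofReal]
    exact Real.one_le_rpow hT hβ
  set Ta := ENNReal.ofReal (T ^ ((d : ℝ) / 2 - d * (p⁻¹).toReal + β))
  calc _ = B₁ * Ta * W + B₂ * (1 + volume (Metric.ball (0 : Rd d) ε)) * 1 * W := by ring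
    _ ≤ B₁ * Ta * W + B₂ * (1 + volume (Metric.ball (0 : Rd d) ε)) * Ta * W := by gcongr
    _ = _ := by ring

/-- The single-frequency estimate at times comparable to a large `T`. -/
theorem ExtensionBound.exists_evol_le_of_le {d : ℕ} {p q r : ℝ≥0∞} {β : ℝ} (hp : 1 ≤ p)
    (hpq : p ≤ q) (hr : 1 ≤ r) (hE : ExtensionBound d p q r β)
    (hβ : 0 ≤ (d : ℝ) / 2 - d * (p⁻¹).toReal + β) (Φ : 𝓢(Rd d, ℂ)) {a b : ℝ} (ha : 0 < a)
    (hab : a ≤ b) (hΦ : ∀ ξ, (‖ξ‖ < a ∨ b < ‖ξ‖) → Φ ξ = 0) : ∃ C : ℝ≥0∞, C ≠ ⊤ ∧ ∃ T₀ : ℝ, 1 ≤ T₀ ∧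
      ∀ T : ℝ, T₀ ≤ T → ∀ f : Rd d → ℂ, MemLp f p volume →
      mixedNorm q r univ (Icc T (2 * T)) (fun x t => evol Φ t f x) ≤
        C * ENNReal.ofReal (T ^ ((d : ℝ) / 2 - d * (p⁻¹).toReal + β)) * eLpNorm f p volume := by
  have hq : 1 ≤ q := hp.trans hpq
  have hpi := Real.pi_pos
  have hb : 0 < b := by linarith
  -- Interaction at t ∈ [T, 2T] requires 4πaT ≤ |x-y| ≤ 8πbT. The annulus from cT to DT about `x₀`
  -- contains all such `y`, with room for the displacement |x-x₀| ≤ εT, where ε ≤ 1 and ε ≤ c/4.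
  set c := 2 * Real.pi * a with hc
  have hc0 : 0 < c := by positivity
  set D := 8 * Real.pi * b + 1 with hD
  have hcD : c ≤ D := by rw [hc, hD]; nlinarith
  set ε := min 1 (c / 4) with hεd
  have hε0 : 0 < ε := by positivity
  have hε1 : ε ≤ 1 := min_le_left _ _
  have hεc : ε ≤ c / 4 := min_le_right _ _
  obtain ⟨C₁, hC₁, H₁⟩ := exists_mixedNorm_evol_far_le hp hq hr Φ ε hε1
  obtain ⟨C₂, hC₂, H₂⟩ := hE.exists_evol_near_le hp hq hr hβ Φ hc0 hε0 (by linarith) hcD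
  obtain ⟨C₃, hC₃, H₃⟩ := exists_eLpNorm_le_of_forall_ball (d := d) hp hpq hε0
  refine ⟨C₃ * (C₁ + C₂), ENNReal.mul_ne_top hC₃ (ENNReal.add_ne_top.2 ⟨hC₁, hC₂⟩),
    max 1 (18 / ε ^ 2 + 1), le_max_left _ _, fun T hT f hf => ?_⟩
  have hT1 : 1 ≤ T := (le_max_left _ _).trans hT
  have hT2 : 18 / ε ^ 2 < T := by linarith [(le_max_right 1 (18 / ε ^ 2 + 1)).trans hT]
  have hT0 : 0 < T := by linarith
  set Ta := ENNReal.ofReal (T ^ ((d : ℝ) / 2 - d * (p⁻¹).toReal + β)) with hTa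
  have hTa1 : 1 ≤ Ta := by
    rw [hTa, ENNReal.one_le_ofReal]
    exact Real.one_le_rpow hT1 hβ
  have key := H₃ T hT0 (fun x => eLpNorm (fun t => evol Φ t f x) r (volume.restrict (Icc T (2 * T))))
    f ((C₁ + C₂) * Ta) (measurable_eLpNorm_right (stronglyMeasurable_evol Φ hf.1) r) hf.1 ?_
  · unfold mixedNorm
    rw [Measure.restrict_univ]
    refine key.trans (le_of_eq ?_)
    ring
  intro x₀
  set N : Set (Rd d) := {y | c * T ≤ ‖y - x₀‖ ∧ ‖y - x₀‖ ≤ D * T} with hN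
  have hNm : MeasurableSet N := by
    have : Measurable fun y : Rd d => ‖y - x₀‖ := by fun_prop
    exact (measurableSet_le measurable_const this).inter (measurableSet_le this measurable_const)
  set W := eLpNorm (fun y => (polyWeight T x₀ y : ℂ) * f y) p volume with hW
  have e1 := H₁ T hT1 x₀ f hf.1 Nᶜ ?_
  · have e2 := H₂ T hT1 hT2 x₀ f hf
    have hs : ∀ x ∈ Metric.ball x₀ (ε * T), ∀ t ∈ Icc T (2 * T), ‖evol Φ t f x‖ ≤
        ‖evol Φ t (Nᶜ.indicator f) x + evol Φ t (N.indicator f) x‖ := by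
      intro x _ t _
      rw [← evol_add Φ t (hf.indicator hNm.compl) (hf.indicator hNm) hp, indicator_compl_add_self]
    have e3 := (mixedNorm_mono (q := q) (r := r) Metric.isOpen_ball.measurableSet measurableSet_Icc
      hs).trans (mixedNorm_add_le hq hr (stronglyMeasurable_evol Φ (hf.1.indicator hNm.compl))
        (stronglyMeasurable_evol Φ (hf.1.indicator hNm)))
    refine e3.trans ((add_le_add e1 e2).trans ?_)
    calc C₁ * W + C₂ * Ta * W = C₁ * 1 * W + C₂ * Ta * W := by rw [mul_one]
      _ ≤ C₁ * Ta * W + C₂ * Ta * W := by gcongr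
      _ = _ := by ring
  · intro x hx t ht y hy
    have ht0 : 0 < t := hT0.trans_le ht.1
    rw [Metric.mem_ball, dist_eq_norm] at hx
    have hz : ‖(4 * Real.pi * t)⁻¹ • (x - y)‖ = ‖x - y‖ / (4 * Real.pi * t) := by
      rw [norm_smul, Real.norm_of_nonneg (by positivity), inv_mul_eq_div]
    have h1 : ‖x - y‖ ≤ ‖x - x₀‖ + ‖y - x₀‖ := by
      rw [← sub_sub_sub_cancel_right x y x₀]; exact norm_sub_le _ _
    have h2 : ‖y - x₀‖ ≤ ‖x - x₀‖ + ‖x - y‖ := by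
      rw [show y - x₀ = (x - x₀) - (x - y) by abel]; exact norm_sub_le _ _
    have h3 : ε * T ≤ c / 4 * T := by gcongr
    have h3' : ε * T ≤ 1 * T := by gcongr
    have h4 : Real.pi * a * T ≤ Real.pi * a * t := by gcongr; exact ht.1
    have h5 : Real.pi * b * t ≤ Real.pi * b * (2 * T) := by gcongr; exact ht.2
    have h6 : 0 < Real.pi * a * T := by positivity
    rcases lt_or_ge ‖y - x₀‖ (c * T) with hlt | hge
    · have hlt' : ‖(4 * Real.pi * t)⁻¹ • (x - y)‖ < a := by
        rw [hz, div_lt_iff₀ (by positivity)]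
        rw [hc] at hlt h3
        linarith
      filter_upwards [(isOpen_lt continuous_norm continuous_const).mem_nhds hlt'] with ζ hζ
      exact hΦ ζ (Or.inl hζ)
    · have hgt : D * T < ‖y - x₀‖ := by
        by_contra! h'
        exact hy ⟨hge, h'⟩
      have hlt' : b < ‖(4 * Real.pi * t)⁻¹ • (x - y)‖ := by
        rw [hz, lt_div_iff₀ (by positivity)]
        rw [hD] at hgt
        linarith
      filter_upwards [(isOpen_lt continuous_const continuous_norm).mem_nhds hlt'] with ζ hζ
      exact hΦ ζ (Or.inr hζ)

/-! ### Negative times, and summation over dyadic time intervals. -/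

/-- The Schwartz function `ξ ↦ conj (Φ (-ξ))`. -/
noncomputable def conjReflect {d : ℕ} (Φ : 𝓢(Rd d, ℂ)) : 𝓢(Rd d, ℂ) :=
  SchwartzMap.compCLMOfContinuousLinearEquiv ℝ
    (LinearIsometryEquiv.neg ℝ (E := Rd d)).toContinuousLinearEquiv
    (Φ.postcompCLM (Complex.conjCLE : ℂ →L[ℝ] ℂ))

theorem conjReflect_apply {d : ℕ} (Φ : 𝓢(Rd d, ℂ)) (ξ : Rd d) :
    conjReflect Φ ξ = (starRingEnd ℂ) (Φ (-ξ)) := rfl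

/-- Time reversal: conjugation changes the sign of the whole phase, and y ↦ -y restores its linear
part. -/
theorem conj_osc {d : ℕ} (Φ : 𝓢(Rd d, ℂ)) (s : ℝ) (ζ : Rd d) :
    (starRingEnd ℂ) (osc Φ s ζ) = osc (conjReflect Φ) (-s) ζ := by
  unfold osc
  rw [← integral_conj, ← integral_neg_eq_self]
  refine integral_congr_ae (Eventually.of_forall fun y => ?_)
  simp only [map_mul, ← Complex.exp_conj, Complex.conj_I, Complex.conj_ofReal, conjReflect_apply,
    norm_neg, inner_neg_right]
  congr 2
  push_cast
  ring

theorem norm_evol_neg {d : ℕ} (Φ : 𝓢(Rd d, ℂ)) (t : ℝ) (f : Rd d → ℂ) (x : Rd d) :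
    ‖evol Φ (-t) f x‖ = ‖evol (conjReflect Φ) t (fun y => (starRingEnd ℂ) (f y)) x‖ := by
  rw [← RCLike.norm_conj]
  unfold evol
  rw [← integral_conj]
  simp only [map_mul, conj_osc]
  ring_nf

theorem mixedNorm_evol_neg_le {d : ℕ} {q r : ℝ≥0∞} (Φ : 𝓢(Rd d, ℂ)) {Λ : ℝ} (f : Rd d → ℂ) :
    mixedNorm q r univ (Icc (-Λ) 0) (fun x t => evol Φ t f x) ≤
    mixedNorm q r univ (Icc 0 Λ)
      (fun x t => evol (conjReflect Φ) t (fun y => (starRingEnd ℂ) (f y)) x) := by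
  have h := mixedNorm_le_comp (q := q) (r := r) (A := univ) (A' := univ) (J := Icc (-Λ) 0)
    (J' := Icc 0 Λ) (F := fun x t => evol Φ t f x) (e := id) (τ := fun t => -t)
    MeasurableEmbedding.id (MeasurableEquiv.neg ℝ).measurableEmbedding (K₁ := 1) (K₂ := 1)
    ENNReal.one_ne_top (by simp) (by
      rw [one_smul]
      refine le_of_eq ?_
      have := (Measure.measurePreserving_neg (volume : Measure ℝ)).restrict_preimage
        (s := Icc (-Λ) 0) measurableSet_Icc
      rw [← this.map_eq]
      congr 2
      ext t
      simp [and_comm])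
  simp only [ENNReal.one_rpow, one_mul, id] at h
  refine h.trans (le_of_eq ?_)
  exact mixedNorm_congr MeasurableSet.univ measurableSet_Icc fun x _ t _ => norm_evol_neg Φ t f x

/-- At bounded times the kernel decays uniformly, so a supremum bound on unit balls together with
the local-to-global lemma suffices. -/
theorem exists_mixedNorm_evol_le {d : ℕ} {p q r : ℝ≥0∞} (hp : 1 ≤ p) (hpq : p ≤ q)
    (Φ : 𝓢(Rd d, ℂ)) (T : ℝ) : ∃ C : ℝ≥0∞, C ≠ ⊤ ∧ ∀ f : Rd d → ℂ, MemLp f p volume →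
      mixedNorm q r univ (Icc 0 T) (fun x t => evol Φ t f x) ≤ C * eLpNorm f p volume := by
  obtain ⟨K, hK, hKΦ⟩ := exists_norm_osc_le_of_abs_le Φ (2 * (d + 1)) (4 * Real.pi ^ 2 * T)
  obtain ⟨C₃, hC₃, H₃⟩ := exists_eLpNorm_le_of_forall_ball (d := d) hp hpq one_pos
  set B := ENNReal.ofReal (2 ^ (2 * (d + 1)) * K) * (1 + polyMass d) *
    (volume (Icc 0 T) ^ r.toReal⁻¹) * (volume (Metric.ball (0 : Rd d) 1) ^ q.toReal⁻¹) with hB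
  refine ⟨C₃ * B, ENNReal.mul_ne_top hC₃ ?_, fun f hf => ?_⟩
  · refine ENNReal.mul_ne_top (ENNReal.mul_ne_top (ENNReal.mul_ne_top ENNReal.ofReal_ne_top
      (ENNReal.add_ne_top.2 ⟨ENNReal.one_ne_top, polyMass_ne_top d⟩)) ?_) ?_
    · exact ENNReal.rpow_ne_top_of_nonneg (by positivity) measure_Icc_lt_top.ne
    · exact ENNReal.rpow_ne_top_of_nonneg (by positivity) measure_ball_lt_top.ne
  have key := H₃ 1 one_pos (fun x => eLpNorm (fun t => evol Φ t f x) r (volume.restrict (Icc 0 T)))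
    f B (measurable_eLpNorm_right (stronglyMeasurable_evol Φ hf.1) r) hf.1 ?_
  · unfold mixedNorm
    rwa [Measure.restrict_univ]
  intro x₀
  rw [one_mul]
  have h := mixedNorm_le_of_norm_le (q := q) (r := r) (A := Metric.ball x₀ 1) (J := Icc 0 T)
    (F := fun x t => evol Φ t f x)
    Metric.isOpen_ball.measurableSet measurableSet_Icc (c :=
      ENNReal.ofReal (2 ^ (2 * (d + 1)) * K) * (1 + polyMass d) *
        eLpNorm (fun y => (polyWeight 1 x₀ y : ℂ) * f y) p volume) fun x hx t ht => ?_
  · refine h.trans (le_of_eq ?_)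
    rw [hB, Measure.addHaar_ball_center volume x₀]
    ring
  · rw [Metric.mem_ball, dist_eq_norm] at hx
    have h := lintegral_enorm_mul_le_of_decay (k := fun y => osc Φ (-4 * Real.pi ^ 2 * t) (x - y))
      hp le_rfl hx.le hf.1 hK fun y => hKΦ _ (by
        rw [abs_mul, abs_mul, abs_neg, abs_of_nonneg ht.1, abs_of_nonneg (by positivity),
          abs_of_nonneg (by positivity)]
        gcongr
        exact ht.2) (x - y)
    refine (enorm_integral_le_lintegral_enorm _).trans (h.trans (le_of_eq ?_))
    simp

/-- The interval [2^n T₀, 2^{n+1} T₀] contributes 2^{nα}, and α > 0 makes the sum comparable to its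
last term. This is the place where strictness of the condition on β matters. -/
theorem ExtensionBound.exists_evol_le_pos {d : ℕ} {p q r : ℝ≥0∞} {β : ℝ} (hp : 1 ≤ p)
    (hpq : p ≤ q) (hr : 1 ≤ r) (hE : ExtensionBound d p q r β)
    (hβ : 0 < (d : ℝ) / 2 - d * (p⁻¹).toReal + β) (Φ : 𝓢(Rd d, ℂ)) {a b : ℝ} (ha : 0 < a)
    (hab : a ≤ b) (hΦ : ∀ ξ, (‖ξ‖ < a ∨ b < ‖ξ‖) → Φ ξ = 0) : ∃ C : ℝ≥0∞, C ≠ ⊤ ∧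
      ∀ Λ : ℝ, 1 ≤ Λ → ∀ f : Rd d → ℂ, MemLp f p volume →
      mixedNorm q r univ (Icc 0 Λ) (fun x t => evol Φ t f x) ≤
        C * ENNReal.ofReal (Λ ^ ((d : ℝ) / 2 - d * (p⁻¹).toReal + β)) * eLpNorm f p volume := by
  obtain ⟨C₁, hC₁, T₀, hT₀, H₁⟩ := hE.exists_evol_le_of_le hp hpq hr hβ.le Φ ha hab hΦ
  obtain ⟨C₀, hC₀, H₀⟩ := exists_mixedNorm_evol_le (r := r) hp hpq Φ T₀
  set α := (d : ℝ) / 2 - d * (p⁻¹).toReal + β with hα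
  set κ := (2 : ℝ) ^ α - 1 with hκ
  have hκ0 : 0 < κ := by
    have := Real.one_lt_rpow (x := 2) (by norm_num) hβ
    linarith
  -- `K` is chosen so that C₁ T₀^α ≤ K κ; then K 2^{nα} + K κ 2^{nα} = K 2^{(n+1)α} closes the
  -- induction.
  set K := C₀ + C₁ * ENNReal.ofReal (T₀ ^ α) * ENNReal.ofReal κ⁻¹ with hK
  have hT00 : 0 < T₀ := by linarith
  have hstep : ∀ f : Rd d → ℂ, MemLp f p volume → ∀ n : ℕ,
      mixedNorm q r univ (Icc 0 (2 ^ n * T₀)) (fun x t => evol Φ t f x) ≤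
        K * ENNReal.ofReal (((2 : ℝ) ^ n) ^ α) * eLpNorm f p volume := by
    intro f hf n
    induction n with
    | zero =>
      simp only [pow_zero, one_mul, Real.one_rpow, ENNReal.ofReal_one, mul_one]
      refine (H₀ f hf).trans ?_
      gcongr
      exact le_self_add
    | succ n ih =>
      have hle : T₀ ≤ 2 ^ n * T₀ := by
        have : (1 : ℝ) ≤ 2 ^ n := one_le_pow₀ (by norm_num)
        nlinarith
      have h1 := H₁ (2 ^ n * T₀) hle f hf
      have hsub : Icc (0 : ℝ) (2 ^ (n + 1) * T₀) ⊆
          Icc 0 (2 ^ n * T₀) ∪ Icc (2 ^ n * T₀) (2 * (2 ^ n * T₀)) := by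
        intro t ht
        rcases le_total t (2 ^ n * T₀) with h | h
        · exact Or.inl ⟨ht.1, h⟩
        · exact Or.inr ⟨h, ht.2.trans (le_of_eq (by ring))⟩
      refine (mixedNorm_mono_set subset_rfl hsub).trans ((mixedNorm_union_le (hp.trans hpq) hr
        (stronglyMeasurable_evol Φ hf.1) measurableSet_Icc measurableSet_Icc).trans
        ((add_le_add ih h1).trans ?_))
      set y := ENNReal.ofReal (((2 : ℝ) ^ n) ^ α) with hy
      have e1 : ENNReal.ofReal (((2 : ℝ) ^ (n + 1)) ^ α) = y + y * ENNReal.ofReal κ := by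
        rw [pow_succ, Real.mul_rpow (by positivity) (by norm_num),
          show (2 : ℝ) ^ α = 1 + κ by rw [hκ]; ring, mul_add, mul_one,
          ENNReal.ofReal_add (by positivity) (by positivity), ENNReal.ofReal_mul (by positivity)]
      have e2 : ENNReal.ofReal ((2 ^ n * T₀) ^ α) = y * ENNReal.ofReal (T₀ ^ α) := by
        rw [Real.mul_rpow (by positivity) hT00.le, ENNReal.ofReal_mul (by positivity)]
      have e3 : ENNReal.ofReal κ⁻¹ * ENNReal.ofReal κ = 1 := by
        rw [← ENNReal.ofReal_mul (by positivity), inv_mul_cancel₀ hκ0.ne', ENNReal.ofReal_one]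
      rw [e1, e2]
      calc K * y * eLpNorm f p volume + C₁ * (y * ENNReal.ofReal (T₀ ^ α)) * eLpNorm f p volume
          = K * y * eLpNorm f p volume + (C₁ * ENNReal.ofReal (T₀ ^ α) *
            (ENNReal.ofReal κ⁻¹ * ENNReal.ofReal κ)) * y * eLpNorm f p volume := by
            rw [e3]; ring
        _ = K * y * eLpNorm f p volume + (C₁ * ENNReal.ofReal (T₀ ^ α) *
            ENNReal.ofReal κ⁻¹) * (y * ENNReal.ofReal κ) * eLpNorm f p volume := by ring
        _ ≤ K * y * eLpNorm f p volume + K * (y * ENNReal.ofReal κ) * eLpNorm f p volume := by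
            gcongr
            exact le_add_self
        _ = _ := by ring
  refine ⟨K * ENNReal.ofReal (2 ^ α), ?_, fun Λ hΛ f hf => ?_⟩
  · exact ENNReal.mul_ne_top (ENNReal.add_ne_top.2 ⟨hC₀, ENNReal.mul_ne_top (ENNReal.mul_ne_top hC₁
      ENNReal.ofReal_ne_top) ENNReal.ofReal_ne_top⟩) ENNReal.ofReal_ne_top
  obtain ⟨n, hn1, hn2⟩ := exists_nat_pow_near hΛ (y := 2) (by norm_num)
  have hsub : Icc 0 Λ ⊆ Icc 0 (2 ^ (n + 1) * T₀) := by
    refine Icc_subset_Icc le_rfl (hn2.le.trans ?_)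
    have : (0 : ℝ) < 2 ^ (n + 1) := by positivity
    nlinarith
  refine (mixedNorm_mono_set subset_rfl hsub).trans ((hstep f hf (n + 1)).trans ?_)
  refine mul_le_mul' ?_ le_rfl
  rw [mul_assoc K]
  refine mul_le_mul' le_rfl ?_
  rw [← ENNReal.ofReal_mul (by positivity), ← Real.mul_rpow (by positivity) (by positivity)]
  refine ENNReal.ofReal_le_ofReal (Real.rpow_le_rpow (by positivity) ?_ hβ.le)
  rw [pow_succ]
  linarith

/-- The single-frequency estimate on long time intervals. -/
theorem ExtensionBound.exists_evol_le {d : ℕ} {p q r : ℝ≥0∞} {β : ℝ} (hp : 1 ≤ p)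
    (hpq : p ≤ q) (hr : 1 ≤ r) (hE : ExtensionBound d p q r β)
    (hβ : 0 < (d : ℝ) / 2 - d * (p⁻¹).toReal + β) (Φ : 𝓢(Rd d, ℂ)) {a b : ℝ} (ha : 0 < a)
    (hab : a ≤ b) (hΦ : ∀ ξ, (‖ξ‖ < a ∨ b < ‖ξ‖) → Φ ξ = 0) : ∃ C : ℝ≥0∞, C ≠ ⊤ ∧
      ∀ Λ : ℝ, 1 ≤ Λ → ∀ f : Rd d → ℂ, MemLp f p volume →
      mixedNorm q r univ (Icc (-Λ) Λ) (fun x t => evol Φ t f x) ≤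
        C * ENNReal.ofReal (Λ ^ ((d : ℝ) / 2 - d * (p⁻¹).toReal + β)) * eLpNorm f p volume := by
  obtain ⟨C₁, hC₁, H₁⟩ := hE.exists_evol_le_pos hp hpq hr hβ Φ ha hab hΦ
  obtain ⟨C₂, hC₂, H₂⟩ := hE.exists_evol_le_pos hp hpq hr hβ (conjReflect Φ) ha hab fun ξ hξ => by
    rw [conjReflect_apply, hΦ (-ξ) (by rwa [norm_neg]), map_zero]
  refine ⟨C₁ + C₂, ENNReal.add_ne_top.2 ⟨hC₁, hC₂⟩, fun Λ hΛ f hf => ?_⟩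
  have hsub : Icc (-Λ) Λ ⊆ Icc 0 Λ ∪ Icc (-Λ) 0 := fun t ht => by
    rcases le_total 0 t with h | h
    · exact Or.inl ⟨h, ht.2⟩
    · exact Or.inr ⟨ht.1, h⟩
  refine (mixedNorm_mono_set subset_rfl hsub).trans ((mixedNorm_union_le (hp.trans hpq) hr
    (stronglyMeasurable_evol Φ hf.1) measurableSet_Icc measurableSet_Icc).trans ?_)
  have hconj : eLpNorm (fun y => (starRingEnd ℂ) (f y)) p volume = eLpNorm f p volume :=
    eLpNorm_congr_norm_ae (Eventually.of_forall fun y => RCLike.norm_conj _)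
  have hfc : MemLp (fun y => (starRingEnd ℂ) (f y)) p volume :=
    ⟨Complex.continuous_conj.comp_aestronglyMeasurable hf.1, by rw [hconj]; exact hf.2⟩
  refine (add_le_add (H₁ Λ hΛ f hf) ((mixedNorm_evol_neg_le Φ f).trans (H₂ Λ hΛ _ hfc))).trans
    (le_of_eq ?_)
  rw [hconj]
  ring

/-! ### Fourier multipliers on tempered distributions and their function representatives. -/

section

theorem fourierInv_modulate {d : ℕ} (Φ : 𝓢(Rd d, ℂ)) (x y : Rd d) :
    𝓕⁻ (SchwartzMap.smulLeftCLM ℂ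
      (fun v : Rd d => Complex.exp (Complex.I * ((-(2 * Real.pi) * inner ℝ y v : ℝ) : ℂ))) Φ) x =
    𝓕⁻ Φ (x - y) := by
  have hg : (fun v : Rd d => Complex.exp
      (Complex.I * ((-(2 * Real.pi) * inner ℝ y v : ℝ) : ℂ))).HasTemperateGrowth := by
    have h : (fun v : Rd d => -(2 * Real.pi) * inner ℝ y v).HasTemperateGrowth := by fun_prop
    exact hasTemperateGrowth_cexp_I_mul.comp h
  rw [SchwartzMap.fourierInv_coe, SchwartzMap.fourierInv_coe, Real.fourierInv_eq',
    Real.fourierInv_eq']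
  refine integral_congr_ae (Eventually.of_forall fun v => ?_)
  simp only [SchwartzMap.smulLeftCLM_apply_apply hg, smul_eq_mul]
  rw [← mul_assoc, ← Complex.exp_add]
  congr 2
  rw [inner_sub_right, real_inner_comm y v]
  push_cast
  ring

/-- The multiplication formula with a modulated symbol: modulation in frequency is translation in
space, so the transpose of a multiplier is an explicit convolution. -/
theorem fourier_smul_fourierInv_apply {d : ℕ} (Φ φ : 𝓢(Rd d, ℂ)) (y : Rd d) :
    𝓕 (SchwartzMap.smulLeftCLM ℂ Φ (𝓕⁻ φ)) y = ∫ x, φ x * 𝓕⁻ Φ (x - y) := by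
  have hg : (fun v : Rd d => Complex.exp
      (Complex.I * ((-(2 * Real.pi) * inner ℝ y v : ℝ) : ℂ))).HasTemperateGrowth := by
    have h : (fun v : Rd d => -(2 * Real.pi) * inner ℝ y v).HasTemperateGrowth := by fun_prop
    exact hasTemperateGrowth_cexp_I_mul.comp h
  have h := SchwartzMap.integral_fourierInv_mul_eq φ (SchwartzMap.smulLeftCLM ℂ
      (fun v : Rd d => Complex.exp (Complex.I * ((-(2 * Real.pi) * inner ℝ y v : ℝ) : ℂ))) Φ)
  simp only [fourierInv_modulate] at h
  rw [← h, SchwartzMap.fourier_coe, Real.fourier_eq']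
  refine integral_congr_ae (Eventually.of_forall fun v => ?_)
  simp only [SchwartzMap.smulLeftCLM_apply_apply hg,
    SchwartzMap.smulLeftCLM_apply_apply Φ.hasTemperateGrowth, smul_eq_mul]
  have e : ((-2 * Real.pi * inner ℝ v y : ℝ) : ℂ) * Complex.I =
      Complex.I * ((-(2 * Real.pi) * inner ℝ y v : ℝ) : ℂ) := by
    rw [real_inner_comm y v]
    push_cast
    ring
  rw [e]
  ring

theorem integrable_mul_osc_mul {d : ℕ} {p : ℝ≥0∞} (hp : 1 ≤ p) (Φ φ : 𝓢(Rd d, ℂ)) (s : ℝ)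
    {g : Rd d → ℂ} (hg : MemLp g p volume) :
    Integrable (fun z : Rd d × Rd d => φ z.1 * (osc Φ s (z.1 - z.2) * g z.2))
      (volume.prod volume) := by
  obtain ⟨K, hK, hKΦ⟩ := exists_norm_osc_le_of_abs_le Φ (2 * (d + 1)) |s|
  have hm : AEStronglyMeasurable (fun z : Rd d × Rd d => φ z.1 * (osc Φ s (z.1 - z.2) * g z.2))
      (volume.prod volume) := by
    refine AEStronglyMeasurable.mul ?_ (AEStronglyMeasurable.mul ?_ hg.1.comp_snd)
    · exact (φ.continuous.comp continuous_fst).aestronglyMeasurable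
    · exact ((continuous_osc_right Φ s).comp
        (continuous_fst.sub continuous_snd)).aestronglyMeasurable
  refine ⟨hm, ?_⟩
  unfold HasFiniteIntegral
  rw [lintegral_prod _ hm.enorm]
  have hw : ∀ x, ∫⁻ y, ‖osc Φ s (x - y) * g y‖ₑ ≤ ENNReal.ofReal (2 ^ (2 * (d + 1)) * K) *
      (1 + polyMass d) * eLpNorm g p volume := by
    intro x
    refine (lintegral_enorm_mul_le_of_decay (k := fun y => osc Φ s (x - y)) hp le_rfl (x := x)
      (x₀ := x) (by simp) hg.1 hK fun y => hKΦ s le_rfl (x - y)).trans ?_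
    simp only [one_pow, inv_one, ENNReal.ofReal_one, one_mul]
    gcongr
    refine eLpNorm_mono fun y => ?_
    rw [norm_mul, Complex.norm_real, Real.norm_of_nonneg (polyWeight_pos one_pos x y).le]
    exact mul_le_of_le_one_left (norm_nonneg _) (polyWeight_le_one one_pos x y)
  calc ∫⁻ x, ∫⁻ y, ‖φ x * (osc Φ s (x - y) * g y)‖ₑ
      ≤ ∫⁻ x, ‖φ x‖ₑ * (ENNReal.ofReal (2 ^ (2 * (d + 1)) * K) *
        (1 + polyMass d) * eLpNorm g p volume) := by
        refine lintegral_mono fun x => ?_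
        simp_rw [enorm_mul (φ x)]
        rw [lintegral_const_mul' _ _ enorm_ne_top]
        exact mul_le_mul' le_rfl (hw x)
    _ < ⊤ := by
        rw [lintegral_mul_const'' _ φ.continuous.aestronglyMeasurable.enorm]
        refine ENNReal.mul_lt_top φ.integrable.2 (ENNReal.mul_lt_top (ENNReal.mul_lt_top
          ENNReal.ofReal_lt_top (ENNReal.add_lt_top.2
            ⟨ENNReal.one_lt_top, (polyMass_ne_top d).lt_top⟩)) hg.2)

variable {d : ℕ} {p : ℝ≥0∞}

theorem hasTemperateGrowth_schrodinger_symbol (t : ℝ) :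
    (fun ξ : Rd d => Complex.exp (-Complex.I * ((t * ‖(2 * Real.pi) • ξ‖ ^ 2 : ℝ) : ℂ))) =
      chirp (-4 * Real.pi ^ 2 * t) := by
  funext ξ
  unfold chirp
  rw [norm_smul, Real.norm_of_nonneg (by positivity)]
  congr 1
  push_cast
  ring

theorem multOp_multOp {m₁ m₂ : Rd d → ℂ}
    (h₁ : (fun ξ => m₁ ((2 * Real.pi) • ξ)).HasTemperateGrowth)
    (h₂ : (fun ξ => m₂ ((2 * Real.pi) • ξ)).HasTemperateGrowth) (T : 𝓢'(Rd d, ℂ)) :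
    multOp m₂ (multOp m₁ T) = multOp (fun ξ => m₁ ξ * m₂ ξ) T :=
  TemperedDistribution.fourierMultiplierCLM_fourierMultiplierCLM_apply h₁ h₂ T

/-- The multiplier acts on the test function by duality, and Fubini moves the resulting convolution
back onto `g`. -/
theorem isGivenBy_multOp_chirp (hp : 1 ≤ p) {T : 𝓢'(Rd d, ℂ)} {g : Rd d → ℂ}
    (hT : IsGivenBy T g) (hg : MemLp g p volume) (Φ : 𝓢(Rd d, ℂ)) {m : Rd d → ℂ} (t : ℝ)
    (hm : ∀ ξ, m ((2 * Real.pi) • ξ) = chirp (-4 * Real.pi ^ 2 * t) ξ * Φ ξ) :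
    IsGivenBy (multOp m T) (evol Φ t g) := by
  intro φ
  set s := -4 * Real.pi ^ 2 * t with hs
  set Ψ := SchwartzMap.smulLeftCLM ℂ (chirp s) Φ with hΨ
  have hmΨ : (fun ξ => m ((2 * Real.pi) • ξ)) = ⇑Ψ := by
    funext ξ
    rw [hm, hΨ, SchwartzMap.smulLeftCLM_apply_apply (hasTemperateGrowth_chirp s), smul_eq_mul]
  have hint := integrable_mul_osc_mul hp Φ φ s hg
  unfold multOp
  rw [TemperedDistribution.fourierMultiplierCLM_apply_apply, hmΨ, hT]
  simp_rw [fourier_smul_fourierInv_apply, hΨ, ← osc_eq_fourierInv, ← integral_mul_const]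
  have h1 : ∀ y, ∫ x, φ x * osc Φ s (x - y) * g y = ∫ x, φ x * (osc Φ s (x - y) * g y) := fun y =>
    integral_congr_ae (Eventually.of_forall fun x => mul_assoc _ _ _)
  simp_rw [h1]
  rw [integral_integral_swap (f := fun y x => φ x * (osc Φ s (x - y) * g y)) hint.swap]
  refine integral_congr_ae (Eventually.of_forall fun x => ?_)
  simp only [evol, ← hs]
  exact integral_const_mul _ _

theorem schrodinger_multOp {m : Rd d → ℂ}
    (h : (fun ξ => m ((2 * Real.pi) • ξ)).HasTemperateGrowth) (t : ℝ) (T : 𝓢'(Rd d, ℂ)) :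
    schrodinger t (multOp m T) = multOp m (schrodinger t T) := by
  have h2 : (fun ξ : Rd d => (fun ξ : Rd d => Complex.exp (-Complex.I * ((t * ‖ξ‖ ^ 2 : ℝ) : ℂ)))
      ((2 * Real.pi) • ξ)).HasTemperateGrowth := by
    simp only [hasTemperateGrowth_schrodinger_symbol]
    exact hasTemperateGrowth_chirp _
  unfold schrodinger
  rw [multOp_multOp h h2, multOp_multOp h2 h]
  congr 1
  funext ξ
  ring

theorem isGivenBy_schrodinger_multOp (hp : 1 ≤ p) {T : 𝓢'(Rd d, ℂ)} {g : Rd d → ℂ}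
    (hT : IsGivenBy T g) (hg : MemLp g p volume) (Φ : 𝓢(Rd d, ℂ)) {m : Rd d → ℂ} (t : ℝ)
    (hm : ∀ ξ, m ((2 * Real.pi) • ξ) = Φ ξ) :
    IsGivenBy (schrodinger t (multOp m T)) (evol Φ t g) := by
  have h1 : (fun ξ => m ((2 * Real.pi) • ξ)).HasTemperateGrowth := by
    simp only [hm]; exact Φ.hasTemperateGrowth
  have h2 : (fun ξ : Rd d => (fun ξ : Rd d => Complex.exp (-Complex.I * ((t * ‖ξ‖ ^ 2 : ℝ) : ℂ)))
      ((2 * Real.pi) • ξ)).HasTemperateGrowth := by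
    simp only [hasTemperateGrowth_schrodinger_symbol]
    exact hasTemperateGrowth_chirp _
  unfold schrodinger
  rw [multOp_multOp h1 h2]
  refine isGivenBy_multOp_chirp hp hT hg Φ t fun ξ => ?_
  rw [hm, congrFun (hasTemperateGrowth_schrodinger_symbol t) ξ, mul_comm]

theorem isGivenBy_multOp (hp : 1 ≤ p) {T : 𝓢'(Rd d, ℂ)} {g : Rd d → ℂ}
    (hT : IsGivenBy T g) (hg : MemLp g p volume) (Φ : 𝓢(Rd d, ℂ)) {m : Rd d → ℂ}
    (hm : ∀ ξ, m ((2 * Real.pi) • ξ) = Φ ξ) :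
    IsGivenBy (multOp m T) (evol Φ 0 g) := by
  refine isGivenBy_multOp_chirp hp hT hg Φ 0 fun ξ => ?_
  rw [hm]
  simp [chirp]

theorem IsGivenBy.congr {T : 𝓢'(Rd d, ℂ)} {g g' : Rd d → ℂ} (h : IsGivenBy T g)
    (hgg : g =ᵐ[volume] g') : IsGivenBy T g' := fun φ => by
  rw [h φ]
  exact integral_congr_ae (by filter_upwards [hgg] with x hx; rw [hx])

theorem IsGivenBy.ae_eq {T : 𝓢'(Rd d, ℂ)} {g g' : Rd d → ℂ} (h : IsGivenBy T g)
    (h' : IsGivenBy T g') (hg : LocallyIntegrable g volume) (hg' : LocallyIntegrable g' volume) :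
    g =ᵐ[volume] g' := by
  refine ae_eq_of_integral_contDiff_smul_eq hg hg' fun u hu hcu => ?_
  have hc : HasCompactSupport fun x => (u x : ℂ) := hcu.comp_left (g := fun r : ℝ => (r : ℂ)) rfl
  have hcd : ContDiff ℝ ∞ fun x => (u x : ℂ) := Complex.ofRealCLM.contDiff.comp hu
  have e := (h (hc.toSchwartzMap hcd)).symm.trans (h' (hc.toSchwartzMap hcd))
  simpa using e

theorem exists_schwartz_ne_zero (x₀ : Rd d) : ∃ ρ : 𝓢(Rd d, ℂ), ρ x₀ ≠ 0 := by
  let b : ContDiffBump x₀ := ⟨1, 2, one_pos, by norm_num⟩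
  have hc : HasCompactSupport fun x => ((b x : ℝ) : ℂ) :=
    b.hasCompactSupport.comp_left (g := fun r : ℝ => (r : ℂ)) rfl
  have hcd : ContDiff ℝ ∞ fun x => ((b x : ℝ) : ℂ) := Complex.ofRealCLM.contDiff.comp b.contDiff
  refine ⟨hc.toSchwartzMap hcd, ?_⟩
  show ((b x₀ : ℝ) : ℂ) ≠ 0
  rw [b.one_of_mem_closedBall (Metric.mem_closedBall_self b.rIn_pos.le)]
  simp

/-- A distribution given by integration against a function that is not locally integrable
vanishes. -/
theorem IsGivenBy.eq_zero {T : 𝓢'(Rd d, ℂ)} {F : Rd d → ℂ} (h : IsGivenBy T F)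
    (hF : AEStronglyMeasurable F volume) (hloc : ¬ LocallyIntegrable F volume) (φ : 𝓢(Rd d, ℂ)) :
    T φ = 0 := by
  unfold LocallyIntegrable at hloc
  push Not at hloc
  obtain ⟨x₀, hx₀⟩ := hloc
  have key : ∀ ψ : 𝓢(Rd d, ℂ), ψ x₀ ≠ 0 → T ψ = 0 := by
    intro ψ hψ
    rw [h ψ]
    -- The integral of a non-integrable function is 0 by convention. If ψ F were integrable, F would
    -- be integrable near `x₀`, where ψ is bounded below.
    refine integral_undef fun hint => hx₀ ?_
    have hpos : 0 < ‖ψ x₀‖ / 2 := by positivity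
    have hU : {x | ‖ψ x₀‖ / 2 < ‖ψ x‖} ∈ 𝓝 x₀ :=
      (isOpen_lt continuous_const ψ.continuous.norm).mem_nhds (by
        show ‖ψ x₀‖ / 2 < ‖ψ x₀‖
        linarith)
    refine ⟨_, hU, ?_⟩
    have hUm : MeasurableSet {x | ‖ψ x₀‖ / 2 < ‖ψ x‖} :=
      (isOpen_lt continuous_const ψ.continuous.norm).measurableSet
    refine Integrable.mono' ((hint.norm.const_mul (‖ψ x₀‖ / 2)⁻¹).integrableOn) hF.restrict ?_
    filter_upwards [ae_restrict_mem hUm] with x hx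
    rw [norm_mul, inv_mul_eq_div, le_div_iff₀ hpos, mul_comm]
    exact mul_le_mul_of_nonneg_right hx.le (norm_nonneg _)
  -- A test function vanishing at `x₀` is a difference of two that do not.
  by_cases hφ : φ x₀ = 0
  · obtain ⟨ρ, hρ⟩ := exists_schwartz_ne_zero x₀
    have h1 := key (φ + ρ) (by rw [add_apply, hφ, zero_add]; exact hρ)
    rw [map_add, key ρ hρ, add_zero] at h1
    exact h1
  · exact key φ hφ

/-- Two locally integrable representatives agree almost everywhere. If `F` is not locally
integrable, the default value of the integral forces `T` to vanish, and then `G` is zero. So exotic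
representatives cannot lower a norm. -/
theorem IsGivenBy.norm_ae_le {T : 𝓢'(Rd d, ℂ)} {F G : Rd d → ℂ} (h : IsGivenBy T F)
    (hG : IsGivenBy T G) (hF : AEStronglyMeasurable F volume)
    (hGloc : LocallyIntegrable G volume) : ∀ᵐ x, ‖G x‖ ≤ ‖F x‖ := by
  by_cases hloc : LocallyIntegrable F volume
  · filter_upwards [h.ae_eq hG hloc hGloc] with x hx
    rw [hx]
  · have h0 : IsGivenBy T (fun _ => 0) := fun φ => by
      rw [h.eq_zero hF hloc φ]
      simp
    filter_upwards [hG.ae_eq h0 hGloc locallyIntegrable_zero] with x hx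
    rw [hx, norm_zero]
    exact norm_nonneg _

theorem distLpNorm_le {T : 𝓢'(Rd d, ℂ)} {g : Rd d → ℂ} (hT : IsGivenBy T g)
    (hg : MemLp g p volume) : distLpNorm p T ≤ eLpNorm g p volume :=
  iInf₂_le g ⟨hg, hT⟩

theorem exists_of_distLpNorm_ne_top (hp : 1 ≤ p) {T : 𝓢'(Rd d, ℂ)} (h : distLpNorm p T ≠ ⊤) :
    ∃ g : Rd d → ℂ, MemLp g p volume ∧ IsGivenBy T g ∧ eLpNorm g p volume = distLpNorm p T := by
  have hne : ∃ g : Rd d → ℂ, MemLp g p volume ∧ IsGivenBy T g := by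
    by_contra! hcon
    refine h ?_
    unfold distLpNorm
    simp only [iInf_eq_top]
    exact fun g hg => absurd hg.2 (hcon g hg.1)
  obtain ⟨g, hg, hT⟩ := hne
  refine ⟨g, hg, hT, le_antisymm ?_ (distLpNorm_le hT hg)⟩
  refine le_iInf₂ fun g' hg' => le_of_eq (eLpNorm_congr_ae ?_)
  exact hT.ae_eq hg'.2 (hg.locallyIntegrable hp) (hg'.1.locallyIntegrable hp)

end

/-! ### Parabolic rescaling to frequency μ. -/

/-- The Schwartz function `ξ ↦ Φ (ξ / μ)`. -/
noncomputable def dilate {d : ℕ} (μ : ℝ) (hμ : μ ≠ 0) (Φ : 𝓢(Rd d, ℂ)) : 𝓢(Rd d, ℂ) :=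
  SchwartzMap.compCLMOfContinuousLinearEquiv ℂ
    (ContinuousLinearEquiv.smulLeft (R₁ := ℝ) (Units.mk0 μ⁻¹ (inv_ne_zero hμ))) Φ

theorem dilate_apply {d : ℕ} {μ : ℝ} (hμ : μ ≠ 0) (Φ : 𝓢(Rd d, ℂ)) (ξ : Rd d) :
    dilate μ hμ Φ ξ = Φ (μ⁻¹ • ξ) := rfl

theorem integral_comp_smul_pos {d : ℕ} {μ : ℝ} (hμ : 0 < μ) (f : Rd d → ℂ) :
    ∫ y, f y = ((μ ^ d : ℝ) : ℂ) * ∫ y, f (μ • y) := by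
  rw [Measure.integral_comp_smul, finrank_euclideanSpace_fin, Complex.real_smul, ← mul_assoc,
    ← Complex.ofReal_mul, abs_of_pos (by positivity), mul_inv_cancel₀ (by positivity),
    Complex.ofReal_one, one_mul]

theorem osc_dilate {d : ℕ} {μ : ℝ} (hμ : 0 < μ) (Φ : 𝓢(Rd d, ℂ)) (s : ℝ) (z : Rd d) :
    osc (dilate μ hμ.ne' Φ) s z = ((μ ^ d : ℝ) : ℂ) * osc Φ (μ ^ 2 * s) (μ • z) := by
  unfold osc
  rw [integral_comp_smul_pos hμ]
  congr 1
  refine integral_congr_ae (Eventually.of_forall fun y => ?_)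
  simp only [dilate_apply, norm_smul, Real.norm_of_nonneg hμ.le, inner_smul_left, inner_smul_right,
    inv_smul_smul₀ hμ.ne']
  congr 4
  simp
  ring

theorem evol_dilate {d : ℕ} {μ : ℝ} (hμ : 0 < μ) (Φ : 𝓢(Rd d, ℂ)) (t : ℝ) (g : Rd d → ℂ)
    (x : Rd d) : evol (dilate μ hμ.ne' Φ) t g x =
      evol Φ (μ ^ 2 * t) (fun y => g ((0 : Rd d) + μ⁻¹ • y)) (μ • x) := by
  unfold evol
  rw [integral_comp_smul_pos hμ (fun y => osc Φ _ (μ • x - y) * g ((0 : Rd d) + μ⁻¹ • y)),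
    ← integral_const_mul]
  refine integral_congr_ae (Eventually.of_forall fun y => ?_)
  simp only [zero_add, inv_smul_smul₀ hμ.ne']
  rw [osc_dilate hμ, smul_sub, mul_assoc]
  ring_nf

theorem mixedNorm_dilate_le {d : ℕ} {q r : ℝ≥0∞} {μ : ℝ} (hμ : 0 < μ) (S : ℝ)
    (F : Rd d → ℝ → ℂ) :
    mixedNorm q r univ (Icc (-S) S) (fun x t => F (μ • x) (μ ^ 2 * t)) ≤
      ENNReal.ofReal ((μ⁻¹) ^ d) ^ (q⁻¹).toReal * ENNReal.ofReal ((μ ^ 2)⁻¹) ^ (r⁻¹).toReal *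
        mixedNorm q r univ (Icc (-(S * μ ^ 2)) (S * μ ^ 2)) F := by
  have hμ2 : 0 < μ ^ 2 := by positivity
  have h2 : (volume.restrict (Icc (-S) S) : Measure ℝ) ≤ ENNReal.ofReal ((μ ^ 2)⁻¹) •
      (volume.restrict (Icc (-(S * μ ^ 2)) (S * μ ^ 2))).map (fun t => (μ ^ 2)⁻¹ * t) := by
    have hm : (fun t => (μ ^ 2)⁻¹ * t) ⁻¹' Icc (-S) S = Icc (-(S * μ ^ 2)) (S * μ ^ 2) := by
      ext t
      simp only [mem_preimage, mem_Icc, inv_mul_eq_div, le_div_iff₀ hμ2, div_le_iff₀ hμ2]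
      rw [neg_mul]
    rw [← hm, ← (measurableEmbedding_mulLeft₀ (inv_ne_zero hμ2.ne')).restrict_map,
      Real.map_volume_mul_left (inv_ne_zero hμ2.ne'), inv_inv, abs_of_pos hμ2,
      Measure.restrict_smul, smul_smul, ← ENNReal.ofReal_mul (by positivity),
      inv_mul_cancel₀ hμ2.ne', ENNReal.ofReal_one, one_smul]
  have h := mixedNorm_le_comp (q := q) (r := r) (A := univ) (A' := univ)
    (F := fun x t => F (μ • x) (μ ^ 2 * t))
    (measurableEmbedding_affine (0 : Rd d) (inv_ne_zero hμ.ne'))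
    (measurableEmbedding_mulLeft₀ (inv_ne_zero hμ2.ne')) ENNReal.ofReal_ne_top
    (restrict_le_smul_map_affine 0 (inv_pos.2 hμ) fun x _ => mem_univ x) h2
  simpa only [zero_add, smul_inv_smul₀ hμ.ne', mul_inv_cancel_left₀ hμ2.ne'] using h

/-- The scaling (x, t) ↦ (μx, μ²t) reduces to unit frequency on the time interval of half-length
Sμ². The powers of μ are 2α from that length, d/p from the data, and -d/q - 2/r from the two
Jacobians, which add up to γ. -/
theorem ExtensionBound.exists_evol_dilate_le {d : ℕ} {p q r : ℝ≥0∞} {β : ℝ} (hp : 1 ≤ p)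
    (hpq : p ≤ q) (hr : 1 ≤ r) (hE : ExtensionBound d p q r β)
    (hβ : 0 < (d : ℝ) / 2 - d * (p⁻¹).toReal + β) (Φ : 𝓢(Rd d, ℂ)) {a b : ℝ} (ha : 0 < a)
    (hab : a ≤ b) (hΦ : ∀ ξ, (‖ξ‖ < a ∨ b < ‖ξ‖) → Φ ξ = 0) {S : ℝ} (hS : 1 ≤ S) :
    ∃ C : ℝ≥0∞, C ≠ ⊤ ∧ ∀ (μ : ℝ) (_ : 1 ≤ μ) (hμ0 : μ ≠ 0), ∀ g : Rd d → ℂ, MemLp g p volume →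
      mixedNorm q r univ (Icc (-S) S) (fun x t => evol (dilate μ hμ0 Φ) t g x) ≤
        C * ENNReal.ofReal (μ ^ ((d : ℝ) * (1 - (p⁻¹).toReal - (q⁻¹).toReal) -
          2 * (r⁻¹).toReal + 2 * β)) * eLpNorm g p volume := by
  obtain ⟨C, hC, H⟩ := hE.exists_evol_le hp hpq hr hβ Φ ha hab hΦ
  set α := (d : ℝ) / 2 - d * (p⁻¹).toReal + β with hα
  refine ⟨C * ENNReal.ofReal (S ^ α), ENNReal.mul_ne_top hC ENNReal.ofReal_ne_top,
    fun μ hμ hμ' g hg => ?_⟩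
  have hμ0 : 0 < μ := by linarith
  set g' : Rd d → ℂ := fun y => g ((0 : Rd d) + μ⁻¹ • y) with hg'
  have hn : eLpNorm g' p volume = ENNReal.ofReal (((μ⁻¹) ^ d)⁻¹) ^ (p⁻¹).toReal *
      eLpNorm g p volume := eLpNorm_comp_affine 0 (inv_pos.2 hμ0) g p
  have hgL : MemLp g' p volume := by
    refine ⟨hg.1.comp_quasiMeasurePreserving
      ⟨(measurableEmbedding_affine 0 (inv_ne_zero hμ0.ne')).measurable, ?_⟩, ?_⟩
    · rw [map_affine_volume 0 (inv_pos.2 hμ0)]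
      exact Measure.smul_absolutelyContinuous
    · rw [hn]
      exact ENNReal.mul_lt_top (ENNReal.rpow_lt_top_of_nonneg (by positivity)
        ENNReal.ofReal_ne_top) hg.2
  have h1 := mixedNorm_dilate_le (q := q) (r := r) hμ0 S (fun x t => evol Φ t g' x)
  have hΛ : 1 ≤ S * μ ^ 2 := one_le_mul_of_one_le_of_one_le hS (one_le_pow₀ hμ)
  simp_rw [evol_dilate hμ0]
  refine h1.trans ((mul_le_mul' le_rfl (H (S * μ ^ 2) hΛ g' hgL)).trans (le_of_eq ?_))
  have hreal : ((μ⁻¹) ^ d) ^ (q⁻¹).toReal * ((μ ^ 2)⁻¹) ^ (r⁻¹).toReal * (S * μ ^ 2) ^ α *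
      (((μ⁻¹) ^ d)⁻¹) ^ (p⁻¹).toReal = S ^ α * μ ^ ((d : ℝ) * (1 - (p⁻¹).toReal - (q⁻¹).toReal) -
          2 * (r⁻¹).toReal + 2 * β) := by
    have e : ((d : ℝ) * (1 - (p⁻¹).toReal - (q⁻¹).toReal) - 2 * (r⁻¹).toReal + 2 * β) =
        (-(d : ℝ)) * (q⁻¹).toReal + (-2 : ℝ) * (r⁻¹).toReal + 2 * α + d * (p⁻¹).toReal := by
      rw [hα]; ring
    rw [e, Real.rpow_add hμ0, Real.rpow_add hμ0, Real.rpow_add hμ0, Real.rpow_mul hμ0.le,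
      Real.rpow_mul hμ0.le, Real.rpow_mul hμ0.le, Real.rpow_mul hμ0.le, Real.rpow_neg hμ0.le,
      Real.rpow_neg hμ0.le, Real.rpow_natCast, Real.mul_rpow (by positivity) (by positivity),
      inv_pow, inv_inv, Real.rpow_two]
    ring
  rw [hn]
  rw [ENNReal.ofReal_rpow_of_pos (by positivity), ENNReal.ofReal_rpow_of_pos (by positivity),
    ENNReal.ofReal_rpow_of_pos (by positivity)]
  calc _ = C * eLpNorm g p volume * (ENNReal.ofReal (((μ⁻¹) ^ d) ^ (q⁻¹).toReal) *
        ENNReal.ofReal (((μ ^ 2)⁻¹) ^ (r⁻¹).toReal) * ENNReal.ofReal ((S * μ ^ 2) ^ α) *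
        ENNReal.ofReal ((((μ⁻¹) ^ d)⁻¹) ^ (p⁻¹).toReal)) := by ring
    _ = C * eLpNorm g p volume * ENNReal.ofReal (S ^ α * μ ^ ((d : ℝ) *
        (1 - (p⁻¹).toReal - (q⁻¹).toReal) - 2 * (r⁻¹).toReal + 2 * β)) := by
        rw [← ENNReal.ofReal_mul (by positivity), ← ENNReal.ofReal_mul (by positivity),
          ← ENNReal.ofReal_mul (by positivity), hreal]
    _ = _ := by
        rw [ENNReal.ofReal_mul (by positivity)]
        ring

/-! ### Time derivatives of the localized evolution. -/

/-- The symbol of the time derivative of the propagator. -/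
noncomputable def timeDeriv {d : ℕ} (Φ : 𝓢(Rd d, ℂ)) : 𝓢(Rd d, ℂ) :=
  ((-4 * Real.pi ^ 2 : ℝ) : ℂ) • quadMul Φ

theorem timeDeriv_apply {d : ℕ} (Φ : 𝓢(Rd d, ℂ)) (ξ : Rd d) :
    timeDeriv Φ ξ = ((-4 * Real.pi ^ 2 : ℝ) : ℂ) * (Complex.I * ((‖ξ‖ ^ 2 : ℝ) : ℂ) * Φ ξ) := by
  rw [timeDeriv, smul_apply, quadMul_apply, smul_eq_mul]

theorem osc_smul {d : ℕ} (c : ℂ) (Φ : 𝓢(Rd d, ℂ)) (s : ℝ) (z : Rd d) :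
    osc (c • Φ) s z = c * osc Φ s z := by
  unfold osc
  rw [← integral_const_mul]
  refine integral_congr_ae (Eventually.of_forall fun y => ?_)
  simp only [smul_apply, smul_eq_mul]
  ring

theorem evol_smul {d : ℕ} (c : ℂ) (Φ : 𝓢(Rd d, ℂ)) (t : ℝ) (g : Rd d → ℂ) (x : Rd d) :
    evol (c • Φ) t g x = c * evol Φ t g x := by
  unfold evol
  rw [← integral_const_mul]
  simp_rw [osc_smul, mul_assoc]

/-- Time frequency is the square of spatial frequency, hence the powers of 4 in the Littlewood–Paley
argument in time. -/
theorem timeDeriv_dilate {d : ℕ} {μ : ℝ} (hμ : μ ≠ 0) (Φ : 𝓢(Rd d, ℂ)) :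
    timeDeriv (dilate μ hμ Φ) = ((μ ^ 2 : ℝ) : ℂ) • dilate μ hμ (timeDeriv Φ) := by
  ext ξ
  rw [smul_apply, timeDeriv_apply, dilate_apply, dilate_apply, timeDeriv_apply, norm_smul, mul_pow,
    norm_inv, Real.norm_eq_abs, inv_pow, sq_abs, smul_eq_mul]
  push_cast
  have : (μ : ℂ) ≠ 0 := by exact_mod_cast hμ
  field_simp

theorem integrable_polyWeight_sq_mul {d : ℕ} {p : ℝ≥0∞} (hp : 1 ≤ p) {g : Rd d → ℂ}
    (hg : MemLp g p volume) (x : Rd d) :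
    Integrable fun y => ((polyWeight 1 x y ^ 2 : ℝ) : ℂ) * g y := by
  refine ⟨?_, ?_⟩
  · refine AEStronglyMeasurable.mul (Continuous.aestronglyMeasurable ?_) hg.1
    have := (continuous_polyWeight (d := d) one_pos).comp (Continuous.prodMk_right x)
    exact Complex.continuous_ofReal.comp (this.pow 2)
  · unfold HasFiniteIntegral
    have h := lintegral_polyWeight_sq_mul_le hp le_rfl x hg.1
    have e : ∀ y, ‖((polyWeight 1 x y ^ 2 : ℝ) : ℂ) * g y‖ₑ =
        ENNReal.ofReal (polyWeight 1 x y ^ 2) * ‖g y‖ₑ := fun y => by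
      rw [enorm_mul, ← ofReal_norm, Complex.norm_real, Real.norm_of_nonneg (by positivity)]
    simp_rw [e]
    refine h.trans_lt (ENNReal.mul_lt_top (ENNReal.mul_lt_top ENNReal.ofReal_lt_top
      (ENNReal.add_lt_top.2 ⟨ENNReal.one_lt_top, (polyMass_ne_top d).lt_top⟩)) ?_)
    refine lt_of_le_of_lt (eLpNorm_mono fun y => ?_) hg.2
    rw [norm_mul, Complex.norm_real, Real.norm_of_nonneg (polyWeight_pos one_pos x y).le]
    exact mul_le_of_le_one_left (norm_nonneg _) (polyWeight_le_one one_pos x y)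

theorem exists_norm_osc_le_polyWeight {d : ℕ} (Φ : 𝓢(Rd d, ℂ)) (S : ℝ) : ∃ C : ℝ, 0 ≤ C ∧
    ∀ s : ℝ, |s| ≤ S → ∀ x y : Rd d, ‖osc Φ s (x - y)‖ ≤ C * polyWeight 1 x y ^ 2 := by
  obtain ⟨K, hK, hKΦ⟩ := exists_norm_osc_le_of_abs_le Φ (2 * (d + 1)) S
  refine ⟨K, hK, fun s hs x y => ?_⟩
  have h := hKΦ s hs (x - y)
  unfold polyWeight
  rw [inv_pow, ← pow_mul, div_one, mul_comm (d + 1) 2, norm_sub_rev y x, ← div_eq_mul_inv,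
    le_div_iff₀ (by positivity)]
  exact h

theorem hasDerivAt_evol {d : ℕ} {p : ℝ≥0∞} (hp : 1 ≤ p) (Φ : 𝓢(Rd d, ℂ)) {g : Rd d → ℂ}
    (hg : MemLp g p volume) (x : Rd d) (t : ℝ) :
    HasDerivAt (fun t => evol Φ t g x) (evol (timeDeriv Φ) t g x) t := by
  obtain ⟨K, hK, hKΦ⟩ := exists_norm_osc_le_polyWeight (timeDeriv Φ) (4 * Real.pi ^ 2 * (|t| + 1))
  have h := hasDerivAt_integral_of_dominated_loc_of_deriv_le (μ := (volume : Measure (Rd d)))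
    (F := fun t y => osc Φ (-4 * Real.pi ^ 2 * t) (x - y) * g y)
    (F' := fun t y => osc (timeDeriv Φ) (-4 * Real.pi ^ 2 * t) (x - y) * g y)
    (x₀ := t) (s := Ioo (t - 1) (t + 1))
    (bound := fun y => K * ‖((polyWeight 1 x y ^ 2 : ℝ) : ℂ) * g y‖)
    (Ioo_mem_nhds (by linarith) (by linarith))
    (Eventually.of_forall fun s => (integrable_osc_sub_mul Φ _ hp hg x).1)
    (integrable_osc_sub_mul Φ _ hp hg x) (integrable_osc_sub_mul (timeDeriv Φ) _ hp hg x).1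
    (ae_of_all _ fun y s hs => ?_)
    ((integrable_polyWeight_sq_mul hp hg x).norm.const_mul K) (ae_of_all _ fun y s hs => ?_)
  · exact h.2
  · rw [norm_mul, norm_mul, Complex.norm_real, Real.norm_of_nonneg (by positivity), ← mul_assoc]
    refine mul_le_mul_of_nonneg_right (hKΦ _ ?_ x y) (norm_nonneg _)
    rw [abs_mul, abs_mul, abs_neg, abs_of_nonneg (by positivity : (0 : ℝ) ≤ 4),
      abs_of_nonneg (by positivity)]
    gcongr
    have h1 : |s - t| ≤ 1 := by
      rw [abs_le]; exact ⟨by linarith [hs.1], by linarith [hs.2]⟩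
    calc |s| = |t + (s - t)| := by ring_nf
      _ ≤ |t| + |s - t| := abs_add_le _ _
      _ ≤ |t| + 1 := by gcongr
  · have h1 := hasDerivAt_osc Φ (-4 * Real.pi ^ 2 * s) (x - y)
    have h2 : HasDerivAt (fun s : ℝ => -4 * Real.pi ^ 2 * s) (-4 * Real.pi ^ 2) s := by
      exact ((hasDerivAt_id s).const_mul (-4 * Real.pi ^ 2)).congr_deriv (mul_one _)
    have h3 := (h1.scomp s h2).mul_const (g y)
    refine h3.congr_deriv ?_
    rw [timeDeriv, osc_smul, Complex.real_smul]

theorem stronglyMeasurable_uncurry_evol {d : ℕ} (Φ : 𝓢(Rd d, ℂ)) {f : Rd d → ℂ}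
    (hf : AEStronglyMeasurable f volume) :
    StronglyMeasurable (Function.uncurry fun x t => evol Φ t f x) :=
  stronglyMeasurable_evol Φ hf

/-! ### A one-sided Littlewood–Paley inequality in time. -/

/-- A second-order Taylor bound modelled on |a+b|² = |a|² + 2 Re(āb) + |b|². The linear term is kept
exactly, because its oscillation will be exploited. If b is small relative to w, then (1+z)^ρ ≤
e^{ρz} ≤ 1 + ρz + (ρz)²; otherwise every term is controlled by b^{2ρ}. -/
theorem exists_rpow_sq_add_le {ρ : ℝ} (hρ : 1 ≤ ρ) : ∃ C : ℝ, 1 ≤ C ∧ ∀ w c b : ℝ, 0 < w → 0 ≤ b →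
    |c| ≤ w * b → (w ^ 2 + 2 * c + b ^ 2) ^ ρ ≤ (w ^ 2) ^ ρ + 2 * ρ * ((w ^ 2) ^ (ρ - 1) * c) +
      C * ((w ^ 2) ^ (ρ - 1) * b ^ 2 + (b ^ 2) ^ ρ) := by
  have hρ0 : 0 < ρ := by linarith
  refine ⟨ρ + 9 * ρ ^ 2 + ((3 * ρ + 1) ^ 2) ^ ρ + 6 * ρ ^ 2 * (9 * ρ ^ 2) ^ (ρ - 1), ?_,
    fun w c b hw hb hc => ?_⟩
  · have : 0 ≤ ((3 * ρ + 1) ^ 2) ^ ρ + 6 * ρ ^ 2 * (9 * ρ ^ 2) ^ (ρ - 1) := by positivity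
    nlinarith
  set W := (w ^ 2) ^ (ρ - 1) with hW
  have hW0 : 0 < W := by positivity
  have hWw : (w ^ 2) ^ ρ = W * w ^ 2 := by
    rw [hW, Real.rpow_sub_one (by positivity)]
    field_simp
  obtain ⟨hc1, hc2⟩ := abs_le.1 hc
  have hsum0 : 0 ≤ w ^ 2 + 2 * c + b ^ 2 := by nlinarith [sq_nonneg (w - b)]
  have hB0 : 0 ≤ (b ^ 2) ^ ρ := by positivity
  set K := ((3 * ρ + 1) ^ 2) ^ ρ + 6 * ρ ^ 2 * (9 * ρ ^ 2) ^ (ρ - 1) with hK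
  have hK0 : 0 ≤ K := by positivity
  rw [add_assoc (ρ + 9 * ρ ^ 2), ← hK]
  -- The threshold ensures |ρz| ≤ 1, since |z| ≤ 3b/w.
  rcases le_or_gt (3 * ρ * b) w with hbw | hbw
  · set z := (2 * c + b ^ 2) / w ^ 2 with hz
    have hzw : w ^ 2 * (1 + z) = w ^ 2 + 2 * c + b ^ 2 := by rw [hz]; field_simp; ring
    have h1z : 0 ≤ 1 + z := by
      by_contra! h
      nlinarith [mul_pos (pow_pos hw 2) (neg_pos.2 h)]
    have hbw' : b ≤ w := by nlinarith
    have hzb : |z| ≤ 3 * b / w := by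
      rw [hz, abs_div, abs_of_pos (pow_pos hw 2), div_le_div_iff₀ (by positivity) hw]
      have : |2 * c + b ^ 2| ≤ 3 * (w * b) := by
        rw [abs_le]; constructor <;> nlinarith
      nlinarith
    have hρz : |ρ * z| ≤ 1 := by
      rw [abs_mul, abs_of_pos hρ0]
      calc ρ * |z| ≤ ρ * (3 * b / w) := by gcongr
        _ = 3 * ρ * b / w := by ring
        _ ≤ 1 := by rw [div_le_one hw]; exact hbw
    have hexp := Real.abs_exp_sub_one_sub_id_le hρz
    have h2 : (1 + z) ^ ρ ≤ 1 + ρ * z + (ρ * z) ^ 2 := by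
      have h3 : (1 + z) ^ ρ ≤ Real.exp z ^ ρ :=
        Real.rpow_le_rpow h1z (by linarith [Real.add_one_le_exp z]) hρ0.le
      rw [← Real.exp_mul, mul_comm] at h3
      linarith [(abs_le.1 hexp).2]
    have h4 : w ^ 2 * (ρ * z) ^ 2 ≤ 9 * ρ ^ 2 * b ^ 2 := by
      have : z ^ 2 ≤ (3 * b / w) ^ 2 := by rw [← sq_abs z]; gcongr
      calc w ^ 2 * (ρ * z) ^ 2 = w ^ 2 * ρ ^ 2 * z ^ 2 := by ring
        _ ≤ w ^ 2 * ρ ^ 2 * (3 * b / w) ^ 2 := by gcongr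
        _ = 9 * ρ ^ 2 * b ^ 2 := by field_simp; ring
    have h5 : w ^ 2 * z = 2 * c + b ^ 2 := by rw [hz]; field_simp
    rw [← hzw, Real.mul_rpow (by positivity) h1z, hWw]
    calc W * w ^ 2 * (1 + z) ^ ρ ≤ W * w ^ 2 * (1 + ρ * z + (ρ * z) ^ 2) := by gcongr
      _ = W * (w ^ 2 + ρ * (w ^ 2 * z) + w ^ 2 * (ρ * z) ^ 2) := by ring
      _ ≤ W * (w ^ 2 + ρ * (2 * c + b ^ 2) + 9 * ρ ^ 2 * b ^ 2) := by rw [h5]; gcongr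
      _ = W * w ^ 2 + 2 * ρ * (W * c) + (ρ + 9 * ρ ^ 2) * (W * b ^ 2) := by ring
      _ ≤ _ := by
        have : 0 ≤ (ρ + 9 * ρ ^ 2) * (b ^ 2) ^ ρ + K * (W * b ^ 2 + (b ^ 2) ^ ρ) := by positivity
        linarith
  · have hb0 : 0 < b := by
      by_contra! h
      have : b = 0 := le_antisymm h hb
      rw [this] at hbw
      linarith
    have h1 : (w ^ 2 + 2 * c + b ^ 2) ^ ρ ≤ ((3 * ρ + 1) ^ 2) ^ ρ * (b ^ 2) ^ ρ := by
      rw [← Real.mul_rpow (by positivity) (by positivity)]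
      refine Real.rpow_le_rpow hsum0 ?_ hρ0.le
      have : w ^ 2 + 2 * c + b ^ 2 ≤ (w + b) ^ 2 := by nlinarith
      refine this.trans ?_
      rw [← mul_pow]
      gcongr
      linarith
    have h2 : W * (w * b) ≤ 3 * ρ * (9 * ρ ^ 2) ^ (ρ - 1) * (b ^ 2) ^ ρ := by
      have hWb : W ≤ (9 * ρ ^ 2) ^ (ρ - 1) * (b ^ 2) ^ (ρ - 1) := by
        rw [← Real.mul_rpow (by positivity) (by positivity), hW]
        refine Real.rpow_le_rpow (by positivity) ?_ (by linarith)
        calc w ^ 2 ≤ (3 * ρ * b) ^ 2 := by gcongr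
          _ = 9 * ρ ^ 2 * b ^ 2 := by ring
      have hBb : (b ^ 2) ^ ρ = (b ^ 2) ^ (ρ - 1) * b ^ 2 := by
        rw [Real.rpow_sub_one (by positivity)]
        field_simp
      calc W * (w * b) ≤ ((9 * ρ ^ 2) ^ (ρ - 1) * (b ^ 2) ^ (ρ - 1)) * ((3 * ρ * b) * b) := by
            gcongr
        _ = _ := by rw [hBb]; ring
    have h3 : -(W * (w * b)) ≤ W * c := by nlinarith
    have h4 : 0 ≤ W * w ^ 2 := by positivity
    have h5 : 0 ≤ (ρ + 9 * ρ ^ 2) * (W * b ^ 2 + (b ^ 2) ^ ρ) + K * (W * b ^ 2) := by positivity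
    have h6 : 2 * ρ * -(W * (w * b)) ≤ 2 * ρ * (W * c) := by gcongr
    have h7 : 2 * ρ * (W * (w * b)) ≤ 2 * ρ * (3 * ρ * (9 * ρ ^ 2) ^ (ρ - 1) * (b ^ 2) ^ ρ) := by
      gcongr
    have h8 : K * (b ^ 2) ^ ρ = ((3 * ρ + 1) ^ 2) ^ ρ * (b ^ 2) ^ ρ +
        2 * ρ * (3 * ρ * (9 * ρ ^ 2) ^ (ρ - 1) * (b ^ 2) ^ ρ) := by rw [hK]; ring
    rw [hWw]
    nlinarith

/-- The term ε² keeps the base positive, so that the power ρ - 1 of it can be differentiated even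
where `a` vanishes. -/
theorem exists_rpow_norm_add_sq_le {ρ : ℝ} (hρ : 1 ≤ ρ) : ∃ C : ℝ, 1 ≤ C ∧ ∀ (ε : ℝ) (a b : ℂ),
    0 < ε → (‖a + b‖ ^ 2 + ε ^ 2) ^ ρ ≤ (‖a‖ ^ 2 + ε ^ 2) ^ ρ +
      2 * ρ * ((‖a‖ ^ 2 + ε ^ 2) ^ (ρ - 1) * ((starRingEnd ℂ) a * b).re) +
      C * ((‖a‖ ^ 2 + ε ^ 2) ^ (ρ - 1) * ‖b‖ ^ 2 + (‖b‖ ^ 2) ^ ρ) := by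
  obtain ⟨C, hC, H⟩ := exists_rpow_sq_add_le hρ
  refine ⟨C, hC, fun ε a b hε => ?_⟩
  have hpos : 0 < ‖a‖ ^ 2 + ε ^ 2 := by positivity
  have hw : Real.sqrt (‖a‖ ^ 2 + ε ^ 2) ^ 2 = ‖a‖ ^ 2 + ε ^ 2 := Real.sq_sqrt hpos.le
  have h := H (Real.sqrt (‖a‖ ^ 2 + ε ^ 2)) ((starRingEnd ℂ) a * b).re ‖b‖ (Real.sqrt_pos.2 hpos)
    (norm_nonneg b) ?_
  · rw [hw] at h
    refine le_trans (le_of_eq ?_) h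
    congr 1
    rw [← Complex.normSq_eq_norm_sq, Complex.normSq_add, Complex.normSq_eq_norm_sq,
      Complex.normSq_eq_norm_sq]
    have : (a * (starRingEnd ℂ) b).re = ((starRingEnd ℂ) a * b).re := by
      simp [Complex.mul_re]
    rw [this]
    ring
  · refine (Complex.abs_re_le_norm _).trans ?_
    rw [norm_mul, RCLike.norm_conj]
    gcongr
    exact Real.le_sqrt_of_sq_le (by nlinarith [sq_nonneg ε])

/-- Hölder's inequality for three factors, one of them raised to the power `r - 2 = 2 * (ρ - 1)`. -/
theorem integral_rpow_mul_mul_le {ρ : ℝ} (hρ : 1 ≤ ρ) {c d : ℝ} (hcd : c ≤ d) {u f g : ℝ → ℝ}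
    (hu : ContinuousOn u (Icc c d)) (hf : ContinuousOn f (Icc c d)) (hg : ContinuousOn g (Icc c d))
    (hu0 : ∀ t, 0 < u t) (hf0 : ∀ t, 0 ≤ f t) (hg0 : ∀ t, 0 ≤ g t) {Y A B : ℝ} (hY : 0 < Y)
    (hA : 0 ≤ A) (hB : 0 ≤ B) (huY : ∫ t in c..d, u t ^ ρ ≤ Y ^ ρ)
    (hfA : ∫ t in c..d, f t ^ (2 * ρ) ≤ A ^ (2 * ρ))
    (hgB : ∫ t in c..d, g t ^ (2 * ρ) ≤ B ^ (2 * ρ)) :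
    ∫ t in c..d, u t ^ (ρ - 1) * (f t * g t) ≤ Y ^ (ρ - 1) * (A * B) := by
  have hρ0 : 0 < ρ := by linarith
  have hui : IntervalIntegrable (fun t => u t ^ ρ) volume c d :=
    (hu.rpow_const fun t _ => Or.inl (hu0 t).ne').intervalIntegrable_of_Icc hcd
  have hfi : IntervalIntegrable (fun t => f t ^ (2 * ρ)) volume c d :=
    (hf.rpow_const fun t _ => Or.inr (by positivity)).intervalIntegrable_of_Icc hcd
  have hgi : IntervalIntegrable (fun t => g t ^ (2 * ρ)) volume c d :=
    (hg.rpow_const fun t _ => Or.inr (by positivity)).intervalIntegrable_of_Icc hcd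
  have hint : IntervalIntegrable (fun t => u t ^ (ρ - 1) * (f t * g t)) volume c d :=
    ((hu.rpow_const fun t _ => Or.inl (hu0 t).ne').mul (hf.mul hg)).intervalIntegrable_of_Icc hcd
  -- `A` and `B` may be zero; slightly larger positive values are used for the normalization and
  -- then sent to `A` and `B`. The weights (ρ-1)/ρ, 1/2ρ, 1/2ρ of the arithmetic-geometric mean are
  -- the Hölder exponents.
  have key : ∀ A' B' : ℝ, 0 < A' → 0 < B' → A ≤ A' → B ≤ B' →
      ∫ t in c..d, u t ^ (ρ - 1) * (f t * g t) ≤ Y ^ (ρ - 1) * (A' * B') := by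
    intro A' B' hA' hB' hAA hBB
    have hpt : ∀ t ∈ Icc c d, u t ^ (ρ - 1) * (f t * g t) ≤ Y ^ (ρ - 1) * (A' * B') *
        ((ρ - 1) / ρ * ((Y ^ ρ)⁻¹ * u t ^ ρ) + 1 / (2 * ρ) * ((A' ^ (2 * ρ))⁻¹ * f t ^ (2 * ρ)) +
          1 / (2 * ρ) * ((B' ^ (2 * ρ))⁻¹ * g t ^ (2 * ρ))) := by
      intro t _
      have h := Real.geom_mean_le_arith_mean3_weighted (w₁ := (ρ - 1) / ρ) (w₂ := 1 / (2 * ρ))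
        (w₃ := 1 / (2 * ρ)) (p₁ := (u t / Y) ^ ρ) (p₂ := (f t / A') ^ (2 * ρ))
        (p₃ := (g t / B') ^ (2 * ρ)) (div_nonneg (by linarith) hρ0.le) (by positivity)
        (by positivity) (Real.rpow_nonneg (div_nonneg (hu0 t).le hY.le) _)
        (Real.rpow_nonneg (div_nonneg (hf0 t) hA'.le) _)
        (Real.rpow_nonneg (div_nonneg (hg0 t) hB'.le) _) (by field_simp; ring)
      rw [← Real.rpow_mul (div_nonneg (hu0 t).le hY.le),
        ← Real.rpow_mul (div_nonneg (hf0 t) hA'.le), ← Real.rpow_mul (div_nonneg (hg0 t) hB'.le),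
        mul_div_cancel₀ _ hρ0.ne', mul_one_div_cancel (by positivity), Real.rpow_one,
        Real.rpow_one, Real.div_rpow (hu0 t).le hY.le, Real.div_rpow (hu0 t).le hY.le,
        Real.div_rpow (hf0 t) hA'.le, Real.div_rpow (hg0 t) hB'.le] at h
      have hYp : 0 < Y ^ (ρ - 1) := by positivity
      have h' := mul_le_mul_of_nonneg_left h (by positivity : 0 ≤ Y ^ (ρ - 1) * (A' * B'))
      refine le_trans (le_of_eq ?_) (h'.trans (le_of_eq ?_))
      · field_simp
      · simp only [div_eq_inv_mul, mul_one]
    have hi1 : IntervalIntegrable (fun t => Y ^ (ρ - 1) * (A' * B') *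
        ((ρ - 1) / ρ * ((Y ^ ρ)⁻¹ * u t ^ ρ) + 1 / (2 * ρ) * ((A' ^ (2 * ρ))⁻¹ * f t ^ (2 * ρ)) +
          1 / (2 * ρ) * ((B' ^ (2 * ρ))⁻¹ * g t ^ (2 * ρ)))) volume c d :=
      ((((hui.const_mul _).const_mul _).add ((hfi.const_mul _).const_mul _)).add
        ((hgi.const_mul _).const_mul _)).const_mul _
    refine (intervalIntegral.integral_mono_on hcd hint hi1 hpt).trans ?_
    rw [intervalIntegral.integral_const_mul, intervalIntegral.integral_add
      (((hui.const_mul _).const_mul _).add ((hfi.const_mul _).const_mul _))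
      ((hgi.const_mul _).const_mul _), intervalIntegral.integral_add
      ((hui.const_mul _).const_mul _) ((hfi.const_mul _).const_mul _)]
    simp only [intervalIntegral.integral_const_mul]
    have e1 : (Y ^ ρ)⁻¹ * ∫ t in c..d, u t ^ ρ ≤ 1 := by
      rw [inv_mul_le_iff₀ (by positivity), mul_one]; exact huY
    have e2 : (A' ^ (2 * ρ))⁻¹ * ∫ t in c..d, f t ^ (2 * ρ) ≤ 1 := by
      rw [inv_mul_le_iff₀ (by positivity), mul_one]
      exact hfA.trans (Real.rpow_le_rpow hA hAA (by positivity))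
    have e3 : (B' ^ (2 * ρ))⁻¹ * ∫ t in c..d, g t ^ (2 * ρ) ≤ 1 := by
      rw [inv_mul_le_iff₀ (by positivity), mul_one]
      exact hgB.trans (Real.rpow_le_rpow hB hBB (by positivity))
    have hρ1 : 0 ≤ (ρ - 1) / ρ := div_nonneg (by linarith) hρ0.le
    calc _ ≤ Y ^ (ρ - 1) * (A' * B') * ((ρ - 1) / ρ * 1 + 1 / (2 * ρ) * 1 + 1 / (2 * ρ) * 1) := by
          gcongr
      _ = Y ^ (ρ - 1) * (A' * B') := by field_simp; ring
  have hlim : Tendsto (fun η : ℝ => Y ^ (ρ - 1) * ((A + η) * (B + η))) (𝓝[>] 0)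
      (𝓝 (Y ^ (ρ - 1) * ((A + 0) * (B + 0)))) := by
    refine Tendsto.mono_left (Continuous.tendsto ?_ 0) nhdsWithin_le_nhds
    fun_prop
  rw [add_zero, add_zero] at hlim
  refine ge_of_tendsto hlim ?_
  filter_upwards [self_mem_nhdsWithin] with η hη
  have hη0 : 0 < η := hη
  exact key _ _ (by positivity) (by positivity) (by linarith) (by linarith)

/-- Converts a bound for the growth of `Y ^ ρ` into one for the growth of `Y`, so that the induction
over pieces becomes additive. -/
theorem add_rpow_ge {ρ Y v : ℝ} (hρ : 1 ≤ ρ) (hY : 0 < Y) (hv : 0 ≤ v) :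
    Y ^ ρ + v * Y ^ (ρ - 1) + v ^ ρ ≤ (Y + 2 * v) ^ ρ := by
  have h0 : 0 < Y + 2 * v := by positivity
  have e : ∀ x : ℝ, 0 < x → x ^ ρ = x * x ^ (ρ - 1) := fun x hx => by
    rw [Real.rpow_sub_one hx.ne']; field_simp
  have h1 : Y ^ (ρ - 1) ≤ (Y + 2 * v) ^ (ρ - 1) :=
    Real.rpow_le_rpow hY.le (by linarith) (by linarith)
  have h2 : v ^ (ρ - 1) ≤ (Y + 2 * v) ^ (ρ - 1) := Real.rpow_le_rpow hv (by linarith) (by linarith)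
  have h3 : v ^ ρ ≤ v * v ^ (ρ - 1) := by
    rcases hv.eq_or_lt with h | h
    · rw [← h, Real.zero_rpow (by linarith)]; simp
    · rw [e v h]
  rw [e Y hY, e _ h0]
  nlinarith [Real.rpow_nonneg hv (ρ - 1), Real.rpow_nonneg hY.le (ρ - 1)]

theorem hasDerivAt_rpow_normSq_mul_conj {ρ ε : ℝ} (hε : 0 < ε) {S : ℝ → ℂ} {S' : ℂ} {t : ℝ}
    (hS : HasDerivAt S S' t) :
    HasDerivAt (fun t => (((‖S t‖ ^ 2 + ε ^ 2) ^ (ρ - 1) : ℝ) : ℂ) * (starRingEnd ℂ) (S t))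
      (((2 * inner ℝ (S t) S' * (ρ - 1) * (‖S t‖ ^ 2 + ε ^ 2) ^ (ρ - 1 - 1) : ℝ) : ℂ) *
        (starRingEnd ℂ) (S t) +
        (((‖S t‖ ^ 2 + ε ^ 2) ^ (ρ - 1) : ℝ) : ℂ) * (starRingEnd ℂ) S') t := by
  have h1 : HasDerivAt (fun t => ‖S t‖ ^ 2 + ε ^ 2) (2 * inner ℝ (S t) S') t :=
    hS.norm_sq.add_const _
  have h2 := (h1.rpow_const (p := ρ - 1) (Or.inl (by positivity))).ofReal_comp
  exact h2.mul hS.star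

theorem norm_deriv_rpow_normSq_mul_conj_le {ρ ε : ℝ} (hρ : 1 ≤ ρ) (hε : 0 < ε) (S S' : ℂ) :
    ‖((2 * inner ℝ S S' * (ρ - 1) * (‖S‖ ^ 2 + ε ^ 2) ^ (ρ - 1 - 1) : ℝ) : ℂ) *
        (starRingEnd ℂ) S + (((‖S‖ ^ 2 + ε ^ 2) ^ (ρ - 1) : ℝ) : ℂ) * (starRingEnd ℂ) S'‖ ≤
      (2 * ρ - 1) * ((‖S‖ ^ 2 + ε ^ 2) ^ (ρ - 1) * ‖S'‖) := by
  have hu : 0 < ‖S‖ ^ 2 + ε ^ 2 := by positivity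
  refine (norm_add_le _ _).trans ?_
  rw [norm_mul, norm_mul, RCLike.norm_conj, RCLike.norm_conj, Complex.norm_real, Complex.norm_real,
    Real.norm_of_nonneg (Real.rpow_nonneg hu.le _), norm_mul, norm_mul, norm_mul,
    Real.norm_of_nonneg (Real.rpow_nonneg hu.le _), Real.norm_of_nonneg (by linarith : 0 ≤ ρ - 1),
    Real.norm_of_nonneg (by norm_num : (0 : ℝ) ≤ 2), Real.rpow_sub_one hu.ne' (ρ - 1)]
  set V := (‖S‖ ^ 2 + ε ^ 2) ^ (ρ - 1) with hV
  have hV0 : 0 < V := by positivity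
  have h1 : ‖(inner ℝ S S' : ℝ)‖ ≤ ‖S‖ * ‖S'‖ := norm_inner_le_norm _ _
  have h2 : ‖S‖ ^ 2 / (‖S‖ ^ 2 + ε ^ 2) ≤ 1 := by
    rw [div_le_one hu]; nlinarith [sq_nonneg ε]
  have hρ1 : 0 ≤ ρ - 1 := by linarith
  calc _ ≤ 2 * (‖S‖ * ‖S'‖) * (ρ - 1) * (V / (‖S‖ ^ 2 + ε ^ 2)) * ‖S‖ + V * ‖S'‖ := by gcongr
    _ = 2 * (ρ - 1) * V * ‖S'‖ * (‖S‖ ^ 2 / (‖S‖ ^ 2 + ε ^ 2)) + V * ‖S'‖ := by ring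
    _ ≤ 2 * (ρ - 1) * V * ‖S'‖ * 1 + V * ‖S'‖ := by gcongr
    _ = _ := by ring

/-- The cutoff removes the boundary terms in the integration by parts, at the price of enlarging
[-1, 1] to [-2, 2]. -/
theorem exists_time_cutoff : ∃ (η η' : ℝ → ℝ) (L : ℝ), 0 ≤ L ∧ (∀ t, HasDerivAt η (η' t) t) ∧
    Continuous η' ∧ (∀ t, 0 ≤ η t ∧ η t ≤ 1) ∧ (∀ t ∈ Icc (-1 : ℝ) 1, η t = 1) ∧ η (-2) = 0 ∧
    η 2 = 0 ∧ ∀ t, |η' t| ≤ L := by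
  let b : ContDiffBump (0 : ℝ) := ⟨1, 2, one_pos, by norm_num⟩
  have hb : ContDiff ℝ 1 b := b.contDiff
  have hc : Continuous (deriv b) := hb.continuous_deriv le_rfl
  obtain ⟨L, hL⟩ := b.hasCompactSupport.deriv.exists_bound_of_continuous hc
  refine ⟨b, deriv b, L, (norm_nonneg _).trans (hL 0), fun t => ?_, hc, fun t => ⟨b.nonneg, b.le_one⟩,
    fun t ht => ?_, ?_, ?_, hL⟩
  · exact (hb.differentiable one_ne_zero t).hasDerivAt
  · refine b.one_of_mem_closedBall ?_
    rw [Metric.mem_closedBall, dist_zero_right, Real.norm_eq_abs, abs_le]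
    exact ht
  · exact b.zero_of_le_dist (by simp [b])
  · exact b.zero_of_le_dist (by simp [b])

section squareFunction

variable {η η' : ℝ → ℝ} {L ρ ε : ℝ}

/-- Write F = G' and integrate by parts: the derivative moves to the slower factors |S|^{2ρ-2} S̄
(regularized) and η, leaving the small function `G`. -/
theorem abs_integral_cross_le (hL : ∀ t, |η' t| ≤ L)
    (hη : ∀ t, HasDerivAt η (η' t) t) (hη' : Continuous η') (hη1 : ∀ t, 0 ≤ η t ∧ η t ≤ 1)
    (hm : η (-2) = 0) (hp : η 2 = 0) (hρ : 1 ≤ ρ) (hε : 0 < ε) {S S' F G : ℝ → ℂ}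
    (hS : ∀ t, HasDerivAt S (S' t) t) (hS' : Continuous S')
    (hG : ∀ t, HasDerivAt G (F t) t) (hF : Continuous F) :
    |∫ t in (-2 : ℝ)..2, (‖S t‖ ^ 2 + ε ^ 2) ^ (ρ - 1) * ((starRingEnd ℂ) (S t) * (η t * F t)).re| ≤
      (2 * ρ - 1) * ∫ t in (-2 : ℝ)..2,
        (‖S t‖ ^ 2 + ε ^ 2) ^ (ρ - 1) * ((‖S' t‖ + L * ‖S t‖) * ‖G t‖) := by
  have hSc : Continuous S := continuous_iff_continuousAt.2 fun t => (hS t).continuousAt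
  have hGc : Continuous G := continuous_iff_continuousAt.2 fun t => (hG t).continuousAt
  have hηc : Continuous η := continuous_iff_continuousAt.2 fun t => (hη t).continuousAt
  have hu : ∀ t, 0 < ‖S t‖ ^ 2 + ε ^ 2 := fun t => by positivity
  set J : ℝ → ℂ := fun t => (((‖S t‖ ^ 2 + ε ^ 2) ^ (ρ - 1) : ℝ) : ℂ) * (starRingEnd ℂ) (S t) with hJ
  set J' : ℝ → ℂ := fun t =>
    ((2 * inner ℝ (S t) (S' t) * (ρ - 1) * (‖S t‖ ^ 2 + ε ^ 2) ^ (ρ - 1 - 1) : ℝ) : ℂ) *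
        (starRingEnd ℂ) (S t) +
        (((‖S t‖ ^ 2 + ε ^ 2) ^ (ρ - 1) : ℝ) : ℂ) * (starRingEnd ℂ) (S' t) with hJ'
  have hJd : ∀ t, HasDerivAt J (J' t) t := fun t => hasDerivAt_rpow_normSq_mul_conj hε (hS t)
  have hup : ∀ e : ℝ, Continuous fun t => (‖S t‖ ^ 2 + ε ^ 2) ^ e := fun e =>
    Continuous.rpow_const (by fun_prop) fun t => Or.inl (hu t).ne'
  have hJc : Continuous J := continuous_iff_continuousAt.2 fun t => (hJd t).continuousAt
  have hJ'c : Continuous J' := by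
    have h1 := hup (ρ - 1 - 1)
    have h2 := hup (ρ - 1)
    have h3 : Continuous fun t => (starRingEnd ℂ) (S t) := Complex.continuous_conj.comp hSc
    have h4 : Continuous fun t => (starRingEnd ℂ) (S' t) := Complex.continuous_conj.comp hS'
    have h5 : Continuous fun t => (inner ℝ (S t) (S' t) : ℝ) := hSc.inner hS'
    refine ((Complex.continuous_ofReal.comp ?_).mul h3).add
      ((Complex.continuous_ofReal.comp h2).mul h4)
    exact ((continuous_const.mul h5).mul continuous_const).mul h1
  have hd : ∀ t, HasDerivAt (fun t => J t * ((η t : ℂ) * G t))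
      (J' t * ((η t : ℂ) * G t) + J t * ((η' t : ℂ) * G t + (η t : ℂ) * F t)) t := fun t =>
    (hJd t).mul ((hη t).ofReal_comp.mul (hG t))
  have hA : Continuous fun t => J' t * ((η t : ℂ) * G t) + J t * ((η' t : ℂ) * G t) := by fun_prop
  have hB : Continuous fun t => J t * ((η t : ℂ) * F t) := by fun_prop
  have hFTC := intervalIntegral.integral_eq_sub_of_hasDerivAt (a := (-2 : ℝ)) (b := 2)
    (fun t _ => hd t) (Continuous.intervalIntegrable (by fun_prop) _ _)
  rw [hm, hp] at hFTC
  have hsum : (∫ t in (-2 : ℝ)..2, J t * ((η t : ℂ) * F t)) =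
      -∫ t in (-2 : ℝ)..2, (J' t * ((η t : ℂ) * G t) + J t * ((η' t : ℂ) * G t)) := by
    rw [eq_neg_iff_add_eq_zero, ← intervalIntegral.integral_add (hB.intervalIntegrable _ _)
      (hA.intervalIntegrable _ _)]
    refine Eq.trans (intervalIntegral.integral_congr fun t _ => ?_) (hFTC.trans (by simp))
    ring
  have hre : (∫ t in (-2 : ℝ)..2, (‖S t‖ ^ 2 + ε ^ 2) ^ (ρ - 1) *
      ((starRingEnd ℂ) (S t) * (η t * F t)).re) =
      (∫ t in (-2 : ℝ)..2, J t * ((η t : ℂ) * F t)).re := by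
    have h := Complex.reCLM.intervalIntegral_comp_comm (hB.intervalIntegrable (-2) 2 (μ := volume))
    rw [Complex.reCLM_apply] at h
    rw [← h]
    refine intervalIntegral.integral_congr fun t _ => ?_
    simp only [hJ, Complex.reCLM_apply]
    rw [mul_assoc, Complex.re_ofReal_mul]
  rw [hre]
  refine (Complex.abs_re_le_norm _).trans ?_
  rw [hsum, norm_neg, ← intervalIntegral.integral_const_mul]
  refine intervalIntegral.norm_integral_le_of_norm_le (by norm_num)
    (ae_of_all _ fun t _ => ?_) (Continuous.intervalIntegrable ?_ _ _)
  · have hJ'b := norm_deriv_rpow_normSq_mul_conj_le hρ hε (S t) (S' t)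
    have hV : 0 < (‖S t‖ ^ 2 + ε ^ 2) ^ (ρ - 1) := Real.rpow_pos_of_pos (hu t) _
    have hJb : ‖J t‖ = (‖S t‖ ^ 2 + ε ^ 2) ^ (ρ - 1) * ‖S t‖ := by
      rw [hJ]
      simp only
      rw [norm_mul, RCLike.norm_conj, Complex.norm_real, Real.norm_of_nonneg hV.le]
    have hηt : |η t| ≤ 1 := by rw [abs_of_nonneg (hη1 t).1]; exact (hη1 t).2
    refine (norm_add_le _ _).trans ?_
    rw [norm_mul (J' t), norm_mul (η t : ℂ), norm_mul (J t), norm_mul (η' t : ℂ),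
      Complex.norm_real, Complex.norm_real, hJb, Real.norm_eq_abs, Real.norm_eq_abs]
    set V := (‖S t‖ ^ 2 + ε ^ 2) ^ (ρ - 1)
    have hL0 : 0 ≤ L := (abs_nonneg _).trans (hL t)
    have h21 : 0 ≤ 2 * ρ - 1 := by linarith
    have h22 : 0 ≤ (2 * ρ - 1) * (V * ‖S' t‖) := mul_nonneg h21 (by positivity)
    calc ‖J' t‖ * (|η t| * ‖G t‖) + V * ‖S t‖ * (|η' t| * ‖G t‖)
        ≤ (2 * ρ - 1) * (V * ‖S' t‖) * (1 * ‖G t‖) + V * ‖S t‖ * (L * ‖G t‖) := by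
          gcongr
          exact hL t
      _ ≤ (2 * ρ - 1) * (V * ‖S' t‖) * (1 * ‖G t‖) + (2 * ρ - 1) * (V * ‖S t‖ * (L * ‖G t‖)) := by
          have h0 : 0 ≤ V * ‖S t‖ * (L * ‖G t‖) := by positivity
          exact add_le_add le_rfl (le_mul_of_one_le_left h0 (by linarith))
      _ = _ := by ring
  · have := hup (ρ - 1)
    fun_prop

/-- Adding the piece of frequency 4^K. After the second-order expansion, Hölder bounds the quadratic
term by Y^{ρ-1} a_K². Integration by parts bounds the cross term by Y^{ρ-1} times 4^{-K} a_K paired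
with the derivatives 4^j a_j of the earlier pieces. All of this fits `add_rpow_ge`. -/
theorem integral_norm_sum_step (hL : ∀ t, |η' t| ≤ L)
    (hη : ∀ t, HasDerivAt η (η' t) t) (hη' : Continuous η') (hη1 : ∀ t, 0 ≤ η t ∧ η t ≤ 1)
    (hm : η (-2) = 0) (hp : η 2 = 0) (hρ : 1 ≤ ρ) (hε : 0 < ε)
    {F G D : ℕ → ℝ → ℂ} {a : ℕ → ℝ} (ha : ∀ j, 0 ≤ a j)
    (hG : ∀ j t, HasDerivAt (G j) (F j t) t) (hF : ∀ j t, HasDerivAt (F j) (D j t) t)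
    (hD : ∀ j, Continuous (D j))
    (hFa : ∀ j, ∫ t in (-2 : ℝ)..2, ‖F j t‖ ^ (2 * ρ) ≤ a j ^ (2 * ρ))
    (hGa : ∀ j, ∫ t in (-2 : ℝ)..2, ‖G j t‖ ^ (2 * ρ) ≤ (((4 : ℝ) ^ j)⁻¹ * a j) ^ (2 * ρ))
    (hDa : ∀ j, ∫ t in (-2 : ℝ)..2, ‖D j t‖ ^ (2 * ρ) ≤ ((4 : ℝ) ^ j * a j) ^ (2 * ρ))
    {C : ℝ} (hC1 : 1 ≤ C) (hC : ∀ a b : ℂ, (‖a + b‖ ^ 2 + ε ^ 2) ^ ρ ≤ (‖a‖ ^ 2 + ε ^ 2) ^ ρ +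
      2 * ρ * ((‖a‖ ^ 2 + ε ^ 2) ^ (ρ - 1) * ((starRingEnd ℂ) a * b).re) +
      C * ((‖a‖ ^ 2 + ε ^ 2) ^ (ρ - 1) * ‖b‖ ^ 2 + (‖b‖ ^ 2) ^ ρ)) (K : ℕ) {Y : ℝ} (hY : 0 < Y)
    (hU : ∫ t in (-2 : ℝ)..2, (‖∑ j ∈ Finset.range K, (η t : ℂ) * F j t‖ ^ 2 + ε ^ 2) ^ ρ ≤ Y ^ ρ) :
    ∫ t in (-2 : ℝ)..2, (‖∑ j ∈ Finset.range (K + 1), (η t : ℂ) * F j t‖ ^ 2 + ε ^ 2) ^ ρ ≤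
      (Y + 2 * ((C + 2 * ρ * (2 * ρ - 1) * (2 * L + 1)) * (a K ^ 2 + a K *
        ∑ j ∈ Finset.range K, (4 : ℝ) ^ j * a j * ((4 : ℝ) ^ K)⁻¹))) ^ ρ := by
  have hL0 : 0 ≤ L := (abs_nonneg _).trans (hL 0)
  have hρ0 : 0 < ρ := by linarith
  have hFc : ∀ j, Continuous (F j) := fun j =>
    continuous_iff_continuousAt.2 fun t => (hF j t).continuousAt
  have hGc : ∀ j, Continuous (G j) := fun j =>
    continuous_iff_continuousAt.2 fun t => (hG j t).continuousAt
  have hηc : Continuous η := continuous_iff_continuousAt.2 fun t => (hη t).continuousAt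
  set S : ℝ → ℂ := fun t => ∑ j ∈ Finset.range K, (η t : ℂ) * F j t with hS
  set S' : ℝ → ℂ := fun t => ∑ j ∈ Finset.range K, ((η' t : ℂ) * F j t + (η t : ℂ) * D j t) with hS'
  have hSd : ∀ t, HasDerivAt S (S' t) t := fun t =>
    HasDerivAt.fun_sum fun j _ => (hη t).ofReal_comp.mul (hF j t)
  have hSc : Continuous S := continuous_iff_continuousAt.2 fun t => (hSd t).continuousAt
  have hS'c : Continuous S' := by fun_prop
  set u : ℝ → ℝ := fun t => ‖S t‖ ^ 2 + ε ^ 2 with hu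
  have hu0 : ∀ t, 0 < u t := fun t => by positivity
  have huc : Continuous u := by fun_prop
  have hup : ∀ e : ℝ, Continuous fun t => u t ^ e := fun e =>
    Continuous.rpow_const huc fun t => Or.inl (hu0 t).ne'
  have h2 : (-2 : ℝ) ≤ 2 := by norm_num
  have hcross := abs_integral_cross_le hL hη hη' hη1 hm hp hρ hε hSd hS'c (hG K) (hFc K)
  set Z := ∑ j ∈ Finset.range K, (4 : ℝ) ^ j * a j * ((4 : ℝ) ^ K)⁻¹ with hZ
  have hZ0 : 0 ≤ Z := Finset.sum_nonneg fun j _ => by have := ha j; positivity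
  have hYp : 0 < Y ^ (ρ - 1) := by positivity
  have hHol : ∀ (f g : ℝ → ℂ) (A B : ℝ), Continuous f → Continuous g → 0 ≤ A → 0 ≤ B →
      (∫ t in (-2 : ℝ)..2, ‖f t‖ ^ (2 * ρ) ≤ A ^ (2 * ρ)) →
      (∫ t in (-2 : ℝ)..2, ‖g t‖ ^ (2 * ρ) ≤ B ^ (2 * ρ)) →
      ∫ t in (-2 : ℝ)..2, u t ^ (ρ - 1) * (‖f t‖ * ‖g t‖) ≤ Y ^ (ρ - 1) * (A * B) :=
    fun f g A B hf hg hA hB hfA hgB => integral_rpow_mul_mul_le hρ h2 huc.continuousOn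
      hf.norm.continuousOn hg.norm.continuousOn hu0 (fun t => norm_nonneg _) (fun t => norm_nonneg _)
      hY hA hB hU hfA hgB
  have hcr : ∫ t in (-2 : ℝ)..2, u t ^ (ρ - 1) * ((‖S' t‖ + L * ‖S t‖) * ‖G K t‖) ≤
      Y ^ (ρ - 1) * ((2 * L + 1) * (a K * Z)) := by
    have hpt : ∀ t ∈ Icc (-2 : ℝ) 2, u t ^ (ρ - 1) * ((‖S' t‖ + L * ‖S t‖) * ‖G K t‖) ≤
        ∑ j ∈ Finset.range K, ((2 * L) * (u t ^ (ρ - 1) * (‖F j t‖ * ‖G K t‖)) +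
          u t ^ (ρ - 1) * (‖D j t‖ * ‖G K t‖)) := by
      intro t _
      have hηt : |η t| ≤ 1 := by rw [abs_of_nonneg (hη1 t).1]; exact (hη1 t).2
      have e1 : ‖S' t‖ ≤ ∑ j ∈ Finset.range K, (L * ‖F j t‖ + ‖D j t‖) := by
        refine norm_sum_le_of_le _ fun j _ => (norm_add_le _ _).trans ?_
        rw [norm_mul, norm_mul, Complex.norm_real, Complex.norm_real, Real.norm_eq_abs,
          Real.norm_eq_abs]
        gcongr
        · exact hL t
        · exact mul_le_of_le_one_left (norm_nonneg _) hηt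
      have e2 : ‖S t‖ ≤ ∑ j ∈ Finset.range K, ‖F j t‖ := by
        refine norm_sum_le_of_le _ fun j _ => ?_
        rw [norm_mul, Complex.norm_real, Real.norm_eq_abs]
        exact mul_le_of_le_one_left (norm_nonneg _) hηt
      have hV : 0 < u t ^ (ρ - 1) := Real.rpow_pos_of_pos (hu0 t) _
      calc _ ≤ u t ^ (ρ - 1) * ((∑ j ∈ Finset.range K, (L * ‖F j t‖ + ‖D j t‖) +
            L * ∑ j ∈ Finset.range K, ‖F j t‖) * ‖G K t‖) := by gcongr
        _ = _ := by
          rw [Finset.mul_sum, ← Finset.sum_add_distrib, Finset.sum_mul, Finset.mul_sum]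
          refine Finset.sum_congr rfl fun j _ => ?_
          ring
    have hi : ∀ f g : ℝ → ℂ, Continuous f → Continuous g → IntervalIntegrable
        (fun t => u t ^ (ρ - 1) * (‖f t‖ * ‖g t‖)) volume (-2) 2 := fun f g hf hg =>
      Continuous.intervalIntegrable ((hup _).mul (hf.norm.mul hg.norm)) _ _
    have hterm : ∀ j, IntervalIntegrable (fun t =>
        (2 * L) * (u t ^ (ρ - 1) * (‖F j t‖ * ‖G K t‖)) +
          u t ^ (ρ - 1) * (‖D j t‖ * ‖G K t‖)) volume (-2) 2 := fun j =>
      ((hi _ _ (hFc j) (hGc K)).const_mul _).add (hi _ _ (hD j) (hGc K))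
    have hsumc : Continuous fun t => ∑ j ∈ Finset.range K,
        ((2 * L) * (u t ^ (ρ - 1) * (‖F j t‖ * ‖G K t‖)) +
          u t ^ (ρ - 1) * (‖D j t‖ * ‖G K t‖)) :=
      continuous_finsetSum _ fun j _ => (continuous_const.mul ((hup _).mul
          ((hFc j).norm.mul (hGc K).norm))).add ((hup _).mul ((hD j).norm.mul (hGc K).norm))
    refine (intervalIntegral.integral_mono_on h2 (Continuous.intervalIntegrable
      ((hup _).mul (by fun_prop)) _ _) (hsumc.intervalIntegrable _ _) hpt).trans ?_
    rw [intervalIntegral.integral_finsetSum fun j _ => hterm j, hZ, Finset.mul_sum, Finset.mul_sum,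
      Finset.mul_sum]
    refine Finset.sum_le_sum fun j _ => ?_
    rw [intervalIntegral.integral_add ((hi _ _ (hFc j) (hGc K)).const_mul _)
      (hi _ _ (hD j) (hGc K)), intervalIntegral.integral_const_mul]
    have hK4 : 0 ≤ ((4 : ℝ) ^ K)⁻¹ * a K := mul_nonneg (by positivity) (ha K)
    have b1 := hHol _ _ _ _ (hFc j) (hGc K) (ha j) hK4 (hFa j) (hGa K)
    have b2 := hHol _ _ _ _ (hD j) (hGc K) (mul_nonneg (by positivity) (ha j)) hK4 (hDa j) (hGa K)
    -- The lower-order terms, in which the cutoff is differentiated, are absorbed in the terms of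
    -- size 4^j a_j.
    have h4 : a j ≤ 4 ^ j * a j := le_mul_of_one_le_left (ha j) (one_le_pow₀ (by norm_num))
    calc _ ≤ 2 * L * (Y ^ (ρ - 1) * (a j * (((4 : ℝ) ^ K)⁻¹ * a K))) +
          Y ^ (ρ - 1) * (4 ^ j * a j * (((4 : ℝ) ^ K)⁻¹ * a K)) := by gcongr
      _ ≤ 2 * L * (Y ^ (ρ - 1) * ((4 ^ j * a j) * (((4 : ℝ) ^ K)⁻¹ * a K))) +
          Y ^ (ρ - 1) * (4 ^ j * a j * (((4 : ℝ) ^ K)⁻¹ * a K)) := by gcongr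
      _ = _ := by ring
  have hquad : ∫ t in (-2 : ℝ)..2, u t ^ (ρ - 1) * ‖(η t : ℂ) * F K t‖ ^ 2 ≤
      Y ^ (ρ - 1) * a K ^ 2 := by
    refine le_trans ?_ ((hHol _ _ _ _ (hFc K) (hFc K) (ha K) (ha K) (hFa K) (hFa K)).trans
      (le_of_eq (by ring)))
    refine intervalIntegral.integral_mono_on h2 (Continuous.intervalIntegrable
      ((hup _).mul (by fun_prop)) _ _) (Continuous.intervalIntegrable
      ((hup _).mul ((hFc K).norm.mul (hFc K).norm)) _ _) fun t _ => ?_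
    have hV : 0 < u t ^ (ρ - 1) := Real.rpow_pos_of_pos (hu0 t) _
    have hηt : |η t| ≤ 1 := by rw [abs_of_nonneg (hη1 t).1]; exact (hη1 t).2
    rw [norm_mul, Complex.norm_real, Real.norm_eq_abs, ← sq]
    gcongr
    exact mul_le_of_le_one_left (norm_nonneg _) hηt
  have hpow : ∫ t in (-2 : ℝ)..2, (‖(η t : ℂ) * F K t‖ ^ 2) ^ ρ ≤ (a K ^ 2) ^ ρ := by
    have e : (a K ^ 2) ^ ρ = a K ^ (2 * ρ) := by
      rw [Real.rpow_mul (ha K), Real.rpow_two]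
    rw [e]
    refine le_trans ?_ (hFa K)
    refine intervalIntegral.integral_mono_on h2 (Continuous.intervalIntegrable
      (Continuous.rpow_const (by fun_prop) fun t => Or.inr hρ0.le) _ _) (Continuous.intervalIntegrable
      (Continuous.rpow_const (hFc K).norm fun t => Or.inr (by positivity)) _ _) fun t _ => ?_
    have hηt : |η t| ≤ 1 := by rw [abs_of_nonneg (hη1 t).1]; exact (hη1 t).2
    rw [Real.rpow_mul (norm_nonneg _), Real.rpow_two, norm_mul, Complex.norm_real, Real.norm_eq_abs]
    gcongr
    exact mul_le_of_le_one_left (norm_nonneg _) hηt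
  set M := C + 2 * ρ * (2 * ρ - 1) * (2 * L + 1) with hM
  have hM1 : 1 ≤ M := by
    have : 0 ≤ 2 * ρ * (2 * ρ - 1) * (2 * L + 1) :=
      mul_nonneg (mul_nonneg (by positivity) (by linarith)) (by linarith)
    linarith
  have haZ : 0 ≤ a K * Z := mul_nonneg (ha K) hZ0
  refine le_trans ?_ (add_rpow_ge hρ hY (v := M * (a K ^ 2 + a K * Z)) (by positivity))
  have i1 : IntervalIntegrable (fun t => u t ^ ρ) volume (-2) 2 := (hup _).intervalIntegrable _ _
  have i2 : IntervalIntegrable (fun t => u t ^ (ρ - 1) *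
      ((starRingEnd ℂ) (S t) * ((η t : ℂ) * F K t)).re) volume (-2) 2 := by
    refine Continuous.intervalIntegrable ((hup _).mul (Complex.continuous_re.comp
      ((Complex.continuous_conj.comp hSc).mul (by fun_prop)))) _ _
  have i3 : IntervalIntegrable (fun t => u t ^ (ρ - 1) * ‖(η t : ℂ) * F K t‖ ^ 2) volume (-2) 2 :=
    Continuous.intervalIntegrable ((hup _).mul (by fun_prop)) _ _
  have i4 : IntervalIntegrable (fun t => (‖(η t : ℂ) * F K t‖ ^ 2) ^ ρ) volume (-2) 2 :=
    Continuous.intervalIntegrable (Continuous.rpow_const (by fun_prop) fun t => Or.inr hρ0.le) _ _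
  calc ∫ t in (-2 : ℝ)..2, (‖∑ j ∈ Finset.range (K + 1), (η t : ℂ) * F j t‖ ^ 2 + ε ^ 2) ^ ρ
      ≤ ∫ t in (-2 : ℝ)..2, (u t ^ ρ + 2 * ρ * (u t ^ (ρ - 1) *
        ((starRingEnd ℂ) (S t) * ((η t : ℂ) * F K t)).re) +
        C * (u t ^ (ρ - 1) * ‖(η t : ℂ) * F K t‖ ^ 2 + (‖(η t : ℂ) * F K t‖ ^ 2) ^ ρ)) := by
        refine intervalIntegral.integral_mono_on h2 ?_ ((i1.add (i2.const_mul _)).add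
          ((i3.add i4).const_mul _)) fun t _ => ?_
        · refine Continuous.intervalIntegrable (Continuous.rpow_const (by fun_prop)
            fun t => Or.inr hρ0.le) _ _
        · rw [Finset.sum_range_succ]
          exact hC _ _
    _ = (∫ t in (-2 : ℝ)..2, u t ^ ρ) + 2 * ρ * (∫ t in (-2 : ℝ)..2, u t ^ (ρ - 1) *
        ((starRingEnd ℂ) (S t) * ((η t : ℂ) * F K t)).re) +
        C * ((∫ t in (-2 : ℝ)..2, u t ^ (ρ - 1) * ‖(η t : ℂ) * F K t‖ ^ 2) +
          ∫ t in (-2 : ℝ)..2, (‖(η t : ℂ) * F K t‖ ^ 2) ^ ρ) := by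
        rw [intervalIntegral.integral_add (i1.add (i2.const_mul _)) ((i3.add i4).const_mul _),
          intervalIntegral.integral_add i1 (i2.const_mul _), intervalIntegral.integral_const_mul,
          intervalIntegral.integral_const_mul, intervalIntegral.integral_add i3 i4]
    _ ≤ Y ^ ρ + 2 * ρ * ((2 * ρ - 1) * (Y ^ (ρ - 1) * ((2 * L + 1) * (a K * Z)))) +
        C * (Y ^ (ρ - 1) * a K ^ 2 + (a K ^ 2) ^ ρ) := by
        have h21 : 0 ≤ 2 * ρ - 1 := by linarith
        gcongr
        exact (le_abs_self _).trans (hcross.trans (by gcongr))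
    _ ≤ Y ^ ρ + M * (a K ^ 2 + a K * Z) * Y ^ (ρ - 1) + (M * (a K ^ 2 + a K * Z)) ^ ρ := by
        have e1 : C * (a K ^ 2) ^ ρ ≤ (M * (a K ^ 2 + a K * Z)) ^ ρ := by
          calc C * (a K ^ 2) ^ ρ ≤ M ^ ρ * (a K ^ 2) ^ ρ := by
                gcongr
                have h1 : C ≤ M := by
                  have : 0 ≤ 2 * ρ * (2 * ρ - 1) * (2 * L + 1) :=
                    mul_nonneg (mul_nonneg (by positivity) (by linarith)) (by linarith)
                  linarith
                exact h1.trans (Real.self_le_rpow_of_one_le hM1 hρ)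
            _ = (M * a K ^ 2) ^ ρ := (Real.mul_rpow (by linarith) (sq_nonneg _)).symm
            _ ≤ _ := by
                gcongr
                linarith
        have e2 : 0 ≤ C * (a K * Z) * Y ^ (ρ - 1) := by positivity
        have e3 : 0 ≤ 2 * ρ * (2 * ρ - 1) * (2 * L + 1) * a K ^ 2 * Y ^ (ρ - 1) := by
          have : 0 ≤ 2 * ρ - 1 := by linarith
          positivity
        rw [hM]
        rw [hM] at e1
        nlinarith

/-- A discrete Schur bound for the kernel 4^{j-K}. The inner sums satisfy Z_{K+1} = (Z_K + a_K)/4,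
and the induction closes once Z_n² is added to the left side. -/
theorem sum_sq_add_mul_le (a : ℕ → ℝ) (n : ℕ) :
    ∑ K ∈ Finset.range n, (a K ^ 2 + a K *
        ∑ j ∈ Finset.range K, (4 : ℝ) ^ j * a j * ((4 : ℝ) ^ K)⁻¹) ≤
      2 * ∑ K ∈ Finset.range n, a K ^ 2 := by
  set Z : ℕ → ℝ := fun K => ∑ j ∈ Finset.range K, (4 : ℝ) ^ j * a j * ((4 : ℝ) ^ K)⁻¹ with hZ
  have hZs : ∀ K, Z (K + 1) = (Z K + a K) / 4 := by
    intro K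
    simp only [hZ]
    rw [Finset.sum_range_succ, add_div, Finset.sum_div]
    congr 1
    · refine Finset.sum_congr rfl fun j _ => ?_
      rw [pow_succ]
      field_simp
    · rw [pow_succ]
      field_simp
  suffices H : ∑ K ∈ Finset.range n, (a K ^ 2 + a K * Z K) + Z n ^ 2 ≤
      2 * ∑ K ∈ Finset.range n, a K ^ 2 by
    linarith [sq_nonneg (Z n)]
  induction n with
  | zero => simp [hZ]
  | succ n ih =>
    rw [Finset.sum_range_succ, Finset.sum_range_succ, hZs]
    nlinarith [sq_nonneg (Z n - a n), sq_nonneg (Z n + a n)]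

end squareFunction

/-- A one-sided Littlewood–Paley inequality on an interval, for functions that behave like
functions of frequency `4 ^ j`. -/
theorem exists_integral_norm_sum_le {ρ : ℝ} (hρ : 1 ≤ ρ) : ∃ C : ℝ, 0 ≤ C ∧
    ∀ (F G D : ℕ → ℝ → ℂ) (a : ℕ → ℝ), (∀ j, 0 ≤ a j) →
    (∀ j t, HasDerivAt (G j) (F j t) t) → (∀ j t, HasDerivAt (F j) (D j t) t) →
    (∀ j, Continuous (D j)) →
    (∀ j, ∫ t in (-2 : ℝ)..2, ‖F j t‖ ^ (2 * ρ) ≤ a j ^ (2 * ρ)) →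
    (∀ j, ∫ t in (-2 : ℝ)..2, ‖G j t‖ ^ (2 * ρ) ≤ (((4 : ℝ) ^ j)⁻¹ * a j) ^ (2 * ρ)) →
    (∀ j, ∫ t in (-2 : ℝ)..2, ‖D j t‖ ^ (2 * ρ) ≤ ((4 : ℝ) ^ j * a j) ^ (2 * ρ)) →
    ∀ n, ∫ t in (-1 : ℝ)..1, (‖∑ j ∈ Finset.range n, F j t‖ ^ 2) ^ ρ ≤
      (C * ∑ j ∈ Finset.range n, a j ^ 2) ^ ρ := by
  obtain ⟨η, η', L, hL0, hη, hη', hη1, hone, hm, hp, hL⟩ := exists_time_cutoff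
  obtain ⟨C, hC1, hC⟩ := exists_rpow_norm_add_sq_le hρ
  have hρ0 : 0 < ρ := by linarith
  set M := C + 2 * ρ * (2 * ρ - 1) * (2 * L + 1) with hM
  have hM0 : 0 ≤ M := by
    have : 0 ≤ 2 * ρ * (2 * ρ - 1) * (2 * L + 1) :=
      mul_nonneg (mul_nonneg (by positivity) (by linarith)) (by linarith)
    linarith
  refine ⟨4 * M, by positivity, fun F G D a ha hG hF hD hFa hGa hDa n => ?_⟩
  have hFc : ∀ j, Continuous (F j) := fun j =>
    continuous_iff_continuousAt.2 fun t => (hF j t).continuousAt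
  have hηc : Continuous η := continuous_iff_continuousAt.2 fun t => (hη t).continuousAt
  have key : ∀ ε : ℝ, 0 < ε → ∀ n,
      ∫ t in (-2 : ℝ)..2, (‖∑ j ∈ Finset.range n, (η t : ℂ) * F j t‖ ^ 2 + ε ^ 2) ^ ρ ≤
      (4 * ε ^ 2 + ∑ K ∈ Finset.range n, 2 * (M * (a K ^ 2 + a K *
        ∑ j ∈ Finset.range K, (4 : ℝ) ^ j * a j * ((4 : ℝ) ^ K)⁻¹))) ^ ρ := by
    intro ε hε n
    induction n with
    | zero =>
      simp only [Finset.range_zero, Finset.sum_empty, norm_zero, add_zero]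
      rw [intervalIntegral.integral_const, smul_eq_mul, Real.mul_rpow (by norm_num) (by positivity),
        zero_pow two_ne_zero, zero_add]
      -- The interval [-2, 2] has length 4, and 4 ε^{2ρ} ≤ (4ε²)^ρ.
      have : (4 : ℝ) ≤ 4 ^ ρ := Real.self_le_rpow_of_one_le (by norm_num) hρ
      norm_num
      gcongr
    | succ n ih =>
      rw [Finset.sum_range_succ, ← add_assoc]
      refine integral_norm_sum_step hL hη hη' hη1 hm hp hρ hε ha hG hF hD hFa hGa hDa hC1
        (hC ε · · hε) n ?_ ih
      have : 0 ≤ ∑ K ∈ Finset.range n, 2 * (M * (a K ^ 2 + a K *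
        ∑ j ∈ Finset.range K, (4 : ℝ) ^ j * a j * ((4 : ℝ) ^ K)⁻¹)) := by
        refine Finset.sum_nonneg fun K _ => ?_
        have h1 : 0 ≤ ∑ j ∈ Finset.range K, (4 : ℝ) ^ j * a j * ((4 : ℝ) ^ K)⁻¹ :=
          Finset.sum_nonneg fun j _ => by have := ha j; positivity
        have := ha K
        positivity
      positivity
  have hSum0 : 0 ≤ ∑ j ∈ Finset.range n, a j ^ 2 := Finset.sum_nonneg fun j _ => sq_nonneg _
  have hbound : ∀ ε : ℝ, 0 < ε → ∫ t in (-1 : ℝ)..1, (‖∑ j ∈ Finset.range n, F j t‖ ^ 2) ^ ρ ≤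
      (4 * ε ^ 2 + 4 * M * ∑ j ∈ Finset.range n, a j ^ 2) ^ ρ := by
    intro ε hε
    have hc1 : Continuous fun t => (‖∑ j ∈ Finset.range n, (η t : ℂ) * F j t‖ ^ 2 + ε ^ 2) ^ ρ :=
      Continuous.rpow_const (by fun_prop) fun t => Or.inr hρ0.le
    have hc2 : Continuous fun t => (‖∑ j ∈ Finset.range n, F j t‖ ^ 2) ^ ρ :=
      Continuous.rpow_const (by fun_prop) fun t => Or.inr hρ0.le
    calc ∫ t in (-1 : ℝ)..1, (‖∑ j ∈ Finset.range n, F j t‖ ^ 2) ^ ρ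
        ≤ ∫ t in (-1 : ℝ)..1,
          (‖∑ j ∈ Finset.range n, (η t : ℂ) * F j t‖ ^ 2 + ε ^ 2) ^ ρ := by
          refine intervalIntegral.integral_mono_on (by norm_num) (hc2.intervalIntegrable _ _)
            (hc1.intervalIntegrable _ _) fun t ht => ?_
          simp only [hone t ht, Complex.ofReal_one, one_mul]
          gcongr
          nlinarith [sq_nonneg ε]
      _ ≤ ∫ t in (-2 : ℝ)..2,
          (‖∑ j ∈ Finset.range n, (η t : ℂ) * F j t‖ ^ 2 + ε ^ 2) ^ ρ := by
          refine intervalIntegral.integral_mono_interval (by norm_num) (by norm_num) (by norm_num)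
            (ae_of_all _ fun t => ?_) (hc1.intervalIntegrable _ _)
          simp only [Pi.zero_apply]
          positivity
      _ ≤ _ := key ε hε n
      _ ≤ _ := by
          rw [← Finset.mul_sum, ← Finset.mul_sum]
          have h1 := sum_sq_add_mul_le a n
          have h3 : 0 ≤ ∑ K ∈ Finset.range n, (a K ^ 2 + a K *
              ∑ j ∈ Finset.range K, (4 : ℝ) ^ j * a j * ((4 : ℝ) ^ K)⁻¹) := by
            refine Finset.sum_nonneg fun K _ => ?_
            have h1 : 0 ≤ ∑ j ∈ Finset.range K, (4 : ℝ) ^ j * a j * ((4 : ℝ) ^ K)⁻¹ :=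
              Finset.sum_nonneg fun j _ => by have := ha j; positivity
            have := ha K
            positivity
          refine Real.rpow_le_rpow (by positivity) ?_ hρ0.le
          have h2 := mul_le_mul_of_nonneg_left h1 hM0
          linarith
  have hlim : Tendsto (fun ε : ℝ => (4 * ε ^ 2 + 4 * M * ∑ j ∈ Finset.range n, a j ^ 2) ^ ρ)
      (𝓝[>] 0) (𝓝 ((4 * 0 ^ 2 + 4 * M * ∑ j ∈ Finset.range n, a j ^ 2) ^ ρ)) := by
    refine Tendsto.mono_left (Continuous.tendsto ?_ 0) nhdsWithin_le_nhds
    exact Continuous.rpow_const (by fun_prop) fun t => Or.inr hρ0.le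
  have h0 : (4 * 0 ^ 2 + 4 * M * ∑ j ∈ Finset.range n, a j ^ 2 : ℝ) =
      4 * M * ∑ j ∈ Finset.range n, a j ^ 2 := by ring
  rw [h0] at hlim
  exact ge_of_tendsto hlim (by filter_upwards [self_mem_nhdsWithin] with ε hε using hbound ε hε)

theorem eLpNorm_restrict_Icc_eq {f : ℝ → ℂ} (hf : Continuous f) {c d : ℝ} (hcd : c ≤ d) {r : ℝ≥0∞}
    (hr0 : r ≠ 0) (hr : r ≠ ⊤) : eLpNorm f r (volume.restrict (Icc c d)) =
      ENNReal.ofReal ((∫ t in c..d, ‖f t‖ ^ r.toReal) ^ r.toReal⁻¹) := by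
  obtain ⟨C, hC⟩ := isCompact_Icc.exists_bound_of_continuousOn (hf.continuousOn (s := Icc c d))
  have hm : MemLp f r (volume.restrict (Icc c d)) := by
    refine MemLp.of_bound hf.aestronglyMeasurable C ?_
    filter_upwards [ae_restrict_mem measurableSet_Icc] with t ht using hC t ht
  rw [hm.eLpNorm_eq_integral_rpow_norm hr0 hr, integral_Icc_eq_integral_Ioc,
    intervalIntegral.integral_of_le hcd]

theorem integral_rpow_le_of_eLpNorm_le {f : ℝ → ℂ} (hf : Continuous f) {c d : ℝ} (hcd : c ≤ d)
    {r : ℝ≥0∞} (hr0 : r ≠ 0) (hr : r ≠ ⊤) {A : ℝ} (hA : 0 ≤ A)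
    (h : eLpNorm f r (volume.restrict (Icc c d)) ≤ ENNReal.ofReal A) :
    ∫ t in c..d, ‖f t‖ ^ r.toReal ≤ A ^ r.toReal := by
  have hr1 : 0 < r.toReal := ENNReal.toReal_pos hr0 hr
  rw [eLpNorm_restrict_Icc_eq hf hcd hr0 hr, ENNReal.ofReal_le_ofReal_iff hA] at h
  have h0 : 0 ≤ ∫ t in c..d, ‖f t‖ ^ r.toReal :=
    intervalIntegral.integral_nonneg hcd fun t _ => by positivity
  exact (Real.rpow_inv_le_iff_of_pos h0 hA hr1).1 h

/-- Minkowski's inequality in L^{q/2}, whence q ≥ 2. -/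
theorem eLpNorm_rpow_half_sum_le {α ι : Type*} [MeasurableSpace α] {μ : Measure α} {q : ℝ≥0∞}
    (hq : 2 ≤ q) (s : Finset ι) {A : ι → α → ℝ≥0∞} (hA : ∀ i, Measurable (A i)) :
    eLpNorm (fun x => (∑ i ∈ s, A i x ^ (2 : ℝ)) ^ (1 / 2 : ℝ)) q μ ≤
      (∑ i ∈ s, eLpNorm (A i) q μ ^ (2 : ℝ)) ^ (1 / 2 : ℝ) := by
  have h1 : eLpNorm (fun x => ‖∑ i ∈ s, A i x ^ (2 : ℝ)‖ₑ ^ (1 / 2 : ℝ)) q μ =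
      eLpNorm (fun x => ∑ i ∈ s, A i x ^ (2 : ℝ)) (q * ENNReal.ofReal (1 / 2)) μ ^ (1 / 2 : ℝ) :=
    eLpNorm_enorm_rpow _ (by norm_num)
  have h12 : ENNReal.ofReal (1 / 2) * ENNReal.ofReal 2 = 1 := by
    rw [← ENNReal.ofReal_mul (by norm_num)]; norm_num
  have h2 : ∀ i, eLpNorm (fun x => A i x ^ (2 : ℝ)) (q * ENNReal.ofReal (1 / 2)) μ =
      eLpNorm (A i) q μ ^ (2 : ℝ) := fun i => by
    have h := eLpNorm_enorm_rpow (p := q * ENNReal.ofReal (1 / 2)) (μ := μ) (q := 2) (A i)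
      (by norm_num)
    rw [mul_assoc, h12, mul_one] at h
    simpa only [enorm_eq_self] using h
  simp only [enorm_eq_self] at h1
  rw [h1]
  refine ENNReal.rpow_le_rpow ?_ (by norm_num)
  have hq2 : 1 ≤ q * ENNReal.ofReal (1 / 2) := by
    calc (1 : ℝ≥0∞) = 2 * ENNReal.ofReal (1 / 2) := by
          rw [mul_comm, ← h12]; simp
      _ ≤ _ := by gcongr
  have h3 := eLpNorm_sum_le (μ := μ) (p := q * ENNReal.ofReal (1 / 2)) (s := s)
    (f := fun i x => A i x ^ (2 : ℝ))
    (fun i _ => ((hA i).pow_const _).aestronglyMeasurable) hq2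
  simp only [h2] at h3
  refine le_trans (le_of_eq ?_) h3
  congr 1
  funext x
  simp

/-- Mixed norm version of the one-sided Littlewood–Paley inequality in the time variable. -/
theorem exists_mixedNorm_sum_le {r : ℝ≥0∞} (hr : 2 ≤ r) (hr' : r ≠ ⊤) : ∃ C : ℝ≥0∞, C ≠ ⊤ ∧
    ∀ {d : ℕ} {q : ℝ≥0∞}, 2 ≤ q → ∀ (F G D : ℕ → Rd d → ℝ → ℂ) (b : ℕ → ℝ≥0∞),
    (∀ j, StronglyMeasurable (Function.uncurry (F j))) →
    (∀ j, StronglyMeasurable (Function.uncurry (G j))) →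
    (∀ j, StronglyMeasurable (Function.uncurry (D j))) →
    (∀ j x t, HasDerivAt (G j x) (F j x t) t) → (∀ j x t, HasDerivAt (F j x) (D j x t) t) →
    (∀ j x, Continuous (D j x)) →
    (∀ j, mixedNorm q r univ (Icc (-2) 2) (F j) ≤ b j) →
    (∀ j, (4 : ℝ≥0∞) ^ j * mixedNorm q r univ (Icc (-2) 2) (G j) ≤ b j) →
    (∀ j, ((4 : ℝ≥0∞) ^ j)⁻¹ * mixedNorm q r univ (Icc (-2) 2) (D j) ≤ b j) →
    ∀ n, mixedNorm q r univ (Icc (-1) 1) (fun x t => ∑ j ∈ Finset.range n, F j x t) ≤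
      C * (∑ j ∈ Finset.range n, b j ^ (2 : ℝ)) ^ (1 / 2 : ℝ) := by
  have hr0 : r ≠ 0 := (two_pos.trans_le hr).ne'
  have hrR : 2 ≤ r.toReal := by
    have := (ENNReal.toReal_le_toReal ENNReal.ofNat_ne_top hr').2 hr
    simpa using this
  obtain ⟨C, hC, H⟩ := exists_integral_norm_sum_le (ρ := r.toReal / 2) (by linarith)
  refine ⟨ENNReal.ofReal C ^ (1 / 2 : ℝ) * 3,
    ENNReal.mul_ne_top (ENNReal.rpow_ne_top_of_nonneg (by norm_num) ENNReal.ofReal_ne_top)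
    (by norm_num), ?_⟩
  intro d q hq F G D b hFm hGm hDm hGd hFd hDc hFb hGb hDb n
  have hq1 : 1 ≤ q := le_trans (by norm_num) hq
  have hρ2 : 2 * (r.toReal / 2) = r.toReal := by ring
  set N : (Rd d → ℝ → ℂ) → Rd d → ℝ≥0∞ := fun f x => eLpNorm (f x) r (volume.restrict (Icc (-2) 2))
    with hN
  -- At fixed `x` a single number must control the piece, its antiderivative and its derivative,
  -- each on its own scale; their scaled sum does, and its q-norm costs only a factor 3.
  set A : ℕ → Rd d → ℝ≥0∞ := fun j x =>
    N (F j) x + (4 : ℝ≥0∞) ^ j * N (G j) x + ((4 : ℝ≥0∞) ^ j)⁻¹ * N (D j) x with hA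
  have h4 : ∀ j : ℕ, (4 : ℝ≥0∞) ^ j ≠ ⊤ := fun j => ENNReal.pow_ne_top (by norm_num)
  have h40 : ∀ j : ℕ, (4 : ℝ≥0∞) ^ j ≠ 0 := fun j => pow_ne_zero _ (by norm_num)
  have h4i : ∀ j : ℕ, ((4 : ℝ≥0∞) ^ j)⁻¹ ≠ ⊤ := fun j => ENNReal.inv_ne_top.2 (h40 j)
  have hNm : ∀ f : Rd d → ℝ → ℂ, StronglyMeasurable (Function.uncurry f) → Measurable (N f) :=
    fun f hf => measurable_eLpNorm_right hf r
  have hAm : ∀ j, Measurable (A j) := fun j =>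
    ((hNm _ (hFm j)).add ((hNm _ (hGm j)).const_mul _)).add ((hNm _ (hDm j)).const_mul _)
  have hFc : ∀ j x, Continuous (F j x) := fun j x =>
    continuous_iff_continuousAt.2 fun t => (hFd j x t).continuousAt
  have hGc : ∀ j x, Continuous (G j x) := fun j x =>
    continuous_iff_continuousAt.2 fun t => (hGd j x t).continuousAt
  have hNfin : ∀ (f : Rd d → ℝ → ℂ) x, Continuous (f x) → N f x ≠ ⊤ := fun f x hf => by
    simp only [hN]
    rw [eLpNorm_restrict_Icc_eq hf (by norm_num) hr0 hr']
    exact ENNReal.ofReal_ne_top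
  have hAfin : ∀ j x, A j x ≠ ⊤ := fun j x =>
    ENNReal.add_ne_top.2 ⟨ENNReal.add_ne_top.2 ⟨hNfin _ _ (hFc j x), ENNReal.mul_ne_top (h4 j)
      (hNfin _ _ (hGc j x))⟩, ENNReal.mul_ne_top (h4i j) (hNfin _ _ (hDc j x))⟩
  have hpt : ∀ x, eLpNorm (fun t => ∑ j ∈ Finset.range n, F j x t) r
      (volume.restrict (Icc (-1) 1)) ≤ ENNReal.ofReal C ^ (1 / 2 : ℝ) *
        (∑ j ∈ Finset.range n, A j x ^ (2 : ℝ)) ^ (1 / 2 : ℝ) := by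
    intro x
    have hsc : Continuous fun t => ∑ j ∈ Finset.range n, F j x t :=
      continuous_finsetSum _ fun j _ => hFc j x
    have hAR : ∀ j, A j x = ENNReal.ofReal (A j x).toReal := fun j =>
      (ENNReal.ofReal_toReal (hAfin j x)).symm
    have e4 : ∀ j : ℕ, (4 : ℝ≥0∞) ^ j = ENNReal.ofReal ((4 : ℝ) ^ j) := fun j => by
      rw [ENNReal.ofReal_pow (by norm_num)]; norm_num
    have hs := H (fun j => F j x) (fun j => G j x) (fun j => D j x) (fun j => (A j x).toReal)
      (fun j => ENNReal.toReal_nonneg) (fun j => hGd j x) (fun j => hFd j x) (fun j => hDc j x)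
      (fun j => by
        rw [hρ2]
        refine integral_rpow_le_of_eLpNorm_le (hFc j x) (by norm_num) hr0 hr'
          ENNReal.toReal_nonneg ?_
        rw [← hAR]
        simp only [hA, add_assoc]
        exact le_self_add)
      (fun j => by
        rw [hρ2]
        refine integral_rpow_le_of_eLpNorm_le (hGc j x) (by norm_num) hr0 hr'
          (by positivity) ?_
        rw [ENNReal.ofReal_mul (by positivity), ← hAR, ENNReal.ofReal_inv_of_pos (by positivity),
          ← e4, mul_comm, ← div_eq_mul_inv, ENNReal.le_div_iff_mul_le (Or.inl (h40 j))
          (Or.inl (h4 j)), mul_comm]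
        simp only [hA]
        rw [add_right_comm]
        exact le_add_self)
      (fun j => by
        rw [hρ2]
        refine integral_rpow_le_of_eLpNorm_le (hDc j x) (by norm_num) hr0 hr'
          (by positivity) ?_
        rw [ENNReal.ofReal_mul (by positivity), ← hAR, ← e4]
        simp only [hA]
        calc eLpNorm (D j x) r (volume.restrict (Icc (-2) 2))
            = (4 : ℝ≥0∞) ^ j * (((4 : ℝ≥0∞) ^ j)⁻¹ * N (D j) x) := by
              rw [← mul_assoc, ENNReal.mul_inv_cancel (h40 j) (h4 j), one_mul]
          _ ≤ _ := by gcongr; exact le_add_self) n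
    have hsum0 : 0 ≤ ∑ j ∈ Finset.range n, (A j x).toReal ^ 2 :=
      Finset.sum_nonneg fun j _ => sq_nonneg _
    rw [eLpNorm_restrict_Icc_eq hsc (by norm_num) hr0 hr']
    have e1 : ∫ t in (-1 : ℝ)..1, ‖∑ j ∈ Finset.range n, F j x t‖ ^ r.toReal =
        ∫ t in (-1 : ℝ)..1, (‖∑ j ∈ Finset.range n, F j x t‖ ^ 2) ^ (r.toReal / 2) := by
      refine intervalIntegral.integral_congr fun t _ => ?_
      rw [← Real.rpow_natCast, ← Real.rpow_mul (norm_nonneg _)]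
      congr 1
      push_cast
      ring
    rw [e1]
    have hrpos : 0 < r.toReal := by linarith
    calc ENNReal.ofReal ((∫ t in (-1 : ℝ)..1,
          (‖∑ j ∈ Finset.range n, F j x t‖ ^ 2) ^ (r.toReal / 2)) ^ r.toReal⁻¹)
        ≤ ENNReal.ofReal (((C * ∑ j ∈ Finset.range n, (A j x).toReal ^ 2) ^ (r.toReal / 2)) ^
          r.toReal⁻¹) := by
          refine ENNReal.ofReal_le_ofReal (Real.rpow_le_rpow ?_ hs (by positivity))
          exact intervalIntegral.integral_nonneg (by norm_num) fun t _ => by positivity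
      _ = ENNReal.ofReal ((C * ∑ j ∈ Finset.range n, (A j x).toReal ^ 2) ^ (1 / 2 : ℝ)) := by
          rw [← Real.rpow_mul (by positivity)]
          congr 2
          field_simp
      _ = (ENNReal.ofReal C * ∑ j ∈ Finset.range n, A j x ^ (2 : ℝ)) ^ (1 / 2 : ℝ) := by
          rw [← ENNReal.ofReal_rpow_of_nonneg (by positivity) (by norm_num),
            ENNReal.ofReal_mul hC, ENNReal.ofReal_sum_of_nonneg fun j _ => sq_nonneg _]
          congr 2
          refine Finset.sum_congr rfl fun j _ => ?_
          rw [ENNReal.ofReal_pow ENNReal.toReal_nonneg, ← hAR]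
          norm_num
      _ = _ := ENNReal.mul_rpow_of_nonneg _ _ (by norm_num)
  have hAb : ∀ j, eLpNorm (A j) q volume ≤ 3 * b j := by
    intro j
    have e : A j = (N (F j) + fun x => (4 : ℝ≥0∞) ^ j * N (G j) x) +
        fun x => ((4 : ℝ≥0∞) ^ j)⁻¹ * N (D j) x := rfl
    have hmix : ∀ f : Rd d → ℝ → ℂ, eLpNorm (N f) q volume = mixedNorm q r univ (Icc (-2) 2) f :=
      fun f => by
        unfold mixedNorm
        rw [Measure.restrict_univ]
    rw [e]
    refine (eLpNorm_add_le ((hNm _ (hFm j)).add ((hNm _ (hGm j)).const_mul _)).aestronglyMeasurable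
      ((hNm _ (hDm j)).const_mul _).aestronglyMeasurable hq1).trans ?_
    refine (add_le_add (eLpNorm_add_le (hNm _ (hFm j)).aestronglyMeasurable
      ((hNm _ (hGm j)).const_mul _).aestronglyMeasurable hq1) le_rfl).trans ?_
    rw [eLpNorm_ennreal_const_mul (h4 j), eLpNorm_ennreal_const_mul (h4i j), hmix, hmix, hmix]
    calc _ ≤ b j + b j + b j := add_le_add (add_le_add (hFb j) (hGb j)) (hDb j)
      _ = 3 * b j := by ring
  calc mixedNorm q r univ (Icc (-1) 1) (fun x t => ∑ j ∈ Finset.range n, F j x t)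
      ≤ eLpNorm (fun x => ENNReal.ofReal C ^ (1 / 2 : ℝ) *
        (∑ j ∈ Finset.range n, A j x ^ (2 : ℝ)) ^ (1 / 2 : ℝ)) q volume := by
        unfold mixedNorm
        rw [Measure.restrict_univ]
        exact eLpNorm_mono_enorm fun x => by simpa only [enorm_eq_self] using hpt x
    _ = ENNReal.ofReal C ^ (1 / 2 : ℝ) *
        eLpNorm (fun x => (∑ j ∈ Finset.range n, A j x ^ (2 : ℝ)) ^ (1 / 2 : ℝ)) q volume :=
        eLpNorm_ennreal_const_mul
          (ENNReal.rpow_ne_top_of_nonneg (by norm_num) ENNReal.ofReal_ne_top) _ _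
    _ ≤ ENNReal.ofReal C ^ (1 / 2 : ℝ) *
        (∑ j ∈ Finset.range n, eLpNorm (A j) q volume ^ (2 : ℝ)) ^ (1 / 2 : ℝ) :=
        mul_le_mul' le_rfl (eLpNorm_rpow_half_sum_le hq _ hAm)
    _ ≤ ENNReal.ofReal C ^ (1 / 2 : ℝ) *
        (∑ j ∈ Finset.range n, (3 * b j) ^ (2 : ℝ)) ^ (1 / 2 : ℝ) := by
        gcongr with j
        exact hAb j
    _ = _ := by
        have e : ∀ j, (3 * b j) ^ (2 : ℝ) = 3 ^ (2 : ℝ) * b j ^ (2 : ℝ) := fun j =>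
          ENNReal.mul_rpow_of_nonneg _ _ (by norm_num)
        simp_rw [e]
        rw [← Finset.mul_sum, ENNReal.mul_rpow_of_nonneg _ _ (by norm_num : (0 : ℝ) ≤ 1 / 2),
          ← ENNReal.rpow_mul, mul_assoc]
        norm_num

/-! ### Littlewood–Paley cutoffs and their fattened versions. -/

section cutoff

variable {d : ℕ} {χ : Rd d → ℝ}

theorem IsLPCutoff.hasCompactSupport (hχ : IsLPCutoff χ) {c : ℝ} (hc : 0 < c) :
    HasCompactSupport fun ξ : Rd d => ((χ (c • ξ) : ℝ) : ℂ) := by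
  refine HasCompactSupport.intro (isCompact_closedBall 0 (2 / c)) fun ξ hξ => ?_
  rw [mem_closedBall_zero_iff, not_le, div_lt_iff₀ hc] at hξ
  rw [hχ.eq_zero _ (by rw [norm_smul, Real.norm_of_nonneg hc.le, mul_comm]; exact hξ.le),
    Complex.ofReal_zero]

theorem IsLPCutoff.contDiff (hχ : IsLPCutoff χ) (c : ℝ) :
    ContDiff ℝ ∞ fun ξ : Rd d => ((χ (c • ξ) : ℝ) : ℂ) :=
  Complex.ofRealCLM.contDiff.comp (hχ.smooth.comp (contDiff_const_smul c))

/-- The Schwartz function `ξ ↦ χ (c ξ)`. -/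
noncomputable def IsLPCutoff.schwartz (hχ : IsLPCutoff χ) {c : ℝ} (hc : 0 < c) : 𝓢(Rd d, ℂ) :=
  (hχ.hasCompactSupport hc).toSchwartzMap (hχ.contDiff c)

theorem IsLPCutoff.schwartz_apply (hχ : IsLPCutoff χ) {c : ℝ} (hc : 0 < c) (ξ : Rd d) :
    hχ.schwartz hc ξ = ((χ (c • ξ) : ℝ) : ℂ) := rfl

/-- The symbol of a fattened Littlewood–Paley piece at frequency `1`. -/
noncomputable def IsLPCutoff.fat (hχ : IsLPCutoff χ) : 𝓢(Rd d, ℂ) :=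
  hχ.schwartz Real.pi_pos - hχ.schwartz (by positivity : 0 < 8 * Real.pi)

theorem IsLPCutoff.fat_apply (hχ : IsLPCutoff χ) (ξ : Rd d) :
    hχ.fat ξ = ((χ (Real.pi • ξ) - χ ((8 * Real.pi) • ξ) : ℝ) : ℂ) := by
  rw [IsLPCutoff.fat, sub_apply, hχ.schwartz_apply, hχ.schwartz_apply, Complex.ofReal_sub]

theorem IsLPCutoff.fat_eq_zero (hχ : IsLPCutoff χ) (ξ : Rd d)
    (h : ‖ξ‖ < (8 * Real.pi)⁻¹ ∨ 2 / Real.pi < ‖ξ‖) : hχ.fat ξ = 0 := by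
  have hpi := Real.pi_pos
  have n1 : ‖Real.pi • ξ‖ = Real.pi * ‖ξ‖ := by rw [norm_smul, Real.norm_of_nonneg hpi.le]
  have n2 : ‖(8 * Real.pi) • ξ‖ = 8 * Real.pi * ‖ξ‖ := by
    rw [norm_smul, Real.norm_of_nonneg (by positivity)]
  rw [hχ.fat_apply]
  rcases h with h | h
  · have h' : 8 * Real.pi * ‖ξ‖ < 1 := by
      calc 8 * Real.pi * ‖ξ‖ < 8 * Real.pi * (8 * Real.pi)⁻¹ := by gcongr
        _ = 1 := mul_inv_cancel₀ (by positivity)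
    have h0 : 0 ≤ Real.pi * ‖ξ‖ := by positivity
    rw [hχ.eq_one _ (by rw [n1]; linarith), hχ.eq_one _ (by rw [n2]; linarith), sub_self,
      Complex.ofReal_zero]
  · rw [div_lt_iff₀ hpi] at h
    rw [hχ.eq_zero _ (by rw [n1]; linarith), hχ.eq_zero _ (by rw [n2]; nlinarith), sub_zero,
      Complex.ofReal_zero]

theorem lpSymbol_zero_mul_fat (hχ : IsLPCutoff χ) (ξ : Rd d) :
    lpSymbol χ 0 ξ * χ ((1 / 2 : ℝ) • ξ) = lpSymbol χ 0 ξ := by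
  simp only [lpSymbol]
  rcases le_or_gt 2 ‖ξ‖ with h | h
  · rw [hχ.eq_zero _ h, zero_mul]
  · rw [hχ.eq_one ((1 / 2 : ℝ) • ξ)
      (by rw [norm_smul, Real.norm_of_nonneg (by norm_num)]; linarith), mul_one]

theorem lpSymbol_succ_mul_fat (hχ : IsLPCutoff χ) (k : ℕ) (ξ : Rd d) :
    lpSymbol χ (k + 1) ξ * (χ ((1 / 2 : ℝ) • ((2 : ℝ) ^ (k + 1))⁻¹ • ξ) -
      χ ((4 : ℝ) • ((2 : ℝ) ^ (k + 1))⁻¹ • ξ)) = lpSymbol χ (k + 1) ξ := by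
  simp only [lpSymbol]
  set w := ((2 : ℝ) ^ (k + 1))⁻¹ • ξ with hw
  have e : ((2 : ℝ) ^ k)⁻¹ • ξ = (2 : ℝ) • w := by
    rw [hw, smul_smul, pow_succ]
    congr 1
    field_simp
  have n : ∀ a : ℝ, 0 ≤ a → ‖a • w‖ = a * ‖w‖ := fun a ha => by
    rw [norm_smul, Real.norm_of_nonneg ha]
  rw [e]
  rcases le_or_gt 2 ‖w‖ with h | h
  · rw [hχ.eq_zero w h, hχ.eq_zero ((2 : ℝ) • w) (by rw [n _ (by norm_num)]; linarith)]
    ring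
  rcases le_or_gt ‖w‖ (1 / 2) with h' | h'
  · rw [hχ.eq_one w (by linarith), hχ.eq_one ((2 : ℝ) • w) (by rw [n _ (by norm_num)]; linarith)]
    ring
  · rw [hχ.eq_one ((1 / 2 : ℝ) • w) (by rw [n _ (by norm_num)]; linarith),
      hχ.eq_zero ((4 : ℝ) • w) (by rw [n _ (by norm_num)]; linarith)]
    ring

theorem sum_lpSymbol (χ : Rd d → ℝ) (n : ℕ) (ξ : Rd d) :
    ∑ k ∈ Finset.range (n + 1), lpSymbol χ k ξ = χ (((2 : ℝ) ^ n)⁻¹ • ξ) := by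
  induction n with
  | zero => simp [lpSymbol]
  | succ n ih =>
    rw [Finset.sum_range_succ, ih]
    simp only [lpSymbol]
    ring

theorem IsLPCutoff.lpSymbol_hasTemperateGrowth (hχ : IsLPCutoff χ) (k : ℕ) :
    (fun ξ : Rd d => ((lpSymbol χ k ((2 * Real.pi) • ξ) : ℝ) : ℂ)).HasTemperateGrowth := by
  cases k with
  | zero => exact (hχ.schwartz Real.two_pi_pos).hasTemperateGrowth
  | succ k =>
    have h1 : 0 < ((2 : ℝ) ^ (k + 1))⁻¹ * (2 * Real.pi) := by positivity
    have h2 : 0 < ((2 : ℝ) ^ k)⁻¹ * (2 * Real.pi) := by positivity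
    have e : (fun ξ : Rd d => ((lpSymbol χ (k + 1) ((2 * Real.pi) • ξ) : ℝ) : ℂ)) =
        ⇑(hχ.schwartz h1 - hχ.schwartz h2) := by
      funext ξ
      rw [sub_apply, hχ.schwartz_apply, hχ.schwartz_apply, lpSymbol, smul_smul, smul_smul,
        Complex.ofReal_sub]
    rw [e]
    exact SchwartzMap.hasTemperateGrowth _

/-- The symbols of the fattened Littlewood–Paley pieces. -/
noncomputable def IsLPCutoff.fatPiece (hχ : IsLPCutoff χ) : ℕ → 𝓢(Rd d, ℂ)
  | 0 => hχ.schwartz Real.pi_pos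
  | k + 1 => dilate ((2 : ℝ) ^ (k + 1)) (by positivity) hχ.fat

/-- A fattened cutoff equals 1 on the support of the symbol and reproduces P_k T. The evolution of
P_k T is thus the convolution of its representative `g` with a Schwartz kernel. -/
theorem IsLPCutoff.isGivenBy_schrodinger_lpProj (hχ : IsLPCutoff χ) {p : ℝ≥0∞} (hp : 1 ≤ p)
    {T : 𝓢'(Rd d, ℂ)} (k : ℕ) {g : Rd d → ℂ} (hg : MemLp g p volume)
    (hT : IsGivenBy (lpProj χ k T) g) (t : ℝ) :
    IsGivenBy (schrodinger t (lpProj χ k T)) (evol (hχ.fatPiece k) t g) := by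
  obtain ⟨m, hm, hmul⟩ : ∃ m : Rd d → ℂ, (∀ ξ, m ((2 * Real.pi) • ξ) = hχ.fatPiece k ξ) ∧
      ∀ ξ, ((lpSymbol χ k ξ : ℝ) : ℂ) * m ξ = ((lpSymbol χ k ξ : ℝ) : ℂ) := by
    cases k with
    | zero =>
      refine ⟨fun ξ => ((χ ((1 / 2 : ℝ) • ξ) : ℝ) : ℂ), fun ξ => ?_, fun ξ => ?_⟩
      · have e : (1 / 2 : ℝ) • (2 * Real.pi) • ξ = Real.pi • ξ := by
          rw [smul_smul]; congr 1; ring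
        simp only [IsLPCutoff.fatPiece, hχ.schwartz_apply, e]
      · rw [← Complex.ofReal_mul, lpSymbol_zero_mul_fat hχ]
    | succ k =>
      refine ⟨fun ξ => ((χ ((1 / 2 : ℝ) • ((2 : ℝ) ^ (k + 1))⁻¹ • ξ) -
        χ ((4 : ℝ) • ((2 : ℝ) ^ (k + 1))⁻¹ • ξ) : ℝ) : ℂ), fun ξ => ?_, fun ξ => ?_⟩
      · rw [IsLPCutoff.fatPiece, dilate_apply, hχ.fat_apply]
        have e1 : (1 / 2 : ℝ) • ((2 : ℝ) ^ (k + 1))⁻¹ • (2 * Real.pi) • ξ =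
            Real.pi • ((2 : ℝ) ^ (k + 1))⁻¹ • ξ := by
          simp only [smul_smul]; congr 1; ring
        have e2 : (4 : ℝ) • ((2 : ℝ) ^ (k + 1))⁻¹ • (2 * Real.pi) • ξ =
            (8 * Real.pi) • ((2 : ℝ) ^ (k + 1))⁻¹ • ξ := by
          simp only [smul_smul]; congr 1; ring
        simp only [e1, e2]
      · rw [← Complex.ofReal_mul, lpSymbol_succ_mul_fat hχ]
  have hmt : (fun ξ => m ((2 * Real.pi) • ξ)).HasTemperateGrowth := by
    simp only [hm]; exact (hχ.fatPiece k).hasTemperateGrowth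
  have e : lpProj χ k T = multOp m (lpProj χ k T) := by
    unfold lpProj
    rw [multOp_multOp (hχ.lpSymbol_hasTemperateGrowth k) hmt]
    congr 1
    funext ξ
    rw [hmul]
  rw [e]
  exact isGivenBy_schrodinger_multOp hp hT hg _ t hm

end cutoff

/-! ### Summation over frequencies. -/

section blocks

/-- The embedding of ℓ^ν in ℓ^σ, from subadditivity of the concave power ν/σ. -/
theorem ENNReal.sum_rpow_le {ι : Type*} (s : Finset ι) (b : ι → ℝ≥0∞) {ν σ : ℝ} (hν : 0 < ν)
    (hσ : ν ≤ σ) : (∑ i ∈ s, b i ^ σ) ^ (1 / σ) ≤ (∑ i ∈ s, b i ^ ν) ^ (1 / ν) := by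
  have hσ0 : 0 < σ := hν.trans_le hσ
  have h1 : ∀ (s : Finset ι) (c : ι → ℝ≥0∞), (∑ i ∈ s, c i) ^ (ν / σ) ≤ ∑ i ∈ s, c i ^ (ν / σ) := by
    classical
    intro s c
    induction s using Finset.induction_on with
    | empty => simp [hν, hσ0]
    | insert i s hi ih =>
      rw [Finset.sum_insert hi, Finset.sum_insert hi]
      exact (ENNReal.rpow_add_le_add_rpow _ _ (by positivity) ((div_le_one hσ0).2 hσ)).trans
        (by gcongr)
  have h2 := h1 s fun i => b i ^ σ
  have e : ∀ i, (b i ^ σ) ^ (ν / σ) = b i ^ ν := fun i => by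
    rw [← ENNReal.rpow_mul, mul_div_cancel₀ _ hσ0.ne']
  simp only [e] at h2
  calc (∑ i ∈ s, b i ^ σ) ^ (1 / σ) = ((∑ i ∈ s, b i ^ σ) ^ (ν / σ)) ^ (1 / ν) := by
        rw [← ENNReal.rpow_mul]
        congr 1
        field_simp
    _ ≤ _ := by gcongr

variable {d : ℕ} {χ : Rd d → ℝ} {p q r : ℝ≥0∞} {β : ℝ}

theorem eLpNorm_ofReal_two_pow (k : ℕ) (γ : ℝ) :
    ENNReal.ofReal (((2 : ℝ) ^ k) ^ γ) = ENNReal.ofReal ((2 : ℝ) ^ ((k : ℝ) * γ)) := by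
  rw [Real.rpow_mul (by norm_num), Real.rpow_natCast]

/-- Division by -4π²i|ξ|² is smooth on an annulus away from the origin; it provides a time
antiderivative of the piece with the same frequency support. -/
theorem exists_schwartz_timeDeriv_eq {Φ : 𝓢(Rd d, ℂ)} {a b : ℝ} (ha : 0 < a)
    (hΦ : ∀ ξ, (‖ξ‖ < a ∨ b < ‖ξ‖) → Φ ξ = 0) : ∃ Ψ : 𝓢(Rd d, ℂ), timeDeriv Ψ = Φ ∧
      ∀ ξ, (‖ξ‖ < a ∨ b < ‖ξ‖) → Ψ ξ = 0 := by
  set m : Rd d → ℂ := fun ξ => Φ ξ * (((-4 * Real.pi ^ 2 * ‖ξ‖ ^ 2 : ℝ) : ℂ) * Complex.I)⁻¹ with hm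
  have hm0 : ∀ ξ, (‖ξ‖ < a ∨ b < ‖ξ‖) → m ξ = 0 := fun ξ hξ => by
    simp only [hm]; rw [hΦ ξ hξ, zero_mul]
  have hcs : HasCompactSupport m := by
    refine HasCompactSupport.intro (isCompact_closedBall 0 b) fun ξ hξ => hm0 ξ (Or.inr ?_)
    rwa [mem_closedBall_zero_iff, not_le] at hξ
  have hcd : ContDiff ℝ ∞ m := by
    rw [contDiff_iff_contDiffAt]
    intro ξ
    rcases lt_or_ge ‖ξ‖ a with h | h
    · refine (contDiffAt_const (c := (0 : ℂ))).congr_of_eventuallyEq ?_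
      filter_upwards [(isOpen_lt continuous_norm continuous_const).mem_nhds h] with ζ hζ
      exact hm0 ζ (Or.inl hζ)
    · have hξ0 : ‖ξ‖ ≠ 0 := (ha.trans_le h).ne'
      refine ContDiffAt.mul (Φ.smooth _).contDiffAt (ContDiffAt.inv ?_ ?_)
      · refine ContDiffAt.mul (Complex.ofRealCLM.contDiff.contDiffAt.comp ξ ?_) contDiffAt_const
        exact contDiffAt_const.mul (contDiff_norm_sq ℝ).contDiffAt
      · refine mul_ne_zero ?_ Complex.I_ne_zero
        have := Real.pi_ne_zero
        exact_mod_cast (by positivity : (-4 * Real.pi ^ 2 * ‖ξ‖ ^ 2 : ℝ) ≠ 0)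
  refine ⟨hcs.toSchwartzMap hcd, ?_, hm0⟩
  ext ξ
  rw [timeDeriv_apply]
  show _ * (_ * m ξ) = _
  rcases lt_or_ge ‖ξ‖ a with h | h
  · rw [hm0 ξ (Or.inl h), hΦ ξ (Or.inl h), mul_zero, mul_zero]
  · have hξ0 : (‖ξ‖ : ℂ) ≠ 0 := by exact_mod_cast (ha.trans_le h).ne'
    have hpi : (Real.pi : ℂ) ≠ 0 := by exact_mod_cast Real.pi_ne_zero
    simp only [hm]
    push_cast
    field_simp

end blocks

theorem exists_mixedNorm_evol_le_symm {d : ℕ} {p q r : ℝ≥0∞} (hp : 1 ≤ p) (hpq : p ≤ q)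
    (hr : 1 ≤ r) (Φ : 𝓢(Rd d, ℂ)) (T : ℝ) : ∃ C : ℝ≥0∞, C ≠ ⊤ ∧ ∀ f : Rd d → ℂ, MemLp f p volume →
      mixedNorm q r univ (Icc (-T) T) (fun x t => evol Φ t f x) ≤ C * eLpNorm f p volume := by
  obtain ⟨C₁, hC₁, H₁⟩ := exists_mixedNorm_evol_le (q := q) (r := r) hp hpq Φ T
  obtain ⟨C₂, hC₂, H₂⟩ := exists_mixedNorm_evol_le (q := q) (r := r) hp hpq (conjReflect Φ) T
  refine ⟨C₁ + C₂, ENNReal.add_ne_top.2 ⟨hC₁, hC₂⟩, fun f hf => ?_⟩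
  have hsub : Icc (-T) T ⊆ Icc 0 T ∪ Icc (-T) 0 := fun t ht => by
    rcases le_total 0 t with h | h
    · exact Or.inl ⟨h, ht.2⟩
    · exact Or.inr ⟨ht.1, h⟩
  refine (mixedNorm_mono_set subset_rfl hsub).trans ((mixedNorm_union_le (hp.trans hpq) hr
    (stronglyMeasurable_evol Φ hf.1) measurableSet_Icc measurableSet_Icc).trans ?_)
  have hconj : eLpNorm (fun y => (starRingEnd ℂ) (f y)) p volume = eLpNorm f p volume :=
    eLpNorm_congr_norm_ae (Eventually.of_forall fun y => RCLike.norm_conj _)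
  have hfc : MemLp (fun y => (starRingEnd ℂ) (f y)) p volume :=
    ⟨Complex.continuous_conj.comp_aestronglyMeasurable hf.1, by rw [hconj]; exact hf.2⟩
  refine (add_le_add (H₁ f hf) ((mixedNorm_evol_neg_le Φ f).trans (H₂ _ hfc))).trans (le_of_eq ?_)
  rw [hconj, add_mul]

section blocks

variable {d : ℕ} {χ : Rd d → ℝ} {p q r : ℝ≥0∞} {β ν : ℝ}

/-- The single pieces of the propagator. -/
theorem ExtensionBound.exists_fatPiece_le (hp : 1 ≤ p) (hpq : p ≤ q) (hr : 1 ≤ r)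
    (hE : ExtensionBound d p q r β) (hβ : 0 < (d : ℝ) / 2 - d * (p⁻¹).toReal + β)
    (hχ : IsLPCutoff χ) : ∃ C : ℝ≥0∞, C ≠ ⊤ ∧ ∀ (k : ℕ) (g : Rd d → ℂ), MemLp g p volume →
      mixedNorm q r univ (Icc (-1) 1) (fun x t => evol (hχ.fatPiece k) t g x) ≤
        C * (ENNReal.ofReal ((2 : ℝ) ^ ((k : ℝ) * ((d : ℝ) * (1 - (p⁻¹).toReal - (q⁻¹).toReal) -
          2 * (r⁻¹).toReal + 2 * β))) * eLpNorm g p volume) := by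
  obtain ⟨C₀, hC₀, H₀⟩ := exists_mixedNorm_evol_le_symm (q := q) (r := r) hp hpq hr
    (hχ.schwartz Real.pi_pos) 1
  obtain ⟨C₁, hC₁, H₁⟩ := hE.exists_evol_dilate_le hp hpq hr hβ hχ.fat
    (a := (8 * Real.pi)⁻¹) (b := 2 / Real.pi) (by positivity)
    (by rw [← one_div]; gcongr; norm_num; linarith [Real.pi_pos]) hχ.fat_eq_zero (le_refl (1 : ℝ))
  refine ⟨C₀ + C₁, ENNReal.add_ne_top.2 ⟨hC₀, hC₁⟩, fun k g hg => ?_⟩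
  cases k with
  | zero =>
    simp only [Nat.cast_zero, zero_mul, Real.rpow_zero, ENNReal.ofReal_one, one_mul]
    exact (H₀ g hg).trans (mul_le_mul' le_self_add le_rfl)
  | succ k =>
    rw [← eLpNorm_ofReal_two_pow]
    refine (H₁ ((2 : ℝ) ^ (k + 1)) (one_le_pow₀ (by norm_num)) (by positivity) g hg).trans ?_
    rw [mul_assoc]
    exact mul_le_mul' le_add_self le_rfl

theorem ExtensionBound.exists_sum_range_le_of_le_one (hp : 1 ≤ p) (hpq : p ≤ q) (hr : 1 ≤ r)
    (hE : ExtensionBound d p q r β) (hβ : 0 < (d : ℝ) / 2 - d * (p⁻¹).toReal + β)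
    (hχ : IsLPCutoff χ) (hν : 0 < ν) (hν1 : ν ≤ 1) : ∃ C : ℝ≥0∞, C ≠ ⊤ ∧ ∀ (g : ℕ → Rd d → ℂ),
      (∀ k, MemLp (g k) p volume) → ∀ n : ℕ,
      mixedNorm q r univ (Icc (-1) 1)
        (fun x t => ∑ k ∈ Finset.range n, evol (hχ.fatPiece k) t (g k) x) ≤
        C * (∑ k ∈ Finset.range n, (ENNReal.ofReal ((2 : ℝ) ^ ((k : ℝ) *
          ((d : ℝ) * (1 - (p⁻¹).toReal - (q⁻¹).toReal) - 2 * (r⁻¹).toReal + 2 * β))) *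
          eLpNorm (g k) p volume) ^ ν) ^ (1 / ν) := by
  obtain ⟨C, hC, H⟩ := hE.exists_fatPiece_le hp hpq hr hβ hχ
  refine ⟨C, hC, fun g hg n => ?_⟩
  refine (mixedNorm_sum_le _ (hp.trans hpq) hr fun k =>
    stronglyMeasurable_uncurry_evol _ (hg k).1).trans ?_
  refine (Finset.sum_le_sum fun k _ => H k (g k) (hg k)).trans ?_
  rw [← Finset.mul_sum]
  refine mul_le_mul' le_rfl ?_
  simpa using ENNReal.sum_rpow_le (Finset.range n) (fun k => ENNReal.ofReal ((2 : ℝ) ^ ((k : ℝ) *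
          ((d : ℝ) * (1 - (p⁻¹).toReal - (q⁻¹).toReal) - 2 * (r⁻¹).toReal + 2 * β))) *
          eLpNorm (g k) p volume) hν hν1

/-- The piece, its antiderivative (symbol `Ψ`) and its derivative (symbol `timeDeriv Φ`) are all
localized to the same annulus, so each obeys the single-frequency estimate and the time inequality
applies. The piece k = 0 contains frequencies near zero, where no antiderivative is available, and
is estimated separately. -/
theorem ExtensionBound.exists_sum_range_le_of_le_two (hp : 1 ≤ p) (hpq : p ≤ q) (hq : 2 ≤ q)
    (hr : 2 ≤ r) (hr' : r < ⊤)
    (hE : ExtensionBound d p q r β) (hβ : 0 < (d : ℝ) / 2 - d * (p⁻¹).toReal + β)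
    (hχ : IsLPCutoff χ) (hν : 0 < ν) (hν2 : ν ≤ 2) : ∃ C : ℝ≥0∞, C ≠ ⊤ ∧ ∀ (g : ℕ → Rd d → ℂ),
      (∀ k, MemLp (g k) p volume) → ∀ n : ℕ,
      mixedNorm q r univ (Icc (-1) 1)
        (fun x t => ∑ k ∈ Finset.range n, evol (hχ.fatPiece k) t (g k) x) ≤
        C * (∑ k ∈ Finset.range n, (ENNReal.ofReal ((2 : ℝ) ^ ((k : ℝ) *
          ((d : ℝ) * (1 - (p⁻¹).toReal - (q⁻¹).toReal) - 2 * (r⁻¹).toReal + 2 * β))) *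
          eLpNorm (g k) p volume) ^ ν) ^ (1 / ν) := by
  have hr1 : 1 ≤ r := le_trans (by norm_num) hr
  have hq1 : 1 ≤ q := hp.trans hpq
  have ha : 0 < (8 * Real.pi)⁻¹ := by positivity
  have hab : (8 * Real.pi)⁻¹ ≤ 2 / Real.pi := by
    rw [← one_div]; gcongr; norm_num; linarith [Real.pi_pos]
  set γ := (d : ℝ) * (1 - (p⁻¹).toReal - (q⁻¹).toReal) - 2 * (r⁻¹).toReal + 2 * β with hγ
  set Φ := hχ.fat with hΦd
  have hΦ := hχ.fat_eq_zero
  obtain ⟨Ψ, hΨ, hΨ0⟩ := exists_schwartz_timeDeriv_eq ha hΦ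
  have hΦ' : ∀ ξ, (‖ξ‖ < (8 * Real.pi)⁻¹ ∨ 2 / Real.pi < ‖ξ‖) → timeDeriv Φ ξ = 0 := fun ξ hξ => by
    rw [timeDeriv_apply, hΦ ξ hξ, mul_zero, mul_zero]
  -- The bounds are taken with S = 2, as the Littlewood–Paley inequality on [-1, 1] needs control on
  -- [-2, 2].
  obtain ⟨C₁, hC₁, H₁⟩ := hE.exists_evol_dilate_le hp hpq hr1 hβ Φ ha hab hΦ (one_le_two (α := ℝ))
  obtain ⟨C₂, hC₂, H₂⟩ := hE.exists_evol_dilate_le hp hpq hr1 hβ Ψ ha hab hΨ0 (one_le_two (α := ℝ))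
  obtain ⟨C₃, hC₃, H₃⟩ := hE.exists_evol_dilate_le hp hpq hr1 hβ (timeDeriv Φ) ha hab hΦ'
    (one_le_two (α := ℝ))
  obtain ⟨C₄, hC₄, H₄⟩ := exists_mixedNorm_sum_le hr hr'.ne
  obtain ⟨C₀, hC₀, H₀⟩ := exists_mixedNorm_evol_le_symm (q := q) (r := r) hp hpq hr1
    (hχ.schwartz Real.pi_pos) 1
  -- The 4 is the shift by one: index j has spatial frequency 2^{j+1}, hence time frequency 4 · 4^j.
  set K := C₁ + C₂ + 4 * C₃ with hK
  have hKt : K ≠ ⊤ := ENNReal.add_ne_top.2 ⟨ENNReal.add_ne_top.2 ⟨hC₁, hC₂⟩,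
    ENNReal.mul_ne_top (by norm_num) hC₃⟩
  refine ⟨C₄ * K + C₀, ENNReal.add_ne_top.2 ⟨ENNReal.mul_ne_top hC₄ hKt, hC₀⟩, fun g hg n => ?_⟩
  set b : ℕ → ℝ≥0∞ := fun k => ENNReal.ofReal ((2 : ℝ) ^ ((k : ℝ) * γ)) * eLpNorm (g k) p volume
    with hb
  cases n with
  | zero => simp [mixedNorm_zero]
  | succ m =>
    have hμ0 : ∀ j : ℕ, ((2 : ℝ) ^ (j + 1)) ≠ 0 := fun j => by positivity
    have hμpos : ∀ j : ℕ, 0 < ((2 : ℝ) ^ (j + 1)) := fun j => by positivity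
    have hμ1 : ∀ j : ℕ, 1 ≤ ((2 : ℝ) ^ (j + 1)) := fun j => one_le_pow₀ (by norm_num)
    set F : ℕ → Rd d → ℝ → ℂ := fun j x t => evol (dilate _ (hμ0 j) Φ) t (g (j + 1)) x with hF
    set G : ℕ → Rd d → ℝ → ℂ := fun j x t =>
      (((((2 : ℝ) ^ (j + 1)) ^ 2)⁻¹ : ℝ) : ℂ) * evol (dilate _ (hμ0 j) Ψ) t (g (j + 1)) x with hG
    set D : ℕ → Rd d → ℝ → ℂ := fun j x t =>
      ((((2 : ℝ) ^ (j + 1)) ^ 2 : ℝ) : ℂ) *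
        evol (dilate _ (hμ0 j) (timeDeriv Φ)) t (g (j + 1)) x with hD
    have hsm : ∀ (Θ : 𝓢(Rd d, ℂ)) (j : ℕ) (c : ℂ), StronglyMeasurable (Function.uncurry
        fun x t => c * evol (dilate _ (hμ0 j) Θ) t (g (j + 1)) x) := fun Θ j c =>
      (stronglyMeasurable_uncurry_evol _ (hg (j + 1)).1).const_mul c
    have e4 : ∀ j : ℕ, ENNReal.ofReal (((2 : ℝ) ^ (j + 1)) ^ 2) = 4 * (4 : ℝ≥0∞) ^ j := fun j => by
      rw [show ((2 : ℝ) ^ (j + 1)) ^ 2 = 4 * 4 ^ j by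
        rw [← pow_mul, mul_comm, pow_mul, pow_succ]; norm_num [mul_comm],
        ENNReal.ofReal_mul (by norm_num), ENNReal.ofReal_pow (by norm_num)]
      norm_num
    have h4t : ∀ j : ℕ, (4 : ℝ≥0∞) ^ j ≠ ⊤ := fun j => ENNReal.pow_ne_top (by norm_num)
    have h40 : ∀ j : ℕ, (4 : ℝ≥0∞) ^ j ≠ 0 := fun j => pow_ne_zero _ (by norm_num)
    have hLP := H₄ hq F G D (fun j => K * b (j + 1))
      (fun j => stronglyMeasurable_uncurry_evol _ (hg (j + 1)).1) (fun j => hsm _ j _)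
      (fun j => hsm _ j _)
      (fun j x t => by
        refine ((hasDerivAt_evol hp (dilate _ (hμ0 j) Ψ) (hg (j + 1)) x t).const_mul
          (((((2 : ℝ) ^ (j + 1)) ^ 2)⁻¹ : ℝ) : ℂ)).congr_deriv ?_
        rw [timeDeriv_dilate, hΨ, evol_smul, ← mul_assoc, ← Complex.ofReal_mul,
          inv_mul_cancel₀ (by positivity), Complex.ofReal_one, one_mul])
      (fun j x t => by
        refine (hasDerivAt_evol hp (dilate _ (hμ0 j) Φ) (hg (j + 1)) x t).congr_deriv ?_
        rw [timeDeriv_dilate, evol_smul])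
      (fun j x => continuous_const.mul (continuous_iff_continuousAt.2 fun t =>
        (hasDerivAt_evol hp _ (hg (j + 1)) x t).continuousAt))
      (fun j => by
        refine (H₁ _ (hμ1 j) (hμ0 j) _ (hg (j + 1))).trans ?_
        rw [eLpNorm_ofReal_two_pow, mul_assoc]
        exact mul_le_mul' (by rw [hK, add_assoc]; exact le_self_add) le_rfl)
      (fun j => by
        rw [hG, mixedNorm_const_mul, ← ofReal_norm, Complex.norm_real,
          Real.norm_of_nonneg (by positivity), ENNReal.ofReal_inv_of_pos (by positivity), e4,
          ← mul_assoc]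
        have : (4 : ℝ≥0∞) ^ j * (4 * 4 ^ j)⁻¹ ≤ 1 := by
          rw [← div_eq_mul_inv]
          refine ENNReal.div_le_of_le_mul ?_
          rw [one_mul]
          exact le_mul_of_one_le_left' (by norm_num)
        refine (mul_le_of_le_one_left' this).trans ((H₂ _ (hμ1 j) (hμ0 j) _ (hg (j + 1))).trans ?_)
        rw [eLpNorm_ofReal_two_pow, mul_assoc]
        exact mul_le_mul' (by rw [hK, add_assoc, add_left_comm]; exact le_self_add) le_rfl)
      (fun j => by
        rw [hD, mixedNorm_const_mul, ← ofReal_norm, Complex.norm_real,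
          Real.norm_of_nonneg (by positivity), e4, ← mul_assoc]
        have : ((4 : ℝ≥0∞) ^ j)⁻¹ * (4 * 4 ^ j) = 4 := by
          rw [mul_left_comm, ENNReal.inv_mul_cancel (h40 j) (h4t j), mul_one]
        rw [this]
        refine (mul_le_mul' le_rfl (H₃ _ (hμ1 j) (hμ0 j) _ (hg (j + 1)))).trans ?_
        rw [eLpNorm_ofReal_two_pow, mul_assoc, ← mul_assoc 4]
        exact mul_le_mul' (by rw [hK]; exact le_add_self) le_rfl) m
    simp only [Finset.sum_range_succ' (n := m)]
    have hFs : StronglyMeasurable (Function.uncurry fun x t => ∑ j ∈ Finset.range m, F j x t) := by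
      have := Finset.stronglyMeasurable_fun_sum (Finset.range m) fun j _ =>
        stronglyMeasurable_uncurry_evol (dilate _ (hμ0 j) Φ) (hg (j + 1)).1
      exact this
    refine (mixedNorm_add_le hq1 hr1 hFs (stronglyMeasurable_uncurry_evol _ (hg 0).1)).trans ?_
    have hS2 := ENNReal.sum_rpow_le (Finset.range (m + 1)) b hν hν2
    rw [Finset.sum_range_succ' (n := m), Finset.sum_range_succ' (n := m)] at hS2
    set R := (∑ k ∈ Finset.range m, b (k + 1) ^ ν + b 0 ^ ν) ^ (1 / ν) with hR
    have h1 : (∑ j ∈ Finset.range m, (K * b (j + 1)) ^ (2 : ℝ)) ^ (1 / 2 : ℝ) ≤ K * R := by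
      have e : ∀ j, (K * b (j + 1)) ^ (2 : ℝ) = K ^ (2 : ℝ) * b (j + 1) ^ (2 : ℝ) := fun j =>
        ENNReal.mul_rpow_of_nonneg _ _ (by norm_num)
      simp_rw [e]
      rw [← Finset.mul_sum, ENNReal.mul_rpow_of_nonneg _ _ (by norm_num : (0 : ℝ) ≤ 1 / 2),
        ← ENNReal.rpow_mul]
      norm_num only [ENNReal.rpow_one]
      refine mul_le_mul' le_rfl (le_trans ?_ hS2)
      exact ENNReal.rpow_le_rpow le_self_add (by norm_num)
    have h2 : b 0 ≤ R := by
      calc b 0 = (b 0 ^ ν) ^ (1 / ν) := by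
            rw [← ENNReal.rpow_mul, mul_one_div_cancel hν.ne', ENNReal.rpow_one]
        _ ≤ R := ENNReal.rpow_le_rpow le_add_self (by positivity)
    have hb0 : b 0 = eLpNorm (g 0) p volume := by simp [hb]
    rw [add_mul]
    refine add_le_add ?_ ?_
    · refine hLP.trans ?_
      rw [mul_assoc]
      exact mul_le_mul' le_rfl h1
    · refine (H₀ _ (hg 0)).trans (mul_le_mul' le_rfl ?_)
      rw [← hb0]
      exact h2

/-- Setting the data below `m` to zero gives bounds for arbitrary blocks, which are needed for the
convergence of the series. -/
theorem ExtensionBound.exists_sum_Ico_le (hp : 1 ≤ p) (hpq : p ≤ q) (hq : 2 ≤ q)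
    (hr : 2 ≤ r) (hE : ExtensionBound d p q r β)
    (hβ : 0 < (d : ℝ) / 2 - d * (p⁻¹).toReal + β)
    (hχ : IsLPCutoff χ) (hν : 0 < ν) (hν' : ν ≤ 1 ∨ (r < ⊤ ∧ ν ≤ 2)) : ∃ C : ℝ≥0∞, C ≠ ⊤ ∧
      ∀ (g : ℕ → Rd d → ℂ), (∀ k, MemLp (g k) p volume) → ∀ m n : ℕ,
      mixedNorm q r univ (Icc (-1) 1)
        (fun x t => ∑ k ∈ Finset.Ico m n, evol (hχ.fatPiece k) t (g k) x) ≤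
        C * (∑ k ∈ Finset.Ico m n, (ENNReal.ofReal ((2 : ℝ) ^ ((k : ℝ) *
          ((d : ℝ) * (1 - (p⁻¹).toReal - (q⁻¹).toReal) - 2 * (r⁻¹).toReal + 2 * β))) *
          eLpNorm (g k) p volume) ^ ν) ^ (1 / ν) := by
  have hr1 : 1 ≤ r := le_trans (by norm_num) hr
  obtain ⟨C, hC, H⟩ := hν'.elim
    (fun h => hE.exists_sum_range_le_of_le_one hp hpq hr1 hβ hχ hν h)
    (fun h => hE.exists_sum_range_le_of_le_two hp hpq hq hr h.1 hβ hχ hν h.2)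
  refine ⟨C, hC, fun g hg m n => ?_⟩
  classical
  set g' : ℕ → Rd d → ℂ := fun k => if m ≤ k then g k else 0 with hg'
  have hgm : ∀ k, MemLp (g' k) p volume := fun k => by
    simp only [hg']
    split_ifs
    · exact hg k
    · exact MemLp.zero
  have h := H g' hgm n
  have hsub : Finset.Ico m n ⊆ Finset.range n := fun k hk =>
    Finset.mem_range.2 (Finset.mem_Ico.1 hk).2
  have hzero : ∀ k ∈ Finset.range n, k ∉ Finset.Ico m n → g' k = 0 := fun k hk hk' => by
    simp only [hg']
    rw [if_neg]
    intro hmk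
    exact hk' (Finset.mem_Ico.2 ⟨hmk, Finset.mem_range.1 hk⟩)
  have heq : ∀ k ∈ Finset.Ico m n, g' k = g k := fun k hk => if_pos (Finset.mem_Ico.1 hk).1
  have e1 : (fun (x : Rd d) (t : ℝ) => ∑ k ∈ Finset.range n, evol (hχ.fatPiece k) t (g' k) x) =
      fun x t => ∑ k ∈ Finset.Ico m n, evol (hχ.fatPiece k) t (g k) x := by
    funext x t
    rw [← Finset.sum_subset hsub fun k hk hk' => by rw [hzero k hk hk']; simp [evol]]
    exact Finset.sum_congr rfl fun k hk => by rw [heq k hk]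
  rw [e1] at h
  refine h.trans (le_of_eq ?_)
  rw [← Finset.sum_subset hsub fun k hk hk' => by
    rw [hzero k hk hk', eLpNorm_zero, mul_zero, ENNReal.zero_rpow_of_pos hν]]
  congr 2
  exact Finset.sum_congr rfl fun k hk => by rw [heq k hk]

end blocks

/-! ### Convergence of the Littlewood–Paley series. -/

theorem SchwartzMap.exists_norm_iteratedFDeriv_one_sub_le {d : ℕ} (η : 𝓢(Rd d, ℂ)) (i : ℕ) :
    ∃ M : ℝ, ∀ ξ, ‖iteratedFDeriv ℝ i (fun ξ => 1 - η ξ) ξ‖ ≤ M := by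
  refine ⟨1 + SchwartzMap.seminorm ℝ 0 i η, fun ξ => ?_⟩
  have h1 : ContDiff ℝ i (fun _ : Rd d => (1 : ℂ)) := contDiff_const
  have h2 : ContDiff ℝ i (fun ξ => η ξ) := η.smooth _
  have e : iteratedFDeriv ℝ i (fun ξ => 1 - η ξ) ξ =
      iteratedFDeriv ℝ i (fun _ : Rd d => (1 : ℂ)) ξ - iteratedFDeriv ℝ i (fun ξ => η ξ) ξ :=
    iteratedFDeriv_sub_apply h1.contDiffAt h2.contDiffAt
  rw [e]
  refine (norm_sub_le _ _).trans (add_le_add ?_ ?_)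
  · rcases Nat.eq_zero_or_pos i with rfl | hi
    · simp
    · rw [iteratedFDeriv_const_of_ne hi.ne']
      simp
  · simpa using SchwartzMap.le_seminorm ℝ 0 i η ξ

/-- The difference lives on c‖ξ‖ ≥ 1, where ‖ξ‖^k ≤ c‖ξ‖^{k+1}: a factor `c` is gained from the next
seminorm. Derivatives of the dilated cutoff stay bounded as c ≤ 1. -/
theorem SchwartzMap.exists_seminorm_sub_le {d : ℕ} (η : 𝓢(Rd d, ℂ)) (hη : ∀ ξ, ‖ξ‖ < 1 → η ξ = 1)
    (ψ : 𝓢(Rd d, ℂ)) (k n : ℕ) : ∃ C : ℝ, ∀ c : ℝ, 0 < c → c ≤ 1 → ∀ f : 𝓢(Rd d, ℂ),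
      (∀ ξ, f ξ = (1 - η (c • ξ)) * ψ ξ) → SchwartzMap.seminorm ℂ k n f ≤ c * C := by
  choose M hM using η.exists_norm_iteratedFDeriv_one_sub_le
  have hM0 : ∀ i, 0 ≤ M i := fun i => (norm_nonneg _).trans (hM i 0)
  refine ⟨∑ i ∈ Finset.range (n + 1), (n.choose i : ℝ) * M i *
    SchwartzMap.seminorm ℝ (k + 1) (n - i) ψ, fun c hc hc1 f hf => ?_⟩
  refine SchwartzMap.seminorm_le_bound ℂ k n f (mul_nonneg hc.le
    (Finset.sum_nonneg fun i _ => mul_nonneg (mul_nonneg (Nat.cast_nonneg _) (hM0 i))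
      (apply_nonneg _ _))) fun ξ => ?_
  rcases lt_or_ge (‖c • ξ‖) 1 with hξ | hξ
  · have h0 : ⇑f =ᶠ[𝓝 ξ] fun _ => 0 := by
      have : ∀ᶠ z in 𝓝 ξ, ‖c • z‖ < 1 :=
        (continuous_norm.comp (continuous_const_smul c)).continuousAt.eventually_lt
          continuousAt_const hξ
      filter_upwards [this] with z hz
      rw [hf, hη _ hz, sub_self, zero_mul]
    rw [(h0.iteratedFDeriv ℝ n).eq_of_nhds]
    rw [show iteratedFDeriv ℝ n (fun _ : Rd d => (0 : ℂ)) ξ = 0 by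
      rw [iteratedFDeriv_fun_zero]; rfl]
    rw [norm_zero, mul_zero]
    exact mul_nonneg hc.le
      (Finset.sum_nonneg fun i _ => mul_nonneg (mul_nonneg (Nat.cast_nonneg _) (hM0 i))
      (apply_nonneg _ _))
  · have h1 : ContDiff ℝ ∞ (fun ξ => 1 - η ξ) := contDiff_const.sub (η.smooth _)
    have h2 : ContDiff ℝ ∞ (fun ξ => 1 - η (c • ξ)) := h1.comp (contDiff_const_smul c)
    have hfe : (⇑f) = fun ξ => (1 - η (c • ξ)) * ψ ξ := funext hf
    rw [hfe]
    have h3 := norm_iteratedFDeriv_mul_le h2 (ψ.smooth ⊤) ξ (n := n) (by exact_mod_cast le_top)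
    have hk : ‖ξ‖ ^ k ≤ c * ‖ξ‖ ^ (k + 1) := by
      rw [norm_smul, Real.norm_of_nonneg hc.le] at hξ
      calc ‖ξ‖ ^ k = 1 * ‖ξ‖ ^ k := (one_mul _).symm
        _ ≤ (c * ‖ξ‖) * ‖ξ‖ ^ k := by gcongr
        _ = _ := by ring
    refine (mul_le_mul hk h3 (norm_nonneg _) (by positivity)).trans ?_
    rw [mul_assoc, Finset.mul_sum]
    refine mul_le_mul_of_nonneg_left (Finset.sum_le_sum fun i _ => ?_) hc.le
    have h4 : ‖iteratedFDeriv ℝ i (fun ξ => 1 - η (c • ξ)) ξ‖ ≤ M i := by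
      have := iteratedFDeriv_comp_const_smul (𝕜 := ℝ) (i := i) c (h1.of_le (by exact_mod_cast le_top))
      rw [this, norm_smul, norm_pow, Real.norm_of_nonneg hc.le]
      calc c ^ i * ‖iteratedFDeriv ℝ i (fun ξ => 1 - η ξ) (c • ξ)‖
          ≤ 1 * M i := mul_le_mul (pow_le_one₀ hc.le hc1) (hM i _) (norm_nonneg _) zero_le_one
        _ = M i := one_mul _
    have h5 := SchwartzMap.le_seminorm ℝ (k + 1) (n - i) ψ ξ
    calc ‖ξ‖ ^ (k + 1) * ((n.choose i : ℝ) * ‖iteratedFDeriv ℝ i (fun ξ => 1 - η (c • ξ)) ξ‖ *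
          ‖iteratedFDeriv ℝ (n - i) (⇑ψ) ξ‖)
        = (n.choose i : ℝ) * ‖iteratedFDeriv ℝ i (fun ξ => 1 - η (c • ξ)) ξ‖ *
          (‖ξ‖ ^ (k + 1) * ‖iteratedFDeriv ℝ (n - i) (⇑ψ) ξ‖) := by ring
      _ ≤ _ := by gcongr; exact mul_nonneg (Nat.cast_nonneg _) (hM0 i)

theorem SchwartzMap.tendsto_of_eq_dilate_mul {d : ℕ} (η : 𝓢(Rd d, ℂ))
    (hη : ∀ ξ, ‖ξ‖ < 1 → η ξ = 1) (ψ : 𝓢(Rd d, ℂ)) {c : ℕ → ℝ} (hc : ∀ n, 0 < c n)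
    (hc1 : ∀ n, c n ≤ 1) (hc0 : Tendsto c atTop (𝓝 0)) (f : ℕ → 𝓢(Rd d, ℂ))
    (hf : ∀ n ξ, f n ξ = η (c n • ξ) * ψ ξ) : Tendsto f atTop (𝓝 ψ) := by
  rw [(schwartz_withSeminorms ℂ (Rd d) ℂ).tendsto_nhds]
  rintro ⟨k, n⟩ ε hε
  obtain ⟨C, hC⟩ := SchwartzMap.exists_seminorm_sub_le η hη ψ k n
  have ht : Tendsto (fun j => c j * C) atTop (𝓝 0) := by simpa using hc0.mul_const C
  filter_upwards [ht.eventually_lt_const hε] with j hj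
  refine lt_of_le_of_lt ?_ hj
  have : schwartzSeminormFamily ℂ (Rd d) ℂ (k, n) (f j - ψ) = SchwartzMap.seminorm ℂ k n (ψ - f j) := by
    rw [← map_neg_eq_map (SchwartzMap.seminorm ℂ k n), neg_sub]
    rfl
  rw [this]
  exact hC _ (hc j) (hc1 j) _ fun ξ => by rw [sub_apply, hf]; ring

/-- The partial sums telescope to the multiplier χ(2^{-n}·), and multiplication by it converges to
the identity on Schwartz functions; the rest is duality. -/
theorem IsLPCutoff.tendsto_sum_lpProj {d : ℕ} {χ : Rd d → ℝ} (hχ : IsLPCutoff χ)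
    (T : 𝓢'(Rd d, ℂ)) (φ : 𝓢(Rd d, ℂ)) :
    Tendsto (fun n => (∑ k ∈ Finset.range n, lpProj χ k T) φ) atTop (𝓝 (T φ)) := by
  rw [← tendsto_add_atTop_iff_nat 1]
  have hsum : ∀ n, ∑ k ∈ Finset.range (n + 1), lpProj χ k T =
      multOp (fun ξ => ((χ (((2 : ℝ) ^ n)⁻¹ • ξ) : ℝ) : ℂ)) T := fun n => by
    have h := congrArg (fun L => L T) (TemperedDistribution.fourierMultiplierCLM_sum ℂ
      (s := Finset.range (n + 1)) fun k _ => hχ.lpSymbol_hasTemperateGrowth k)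
    simp only [sum_apply] at h
    unfold lpProj multOp
    rw [← h]
    congr 2
    funext ξ
    rw [← Complex.ofReal_sum, sum_lpSymbol]
  have hη : ∀ ξ : Rd d, ‖ξ‖ < 1 → hχ.schwartz one_pos ξ = 1 := fun ξ hξ => by
    rw [hχ.schwartz_apply, one_smul, hχ.eq_one _ hξ.le, Complex.ofReal_one]
  have hg : ∀ n : ℕ, (fun ξ : Rd d => ((χ (((2 : ℝ) ^ n)⁻¹ • (2 * Real.pi) • ξ) : ℝ) : ℂ)) =
      hχ.schwartz (c := ((2 : ℝ) ^ n)⁻¹ * (2 * Real.pi)) (by positivity) := fun n => by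
    funext ξ
    rw [hχ.schwartz_apply, smul_smul]
  have key : Tendsto (fun n : ℕ => SchwartzMap.smulLeftCLM ℂ
      (fun ξ : Rd d => ((χ (((2 : ℝ) ^ n)⁻¹ • (2 * Real.pi) • ξ) : ℝ) : ℂ)) (𝓕⁻ φ)) atTop
      (𝓝 (𝓕⁻ φ)) := by
    -- After three steps the dilation parameter 2π/2^{n+3} is at most 1.
    rw [← tendsto_add_atTop_iff_nat 3]
    refine SchwartzMap.tendsto_of_eq_dilate_mul _ hη (𝓕⁻ φ)
      (c := fun n : ℕ => ((2 : ℝ) ^ (n + 3))⁻¹ * (2 * Real.pi)) (fun n => by positivity)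
      (fun n => ?_) ?_ _ fun n ξ => ?_
    · rw [inv_mul_le_one₀ (by positivity), pow_add]
      have : (1 : ℝ) ≤ 2 ^ n := one_le_pow₀ (by norm_num)
      nlinarith [Real.pi_lt_four]
    · have h0 : Tendsto (fun n : ℕ => ((2 : ℝ)⁻¹) ^ (n + 3)) atTop (𝓝 0) :=
        (tendsto_pow_atTop_nhds_zero_of_lt_one (by norm_num) (by norm_num)).comp
          (tendsto_add_atTop_nat 3)
      simpa [inv_pow] using h0.mul_const (2 * Real.pi)
    · rw [hg, SchwartzMap.smulLeftCLM_apply_apply (SchwartzMap.hasTemperateGrowth _), smul_eq_mul,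
        hχ.schwartz_apply, hχ.schwartz_apply, one_smul]
  simp_rw [hsum]
  have hF : Continuous (fun ψ : 𝓢(Rd d, ℂ) => 𝓕 ψ) :=
    (FourierTransform.fourierCLE ℂ 𝓢(Rd d, ℂ)).continuous
  have hT := ((T : 𝓢(Rd d, ℂ) →L[ℂ] ℂ).continuous.tendsto _).comp ((hF.tendsto _).comp key)
  rw [fourier_fourierInv_eq] at hT
  refine hT.congr fun n => ?_
  exact (TemperedDistribution.fourierMultiplierCLM_apply_apply _ T φ).symm

theorem eLpNorm_liminf_le {α : Type*} [MeasurableSpace α] {μ : Measure α} {A : ℕ → α → ℝ≥0∞}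
    (hA : ∀ n, Measurable (A n)) (q : ℝ≥0∞) :
    eLpNorm (fun x => liminf (fun n => A n x) atTop) q μ ≤
      liminf (fun n => eLpNorm (A n) q μ) atTop := by
  rcases eq_or_ne q 0 with rfl | hq0
  · simp
  rcases eq_or_ne q ⊤ with rfl | hq
  · simp only [eLpNorm_exponent_top, eLpNormEssSup, enorm_eq_self]
    exact ENNReal.essSup_liminf_le A
  have hq' : 0 < q.toReal := ENNReal.toReal_pos hq0 hq
  simp only [eLpNorm_eq_lintegral_rpow_enorm_toReal hq0 hq, enorm_eq_self]
  have e : ∀ (s : ℝ), 0 < s → ∀ u : ℕ → ℝ≥0∞,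
      (liminf u atTop) ^ s = liminf (fun n => u n ^ s) atTop := fun s hs u =>
    (ENNReal.orderIsoRpow s hs).liminf_apply
  rw [← e _ (by positivity) (fun n => ∫⁻ x, A n x ^ q.toReal ∂μ)]
  refine ENNReal.rpow_le_rpow ?_ (by positivity)
  simp_rw [e _ hq']
  exact lintegral_liminf_le fun n => (hA n).pow_const _

section

variable {d : ℕ} {q r : ℝ≥0∞}

theorem mixedNorm_le_liminf {A : Set (Rd d)} {J : Set ℝ} {S : ℕ → Rd d → ℝ → ℂ} {F : Rd d → ℝ → ℂ}
    (hS : ∀ n, StronglyMeasurable (Function.uncurry (S n)))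
    (h : ∀ᵐ x ∂(volume.restrict A), ∀ᵐ t ∂(volume.restrict J),
      Tendsto (fun n => S n x t) atTop (𝓝 (F x t))) :
    mixedNorm q r A J F ≤ liminf (fun n => mixedNorm q r A J (S n)) atTop := by
  unfold mixedNorm
  refine le_trans (eLpNorm_mono_enorm_ae ?_)
    (eLpNorm_liminf_le (fun n => measurable_eLpNorm_right (hS n) r) q)
  filter_upwards [h] with x hx
  simp only [enorm_eq_self]
  exact Lp.eLpNorm_lim_le_liminf_eLpNorm
    (fun n => ((hS n).comp_measurable measurable_prodMk_left).aestronglyMeasurable) _ hx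

theorem measurable_ofReal_polyWeight :
    Measurable fun x : Rd d => ENNReal.ofReal (polyWeight 1 0 x) := by
  unfold polyWeight
  fun_prop

/-- The mixed norm controls a weighted L¹ norm on space-time, by Hölder in `t` on an interval of
length 2 and against the weight in `x`. In this space absolute convergence and Fubini are available.
-/
theorem lintegral_polyWeight_mul_enorm_le (hq : 1 ≤ q) (hr : 1 ≤ r) {F : Rd d → ℝ → ℂ}
    (hF : StronglyMeasurable (Function.uncurry F)) :
    ∫⁻ x, ∫⁻ t in Icc (-1 : ℝ) 1, ENNReal.ofReal (polyWeight 1 0 x) * ‖F x t‖ₑ ≤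
      (1 + polyMass d) * 2 * mixedNorm q r univ (Icc (-1) 1) F := by
  have hr2 : (1 : ℝ) / (1 : ℝ≥0∞).toReal - 1 / r.toReal ≤ 1 := by
    simp
  have h1 : ∀ x, ∫⁻ t in Icc (-1 : ℝ) 1, ENNReal.ofReal (polyWeight 1 0 x) * ‖F x t‖ₑ ≤
      ENNReal.ofReal (polyWeight 1 0 x) * (2 * eLpNorm (F x) r (volume.restrict (Icc (-1) 1))) := by
    intro x
    rw [lintegral_const_mul' _ _ ENNReal.ofReal_ne_top]
    refine mul_le_mul' le_rfl ?_
    rw [← eLpNorm_one_eq_lintegral_enorm]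
    refine (eLpNorm_le_eLpNorm_mul_rpow_measure_univ hr
      ((hF.comp_measurable measurable_prodMk_left).aestronglyMeasurable)).trans ?_
    rw [mul_comm]
    refine mul_le_mul' ?_ le_rfl
    rw [Measure.restrict_apply_univ, Real.volume_Icc]
    norm_num only
    rw [show ENNReal.ofReal 2 = 2 by simp]
    calc (2 : ℝ≥0∞) ^ (1 / (1 : ℝ≥0∞).toReal - 1 / r.toReal) ≤ 2 ^ (1 : ℝ) :=
          ENNReal.rpow_le_rpow_of_exponent_le (by norm_num) hr2
      _ = 2 := ENNReal.rpow_one _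
  refine (lintegral_mono h1).trans ?_
  have hm := (measurable_eLpNorm_right (μ := volume.restrict (Icc (-1 : ℝ) 1)) hF r)
  refine (lintegral_polyWeight_mul_le hq le_rfl 0 (hm.const_mul 2).aemeasurable).trans ?_
  rw [eLpNorm_ennreal_const_mul (by norm_num), one_pow, ENNReal.ofReal_one, one_mul]
  simp only [mixedNorm, Measure.restrict_univ]
  rw [mul_assoc]

theorem SchwartzMap.exists_norm_le_polyWeight (φ : 𝓢(Rd d, ℂ)) :
    ∃ C : ℝ, 0 ≤ C ∧ ∀ x, ‖φ x‖ ≤ C * polyWeight 1 0 x := by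
  obtain ⟨C, hC0, hC⟩ := exists_norm_osc_le_of_abs_le (𝓕 φ) (d + 1) 0
  refine ⟨C, hC0, fun x => ?_⟩
  have h := hC 0 (by simp) x
  rw [osc_zero, fourierInv_fourier_eq] at h
  rw [polyWeight, ← div_eq_mul_inv, le_div_iff₀ (by positivity)]
  simpa using h

theorem lintegral_polyWeight_mul_tsum_ne_top (hq : 1 ≤ q) (hr : 1 ≤ r) {B : ℕ → Rd d → ℝ → ℂ}
    (hB : ∀ n, StronglyMeasurable (Function.uncurry (B n)))
    (hsum : ∑' n, mixedNorm q r univ (Icc (-1) 1) (B n) ≠ ⊤) :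
    ∫⁻ x, ∫⁻ t in Icc (-1 : ℝ) 1, ENNReal.ofReal (polyWeight 1 0 x) * ∑' n, ‖B n x t‖ₑ ≠ ⊤ := by
  have hwm : Measurable fun x : Rd d => ENNReal.ofReal (polyWeight 1 0 x) :=
    measurable_ofReal_polyWeight
  have hm : ∀ n, Measurable
      (Function.uncurry fun x t => ENNReal.ofReal (polyWeight 1 0 x) * ‖B n x t‖ₑ) := fun n =>
    (hwm.comp measurable_fst).mul (hB n).enorm
  have hs : ∀ n x, Measurable fun t => ENNReal.ofReal (polyWeight 1 0 x) * ‖B n x t‖ₑ :=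
    fun n x => (hm n).of_uncurry_left
  have hi : ∀ n, Measurable fun x =>
      ∫⁻ t in Icc (-1 : ℝ) 1, ENNReal.ofReal (polyWeight 1 0 x) * ‖B n x t‖ₑ := fun n =>
    (hm n).lintegral_prod_right
  have e : ∀ x, ∫⁻ t in Icc (-1 : ℝ) 1, ENNReal.ofReal (polyWeight 1 0 x) * ∑' n, ‖B n x t‖ₑ =
      ∑' n, ∫⁻ t in Icc (-1 : ℝ) 1, ENNReal.ofReal (polyWeight 1 0 x) * ‖B n x t‖ₑ := fun x => by
    rw [← lintegral_tsum fun n => (hs n x).aemeasurable]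
    simp only [ENNReal.tsum_mul_left]
  simp_rw [e]
  rw [lintegral_tsum fun n => (hi n).aemeasurable]
  refine ne_top_of_le_ne_top ?_ (ENNReal.tsum_le_tsum fun n =>
    lintegral_polyWeight_mul_enorm_le hq hr (hB n))
  rw [ENNReal.tsum_mul_left]
  exact ENNReal.mul_ne_top (ENNReal.mul_ne_top (ENNReal.add_ne_top.2
    ⟨ENNReal.one_ne_top, polyMass_ne_top d⟩) (by norm_num)) hsum

/-- A series of functions with summable mixed norms converges, also in the sense of tempered
distributions at almost every time. -/
theorem exists_limit_of_tsum_mixedNorm_ne_top (hq : 1 ≤ q) (hr : 1 ≤ r) {B : ℕ → Rd d → ℝ → ℂ}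
    (hB : ∀ n, StronglyMeasurable (Function.uncurry (B n)))
    (hsum : ∑' n, mixedNorm q r univ (Icc (-1) 1) (B n) ≠ ⊤) :
    ∃ F : Rd d → ℝ → ℂ, StronglyMeasurable (Function.uncurry F) ∧
      mixedNorm q r univ (Icc (-1) 1) F ≤ liminf (fun n => mixedNorm q r univ (Icc (-1) 1)
        fun x t => ∑ k ∈ Finset.range n, B k x t) atTop ∧
      ∀ᵐ t ∂(volume.restrict (Icc (-1 : ℝ) 1)), ∀ φ : 𝓢(Rd d, ℂ),
        Tendsto (fun n => ∫ x, φ x * ∑ k ∈ Finset.range n, B k x t) atTop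
          (𝓝 (∫ x, φ x * F x t)) := by
  have hfin := lintegral_polyWeight_mul_tsum_ne_top hq hr hB hsum
  have hS : ∀ n, StronglyMeasurable
      (Function.uncurry fun x t => ∑ k ∈ Finset.range n, B k x t) := fun n =>
    Finset.stronglyMeasurable_fun_sum (Finset.range n) fun k _ => hB k
  obtain ⟨M, hM⟩ : ∃ M : Rd d → ℝ → ℝ≥0∞, ∀ x t, M x t = ∑' n, ‖B n x t‖ₑ := ⟨_, fun _ _ => rfl⟩
  obtain ⟨w, hw⟩ : ∃ w : Rd d → ℝ≥0∞, ∀ x, w x = ENNReal.ofReal (polyWeight 1 0 x) :=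
    ⟨_, fun _ => rfl⟩
  simp_rw [← hM, ← hw] at hfin
  have hMm : Measurable (Function.uncurry M) := by
    have : Function.uncurry M = fun z => ∑' n, ‖Function.uncurry (B n) z‖ₑ :=
      funext fun z => hM z.1 z.2
    rw [this]
    exact Measurable.tsum fun n => (hB n).enorm
  have hwm : Measurable w := by
    rw [funext hw]
    exact measurable_ofReal_polyWeight
  have hw0 : ∀ x, w x ≠ 0 := fun x => by
    rw [hw, ne_eq, ENNReal.ofReal_eq_zero, not_le]
    exact polyWeight_pos one_pos _ _
  have hwM : Measurable (Function.uncurry fun x t => w x * M x t) :=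
    (hwm.comp measurable_fst).mul hMm
  have hconv : ∀ x t, M x t ≠ ⊤ → Tendsto (fun n => ∑ k ∈ Finset.range n, B k x t) atTop
      (𝓝 (limUnder atTop fun n => ∑ k ∈ Finset.range n, B k x t)) := fun x t hxt => by
    refine (cauchySeq_of_edist_le_of_tsum_ne_top (fun n => ‖B n x t‖ₑ) (fun n => ?_)
      (by rwa [hM] at hxt)).tendsto_limUnder
    rw [edist_comm, edist_eq_enorm_sub, Nat.succ_eq_add_one, Finset.sum_range_succ,
      add_sub_cancel_left]
  have hSM : ∀ n x t, ‖∑ k ∈ Finset.range n, B k x t‖ₑ ≤ M x t := fun n x t => by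
    rw [hM]
    exact (enorm_sum_le _ _).trans (ENNReal.sum_le_tsum _)
  have hdiv : ∀ x t, w x * M x t < ⊤ → M x t ≠ ⊤ := fun x t h hxt => by
    rw [hxt, ENNReal.mul_top (hw0 x)] at h
    exact lt_irrefl _ h
  have hae_x : ∀ᵐ x : Rd d, ∀ᵐ t ∂(volume.restrict (Icc (-1 : ℝ) 1)), M x t ≠ ⊤ := by
    have h1 := ae_lt_top hwM.lintegral_prod_right' hfin
    filter_upwards [h1] with x hx
    have h2 := ae_lt_top (hwM.comp measurable_prodMk_left) hx.ne
    filter_upwards [h2] with t ht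
    exact hdiv x t ht
  -- The order of integration `x`, then `t` was used for the norm. In the other order, for almost
  -- every `t` the majorant is integrable against the weight, hence against every Schwartz function,
  -- with one exceptional set of times for all of them.
  rw [lintegral_lintegral_swap hwM.aemeasurable] at hfin
  have hlim : StronglyMeasurable fun z : Rd d × ℝ =>
      limUnder atTop fun n => ∑ k ∈ Finset.range n, B k z.1 z.2 := StronglyMeasurable.limUnder hS
  refine ⟨fun x t => limUnder atTop fun n => ∑ k ∈ Finset.range n, B k x t, hlim, ?_, ?_⟩
  · refine mixedNorm_le_liminf hS ?_
    rw [Measure.restrict_univ]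
    filter_upwards [hae_x] with x hx
    filter_upwards [hx] with t ht
    exact hconv x t ht
  · have h1 := ae_lt_top hwM.lintegral_prod_left' hfin
    filter_upwards [h1] with t ht φ
    have hwt : Measurable fun x => w x * M x t := hwM.comp measurable_prodMk_right
    have h2 : ∀ᵐ x : Rd d, M x t ≠ ⊤ := by
      filter_upwards [ae_lt_top hwt ht.ne] with x hx
      exact hdiv x t hx
    obtain ⟨C, hC0, hC⟩ := φ.exists_norm_le_polyWeight
    refine tendsto_integral_of_dominated_convergence (fun x => C * (w x * M x t).toReal)
      (fun n => φ.continuous.aestronglyMeasurable.mul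
        ((hS n).comp_measurable measurable_prodMk_right).aestronglyMeasurable)
      ((integrable_toReal_of_lintegral_ne_top hwt.aemeasurable ht.ne).const_mul C)
      (fun n => ?_) ?_
    · filter_upwards [h2] with x hx
      rw [norm_mul, ENNReal.toReal_mul, ← mul_assoc]
      refine mul_le_mul ?_ ?_ (norm_nonneg _) (mul_nonneg hC0 ENNReal.toReal_nonneg)
      · rw [hw, ENNReal.toReal_ofReal (polyWeight_pos one_pos _ _).le]
        exact hC x
      · rw [← toReal_enorm]
        exact ENNReal.toReal_mono hx (hSM n x t)
    · filter_upwards [h2] with x hx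
      exact (hconv x t hx).const_mul _

end

theorem integrable_mul_evol {d : ℕ} {p : ℝ≥0∞} (hp : 1 ≤ p) (Φ φ : 𝓢(Rd d, ℂ)) (t : ℝ)
    {g : Rd d → ℂ} (hg : MemLp g p volume) : Integrable fun x => φ x * evol Φ t g x := by
  refine (integrable_mul_osc_mul hp Φ φ (-4 * Real.pi ^ 2 * t) hg).integral_prod_left.congr
    (Eventually.of_forall fun x => ?_)
  exact integral_const_mul (φ x) fun y => osc Φ (-4 * Real.pi ^ 2 * t) (x - y) * g y

theorem besovNorm_le_one {d : ℕ} {χ : Rd d → ℝ} {p : ℝ≥0∞} {γ ν : ℝ} (hν : 0 < ν)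
    {f : 𝓢'(Rd d, ℂ)} (hf : besovNorm χ p γ ν f ≤ 1) :
    (∑' k : ℕ, (ENNReal.ofReal ((2 : ℝ) ^ ((k : ℝ) * γ)) * distLpNorm p (lpProj χ k f)) ^ ν) ≤ 1 ∧
      ∀ k, distLpNorm p (lpProj χ k f) ≠ ⊤ := by
  have h1 : (∑' k : ℕ, (ENNReal.ofReal ((2 : ℝ) ^ ((k : ℝ) * γ)) *
      distLpNorm p (lpProj χ k f)) ^ ν) ≤ 1 := by
    unfold besovNorm at hf
    rwa [← ENNReal.one_rpow (1 / ν), ENNReal.rpow_le_rpow_iff (by positivity)] at hf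
  refine ⟨h1, fun k hk => ?_⟩
  have h2 := (ENNReal.le_tsum k).trans h1
  rw [hk, ENNReal.mul_top, ENNReal.top_rpow_of_pos hν] at h2
  · exact absurd h2 (by simp)
  · rw [ne_eq, ENNReal.ofReal_eq_zero, not_le]
    positivity

theorem ENNReal.exists_strictMono_tsum_le {a : ℕ → ℝ≥0∞} (ha : ∑' k, a k ≠ ⊤) {ε : ℕ → ℝ≥0∞}
    (hε : ∀ i, ε i ≠ 0) : ∃ N : ℕ → ℕ, StrictMono N ∧
      ∀ i n, ∑ k ∈ Finset.Ico (N i) n, a k ≤ ε i := by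
  have ht := ENNReal.tendsto_sum_nat_add a ha
  obtain ⟨N, hN, h⟩ := extraction_forall_of_eventually
    (P := fun i n => ∑' k, a (k + n) ≤ ε i) fun i =>
      (ht.eventually_lt_const (pos_iff_ne_zero.2 (hε i))).mono fun n hn => hn.le
  refine ⟨N, hN, fun i n => (le_trans ?_ (h i))⟩
  rw [Finset.sum_Ico_eq_sum_range]
  simp_rw [add_comm (N i)]
  exact ENNReal.sum_le_tsum _

/-! ### From the extension bound to the Besov bound. -/

/-- For ν > 1 the mixed norms of the pieces need not be summable, so the pieces are grouped into
blocks of geometrically decreasing norm. The limit function is identified with e^{itΔ}f by comparing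
two limits of the same partial sums, and its norm is bounded by Fatou using only the uniform bound
for partial sums. -/
theorem ExtensionBound.schrodingerBound {d : ℕ} {χ : Rd d → ℝ} {p q r : ℝ≥0∞} {β ν : ℝ}
    (hp : 1 ≤ p) (hpq : p ≤ q) (hq : 2 ≤ q)
    (hr : 2 ≤ r) (hE : ExtensionBound d p q r β)
    (hβ : 0 < (d : ℝ) / 2 - d * (p⁻¹).toReal + β)
    (hχ : IsLPCutoff χ) (hν : 0 < ν) (hν' : ν ≤ 1 ∨ (r < ⊤ ∧ ν ≤ 2)) :
    SchrodingerBound χ p q r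
      ((d : ℝ) * (1 - (p⁻¹).toReal - (q⁻¹).toReal) - 2 * (r⁻¹).toReal + 2 * β) ν := by
  obtain ⟨C, hC, H⟩ := hE.exists_sum_Ico_le hp hpq hq hr hβ hχ hν hν'
  set γ := (d : ℝ) * (1 - (p⁻¹).toReal - (q⁻¹).toReal) - 2 * (r⁻¹).toReal + 2 * β with hγ
  refine lt_of_le_of_lt (iSup₂_le fun f hf => ?_) hC.lt_top
  obtain ⟨hsum, hfin⟩ := besovNorm_le_one hν hf
  choose g hg hgT hgn using fun k => exists_of_distLpNorm_ne_top hp (hfin k)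
  simp_rw [← hgn] at hsum
  set a : ℕ → ℝ≥0∞ := fun k =>
    (ENNReal.ofReal ((2 : ℝ) ^ ((k : ℝ) * γ)) * eLpNorm (g k) p volume) ^ ν with ha
  -- The tail of the ν-th powers is made smaller than 2^{-iν}, which makes the i-th tail block have
  -- mixed norm at most C 2^{-i}.
  have hε : ∀ i : ℕ, (((2 : ℝ≥0∞)⁻¹) ^ i) ^ ν ≠ 0 := fun i => by
    simp [ENNReal.rpow_eq_zero_iff, hν.not_gt]
  obtain ⟨N, hN, hNa⟩ := ENNReal.exists_strictMono_tsum_le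
    (ne_top_of_le_ne_top ENNReal.one_ne_top hsum) hε
  have hb : ∀ m n, mixedNorm q r univ (Icc (-1) 1)
      (fun x t => ∑ k ∈ Finset.Ico m n, evol (hχ.fatPiece k) t (g k) x) ≤
      C * (∑ k ∈ Finset.Ico m n, a k) ^ (1 / ν) := H g hg
  obtain ⟨n, hn0, hns⟩ : ∃ n : ℕ → ℕ, n 0 = 0 ∧ ∀ i, n (i + 1) = N i :=
    ⟨fun i => Nat.casesOn i 0 N, rfl, fun _ => rfl⟩
  have hmono : Monotone n := monotone_nat_of_le_succ fun i => by
    cases i with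
    | zero => rw [hn0]; exact Nat.zero_le _
    | succ i => rw [hns, hns]; exact hN.monotone (Nat.le_succ i)
  have htop : Tendsto n atTop atTop := by
    rw [← tendsto_add_atTop_iff_nat 1]
    simp_rw [hns]
    exact hN.tendsto_atTop
  set B : ℕ → Rd d → ℝ → ℂ := fun i x t =>
    ∑ k ∈ Finset.Ico (n i) (n (i + 1)), evol (hχ.fatPiece k) t (g k) x with hB
  have hBm : ∀ i, StronglyMeasurable (Function.uncurry (B i)) := fun i => by
    have : StronglyMeasurable fun z : Rd d × ℝ =>
        ∑ k ∈ Finset.Ico (n i) (n (i + 1)), evol (hχ.fatPiece k) z.2 (g k) z.1 :=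
      Finset.stronglyMeasurable_fun_sum _ fun k _ => stronglyMeasurable_evol _ (hg k).1
    exact this
  have hBsum : ∀ i x t, ∑ j ∈ Finset.range i, B j x t =
      ∑ k ∈ Finset.Ico 0 (n i), evol (hχ.fatPiece k) t (g k) x := fun i x t => by
    induction i with
    | zero => simp [hn0]
    | succ i ih =>
      rw [Finset.sum_range_succ, ih]
      exact Finset.sum_Ico_consecutive _ (Nat.zero_le _) (hmono (Nat.le_succ i))
  have hB1 : ∀ i, mixedNorm q r univ (Icc (-1) 1) (B (i + 1)) ≤ C * (2 : ℝ≥0∞)⁻¹ ^ i := fun i => by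
    refine (hb _ _).trans (mul_le_mul' le_rfl ?_)
    rw [hns, ← ENNReal.rpow_le_rpow_iff hν, ← ENNReal.rpow_mul, one_div_mul_cancel hν.ne',
      ENNReal.rpow_one]
    exact hNa i _
  have hbC : ∀ m, mixedNorm q r univ (Icc (-1) 1)
      (fun x t => ∑ k ∈ Finset.Ico 0 m, evol (hχ.fatPiece k) t (g k) x) ≤ C := fun m => by
    refine (hb _ _).trans (mul_le_of_le_one_right' ?_)
    refine (ENNReal.rpow_le_rpow ((ENNReal.sum_le_tsum _).trans hsum) (by positivity)).trans ?_
    rw [ENNReal.one_rpow]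
  have hBtop : ∑' i, mixedNorm q r univ (Icc (-1) 1) (B i) ≠ ⊤ := by
    rw [tsum_eq_zero_add' ENNReal.summable]
    refine ENNReal.add_ne_top.2 ⟨ne_top_of_le_ne_top hC ?_,
      ne_top_of_le_ne_top ?_ (ENNReal.tsum_le_tsum hB1)⟩
    · simpa only [hB, hn0] using hbC (n (0 + 1))
    · rw [ENNReal.tsum_mul_left, ENNReal.tsum_geometric, ENNReal.one_sub_inv_two, inv_inv]
      exact ENNReal.mul_ne_top hC (by norm_num)
  obtain ⟨F, hFm, hFle, hF⟩ := exists_limit_of_tsum_mixedNorm_ne_top (hp.trans hpq)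
    (le_trans (by norm_num) hr) hBm hBtop
  simp_rw [hBsum] at hFle hF
  have hsol : IsSolution f F := by
    refine ⟨hFm.aestronglyMeasurable, ?_⟩
    filter_upwards [hF] with t ht φ
    have h1 := (hχ.tendsto_sum_lpProj (schrodinger t f) φ).comp htop
    refine tendsto_nhds_unique h1 ((ht φ).congr fun i => ?_)
    simp_rw [Finset.mul_sum]
    rw [integral_finsetSum _ fun k _ => integrable_mul_evol hp _ φ t (hg k), ← Finset.range_eq_Ico,
      Function.comp_apply, sum_apply]
    refine Finset.sum_congr rfl fun k _ => ?_
    rw [← hχ.isGivenBy_schrodinger_lpProj hp k (hg k) (hgT k) t φ]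
    unfold lpProj
    rw [schrodinger_multOp (hχ.lpSymbol_hasTemperateGrowth k)]
  refine (iInf₂_le F hsol).trans (hFle.trans ?_)
  refine (liminf_le_liminf (Eventually.of_forall fun i => hbC (n i))).trans ?_
  rw [liminf_const]

/-! ### Besov norms of functions with frequencies of a single size. -/

section

variable {d : ℕ} {p q r : ℝ≥0∞}

theorem memLp_evol (hp : 1 ≤ p) (Φ : 𝓢(Rd d, ℂ)) (t : ℝ) {g : Rd d → ℂ} (hg : MemLp g p volume) :
    MemLp (evol Φ t g) p volume := by
  refine ⟨((stronglyMeasurable_evol Φ hg.1).comp_measurable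
    measurable_prodMk_right).aestronglyMeasurable, ?_⟩
  refine (eLpNorm_convolution_le hp (continuous_osc_right Φ (-4 * Real.pi ^ 2 * t)) hg.1).trans_lt
    (ENNReal.mul_lt_top ?_ hg.2)
  have e : osc Φ (-4 * Real.pi ^ 2 * t) =
      ⇑(𝓕⁻ (SchwartzMap.smulLeftCLM ℂ (chirp (-4 * Real.pi ^ 2 * t)) Φ) : 𝓢(Rd d, ℂ)) :=
    funext fun z => osc_eq_fourierInv Φ _ z
  rw [e]
  exact (SchwartzMap.integrable _).2

theorem eLpNorm_evol_zero_le (hp : 1 ≤ p) (Φ : 𝓢(Rd d, ℂ)) {g : Rd d → ℂ}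
    (hg : MemLp g p volume) :
    eLpNorm (evol Φ 0 g) p volume ≤ (∫⁻ y, ‖𝓕⁻ Φ y‖ₑ) * eLpNorm g p volume := by
  have e : evol Φ 0 g = fun x => ∫ y, 𝓕⁻ Φ (x - y) * g y := by
    funext x
    simp only [evol, mul_zero, osc_zero]
  rw [e]
  exact eLpNorm_convolution_le hp (𝓕⁻ Φ).continuous hg.1

/-- Dilation invariance of the L¹ norm of the kernels, which by Young's inequality bounds the P_k on
L^p uniformly in k. -/
theorem lintegral_enorm_fourierInv_dilate {μ : ℝ} (hμ : 0 < μ) (Φ : 𝓢(Rd d, ℂ)) :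
    ∫⁻ y, ‖𝓕⁻ (dilate μ hμ.ne' Φ) y‖ₑ = ∫⁻ y, ‖𝓕⁻ Φ y‖ₑ := by
  rw [lintegral_comp_affine 0 hμ fun y => ‖𝓕⁻ Φ y‖ₑ, ← lintegral_const_mul' _ _ ENNReal.ofReal_ne_top]
  refine lintegral_congr fun y => ?_
  rw [← osc_zero, osc_dilate hμ, mul_zero, osc_zero, enorm_mul, zero_add, ← ofReal_norm,
    Complex.norm_real, Real.norm_of_nonneg (by positivity)]

theorem exists_isGivenBy (hp : 1 ≤ p) {h : Rd d → ℂ} (hh : MemLp h p volume) :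
    ∃ T : 𝓢'(Rd d, ℂ), IsGivenBy T h := by
  have : Fact (1 ≤ p) := ⟨hp⟩
  refine ⟨Lp.toTemperedDistribution (hh.toLp h), fun φ => ?_⟩
  rw [Lp.toTemperedDistribution_apply]
  refine integral_congr_ae ?_
  filter_upwards [hh.coeFn_toLp] with x hx
  rw [hx, smul_eq_mul]

theorem multOp_zero (T : 𝓢'(Rd d, ℂ)) : multOp (fun _ => 0) T = 0 := by
  unfold multOp
  rw [TemperedDistribution.fourierMultiplierCLM_const, zero_smul, zero_apply]

theorem distLpNorm_zero : distLpNorm p (0 : 𝓢'(Rd d, ℂ)) = 0 := by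
  have h : IsGivenBy (0 : 𝓢'(Rd d, ℂ)) (0 : Rd d → ℂ) := fun φ => by simp
  simpa using distLpNorm_le (p := p) h MemLp.zero

end

section

variable {d : ℕ} {χ : Rd d → ℝ} {p : ℝ≥0∞}

theorem IsLPCutoff.exists_schwartz_lpSymbol (hχ : IsLPCutoff χ) :
    ∃ Θ : ℕ → 𝓢(Rd d, ℂ), (∀ k ξ, ((lpSymbol χ k ((2 * Real.pi) • ξ) : ℝ) : ℂ) = Θ k ξ) ∧
      ∃ C : ℝ≥0∞, C ≠ ⊤ ∧ ∀ k, ∫⁻ y, ‖𝓕⁻ (Θ k) y‖ₑ ≤ C := by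
  have h2 : 0 < 2 * Real.pi := Real.two_pi_pos
  have h4 : 0 < 4 * Real.pi := by positivity
  set θ := hχ.schwartz h2 - hχ.schwartz h4 with hθ
  refine ⟨fun k => Nat.casesOn k (hχ.schwartz h2) fun k =>
    dilate ((2 : ℝ) ^ (k + 1)) (by positivity) θ, fun k ξ => ?_,
    (∫⁻ y, ‖𝓕⁻ (hχ.schwartz h2) y‖ₑ) + ∫⁻ y, ‖𝓕⁻ θ y‖ₑ,
    ENNReal.add_ne_top.2 ⟨(SchwartzMap.integrable _).2.ne, (SchwartzMap.integrable _).2.ne⟩,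
    fun k => ?_⟩
  · cases k with
    | zero => rfl
    | succ k =>
      simp only [dilate_apply, hθ, sub_apply, hχ.schwartz_apply, lpSymbol]
      have e1 : (((2 : ℝ) ^ (k + 1))⁻¹ • (2 * Real.pi) • ξ) =
          (2 * Real.pi) • ((2 : ℝ) ^ (k + 1))⁻¹ • ξ := smul_comm _ _ _
      have e2 : (((2 : ℝ) ^ k)⁻¹ • (2 * Real.pi) • ξ) =
          (4 * Real.pi) • ((2 : ℝ) ^ (k + 1))⁻¹ • ξ := by
        rw [smul_smul, smul_smul, pow_succ, mul_inv]
        congr 1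
        ring
      rw [e1, e2, Complex.ofReal_sub]
  · cases k with
    | zero => exact le_self_add
    | succ k => exact (lintegral_enorm_fourierInv_dilate
      (by positivity : (0 : ℝ) < 2 ^ (k + 1)) θ).le.trans le_add_self

theorem IsLPCutoff.lpSymbol_eq_zero_of_le (hχ : IsLPCutoff χ) {k : ℕ} {ξ : Rd d}
    (h : (2 : ℝ) ^ (k + 1) ≤ ‖ξ‖) : lpSymbol χ k ξ = 0 := by
  cases k with
  | zero => exact hχ.eq_zero ξ (by simpa using h)
  | succ k =>
    rw [lpSymbol, hχ.eq_zero, hχ.eq_zero, sub_zero]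
    · rw [norm_smul, norm_inv, norm_pow, Real.norm_ofNat, ← div_eq_inv_mul,
        le_div_iff₀ (by positivity)]
      refine le_trans (le_of_eq (by ring)) ((pow_le_pow_right₀ (by norm_num : (1 : ℝ) ≤ 2)
        (by lia : k + 1 ≤ k + 1 + 1)).trans h)
    · rw [norm_smul, norm_inv, norm_pow, Real.norm_ofNat, ← div_eq_inv_mul,
        le_div_iff₀ (by positivity)]
      exact le_trans (le_of_eq (by ring)) h

theorem IsLPCutoff.lpSymbol_succ_eq_zero_of_le (hχ : IsLPCutoff χ) {k : ℕ} {ξ : Rd d}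
    (h : ‖ξ‖ ≤ (2 : ℝ) ^ k) : lpSymbol χ (k + 1) ξ = 0 := by
  rw [lpSymbol, hχ.eq_one, hχ.eq_one, sub_self]
  · rw [norm_smul, norm_inv, norm_pow, Real.norm_ofNat, ← div_eq_inv_mul,
      div_le_one₀ (by positivity)]
    exact h
  · rw [norm_smul, norm_inv, norm_pow, Real.norm_ofNat, ← div_eq_inv_mul,
      div_le_one₀ (by positivity)]
    exact h.trans (pow_le_pow_right₀ (by norm_num) (Nat.le_succ k))

theorem ENNReal.tsum_le_of_forall_le {a : ℕ → ℝ≥0∞} {A : ℝ≥0∞} (hA : ∀ k, a k ≤ A) {n : ℕ}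
    (hn : ∀ k l, a k ≠ 0 → a l ≠ 0 → l < k + n) : ∑' k, a k ≤ n * A := by
  by_cases h : ∃ k, a k ≠ 0
  · classical
    set k₀ := Nat.find h with hk₀
    rw [tsum_eq_sum (s := Finset.Ico k₀ (k₀ + n)) fun k hk => ?_]
    · refine (Finset.sum_le_card_nsmul _ _ A fun k _ => hA k).trans ?_
      simp
    · by_contra hak
      exact hk (Finset.mem_Ico.2 ⟨Nat.find_min' h hak, hn _ _ (Nat.find_spec h) hak⟩)
  · push Not at h
    simp [h]

theorem rpow_le_add_rpow_of_mem_Icc {α β x γ : ℝ} (hα : 0 < α) (hx : x ∈ Icc α β) :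
    x ^ γ ≤ α ^ γ + β ^ γ := by
  have hx0 := hα.trans_le hx.1
  rcases le_total 0 γ with h | h
  · exact (Real.rpow_le_rpow hx0.le hx.2 h).trans
      (le_add_of_nonneg_left (Real.rpow_nonneg hα.le γ))
  · exact (Real.rpow_le_rpow_of_nonpos hα hx.1 h).trans
      (le_add_of_nonneg_right (Real.rpow_nonneg (hx0.le.trans hx.2) γ))

/-- The Besov norm of a function whose frequencies are comparable to `R`. -/
theorem IsLPCutoff.exists_besovNorm_multOp_le (hχ : IsLPCutoff χ) (hp : 1 ≤ p) {ν : ℝ}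
    (hν : 0 < ν) (γ : ℝ) (ψ : 𝓢(Rd d, ℂ)) {a b : ℝ} (ha : 0 < a) (hb : 0 < b)
    (hψ : ∀ ξ, (‖ξ‖ < a ∨ b < ‖ξ‖) → ψ ξ = 0) : ∃ C : ℝ≥0∞, C ≠ ⊤ ∧ ∀ (R : ℝ) (_ : 1 ≤ R)
      (hR0 : R ≠ 0) (h : Rd d → ℂ) (T : 𝓢'(Rd d, ℂ)), MemLp h p volume → IsGivenBy T h →
      besovNorm χ p γ ν (multOp (fun ξ => dilate R hR0 ψ ((2 * Real.pi)⁻¹ • ξ)) T) ≤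
        C * ENNReal.ofReal (R ^ γ) * eLpNorm h p volume := by
  obtain ⟨Θ, hΘ, C₁, hC₁, hΘC⟩ := hχ.exists_schwartz_lpSymbol
  have hpi := Real.pi_pos
  -- The multiplier lives on 2πRa ≤ |ξ| ≤ 2πRb, and the k-th symbol, for k ≥ 1, on 2^{k-1} ≤ |ξ| ≤
  -- 2^{k+1}. They meet only if Rα ≤ 2^k ≤ Rβ; the summand 1 in `β` accommodates k = 0.
  set α := Real.pi * a with hα
  set β := 1 + 4 * Real.pi * b with hβ
  have hα0 : 0 < α := by positivity
  have hβ0 : 0 < β := by positivity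
  -- Since 2^n > β/α, at most `n` consecutive indices are active, uniformly in `R`.
  obtain ⟨n, hn⟩ := pow_unbounded_of_one_lt (β / α) (by norm_num : (1 : ℝ) < 2)
  set M := α ^ γ + β ^ γ with hM
  have hM0 : 0 ≤ M := by positivity
  set I := ∫⁻ y, ‖𝓕⁻ ψ y‖ₑ with hI
  have hItop : I ≠ ⊤ := (SchwartzMap.integrable _).2.ne
  refine ⟨(n : ℝ≥0∞) ^ (1 / ν) * ENNReal.ofReal M * (C₁ * I), ENNReal.mul_ne_top
    (ENNReal.mul_ne_top (ENNReal.rpow_ne_top_of_nonneg (by positivity) (ENNReal.natCast_ne_top n))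
    ENNReal.ofReal_ne_top) (ENNReal.mul_ne_top hC₁ hItop), fun R hR hR0 h T hh hT => ?_⟩
  have hRpos : 0 < R := by linarith
  set m : Rd d → ℂ := fun ξ => dilate R hR0 ψ ((2 * Real.pi)⁻¹ • ξ) with hm
  have hmψ : ∀ ξ, m ((2 * Real.pi) • ξ) = dilate R hR0 ψ ξ := fun ξ => by
    simp only [hm]
    rw [inv_smul_smul₀ Real.two_pi_pos.ne']
  have hmt : (fun ξ => m ((2 * Real.pi) • ξ)).HasTemperateGrowth := by
    rw [funext hmψ]
    exact SchwartzMap.hasTemperateGrowth _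
  set g := evol (dilate R hR0 ψ) 0 h with hg
  have hgT : IsGivenBy (multOp m T) g := isGivenBy_multOp hp hT hh _ hmψ
  have hgp : MemLp g p volume := memLp_evol hp _ 0 hh
  have hgle : eLpNorm g p volume ≤ I * eLpNorm h p volume := by
    rw [hI, ← lintegral_enorm_fourierInv_dilate hRpos]
    exact eLpNorm_evol_zero_le hp _ hh
  have hdist : ∀ k, distLpNorm p (lpProj χ k (multOp m T)) ≤ C₁ * I * eLpNorm h p volume :=
    fun k => by
      refine (distLpNorm_le (isGivenBy_multOp hp hgT hgp (Θ k) (hΘ k))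
        (memLp_evol hp _ 0 hgp)).trans ((eLpNorm_evol_zero_le hp _ hgp).trans ?_)
      rw [mul_assoc]
      exact mul_le_mul' (hΘC k) hgle
  have hzero : ∀ k, distLpNorm p (lpProj χ k (multOp m T)) ≠ 0 →
      R * α ≤ 2 ^ k ∧ (2 : ℝ) ^ k ≤ R * β := by
    intro k
    contrapose!
    intro hk
    have hz : (fun ξ => m ξ * ((lpSymbol χ k ξ : ℝ) : ℂ)) = fun _ => 0 := by
      funext ξ
      by_cases hξ : ‖R⁻¹ • (2 * Real.pi)⁻¹ • ξ‖ < a ∨ b < ‖R⁻¹ • (2 * Real.pi)⁻¹ • ξ‖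
      · simp only [hm]
        rw [dilate_apply, hψ _ hξ, zero_mul]
      · push Not at hξ
        have hnorm : ‖ξ‖ = R * (2 * Real.pi) * ‖R⁻¹ • (2 * Real.pi)⁻¹ • ξ‖ := by
          rw [norm_smul, norm_smul, Real.norm_of_nonneg (by positivity),
            Real.norm_of_nonneg (by positivity)]
          field_simp
        have h1 : R * (2 * Real.pi) * a ≤ ‖ξ‖ := by rw [hnorm]; gcongr; exact hξ.1
        have h2 : ‖ξ‖ ≤ R * (2 * Real.pi) * b := by rw [hnorm]; gcongr; exact hξ.2
        suffices lpSymbol χ k ξ = 0 by rw [this, Complex.ofReal_zero, mul_zero]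
        by_cases hk1 : R * α ≤ 2 ^ k
        · have hk2 := hk hk1
          cases k with
          | zero =>
            exfalso
            rw [pow_zero] at hk2
            have : 1 * 1 ≤ R * β := by
              refine mul_le_mul hR ?_ zero_le_one hRpos.le
              rw [hβ]
              have : 0 < 4 * Real.pi * b := by positivity
              linarith
            linarith
          | succ k =>
            refine hχ.lpSymbol_succ_eq_zero_of_le (h2.trans ?_)
            rw [pow_succ, hβ] at hk2
            nlinarith
        · refine hχ.lpSymbol_eq_zero_of_le (le_trans ?_ h1)
          push Not at hk1
          rw [hα] at hk1
          rw [pow_succ]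
          nlinarith
    unfold lpProj
    rw [multOp_multOp hmt (hχ.lpSymbol_hasTemperateGrowth k), hz, multOp_zero, distLpNorm_zero]
  set A := ENNReal.ofReal M * ENNReal.ofReal (R ^ γ) * (C₁ * I * eLpNorm h p volume) with hA
  have hterm : ∀ k : ℕ, (ENNReal.ofReal ((2 : ℝ) ^ ((k : ℝ) * γ)) *
      distLpNorm p (lpProj χ k (multOp m T))) ^ ν ≤ A ^ ν := fun k => by
    refine ENNReal.rpow_le_rpow ?_ hν.le
    by_cases hk : distLpNorm p (lpProj χ k (multOp m T)) = 0
    · rw [hk, mul_zero]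
      exact zero_le
    · refine mul_le_mul' ?_ (hdist k)
      rw [← ENNReal.ofReal_mul hM0]
      refine ENNReal.ofReal_le_ofReal ?_
      rw [Real.rpow_mul (by norm_num), Real.rpow_natCast]
      refine (rpow_le_add_rpow_of_mem_Icc (by positivity) (hzero k hk)).trans (le_of_eq ?_)
      rw [Real.mul_rpow hRpos.le hα0.le, Real.mul_rpow hRpos.le hβ0.le, hM]
      ring
  have hsum := ENNReal.tsum_le_of_forall_le hterm (n := n) fun k l hk hl => by
    have hne : ∀ k : ℕ, (ENNReal.ofReal ((2 : ℝ) ^ ((k : ℝ) * γ)) *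
        distLpNorm p (lpProj χ k (multOp m T))) ^ ν ≠ 0 →
        distLpNorm p (lpProj χ k (multOp m T)) ≠ 0 := fun k hk h0 => hk (by
      rw [h0, mul_zero, ENNReal.zero_rpow_of_pos hν])
    have hk1 := (hzero k (hne k hk)).1
    have hl1 := (hzero l (hne l hl)).2
    rw [← pow_lt_pow_iff_right₀ (by norm_num : (1 : ℝ) < 2), pow_add]
    refine hl1.trans_lt ?_
    rw [div_lt_iff₀ hα0] at hn
    calc R * β < R * (2 ^ n * α) := by gcongr
      _ = (R * α) * 2 ^ n := by ring
      _ ≤ 2 ^ k * 2 ^ n := by gcongr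
  unfold besovNorm
  refine (ENNReal.rpow_le_rpow hsum (by positivity)).trans (le_of_eq ?_)
  rw [ENNReal.mul_rpow_of_nonneg _ _ (by positivity), ← ENNReal.rpow_mul, mul_one_div_cancel hν.ne',
    ENNReal.rpow_one, hA]
  ring

end

/-! ### From the Besov bound to the extension bound. -/

section

variable {d : ℕ} {p q r : ℝ≥0∞}

/-- `solutionNorm` is an infimum over representatives, so every representative must be shown to
dominate `G`. At almost every time it does so almost everywhere by `IsGivenBy.norm_ae_le`; Fubini
turns this into the order of the mixed norm. -/
theorem mixedNorm_le_solutionNorm (hp : 1 ≤ p) {T : 𝓢'(Rd d, ℂ)} {G : Rd d → ℝ → ℂ}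
    (hGm : StronglyMeasurable (Function.uncurry G)) (hGp : ∀ t, MemLp (fun x => G x t) p volume)
    (hG : ∀ t, IsGivenBy (schrodinger t T) fun x => G x t) :
    mixedNorm q r univ (Icc (-1) 1) G ≤ solutionNorm q r T := by
  refine le_iInf₂ fun F hF => ?_
  obtain ⟨hFm, hFT⟩ := hF
  obtain ⟨F', hF'm, hFF'⟩ := hFm
  have hswap : ∀ᵐ t ∂(volume.restrict (Icc (-1 : ℝ) 1)), ∀ᵐ x : Rd d, F x t = F' (x, t) := by
    have h1 := Measure.ae_ae_of_ae_prod (Measure.measurePreserving_swap.quasiMeasurePreserving.ae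
      (f := Prod.swap) (μa := (volume.restrict (Icc (-1 : ℝ) 1)).prod (volume : Measure (Rd d))) hFF')
    exact h1
  have hle : ∀ᵐ t ∂(volume.restrict (Icc (-1 : ℝ) 1)), ∀ᵐ x : Rd d, ‖G x t‖ ≤ ‖F' (x, t)‖ := by
    filter_upwards [hswap, hFT] with t h1 h2
    exact (h2.congr h1).norm_ae_le (hG t)
      (hF'm.comp_measurable measurable_prodMk_right).aestronglyMeasurable
      ((hGp t).locallyIntegrable hp)
  have hset : MeasurableSet {z : Rd d × ℝ | ‖G z.1 z.2‖ ≤ ‖F' (z.1, z.2)‖} :=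
    measurableSet_le hGm.norm.measurable hF'm.norm.measurable
  rw [← Measure.ae_ae_comm hset] at hle
  unfold mixedNorm
  rw [Measure.restrict_univ]
  refine eLpNorm_mono_enorm_ae ?_
  filter_upwards [hle, Measure.ae_ae_of_ae_prod hFF'] with x hx hx'
  simp only [enorm_eq_self]
  refine eLpNorm_mono_ae ?_
  filter_upwards [hx, hx'] with t ht ht'
  have e : F x t = F' (x, t) := ht'
  rwa [e]

theorem evol_const_mul (Φ : 𝓢(Rd d, ℂ)) (t : ℝ) (c : ℂ) (h : Rd d → ℂ) (x : Rd d) :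
    evol Φ t (fun y => c * h y) x = c * evol Φ t h x := by
  unfold evol
  rw [← integral_const_mul]
  exact integral_congr_ae (Eventually.of_forall fun y => mul_left_comm _ _ _)

/-- Boundedness on the Besov space, at frequencies comparable to `R`. -/
theorem SchrodingerBound.exists_evol_dilate_le {χ : Rd d → ℝ} {γ ν : ℝ} (hχ : IsLPCutoff χ)
    (hp : 1 ≤ p) (hν : 0 < ν) (hS : SchrodingerBound χ p q r γ ν) (ψ : 𝓢(Rd d, ℂ)) {a b : ℝ}
    (ha : 0 < a) (hb : 0 < b) (hψ : ∀ ξ, (‖ξ‖ < a ∨ b < ‖ξ‖) → ψ ξ = 0) :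
    ∃ C : ℝ≥0∞, C ≠ ⊤ ∧ ∀ (R : ℝ) (_ : 1 ≤ R) (hR0 : R ≠ 0) (h : Rd d → ℂ), MemLp h p volume →
      mixedNorm q r univ (Icc (-1) 1) (fun x t => evol (dilate R hR0 ψ) t h x) ≤
        C * ENNReal.ofReal (R ^ γ) * eLpNorm h p volume := by
  obtain ⟨C, hC, H⟩ := hχ.exists_besovNorm_multOp_le hp hν γ ψ ha hb hψ
  set K := ⨆ (f : 𝓢'(Rd d, ℂ)) (_ : besovNorm χ p γ ν f ≤ 1), solutionNorm q r f with hK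
  have hKt : K ≠ ⊤ := hS.ne
  refine ⟨K * (1 + C), ENNReal.mul_ne_top hKt (ENNReal.add_ne_top.2 ⟨ENNReal.one_ne_top, hC⟩),
    fun R hR hR0 h hh => ?_⟩
  have hRpos : 0 < R := by linarith
  have unit : ∀ h : Rd d → ℂ, MemLp h p volume →
      C * ENNReal.ofReal (R ^ γ) * eLpNorm h p volume ≤ 1 →
      mixedNorm q r univ (Icc (-1) 1) (fun x t => evol (dilate R hR0 ψ) t h x) ≤ K := by
    intro h hh h1
    obtain ⟨T, hT⟩ := exists_isGivenBy hp hh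
    refine (mixedNorm_le_solutionNorm hp (stronglyMeasurable_uncurry_evol _ hh.1)
      (fun t => memLp_evol hp _ t hh)
      (T := multOp (fun ξ => dilate R hR0 ψ ((2 * Real.pi)⁻¹ • ξ)) T) fun t => ?_).trans
      (le_iSup₂ (f := fun (f : 𝓢'(Rd d, ℂ)) (_ : besovNorm χ p γ ν f ≤ 1) => solutionNorm q r f)
        _ ((H R hR hR0 h T hh hT).trans h1))
    refine isGivenBy_schrodinger_multOp hp hT hh _ t fun ξ => ?_
    rw [inv_smul_smul₀ Real.two_pi_pos.ne']
  -- The normalization uses 1 + C rather than C so that it does not vanish when C = 0.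
  set c := (1 + C) * ENNReal.ofReal (R ^ γ) * eLpNorm h p volume with hc
  have hRγ : ENNReal.ofReal (R ^ γ) ≠ 0 := by
    rw [ne_eq, ENNReal.ofReal_eq_zero, not_le]; positivity
  have hct : c ≠ ⊤ := ENNReal.mul_ne_top (ENNReal.mul_ne_top
    (ENNReal.add_ne_top.2 ⟨ENNReal.one_ne_top, hC⟩) ENNReal.ofReal_ne_top) hh.2.ne
  rw [show K * (1 + C) * ENNReal.ofReal (R ^ γ) * eLpNorm h p volume = K * c by rw [hc]; ring]
  rcases eq_or_ne (eLpNorm h p volume) 0 with h0 | h0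
  · have hz : h =ᵐ[volume] 0 := (eLpNorm_eq_zero_iff hh.1 (by positivity)).1 h0
    have e : (fun x t => evol (dilate R hR0 ψ) t h x) = fun (_ : Rd d) (_ : ℝ) => (0 : ℂ) := by
      funext x t
      rw [evol_congr _ _ hz]
      simp [evol]
    rw [e, mixedNorm_zero]
    exact zero_le
  have hc0 : c ≠ 0 := mul_ne_zero (mul_ne_zero (by simp) hRγ) h0
  have hcr : 0 < c.toReal := ENNReal.toReal_pos hc0 hct
  have hcn : ‖((c.toReal⁻¹ : ℝ) : ℂ)‖ₑ = c⁻¹ := by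
    rw [← ofReal_norm, Complex.norm_real, Real.norm_of_nonneg (by positivity),
      ENNReal.ofReal_inv_of_pos hcr, ENNReal.ofReal_toReal hct]
  have hh' : MemLp (fun y => ((c.toReal⁻¹ : ℝ) : ℂ) * h y) p volume := hh.const_mul _
  have hn : eLpNorm (fun y => ((c.toReal⁻¹ : ℝ) : ℂ) * h y) p volume = c⁻¹ * eLpNorm h p volume := by
    rw [← hcn, ← eLpNorm_const_smul]
    rfl
  have hu := unit _ hh' (by
    rw [hn]
    calc C * ENNReal.ofReal (R ^ γ) * (c⁻¹ * eLpNorm h p volume)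
        = C * ENNReal.ofReal (R ^ γ) * eLpNorm h p volume * c⁻¹ := by ring
      _ ≤ c * c⁻¹ := by
        refine mul_le_mul' ?_ le_rfl
        rw [hc]
        gcongr
        exact le_add_self
      _ ≤ 1 := ENNReal.mul_inv_le_one c)
  simp_rw [evol_const_mul] at hu
  rw [mixedNorm_const_mul, hcn, mul_comm, ← div_eq_mul_inv] at hu
  exact (ENNReal.div_le_iff hc0 hct).1 hu

end

/-- Parabolic scaling of the kernel; the principal power is multiplicative here because one factor
is a positive real. -/
theorem schrodingerKernel_smul {d : ℕ} {t R : ℝ} (ht : 0 < t) (hR : 0 < R) (z : Rd d) :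
    schrodingerKernel t z = ((R ^ d : ℝ) : ℂ) * schrodingerKernel (R ^ 2 * t) (R • z) := by
  have hpi := Real.pi_pos
  have hw : (Real.pi : ℂ) / (4 * Real.pi ^ 2 * ((R ^ 2 * t : ℝ) : ℂ) * Complex.I) ≠ 0 := by
    have h1 : (Real.pi : ℂ) ≠ 0 := Complex.ofReal_ne_zero.2 hpi.ne'
    have h2 : ((R ^ 2 * t : ℝ) : ℂ) ≠ 0 := Complex.ofReal_ne_zero.2 (by positivity)
    exact div_ne_zero h1 (mul_ne_zero (mul_ne_zero (mul_ne_zero (by norm_num) (pow_ne_zero _ h1)) h2)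
      Complex.I_ne_zero)
  have hR2 : 0 < R ^ 2 := by positivity
  have e : (Real.pi : ℂ) / (4 * Real.pi ^ 2 * t * Complex.I) = ((R ^ 2 : ℝ) : ℂ) *
      ((Real.pi : ℂ) / (4 * Real.pi ^ 2 * ((R ^ 2 * t : ℝ) : ℂ) * Complex.I)) := by
    have hRc : (R : ℂ) ≠ 0 := Complex.ofReal_ne_zero.2 hR.ne'
    have htc : (t : ℂ) ≠ 0 := Complex.ofReal_ne_zero.2 ht.ne'
    push_cast
    field_simp
  have hpow : ((R ^ 2 : ℝ) : ℂ) ^ ((d : ℂ) / 2) = ((R ^ d : ℝ) : ℂ) := by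
    rw [show ((d : ℂ) / 2) = (((d : ℝ) / 2 : ℝ) : ℂ) by push_cast; rfl,
      ← Complex.ofReal_cpow hR2.le, ← Real.rpow_natCast R 2, ← Real.rpow_mul hR.le,
      ← Real.rpow_natCast R d]
    congr 2
    push_cast
    ring
  have hmul : (((R ^ 2 : ℝ) : ℂ) * ((Real.pi : ℂ) / (4 * Real.pi ^ 2 * ((R ^ 2 * t : ℝ) : ℂ) *
      Complex.I))) ^ ((d : ℂ) / 2) = ((R ^ 2 : ℝ) : ℂ) ^ ((d : ℂ) / 2) *
      ((Real.pi : ℂ) / (4 * Real.pi ^ 2 * ((R ^ 2 * t : ℝ) : ℂ) * Complex.I)) ^ ((d : ℂ) / 2) := by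
    have hRc : ((R ^ 2 : ℝ) : ℂ) ≠ 0 := Complex.ofReal_ne_zero.2 hR2.ne'
    rw [Complex.cpow_def_of_ne_zero (mul_ne_zero hRc hw), Complex.cpow_def_of_ne_zero hRc,
      Complex.cpow_def_of_ne_zero hw, Complex.log_ofReal_mul hR2 hw, ← Complex.exp_add, ← add_mul,
      Complex.ofReal_log hR2.le]
  rw [schrodingerKernel, schrodingerKernel, e, hmul, hpow, mul_assoc, norm_smul,
    Real.norm_of_nonneg hR.le]
  congr 5
  field_simp

/-- Rescaled to unit frequency, the time R²t is large and the velocity ‖z‖/(4πRt) lies between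
1/(2π) and 14/π, inside the region where ψ = 1. The prefactor R^d of the scaling cancels the decay
(R²)^{-d/2}, and (R²t)^{-(N+1)} is O(R^{-N}). -/
theorem exists_norm_osc_dilate_sub_schrodingerKernel_le {d : ℕ} (ψ : 𝓢(Rd d, ℂ))
    (hψ : ∀ ξ, (4 * Real.pi)⁻¹ < ‖ξ‖ → ‖ξ‖ < 16 / Real.pi → ψ ξ = 1) (N : ℕ) :
    ∃ C : ℝ, 0 ≤ C ∧ ∀ (R : ℝ) (_ : 1 ≤ R) (hR0 : R ≠ 0), ∀ t ∈ Icc (1 / 8 : ℝ) (1 / 4),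
      ∀ z : Rd d, R / 2 ≤ ‖z‖ → ‖z‖ ≤ 7 * R →
      ‖osc (dilate R hR0 ψ) (-4 * Real.pi ^ 2 * t) z - schrodingerKernel t z‖ ≤ C * (R ^ N)⁻¹ := by
  obtain ⟨C, hC, H⟩ := exists_norm_osc_sub_schrodingerKernel_le ψ N
  have hpi := Real.pi_pos
  refine ⟨C * 8 ^ (N + 1), by positivity, fun R hR hR0 t ht z hz1 hz2 => ?_⟩
  have hR' : 0 < R := by linarith
  have ht0 : 0 < t := lt_of_lt_of_le (by norm_num) ht.1
  have hn : ‖(4 * Real.pi * (R ^ 2 * t))⁻¹ • (R • z)‖ = ‖z‖ / (4 * Real.pi * R * t) := by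
    rw [norm_smul, norm_smul, Real.norm_of_nonneg (by positivity), Real.norm_of_nonneg hR'.le]
    field_simp
  have h1 : (4 * Real.pi)⁻¹ < ‖(4 * Real.pi * (R ^ 2 * t))⁻¹ • (R • z)‖ := by
    rw [hn, lt_div_iff₀ (by positivity)]
    have : (4 * Real.pi)⁻¹ * (4 * Real.pi * R * t) = R * t := by field_simp
    rw [this]
    nlinarith [ht.2]
  have h2 : ‖(4 * Real.pi * (R ^ 2 * t))⁻¹ • (R • z)‖ < 16 / Real.pi := by
    rw [hn, div_lt_iff₀ (by positivity)]
    have : 16 / Real.pi * (4 * Real.pi * R * t) = 64 * (R * t) := by field_simp; norm_num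
    rw [this]
    nlinarith [ht.1]
  have hev : ∀ᶠ ζ in 𝓝 ((4 * Real.pi * (R ^ 2 * t))⁻¹ • (R • z)), ψ ζ = 1 := by
    filter_upwards [continuous_norm.continuousAt.eventually_const_lt h1,
      continuous_norm.continuousAt.eventually_lt_const h2] with ζ a b using hψ ζ a b
  have h3 := H (R ^ 2 * t) (by positivity) (R • z) hev
  rw [osc_dilate hR', schrodingerKernel_smul ht0 hR', ← mul_sub, norm_mul, Complex.norm_real,
    Real.norm_of_nonneg (by positivity),
    show R ^ 2 * (-4 * Real.pi ^ 2 * t) = -4 * Real.pi ^ 2 * (R ^ 2 * t) by ring]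
  refine (mul_le_mul_of_nonneg_left h3 (by positivity)).trans ?_
  have e : R ^ d * (4 * Real.pi * (R ^ 2 * t)) ^ (-(d : ℝ) / 2) = (4 * Real.pi * t) ^ (-(d : ℝ) / 2) := by
    rw [show 4 * Real.pi * (R ^ 2 * t) = R ^ 2 * (4 * Real.pi * t) by ring,
      Real.mul_rpow (by positivity) (by positivity), ← mul_assoc, ← Real.rpow_natCast R 2,
      ← Real.rpow_mul hR'.le, ← Real.rpow_natCast R d, ← Real.rpow_add hR']
    rw [show (d : ℝ) + ((2 : ℕ) : ℝ) * (-(d : ℝ) / 2) = 0 by push_cast; ring, Real.rpow_zero, one_mul]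
  rw [← mul_assoc, e]
  have h4 : (4 * Real.pi * t) ^ (-(d : ℝ) / 2) ≤ 1 := by
    refine Real.rpow_le_one_of_one_le_of_nonpos ?_ (by
      rw [neg_div]; exact neg_nonpos.2 (by positivity))
    nlinarith [ht.1, Real.pi_gt_three]
  have h5 : (1 / (R ^ 2 * t)) ^ (N + 1) ≤ 8 ^ (N + 1) * (R ^ N)⁻¹ := by
    have : 1 / (R ^ 2 * t) ≤ 8 * R⁻¹ := by
      rw [div_le_iff₀ (by positivity)]
      have : 8 * R⁻¹ * (R ^ 2 * t) = 8 * (R * t) := by field_simp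
      rw [this]
      nlinarith [ht.1]
    calc (1 / (R ^ 2 * t)) ^ (N + 1) ≤ (8 * R⁻¹) ^ (N + 1) := by gcongr
      _ = 8 ^ (N + 1) * (R ^ (N + 1))⁻¹ := by rw [mul_pow, inv_pow]
      _ ≤ 8 ^ (N + 1) * (R ^ N)⁻¹ := by
        gcongr
        exact Nat.le_succ N
  calc (4 * Real.pi * t) ^ (-(d : ℝ) / 2) * (C * (1 / (R ^ 2 * t)) ^ (N + 1))
      ≤ 1 * (C * (8 ^ (N + 1) * (R ^ N)⁻¹)) := by gcongr
    _ = _ := by ring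

theorem IsLPCutoff.exists_schwartz_annulus {d : ℕ} {χ : Rd d → ℝ} (hχ : IsLPCutoff χ) {a b : ℝ}
    (ha : 0 < a) (hab : a ≤ b) : ∃ ψ : 𝓢(Rd d, ℂ), (∀ ξ, a < ‖ξ‖ → ‖ξ‖ < b → ψ ξ = 1) ∧
      ∀ ξ, (‖ξ‖ < a / 2 ∨ 2 * b < ‖ξ‖) → ψ ξ = 0 := by
  have hb : 0 < b := ha.trans_le hab
  have hn : ∀ c : ℝ, 0 < c → ∀ ξ : Rd d, ‖c • ξ‖ = c * ‖ξ‖ := fun c hc ξ => by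
    rw [norm_smul, Real.norm_of_nonneg hc.le]
  have hb' : 0 < b⁻¹ := by positivity
  have ha' : 0 < 2 / a := by positivity
  have hone : ∀ {c : ℝ}, 0 < c → ∀ ξ : Rd d, c * ‖ξ‖ ≤ 1 → χ (c • ξ) = 1 := fun hc ξ h =>
    hχ.eq_one _ (by rwa [hn _ hc])
  have hzero : ∀ {c : ℝ}, 0 < c → ∀ ξ : Rd d, 2 ≤ c * ‖ξ‖ → χ (c • ξ) = 0 := fun hc ξ h =>
    hχ.eq_zero _ (by rwa [hn _ hc])
  refine ⟨hχ.schwartz hb' - hχ.schwartz ha', fun ξ h1 h2 => ?_, fun ξ h => ?_⟩ <;>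
    rw [sub_apply, hχ.schwartz_apply, hχ.schwartz_apply]
  · rw [hone hb' ξ (by rw [← div_eq_inv_mul, div_le_one₀ hb]; exact h2.le),
      hzero ha' ξ (by rw [div_mul_eq_mul_div, le_div_iff₀ ha]; linarith)]
    simp
  · rcases h with h | h
    · rw [hone hb' ξ (by rw [← div_eq_inv_mul, div_le_one₀ hb]; linarith),
        hone ha' ξ (by rw [div_mul_eq_mul_div, div_le_one₀ ha]; linarith), sub_self]
    · rw [hzero hb' ξ (by rw [← div_eq_inv_mul, le_div_iff₀ hb]; linarith),
        hzero ha' ξ (by rw [div_mul_eq_mul_div, le_div_iff₀ ha]; linarith), sub_self]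

section

variable {d : ℕ} {p q r : ℝ≥0∞}

theorem lintegral_enorm_le_of_support_subset (hp : 1 ≤ p) {R : ℝ} (hR : 1 ≤ R) {h : Rd d → ℂ}
    (hh : MemLp h p volume) (hs : ∀ y, y ∉ Metric.closedBall (0 : Rd d) R → h y = 0) :
    ∫⁻ y, ‖h y‖ₑ ≤ ENNReal.ofReal (R ^ d) * (ENNReal.ofReal ((1 + 1) ^ (2 * (d + 1))) *
      (1 + polyMass d) * eLpNorm h p volume) := by
  have h1 := setLIntegral_enorm_le_of_near hp hR (x₀ := 0) hh.1 zero_le_one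
    Metric.isClosed_closedBall.measurableSet (S := Metric.closedBall (0 : Rd d) R) fun y hy => by
      rw [Metric.mem_closedBall, dist_eq_norm] at hy
      rwa [one_mul]
  rw [setLIntegral_eq_of_support_subset fun y hy => by
    by_contra hyS
    exact hy (by simp [hs y hyS])] at h1
  refine h1.trans ?_
  gcongr
  refine eLpNorm_mono fun y => ?_
  rw [norm_mul, Complex.norm_real, Real.norm_of_nonneg (polyWeight_pos (by linarith) _ y).le]
  exact mul_le_of_le_one_left (norm_nonneg _) (polyWeight_le_one (by linarith) _ y)

end

section

variable {d : ℕ} {p q r : ℝ≥0∞}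

theorem measurableSet_norm_mem_Icc (a b : ℝ) : MeasurableSet {x : Rd d | a ≤ ‖x‖ ∧ ‖x‖ ≤ b} :=
  (measurableSet_le measurable_const measurable_norm).inter
    (measurableSet_le measurable_norm measurable_const)

theorem volume_rpow_annulus_le (hq : 1 ≤ q) {R : ℝ} (hR : 1 ≤ R) :
    volume {x : Rd d | 3 / 2 * R ≤ ‖x‖ ∧ ‖x‖ ≤ 6 * R} ^ q.toReal⁻¹ ≤
      ENNReal.ofReal (R ^ d) * (1 + volume (Metric.closedBall (0 : Rd d) 6)) := by
  have hR0 : 0 ≤ R := by linarith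
  have hone : 1 ≤ ENNReal.ofReal (R ^ d) := by
    rw [← ENNReal.ofReal_one]
    exact ENNReal.ofReal_le_ofReal (one_le_pow₀ hR)
  refine rpow_toReal_inv_le hq ?_ ?_
  · have hsub : {x : Rd d | 3 / 2 * R ≤ ‖x‖ ∧ ‖x‖ ≤ 6 * R} ⊆ Metric.closedBall 0 (R * 6) :=
      fun x hx => by
        rw [Metric.mem_closedBall, dist_zero_right, mul_comm]
        exact hx.2
    refine (measure_mono hsub).trans ?_
    rw [Measure.addHaar_closedBall_mul volume (0 : Rd d) hR0 (by norm_num), finrank_euclideanSpace_fin]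
    exact mul_le_mul' le_rfl le_add_self
  · calc (1 : ℝ≥0∞) = 1 * 1 := (one_mul 1).symm
      _ ≤ _ := mul_le_mul' hone le_self_add

theorem exists_mixedNorm_kernelInt_sub_evol_le (hp : 1 ≤ p) (hq : 1 ≤ q) (hr : 1 ≤ r)
    (ψ : 𝓢(Rd d, ℂ)) (hψ : ∀ ξ, (4 * Real.pi)⁻¹ < ‖ξ‖ → ‖ξ‖ < 16 / Real.pi → ψ ξ = 1) (γ : ℝ) :
    ∃ C : ℝ≥0∞, C ≠ ⊤ ∧ ∀ (R : ℝ) (_ : 1 ≤ R) (hR0 : R ≠ 0) (h : Rd d → ℂ), MemLp h p volume →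
      (∀ y, y ∉ Metric.closedBall (0 : Rd d) R → h y = 0) →
      mixedNorm q r {x : Rd d | 3 / 2 * R ≤ ‖x‖ ∧ ‖x‖ ≤ 6 * R} (Icc (1 / 8) (1 / 4))
        (fun x t => kernelInt t h x - evol (dilate R hR0 ψ) t h x) ≤
        C * ENNReal.ofReal (R ^ γ) * eLpNorm h p volume := by
  -- The pointwise error R^{-N} is multiplied by R^d from the L¹ norm of `h` and by R^d from the
  -- volume of the annulus, so N ≥ 2d - γ suffices.
  obtain ⟨N, hN⟩ := exists_nat_ge (2 * (d : ℝ) - γ)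
  obtain ⟨C, hC, H⟩ := exists_norm_osc_dilate_sub_schrodingerKernel_le ψ hψ N
  set c₁ : ℝ≥0∞ := ENNReal.ofReal ((1 + 1) ^ (2 * (d + 1))) * (1 + polyMass d) with hc₁
  have hc₁t : c₁ ≠ ⊤ := ENNReal.mul_ne_top ENNReal.ofReal_ne_top
    (ENNReal.add_ne_top.2 ⟨ENNReal.one_ne_top, polyMass_ne_top d⟩)
  set c₂ : ℝ≥0∞ := 1 + volume (Metric.closedBall (0 : Rd d) 6) with hc₂
  have hc₂t : c₂ ≠ ⊤ := ENNReal.add_ne_top.2 ⟨ENNReal.one_ne_top, measure_closedBall_lt_top.ne⟩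
  refine ⟨ENNReal.ofReal C * c₁ * c₂, ENNReal.mul_ne_top
    (ENNReal.mul_ne_top ENNReal.ofReal_ne_top hc₁t) hc₂t, fun R hR hR0 h hh hs => ?_⟩
  have hRpos : 0 < R := by linarith
  have hI := lintegral_enorm_le_of_support_subset hp hR hh hs
  have hhi : Integrable h := ⟨hh.1, hI.trans_lt (ENNReal.mul_lt_top ENNReal.ofReal_lt_top
    (ENNReal.mul_lt_top hc₁t.lt_top hh.2))⟩
  have hpt : ∀ x ∈ {x : Rd d | 3 / 2 * R ≤ ‖x‖ ∧ ‖x‖ ≤ 6 * R}, ∀ t ∈ Icc (1 / 8 : ℝ) (1 / 4),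
      ‖kernelInt t h x - evol (dilate R hR0 ψ) t h x‖ₑ ≤
        ENNReal.ofReal (C * (R ^ N)⁻¹) * ∫⁻ y, ‖h y‖ₑ := by
    intro x hx t ht
    have ht0 : 0 < t := lt_of_lt_of_le (by norm_num) ht.1
    unfold kernelInt evol
    rw [← integral_sub (integrable_schrodingerKernel_mul ht0 hhi x)
      (integrable_osc_sub_mul _ _ hp hh x), ← lintegral_const_mul' _ _ ENNReal.ofReal_ne_top]
    refine (enorm_integral_le_lintegral_enorm _).trans (lintegral_mono fun y => ?_)
    rw [← sub_mul, enorm_mul]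
    by_cases hy : y ∈ Metric.closedBall (0 : Rd d) R
    · refine mul_le_mul' ?_ le_rfl
      rw [mem_closedBall_zero_iff] at hy
      rw [enorm_sub_rev, ← ofReal_norm]
      -- From 3R/2 ≤ ‖x‖ ≤ 6R and ‖y‖ ≤ R follows R/2 ≤ ‖x - y‖ ≤ 7R.
      refine ENNReal.ofReal_le_ofReal (H R hR hR0 t ht (x - y) ?_ ?_)
      · have := norm_sub_norm_le x y
        linarith [hx.1]
      · have := norm_sub_le x y
        linarith [hx.2]
    · rw [hs y hy]
      simp
  have hJ : volume (Icc (1 / 8 : ℝ) (1 / 4)) ^ r.toReal⁻¹ ≤ 1 := by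
    refine rpow_toReal_inv_le hr ?_ le_rfl
    rw [Real.volume_Icc, ENNReal.ofReal_le_one]
    norm_num
  refine (mixedNorm_le_of_norm_le (measurableSet_norm_mem_Icc _ _) measurableSet_Icc hpt).trans ?_
  refine (mul_le_mul' (mul_le_mul' (mul_le_mul' le_rfl hI) hJ) (volume_rpow_annulus_le hq hR)).trans ?_
  have hreal : (R ^ N)⁻¹ * R ^ d * R ^ d ≤ R ^ γ := by
    rw [← Real.rpow_natCast R N, ← Real.rpow_natCast R d, ← Real.rpow_neg hRpos.le,
      ← Real.rpow_add hRpos, ← Real.rpow_add hRpos]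
    exact Real.rpow_le_rpow_of_exponent_le hR (by linarith)
  calc ENNReal.ofReal (C * (R ^ N)⁻¹) * (ENNReal.ofReal (R ^ d) *
        (ENNReal.ofReal ((1 + 1) ^ (2 * (d + 1))) * (1 + polyMass d) * eLpNorm h p volume)) * 1 *
        (ENNReal.ofReal (R ^ d) * (1 + volume (Metric.closedBall (0 : Rd d) 6)))
      = ENNReal.ofReal C * c₁ * c₂ * ENNReal.ofReal ((R ^ N)⁻¹ * R ^ d * R ^ d) *
        eLpNorm h p volume := by
        rw [ENNReal.ofReal_mul hC, ENNReal.ofReal_mul (by positivity),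
          ENNReal.ofReal_mul (by positivity)]
        ring
    _ ≤ _ := by gcongr

theorem SchrodingerBound.exists_kernelInt_le {χ : Rd d → ℝ} {γ ν : ℝ} (hχ : IsLPCutoff χ)
    (hp : 1 ≤ p) (hq : 1 ≤ q) (hr : 1 ≤ r) (hν : 0 < ν) (hS : SchrodingerBound χ p q r γ ν) :
    ∃ C : ℝ≥0∞, C ≠ ⊤ ∧ ∀ R : ℝ, 1 ≤ R → ∀ h : Rd d → ℂ, MemLp h p volume →
      (∀ y, y ∉ Metric.closedBall (0 : Rd d) R → h y = 0) →
      mixedNorm q r {x : Rd d | 3 / 2 * R ≤ ‖x‖ ∧ ‖x‖ ≤ 6 * R} (Icc (1 / 8) (1 / 4))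
        (fun x t => kernelInt t h x) ≤ C * ENNReal.ofReal (R ^ γ) * eLpNorm h p volume := by
  have hpi := Real.pi_pos
  obtain ⟨ψ, hψ1, hψ0⟩ := hχ.exists_schwartz_annulus (a := (4 * Real.pi)⁻¹) (b := 16 / Real.pi)
    (by positivity) (by rw [← one_div]; gcongr <;> linarith)
  obtain ⟨C₁, hC₁, H₁⟩ := hS.exists_evol_dilate_le hχ hp hν ψ (by positivity) (by positivity) hψ0
  obtain ⟨C₂, hC₂, H₂⟩ := exists_mixedNorm_kernelInt_sub_evol_le hp hq hr ψ hψ1 γ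
  refine ⟨C₁ + C₂, ENNReal.add_ne_top.2 ⟨hC₁, hC₂⟩, fun R hR h hh hs => ?_⟩
  have hR0 : R ≠ 0 := by linarith
  have e : (fun x t => kernelInt t h x) = fun x t => evol (dilate R hR0 ψ) t h x +
      (kernelInt t h x - evol (dilate R hR0 ψ) t h x) := by
    funext x t
    rw [add_sub_cancel]
  have hm := stronglyMeasurable_uncurry_evol (dilate R hR0 ψ) hh.1
  rw [e, add_mul, add_mul]
  have hm' : StronglyMeasurable (Function.uncurry fun x t =>
      kernelInt t h x - evol (dilate R hR0 ψ) t h x) := (stronglyMeasurable_kernelInt hh.1).sub hm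
  refine (mixedNorm_add_le hq hr hm hm').trans
    (add_le_add ?_ (H₂ R hR hR0 h hh hs))
  refine (mixedNorm_mono_set (subset_univ _) ?_).trans (H₁ R hR hR0 h hh)
  exact Icc_subset_Icc (by norm_num) (by norm_num)

/-- With λ = R², the data is f(·/R) and the variables are s = λ/4t, ξ = 2Rx. This maps t ∈ [1/8,
1/4] to s ∈ [λ, 2λ], and the annulus 3R/2 ≤ |x| ≤ 6R to A(λ). The powers of R sum to d/q + 2/r - d +
γ + d/p = 2β, that is, to λ^β. -/
theorem SchrodingerBound.extensionBound {χ : Rd d → ℝ} {β ν : ℝ} (hχ : IsLPCutoff χ)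
    (hp : 1 ≤ p) (hq : 1 ≤ q) (hr : 1 ≤ r) (hν : 0 < ν) (hS : SchrodingerBound χ p q r
      ((d : ℝ) * (1 - (p⁻¹).toReal - (q⁻¹).toReal) - 2 * (r⁻¹).toReal + 2 * β) ν) :
    ExtensionBound d p q r β := by
  obtain ⟨C, hC, H⟩ := hS.exists_kernelInt_le hχ hp hq hr hν
  set p' := (p⁻¹).toReal with hp'
  set q' := (q⁻¹).toReal with hq'
  set r' := (r⁻¹).toReal with hr'
  set γ := (d : ℝ) * (1 - p' - q') - 2 * r' + 2 * β with hγ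
  have hq0 : 0 ≤ q' := ENNReal.toReal_nonneg
  have hr0 : 0 ≤ r' := ENNReal.toReal_nonneg
  have hp0 : 0 ≤ p' := ENNReal.toReal_nonneg
  refine lt_of_le_of_lt (b := C * ENNReal.ofReal ((2 ^ d) ^ q' * 16 ^ r' * 2 ^ d)) ?_
    (ENNReal.mul_lt_top hC.lt_top ENNReal.ofReal_lt_top)
  refine iSup₂_le fun l hl => ?_
  have hl0 : 0 < l := by linarith
  have hR1 : 1 ≤ √l := Real.one_le_sqrt.2 hl.le
  obtain ⟨R, hR⟩ : ∃ R : ℝ, R = √l := ⟨_, rfl⟩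
  rw [← hR] at hR1
  have hR0 : 0 < R := by linarith
  have hlR : l = R ^ 2 := by rw [hR, Real.sq_sqrt hl0.le]
  suffices h : ∀ f : Rd d → ℂ, MemLp f p volume ∧ eLpNorm f p volume ≤ 1 →
      mixedNorm q r (annulus d l) (Icc l (2 * l)) (fun ξ s => extensionOp f ((s / l) • ξ) s) ≤
        C * ENNReal.ofReal ((2 ^ d) ^ q' * 16 ^ r' * 2 ^ d) * ENNReal.ofReal (l ^ β) by
    refine (mul_le_mul' le_rfl (iSup₂_le h)).trans (le_of_eq ?_)
    rw [mul_left_comm, ← ENNReal.ofReal_mul (by positivity), ← Real.rpow_add hl0, neg_add_cancel,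
      Real.rpow_zero, ENNReal.ofReal_one, mul_one]
  rintro f ⟨hf, hf1⟩
  set B := Metric.closedBall (0 : Rd d) 1 with hB
  have hBm : MeasurableSet B := Metric.isClosed_closedBall.measurableSet
  set h : Rd d → ℂ := fun y => B.indicator f (0 + R⁻¹ • y) with hh
  have hRi : 0 < R⁻¹ := by positivity
  have hfB : MemLp (B.indicator f) p volume := hf.indicator hBm
  have hhn : eLpNorm h p volume ≤ ENNReal.ofReal ((R ^ d) ^ p') := by
    rw [hh, eLpNorm_comp_affine 0 hRi, inv_pow, inv_inv, ← hp',
      ENNReal.ofReal_rpow_of_nonneg (by positivity) hp0]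
    exact mul_le_of_le_one_right' ((eLpNorm_indicator_le f).trans hf1)
  have hhp : MemLp h p volume := by
    refine ⟨?_, hhn.trans_lt ENNReal.ofReal_lt_top⟩
    refine hfB.1.comp_quasiMeasurePreserving ⟨(measurableEmbedding_affine 0 hRi.ne').measurable, ?_⟩
    rw [map_affine_volume 0 hRi]
    exact Measure.smul_absolutelyContinuous
  have hsupp : ∀ y, y ∉ Metric.closedBall (0 : Rd d) R → h y = 0 := fun y hy => by
    refine indicator_of_notMem (fun hyB => hy ?_) _
    rw [hB, mem_closedBall_zero_iff, zero_add, norm_smul, Real.norm_of_nonneg hRi.le,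
      ← div_eq_inv_mul, div_le_one₀ hR0] at hyB
    rwa [mem_closedBall_zero_iff]
  have hext : ∀ ξ s, extensionOp (fun y => h ((0 : Rd d) + R • y)) ξ s = extensionOp f ξ s :=
    fun ξ s => by
      refine setIntegral_congr_fun hBm fun y hy => ?_
      simp only [hh]
      rw [zero_add, zero_add, inv_smul_smul₀ hR0.ne', indicator_of_mem hy]
  set A : Set (Rd d) := {x | 3 / 2 * R ≤ ‖x‖ ∧ ‖x‖ ≤ 6 * R} with hA
  have hb : 0 < l / 4 := by positivity
  have h2R : 0 < 2 * R := by positivity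
  have hK₁ := restrict_le_smul_map_affine (0 : Rd d) h2R (A := annulus d l) (A' := A) fun x hx => by
    have h1 : 3 * l ≤ ‖(0 : Rd d) + (2 * R) • x‖ ∧ ‖(0 : Rd d) + (2 * R) • x‖ ≤ 12 * l := hx
    rw [zero_add, norm_smul, Real.norm_of_nonneg h2R.le, hlR] at h1
    exact ⟨by nlinarith [h1.1], by nlinarith [h1.2]⟩
  have hK₂ := restrict_le_smul_map_const_div hb (by norm_num : (0 : ℝ) < 1 / 8) (J := Icc l (2 * l))
    (J' := Icc (1 / 8) (1 / 4)) measurableSet_Icc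
    (fun s hs => by
      have : 0 < s := hl0.trans_le hs.1
      rw [le_div_iff₀ this]
      linarith [hs.2])
    (fun s hs => by
      have : 0 < s := hl0.trans_le hs.1
      refine ⟨?_, ?_⟩
      · rw [le_div_iff₀ this]
        linarith [hs.2]
      · rw [div_le_iff₀ this]
        linarith [hs.1])
  refine (mixedNorm_le_comp (q := q) (r := r) (measurableEmbedding_affine 0 h2R.ne')
    (measurableEmbedding_const_div hb.ne') ENNReal.ofReal_ne_top hK₁ hK₂).trans ?_
  have hmono : mixedNorm q r A (Icc (1 / 8) (1 / 4))
      (fun x t => extensionOp f ((l / 4 / t / l) • ((0 : Rd d) + (2 * R) • x)) (l / 4 / t)) ≤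
      ENNReal.ofReal (2 ^ d * (R ^ d)⁻¹) * mixedNorm q r A (Icc (1 / 8) (1 / 4))
        (fun x t => kernelInt t h x) := by
    refine mixedNorm_le_mul_of_norm_le (measurableSet_norm_mem_Icc _ _) measurableSet_Icc
      fun x _ t ht => ?_
    have ht0 : 0 < t := lt_of_lt_of_le (by norm_num) ht.1
    have e1 : R ^ 2 / (4 * t) = l / 4 / t := by rw [hlR, div_div]
    have e2 : (R / (2 * t)) • (x - 0) = (l / 4 / t / l) • ((0 : Rd d) + (2 * R) • x) := by
      rw [sub_zero, zero_add, smul_smul]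
      congr 1
      field_simp
      ring
    rw [norm_kernelInt_eq ht0 hR0 0 hsupp, hext, e1, e2]
    set E := ‖extensionOp f ((l / 4 / t / l) • ((0 : Rd d) + (2 * R) • x)) (l / 4 / t)‖ with hE
    -- For t ≤ 1/4 one has 4πt ≤ π < 4, so the kernel factor is at least 4^{-d/2} = 2^{-d}.
    have hpow : ((2 : ℝ) ^ d)⁻¹ ≤ (4 * Real.pi * t) ^ (-(d : ℝ) / 2) := by
      have h4 : ((2 : ℝ) ^ d)⁻¹ = (4 : ℝ) ^ (-(d : ℝ) / 2) := by
        rw [show (4 : ℝ) = 2 ^ (2 : ℝ) by norm_num, ← Real.rpow_mul (by norm_num),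
          ← Real.rpow_natCast, ← Real.rpow_neg (by norm_num)]
        congr 1
        ring
      rw [h4]
      refine Real.rpow_le_rpow_of_nonpos (by positivity) ?_ (by
        rw [neg_div]; exact neg_nonpos.2 (by positivity))
      nlinarith [ht.2, Real.pi_lt_four, Real.pi_pos]
    have hE0 : 0 ≤ E := norm_nonneg _
    calc E = 2 ^ d * (R ^ d)⁻¹ * (((2 : ℝ) ^ d)⁻¹ * R ^ d * E) := by field_simp
      _ ≤ _ := by gcongr
  refine (mul_le_mul' le_rfl (hmono.trans (mul_le_mul' le_rfl
    ((H R hR1 h hhp hsupp).trans (mul_le_mul' le_rfl hhn))))).trans (le_of_eq ?_)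
  rw [ENNReal.ofReal_rpow_of_nonneg (by positivity) hq0,
    ENNReal.ofReal_rpow_of_nonneg (by positivity) hr0]
  have hreal : ((2 * R) ^ d) ^ q' * (l / 4 / (1 / 8) ^ 2) ^ r' * (2 ^ d * (R ^ d)⁻¹) * R ^ γ *
      (R ^ d) ^ p' = (2 ^ d) ^ q' * 16 ^ r' * 2 ^ d * l ^ β := by
    have e1 : l / 4 / (1 / 8) ^ 2 = 16 * R ^ 2 := by rw [hlR]; ring
    have e2 : R ^ (2 * β) = (R ^ d) ^ q' * (R ^ 2) ^ r' * (R ^ d)⁻¹ * R ^ γ * (R ^ d) ^ p' := by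
      rw [← Real.rpow_natCast R d, ← Real.rpow_natCast R 2, ← Real.rpow_neg hR0.le,
        ← Real.rpow_mul hR0.le, ← Real.rpow_mul hR0.le, ← Real.rpow_mul hR0.le, ← Real.rpow_add hR0,
        ← Real.rpow_add hR0, ← Real.rpow_add hR0, ← Real.rpow_add hR0, hγ]
      congr 1
      push_cast
      ring
    have e3 : l ^ β = R ^ (2 * β) := by
      rw [hlR, ← Real.rpow_natCast R 2, ← Real.rpow_mul hR0.le]
      norm_num
    rw [e1, e3, e2, mul_pow, Real.mul_rpow (by positivity) (by positivity),
      Real.mul_rpow (by positivity) (by positivity)]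
    ring
  have hprod : ENNReal.ofReal ((2 ^ d) ^ q' * 16 ^ r' * 2 ^ d) * ENNReal.ofReal (l ^ β) =
      ENNReal.ofReal (((2 * R) ^ d) ^ q') * ENNReal.ofReal ((l / 4 / (1 / 8) ^ 2) ^ r') *
        ENNReal.ofReal (2 ^ d * (R ^ d)⁻¹) * ENNReal.ofReal (R ^ γ) *
        ENNReal.ofReal ((R ^ d) ^ p') := by
    rw [← ENNReal.ofReal_mul (by positivity), ← hreal, ENNReal.ofReal_mul (by positivity),
      ENNReal.ofReal_mul (by positivity), ENNReal.ofReal_mul (by positivity),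
      ENNReal.ofReal_mul (by positivity)]
  rw [mul_assoc C, mul_assoc C, hprod]
  ring

end

theorem theorem2p1 (d : ℕ) (hd : 1 ≤ d) (p q r : ℝ≥0∞) (hp : 2 ≤ p) (hq : 2 ≤ q) (hr : 2 ≤ r)
    (hpq : p ≤ q) (β : ℝ) (hβ : -(d : ℝ) * (1 / 2 - (p⁻¹).toReal) < β)
    (χ : Rd d → ℝ) (hχ : IsLPCutoff χ)
    (ν : ℝ) (hν : 0 < ν) (hν' : ν ≤ 1 ∨ (r < ⊤ ∧ ν ≤ 2)) :
    ExtensionBound d p q r β ↔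
      SchrodingerBound χ p q r
        ((d : ℝ) * (1 - (p⁻¹).toReal - (q⁻¹).toReal) - 2 * (r⁻¹).toReal + 2 * β) ν := by
  have h12 : (1 : ℝ≥0∞) ≤ 2 := by norm_num
  -- The hypothesis on β is rewritten as d/2 - d/p + β > 0, positivity of the growth exponent in
  -- time.
  exact ⟨fun hE => hE.schrodingerBound (h12.trans hp) hpq hq hr (by linarith) hχ hν hν',
    fun hS => hS.extensionBound hχ (h12.trans hp) (h12.trans hq) (h12.trans hr) hν⟩
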